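/- Theorem. Let $X_0$ be a reduced complex-analytic variety, or a reduced algebraic variety over an algebraically closed field of characteristic zero, and let $\sigma : (X,E)\to (X_0, \mathrm{Sing}\,X_0)$ be a resolution of singularities: $\sigma: X\to X_0$ is proper, $X$ is smooth, $\sigma$ is an isomorphism over $X_0\setminus \mathrm{Sing}\,X_0$, and $\sigma^{-1}(\mathrm{Sing}\,X_0)$ is the support of a simple normal crossings divisor $E$. (In the algebraic case, points are closed points, and coordinates of $X$ are étale coordinates, i.e. a regular system of parameters on an étale neighbourhood.) Write $n=\dim X$ (the local dimension at the point considered, in the algebraic case). Coordinates $(u,v)=(u_1,\dots,u_s,v_1,\dots,v_{n-s})$ of $X$ at $a=0$ are called adapted to $E$ if $(u_i=0)$, $i=1,\dots,s$, are the components of $E$ at $a$. The logarithmic rank $\log\mathrm{rk}_a\,\sigma$ is the rank at $a$ of the logarithmic Jacobian matrix with entries $u_i\,\partial\sigma_j/\partial u_i$, $\partial\sigma_j/\partial v_l$, where $(u,v)$ are adapted coordinates at $a$ and $\sigma=(\sigma_1,\dots,\sigma_N)$ in coordinates of a smooth variety in which $X_0$ is locally embedded at $\sigma(a)$; it does not depend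 on the choices. Set $p:=\max_{a\in E}\log\mathrm{rk}_a\,\sigma$ and, for each $k$, $$\Sigma_k:=\{a\in E:\ \log\mathrm{rk}_a\,\sigma\le p-k\},\qquad Y_k:=\sigma(\Sigma_k),$$ (so $\Sigma_{p+1}=Y_{p+1}=\emptyset$), and let $\mathcal I_{Y_k}\subset\mathcal O_{X_0}$ be the ideal of functions vanishing on $Y_k$. Assume that, for every $k=0,\dots,p$, $\Sigma_k=\sigma^{-1}(Y_k)$, $Y_k\setminus Y_{k+1}$ is smooth, and $\sigma^*\mathcal I_{Y_k}$ is a principal monomial ideal (generated locally by a monomial in generators of the components of $E$). Let $a\in E$ and $r:=\log\mathrm{rk}_a\,\sigma$. Then, for any local embedding $X_0\hookrightarrow M_0$ at $\sigma(a)$ in a smooth variety $M_0$, there are coordinates $(u,v)=(u_1,\dots,u_s,v_1,\dots,v_{n-s})$ of $X$ at $a=0$ adapted to $E$ and coordinates $z=(z_1,\dots,z_N)$ of $M_0$ at $\sigma(a)=0$, where $r\le n-s$ and $r<N$, such that, writing $\sigma_j=\sigma^*z_j$, $$\sigma_1=v_1,\ \dots,\ \sigma_r=v_r,\qquad \sigma_{r+1}=u^{\alpha_1}=u_1^{\alpha_{1,1}}\cdots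 u_s^{\alpha_{1,s}}\quad\text{for some }\alpha_1\in\mathbb N^s,$$ the ideal $\mathcal I_{Y_{p-r}}$ is generated at $\sigma(a)$ by (the restrictions to $X_0$ of) $z_{r+1},\dots,z_N$, and $\sigma^*\mathcal I_{Y_{p-r}}$ is generated at $a$ by $\sigma_{r+1}$. -/

import Mathlib

open scoped Topology Manifold ContDiff
open CategoryTheory AlgebraicGeometry

noncomputable section

/-! # Complex-analytic varieties -/

namespace Analytic

section Germs

variable (N : ℕ) {M : Type*} [TopologicalSpace M] [ChartedSpace (Fin N → ℂ) M]

/-- `f` is holomorphic in a neighbourhood of the point `x` of the complex manifold `M`. -/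
def HolAt (N : ℕ) {M : Type*} [TopologicalSpace M] [ChartedSpace (Fin N → ℂ) M]
    (f : M → ℂ) (x : M) : Prop :=
  ContMDiffAt 𝓘(ℂ, Fin N → ℂ) 𝓘(ℂ, ℂ) ω f x

variable (M) in
/-- The local ring `𝒪_{M,x}` of germs of holomorphic functions on a complex manifold. -/
def holGerm (x : M) : Subring ((𝓝 x).Germ ℂ) where
  carrier := {g | ∃ f : M → ℂ, HolAt N f x ∧ (f : (𝓝 x).Germ ℂ) = g}
  mul_mem' := by
    rintro _ _ ⟨f, hf, rfl⟩ ⟨g, hg, rfl⟩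
    exact ⟨f * g, ContMDiffAt.mul hf hg, rfl⟩
  one_mem' := ⟨1, contMDiffAt_const, rfl⟩
  add_mem' := by
    rintro _ _ ⟨f, hf, rfl⟩ ⟨g, hg, rfl⟩
    exact ⟨f + g, ContMDiffAt.add hf hg, rfl⟩
  zero_mem' := ⟨0, contMDiffAt_const, rfl⟩
  neg_mem' := by
    rintro _ ⟨f, hf, rfl⟩
    exact ⟨-f, ContMDiffAt.neg hf, rfl⟩

/-- `A` is a closed analytic subset of the open set `W` of the complex manifold `M`: near each
point of `W` it is the zero set of finitely many holomorphic functions. -/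
def IsAnalyticIn (W A : Set M) : Prop :=
  A ⊆ W ∧ ∀ w ∈ W, ∃ (l : ℕ) (f : Fin l → M → ℂ), (∀ i, HolAt N (f i) w) ∧
    ∀ᶠ x in 𝓝 w, x ∈ A ↔ ∀ i, f i x = 0

/-- Let `𝒪 x` be rings of germs of functions on `X₀`. The map `ι`, considered on the open subset
`U` of `X₀` only, is a local embedding in the complex manifold `M`: it is an isomorphism of `U`
with a closed analytic subset of an open subset of `M`, equipped with the restrictions of
holomorphic functions. -/
structure IsLocalEmbedding {X₀ : Type*} [TopologicalSpace X₀]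
    (𝒪 : ∀ x : X₀, Subring ((𝓝 x).Germ ℂ)) (ι : X₀ → M) (U : Set X₀) : Prop where
  isOpen : IsOpen U
  isEmbedding : Topology.IsEmbedding (U.domRestrict ι)
  image_analytic : ∃ W : Set M, IsOpen W ∧ IsAnalyticIn N W (ι '' U)
  mem_iff : ∀ y ∈ U, ∀ g : (𝓝 y).Germ ℂ,
    g ∈ 𝒪 y ↔ ∃ f : M → ℂ, HolAt N f (ι y) ∧ ((f ∘ ι : X₀ → ℂ) : (𝓝 y).Germ ℂ) = g

end Germs

/-- A reduced complex-analytic space. As the space is reduced, its structure sheaf is a sheaf of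
complex-valued functions, given here by its stalks; locally the space is isomorphic to a closed
analytic subset of an open subset of some `ℂ^N`. -/
class ReducedSpace (X₀ : Type*) [TopologicalSpace X₀] where
  stalk : ∀ x : X₀, Subring ((𝓝 x).Germ ℂ)
  exists_localEmbedding : ∀ x : X₀, ∃ (N : ℕ) (φ : X₀ → (Fin N → ℂ)) (U : Set X₀),
    x ∈ U ∧ IsLocalEmbedding N stalk φ U

section Space

variable {X₀ : Type*} [TopologicalSpace X₀] [ReducedSpace X₀]

/-- `f` is holomorphic in a neighbourhood of the point `b` of the reduced complex space `X₀`. -/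
def RegAt (f : X₀ → ℂ) (b : X₀) : Prop :=
  (f : (𝓝 b).Germ ℂ) ∈ ReducedSpace.stalk b

variable (X₀) in
/-- The singular locus: the points near which `X₀` is not isomorphic to an open subset of
some `ℂ^d`. -/
def Sing : Set X₀ :=
  {x | ¬ ∃ (d : ℕ) (φ : X₀ → (Fin d → ℂ)) (U : Set X₀),
    x ∈ U ∧ IsLocalEmbedding d ReducedSpace.stalk φ U ∧ IsOpen (φ '' U)}

/-- The stalk at `b` of the ideal sheaf in `𝒪_{X₀}` of functions vanishing on `Y`. -/
def idealAt (Y : Set X₀) (b : X₀) : Ideal (ReducedSpace.stalk b) :=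
  Ideal.span {g : ReducedSpace.stalk b | ∃ f : X₀ → ℂ, (f : (𝓝 b).Germ ℂ) = g ∧ ∀ᶠ y in 𝓝 b, y ∈ Y → f y = 0}

/-- The subset `Y` of `X₀` is smooth at `b`: in some local embedding of `X₀` in `ℂ^N`, it is
given by a complex submanifold near (the image of) `b`. -/
def IsSmoothAt (Y : Set X₀) (b : X₀) : Prop :=
  ∃ (N : ℕ) (φ : X₀ → (Fin N → ℂ)) (U : Set X₀), b ∈ U ∧
    IsLocalEmbedding N ReducedSpace.stalk φ U ∧
    ∃ z ∈ IsManifold.maximalAtlas 𝓘(ℂ, Fin N → ℂ) ω (Fin N → ℂ), ∃ d : ℕ,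
      φ b ∈ z.source ∧ z (φ b) = 0 ∧
      ∀ᶠ w in 𝓝 (φ b), w ∈ φ '' (Y ∩ U) ↔ ∀ j : Fin N, d ≤ (j : ℕ) → z w j = 0

end Space

section Divisor

variable {n : ℕ} {X : Type*} [TopologicalSpace X] [ChartedSpace (Fin n → ℂ) X] {Q : Type*}

/-- Local coordinates of the complex manifold `X` at `a = 0`, written
`(u, v) = (u_1, …, u_s, v_1, …, v_m)` through the labelling `κ`, which are adapted to the family
`E` of hypersurfaces: `(u_i = 0)`, `i = 1, …, s`, are the components of `E` in the domain of the
chart, `c i` being the index of the component `(u_i = 0)`. -/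
structure IsAdapted (E : Q → Set X) (a : X) {s m : ℕ}
    (e : OpenPartialHomeomorph X (Fin n → ℂ)) (κ : Fin s ⊕ Fin m ≃ Fin n) (c : Fin s → Q) :
    Prop where
  mem_atlas : e ∈ IsManifold.maximalAtlas 𝓘(ℂ, Fin n → ℂ) ω X
  mem_source : a ∈ e.source
  map_eq_zero : e a = 0
  injective : Function.Injective c
  range_eq : Set.range c = {q | a ∈ E q}
  mem_comp_iff : ∀ i, ∀ x ∈ e.source, x ∈ E (c i) ↔ e x (κ (.inl i)) = 0
  disjoint : ∀ q, a ∉ E q → Disjoint (E q) e.source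

/-- The family `E` consists of the components of a simple normal crossings divisor on `X`. -/
def IsSNC (n : ℕ) {X : Type*} [TopologicalSpace X] [ChartedSpace (Fin n → ℂ) X] {Q : Type*}
    (E : Q → Set X) : Prop :=
  ∀ a : X, ∃ (s m : ℕ) (e : OpenPartialHomeomorph X (Fin n → ℂ)) (κ : Fin s ⊕ Fin m ≃ Fin n)
    (c : Fin s → Q), IsAdapted E a e κ c

/-- The ideal `J` of `𝒪_{X,a}` is generated by a monomial in generators of the components
of `E` at `a`. -/
def IsMonomialAt (E : Q → Set X) (a : X) (J : Ideal (holGerm n X a)) : Prop :=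
  ∃ (s m : ℕ) (e : OpenPartialHomeomorph X (Fin n → ℂ)) (κ : Fin s ⊕ Fin m ≃ Fin n)
    (c : Fin s → Q) (α : Fin s → ℕ), IsAdapted E a e κ c ∧
    J = Ideal.span
      {g : holGerm n X a | ((fun x => ∏ i, e x (κ (.inl i)) ^ α i : X → ℂ) : (𝓝 a).Germ ℂ) = g}

/-- The logarithmic Jacobian matrix at `x` of the map `F` written in coordinates, with columns
`u_i ∂F/∂u_i` and `∂F/∂v_j`. -/
def logJac {s m N : ℕ} (κ : Fin s ⊕ Fin m ≃ Fin n) (F : (Fin n → ℂ) → (Fin N → ℂ))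
    (x : Fin n → ℂ) : Matrix (Fin N) (Fin s ⊕ Fin m) ℂ :=
  .of fun j i => Sum.elim (fun i => x (κ (.inl i))) (fun _ => 1) i *
    fderiv ℂ F x (Pi.single (κ i) 1) j

end Divisor

section Resolution

variable (n : ℕ) {X : Type*} [TopologicalSpace X] [ChartedSpace (Fin n → ℂ) X]
variable {X₀ : Type*} [TopologicalSpace X₀] [ReducedSpace X₀] {Q : Type*}

/-- `σ : (X, E) → (X₀, Sing X₀)` is a resolution of singularities. (Since `Sing X₀` is nowhere
dense in the reduced space `X₀`, and the support of `E` in `X`, `σ` is bimeromorphic.) -/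
structure IsResolution (E : Q → Set X) (σ : X → X₀) : Prop where
  isSNC : IsSNC n E
  isProperMap : IsProperMap σ
  holomorphic : ∀ (a : X) (f : X₀ → ℂ), RegAt f (σ a) → HolAt n (f ∘ σ) a
  isHomeomorph : IsHomeomorph ((Sing X₀)ᶜ.restrictPreimage σ)
  stalk_surjective : ∀ a : X, σ a ∉ Sing X₀ → ∀ h : X → ℂ, HolAt n h a →
    ∃ f : X₀ → ℂ, RegAt f (σ a) ∧ f ∘ σ =ᶠ[𝓝 a] h
  preimage_sing : σ ⁻¹' Sing X₀ = ⋃ q, E q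

/-- The logarithmic rank of `σ` at `a`: the rank at `a` of the logarithmic Jacobian matrix with
respect to adapted coordinates at `a` and a local embedding of `X₀` in `ℂ^N`. It does not depend
on these choices: `sInf` is taken of a set with one element. -/
def logRank (E : Q → Set X) (σ : X → X₀) (a : X) : ℕ :=
  sInf {r | ∃ (s m : ℕ) (e : OpenPartialHomeomorph X (Fin n → ℂ)) (κ : Fin s ⊕ Fin m ≃ Fin n)
    (c : Fin s → Q), IsAdapted E a e κ c ∧
    ∃ (N : ℕ) (φ : X₀ → (Fin N → ℂ)) (U : Set X₀), σ a ∈ U ∧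
      IsLocalEmbedding N ReducedSpace.stalk φ U ∧
      r = (logJac κ (φ ∘ σ ∘ e.symm) (e a)).rank}

/-- `p`, the maximum of the logarithmic rank on the support of `E`. -/
def maxLogRank (E : Q → Set X) (σ : X → X₀) : ℕ :=
  sSup (logRank n E σ '' ⋃ q, E q)

/-- `Σ_k`, the set of points of the support of `E` at which the logarithmic rank is at most
`p - k` (so that `Σ_{p+1}` is empty). -/
def logStratum (E : Q → Set X) (σ : X → X₀) (k : ℕ) : Set X :=
  {a | a ∈ ⋃ q, E q ∧ logRank n E σ a + k ≤ maxLogRank n E σ}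

/-- `Y_k = σ(Σ_k)`. -/
def imgStratum (E : Q → Set X) (σ : X → X₀) (k : ℕ) : Set X₀ :=
  σ '' logStratum n E σ k

/-- The stalk at `a` of `σ^*ℐ_Y`, the ideal generated by the pull-backs to `X` of functions
vanishing on `Y`. -/
def pullbackIdealAt (σ : X → X₀) (Y : Set X₀) (a : X) : Ideal (holGerm n X a) :=
  Ideal.span {g : holGerm n X a | ∃ f : X₀ → ℂ, (∃ hf : RegAt f (σ a), ⟨_, hf⟩ ∈ idealAt Y (σ a)) ∧
    ((f ∘ σ : X → ℂ) : (𝓝 a).Germ ℂ) = g}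

/-- For all `k = 0, …, p`: `Σ_k = σ⁻¹(Y_k)`, `Y_k ∖ Y_{k+1}` is smooth, and `σ^*ℐ_{Y_k}` is a
principal monomial ideal. -/
structure IsStratified (E : Q → Set X) (σ : X → X₀) : Prop where
  eq_preimage : ∀ k ≤ maxLogRank n E σ, logStratum n E σ k = σ ⁻¹' imgStratum n E σ k
  smooth : ∀ k ≤ maxLogRank n E σ, ∀ b ∈ imgStratum n E σ k \ imgStratum n E σ (k + 1),
    IsSmoothAt (imgStratum n E σ k \ imgStratum n E σ (k + 1)) b
  monomial : ∀ k ≤ maxLogRank n E σ, ∀ a : X,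
    IsMonomialAt E a (pullbackIdealAt n σ (imgStratum n E σ k) a)

end Resolution

end Analytic

/-! # Algebraic varieties over an algebraically closed field -/

namespace Algebraic

universe u

/-- The stalk at `b` of the ideal sheaf in `𝒪_X` of functions vanishing on `Y`. -/
def idealAt {X : Scheme.{u}} (Y : Set X) (b : X) : Ideal (X.presheaf.stalk b) :=
  Ideal.span {g | ∃ (U : X.Opens) (hb : b ∈ U) (f : Γ(X, U)), X.presheaf.germ U b hb f = g ∧
    ∀ y ∈ Y, y ∈ U → y ∉ X.basicOpen f}

/-- The family `x` is a regular system of parameters of the local ring `A`. For the local ring of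
a smooth variety at a closed point, this means that the `x i` are (étale) coordinates vanishing at
that point. -/
def IsCoords {ι : Type*} [Fintype ι] {A : Type*} [CommRing A] [IsLocalRing A] (x : ι → A) : Prop :=
  Ideal.span (Set.range x) = IsLocalRing.maximalIdeal A ∧ ringKrullDim A = Fintype.card ι

/-- An étale neighbourhood of the point `a` of `X`. -/
structure EtaleNhd (X : Scheme.{u}) (a : X) where
  U : Scheme.{u}
  π : U ⟶ X
  etale : Etale π
  pt : U
  map_pt : π pt = a

/-- The local ring of an étale neighbourhood of `a`. -/
abbrev EtaleNhd.ring {X : Scheme.{u}} {a : X} (W : EtaleNhd X a) : CommRingCat.{u} :=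
  W.U.presheaf.stalk W.pt

/-- The pull-back of germs at `a` to an étale neighbourhood of `a`. -/
def EtaleNhd.germMap {X : Scheme.{u}} {a : X} (W : EtaleNhd X a) :
    X.presheaf.stalk a ⟶ W.ring :=
  X.presheaf.stalkSpecializes (specializes_of_eq W.map_pt) ≫ W.π.stalkMap W.pt

/-- Étale local coordinates `(u, v) = (u_1, …, u_s, v_1, …, v_m)` of `X` at `a = 0`, which are
adapted to the family `E` of hypersurfaces: `(u_i = 0)`, `i = 1, …, s`, are the components of `E`
at `a`, `c i` being the index of the component `(u_i = 0)`. -/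
structure IsAdapted {X : Scheme.{u}} {Q : Type*} (E : Q → Set X) {a : X} (W : EtaleNhd X a)
    {s m : ℕ} (u : Fin s → W.ring) (v : Fin m → W.ring) (c : Fin s → Q) : Prop where
  isCoords : IsCoords (Sum.elim u v)
  injective : Function.Injective c
  range_eq : Set.range c = {q | a ∈ E q}
  idealAt_comp : ∀ i, idealAt (W.π ⁻¹' E (c i)) W.pt = Ideal.span {u i}

/-- The finite family `E` consists of the components of a simple normal crossings divisor on the
variety `X`. -/
structure IsSNC {X : Scheme.{u}} {Q : Type*} (E : Q → Set X) : Prop where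
  isClosed : ∀ q, IsClosed (E q)
  exists_adapted : ∀ a : X, IsClosed {a} → ∃ (W : EtaleNhd X a) (s m : ℕ) (u : Fin s → W.ring)
    (v : Fin m → W.ring) (c : Fin s → Q), IsAdapted E W u v c

/-- The ideal `J` of `𝒪_{X,a}` is generated by a monomial in generators of the components
of `E` at `a`; the ideal of a component that does not contain `a` is the unit ideal. -/
def IsMonomialAt {X : Scheme.{u}} {Q : Type*} [Fintype Q] (E : Q → Set X) (a : X)
    (J : Ideal (X.presheaf.stalk a)) : Prop :=
  ∃ α : Q → ℕ, J = ∏ q, idealAt (E q) a ^ α q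

variable {k : Type u} [Field k]

/-- The `k`-algebra structure of the local rings of a scheme over `k`. -/
abbrev stalkAlgebra {X : Scheme.{u}} (f : X ⟶ Spec (.of k)) (a : X) :
    Algebra k (X.presheaf.stalk a) :=
  ((Scheme.ΓSpecIso (.of k)).inv ≫ f.appTop ≫ X.presheaf.germ ⊤ a trivial).hom.toAlgebra

/-- `δ i` is the partial derivative `∂/∂x_i` on the local ring at `a` with respect to the
coordinates `x`: the `k`-derivation with `∂x_j/∂x_i` equal to `1` for `j = i` and to `0`
otherwise. -/
def IsPartials {X : Scheme.{u}} (f : X ⟶ Spec (.of k)) (a : X) {ι : Type*}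
    (x : ι → X.presheaf.stalk a) (δ : ι → X.presheaf.stalk a → X.presheaf.stalk a) : Prop :=
  letI := stalkAlgebra f a
  ∃ D : ι → Derivation k (X.presheaf.stalk a) (X.presheaf.stalk a),
    (∀ i g, δ i g = D i g) ∧ ∀ i, D i (x i) = 1 ∧ ∀ j, j ≠ i → D i (x j) = 0

/-- A local embedding of the variety `X₀` at `b` in a smooth variety `M₀`, over `k`. -/
structure LocalEmbedding {X₀ : Scheme.{u}} (f₀ : X₀ ⟶ Spec (.of k)) (b : X₀) where
  V : X₀.Opens
  mem : b ∈ V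
  M₀ : Scheme.{u}
  g : M₀ ⟶ Spec (.of k)
  smooth : Smooth g
  ι : V.toScheme ⟶ M₀
  isImmersion : IsImmersion ι
  comp_eq : ι ≫ g = V.ι ≫ f₀

section LocalEmbedding

variable {X₀ : Scheme.{u}} {f₀ : X₀ ⟶ Spec (.of k)} {b : X₀}

/-- The image of `b` in `M₀`. -/
abbrev LocalEmbedding.pt (ε : LocalEmbedding f₀ b) : ε.M₀ := ε.ι ⟨b, ε.mem⟩

/-- The local ring of `M₀` at the image of `b`. -/
abbrev LocalEmbedding.ring (ε : LocalEmbedding f₀ b) : CommRingCat.{u} :=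
  ε.M₀.presheaf.stalk ε.pt

/-- The restriction to `X₀` of germs of functions on `M₀`. -/
def LocalEmbedding.germMap (ε : LocalEmbedding f₀ b) : ε.ring ⟶ X₀.presheaf.stalk b :=
  ε.ι.stalkMap ⟨b, ε.mem⟩ ≫ (ε.V.stalkIso ⟨b, ε.mem⟩).hom

end LocalEmbedding

section Resolution

variable {X X₀ : Scheme.{u}} {Q : Type*}

/-- The component `σ_j = σ^*z_j` of `σ` in `𝒪_{X,a}`, for a function `z_j` on `M₀` at `σ(a)`. -/
def component {f₀ : X₀ ⟶ Spec (.of k)} (σ : X ⟶ X₀) (a : X) (ε : LocalEmbedding f₀ (σ a))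
    (z : ε.ring) : X.presheaf.stalk a :=
  σ.stalkMap a (ε.germMap z)

/-- `σ : (X, E) → (X₀, Sing X₀)` is a resolution of singularities. (Since `Sing X₀`, the complement
of the smooth locus, is nowhere dense in the reduced variety `X₀`, and the support of `E` in `X`,
`σ` is birational.) -/
structure IsResolution (f₀ : X₀ ⟶ Spec (.of k)) [LocallyOfFinitePresentation f₀] (E : Q → Set X)
    (σ : X ⟶ X₀) : Prop where
  smooth : Smooth (σ ≫ f₀)
  isSNC : IsSNC E
  isProper : IsProper σ
  isIso : IsIso (σ ∣_ f₀.smoothLocus)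
  preimage_sing : σ ⁻¹' (f₀.smoothLocus : Set X₀)ᶜ = ⋃ q, E q

/-- The logarithmic rank of `σ` at the closed point `a`: the rank at `a` of the logarithmic
Jacobian matrix, with columns `u_i ∂σ/∂u_i` and `∂σ/∂v_j`, with respect to adapted coordinates
`(u, v)` at `a`, a local embedding of `X₀` in a smooth variety, and coordinates `z` of the latter
at `σ(a)`. It does not depend on these choices: `sInf` is taken of a set with one element. -/
def logRank (f₀ : X₀ ⟶ Spec (.of k)) (E : Q → Set X) (σ : X ⟶ X₀) (a : X) : ℕ :=
  sInf {r | ∃ (W : EtaleNhd X a) (s m : ℕ) (u : Fin s → W.ring) (v : Fin m → W.ring)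
    (c : Fin s → Q) (δ : Fin s ⊕ Fin m → W.ring → W.ring),
    IsAdapted E W u v c ∧ IsPartials (W.π ≫ σ ≫ f₀) W.pt (Sum.elim u v) δ ∧
    ∃ (ε : LocalEmbedding f₀ (σ a)) (N : ℕ) (z : Fin N → ε.ring), IsCoords z ∧
      r = (Matrix.of fun (j : Fin N) (i : Fin s ⊕ Fin m) => IsLocalRing.residue W.ring
        (Sum.elim u (fun _ => 1) i * δ i (W.germMap (component σ a ε (z j))))).rank}

/-- `p`, the maximum of the logarithmic rank on (the closed points of) the support of `E`. -/
def maxLogRank (f₀ : X₀ ⟶ Spec (.of k)) (E : Q → Set X) (σ : X ⟶ X₀) : ℕ :=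
  sSup (logRank f₀ E σ '' {a | IsClosed {a} ∧ a ∈ ⋃ q, E q})

/-- `Σ_k`, the set of closed points of the support of `E` at which the logarithmic rank is at most
`p - k` (so that `Σ_{p+1}` is empty). -/
def logStratum (f₀ : X₀ ⟶ Spec (.of k)) (E : Q → Set X) (σ : X ⟶ X₀) (l : ℕ) : Set X :=
  {a | IsClosed {a} ∧ a ∈ ⋃ q, E q ∧ logRank f₀ E σ a + l ≤ maxLogRank f₀ E σ}

/-- `Y_k = σ(Σ_k)`, a set of closed points. -/
def imgStratum (f₀ : X₀ ⟶ Spec (.of k)) (E : Q → Set X) (σ : X ⟶ X₀) (l : ℕ) : Set X₀ :=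
  σ '' logStratum f₀ E σ l

/-- The stalk at `a` of the inverse image ideal sheaf `σ^*ℐ_Y`. -/
def pullbackIdealAt (σ : X ⟶ X₀) (Y : Set X₀) (a : X) : Ideal (X.presheaf.stalk a) :=
  (idealAt Y (σ a)).map (σ.stalkMap a).hom

/-- For all `k = 0, …, p` (written `l` here): `Σ_k = σ⁻¹(Y_k)`, `Y_k ∖ Y_{k+1}` is smooth (its
local rings are regular), and `σ^*ℐ_{Y_k}` is a principal monomial ideal. -/
structure IsStratified (f₀ : X₀ ⟶ Spec (.of k)) [Fintype Q] (E : Q → Set X) (σ : X ⟶ X₀) :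
    Prop where
  eq_preimage : ∀ l ≤ maxLogRank f₀ E σ,
    logStratum f₀ E σ l = {a | IsClosed {a} ∧ σ a ∈ imgStratum f₀ E σ l}
  smooth : ∀ l ≤ maxLogRank f₀ E σ, ∀ b ∈ imgStratum f₀ E σ l \ imgStratum f₀ E σ (l + 1),
    IsRegularLocalRing (X₀.presheaf.stalk b ⧸
      idealAt (imgStratum f₀ E σ l \ imgStratum f₀ E σ (l + 1)) b)
  monomial : ∀ l ≤ maxLogRank f₀ E σ, ∀ a : X, IsClosed {a} →
    IsMonomialAt E a (pullbackIdealAt σ (imgStratum f₀ E σ l) a)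

end Resolution

end Algebraic

end

/-! Where all E-coordinates vanish, the columns u_i ∂σ/∂u_i of the logarithmic Jacobian are zero. So
the logarithmic rank at a is the rank of dσ on the tangent space of the stratum of E through a, the
intersection of the components through a. Put b = σ(a) and k = p - r. Then b ∈ Y_k ∖ Y_{k+1}; since
the rank is lower semicontinuous and σ is proper, Y_{k+1} stays away from b, and near b this
difference is Y_k itself. The crux is that the smooth set Y_k has dimension exactly r at b.

At least r: the monomial generating σ^*ℐ_{Y_k} at a is not a unit, because its zero set contains a,
so it is divisible by some u_i. Functions vanishing on Y_k therefore pull back to functions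
vanishing on a component through a, hence on the stratum, and dσ maps the tangent space of the
stratum into that of Y_k.

At most r: all points over Y_k ∖ Y_{k+1} have logarithmic rank r, so Y_k is covered, near b, by
images of pieces of strata on which σ has rank r.

Consequently dσ maps the tangent space of the stratum onto that of Y_k. Choose coordinates z with
Y_k = (z_{r+1} = … = z_N = 0); these z_j generate the ideal. The pull-backs of z_1, …, z_r have
independent differentials along the stratum and can serve as v_1, …, v_r. The pull-backs of z_{r+1},
…, z_N generate the same ideal as a monomial; by Nakayama one of them is a unit times the monomial,
and after a permutation it is σ_{r+1}. A root of the unit is absorbed into a u_i of positive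
exponent.

Analytic case: `IsStratified.eventually_mem_of_stratum` carries the vanishing argument. The upper
bound `finrank_firstCoords_le` compares Hausdorff dimensions, through the constant-rank estimate
`exists_mem_nhds_dimH_image_le`. `AnalyticAt.exists_eq_sum_mul` identifies the ideal, and
`exists_monomial_coordinates` produces the coordinates of X.

Algebraic case: `IsResolution.le_logRank_iff` replaces the matrix by the rank `RankGE` of the map
from the maximal ideal at b to the local ring at a modulo `logIdeal`, which is insensitive to étale
neighbourhoods and to the embedding. The upper bound `IsResolution.add_le_maxLogRank` works at a
generic point of Y_k: derivations extend to field extensions in characteristic zero, and a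
nonvanishing minor spreads out to closed points (`IsResolution.exists_open_le_logRank`). The lower
bound is `RankGE.le`. Coordinates come from `exists_isCoords_of_quotient_fin` and
`IsCoords.exists_exchange`, and the root of the unit from `exists_etaleNhd_root`. -/

open scoped Topology Manifold ContDiff
open CategoryTheory AlgebraicGeometry

noncomputable section

set_option linter.unusedSectionVars false

/-! ### Completing linear forms to coordinates. -/

section LinearAlgebra

variable {K V : Type*} [Field K] [AddCommGroup V] [Module K V] [FiniteDimensional K V]

/-- A surjection onto `K^r` is completed to a system of linear coordinates. -/
theorem LinearMap.exists_linearEquiv_extending {r m : ℕ} (B : V →ₗ[K] (Fin r → K))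
    (hB : Function.Surjective B) (hm : Module.finrank K V = m) (hr : r ≤ m) :
    ∃ C : V ≃ₗ[K] (Fin m → K), ∀ v (j : Fin r), C v (Fin.castLE hr j) = B v j := by
  obtain ⟨k, rfl⟩ := Nat.exists_eq_add_of_le hr
  have hker : Module.finrank K (LinearMap.ker B) = k := by
    have := B.finrank_range_add_finrank_ker
    rw [LinearMap.range_eq_top.2 hB, finrank_top, hm] at this
    simpa using this
  let f : LinearMap.ker B ≃ₗ[K] (Fin k → K) := LinearEquiv.ofFinrankEq _ _ (by simp [hker])
  -- Linear coordinates of the kernel, extended to V, are the missing ones: the pair (B, g) is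
  -- injective, hence bijective by dimension.
  obtain ⟨g, hg⟩ := LinearMap.exists_extend (f : LinearMap.ker B →ₗ[K] (Fin k → K))
  let e : (Fin r ⊕ Fin k → K) ≃ₗ[K] (Fin (r + k) → K) :=
    LinearEquiv.funCongrLeft K K finSumFinEquiv.symm
  let D : V →ₗ[K] (Fin r ⊕ Fin k → K) :=
    (LinearEquiv.sumArrowLequivProdArrow (Fin r) (Fin k) K K).symm.toLinearMap ∘ₗ (B.prod g)
  have hD : Function.Injective (e.toLinearMap ∘ₗ D) := by
    rw [← LinearMap.ker_eq_bot, LinearMap.ker_eq_bot']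
    intro v hv
    have h1 : D v = 0 := by
      apply e.injective
      simpa using hv
    have h2 : B v = 0 ∧ g v = 0 := by
      have : (B.prod g) v = 0 := by
        apply (LinearEquiv.sumArrowLequivProdArrow (Fin r) (Fin k) K K).symm.injective
        simpa [D] using h1
      simpa using this
    have h3 := LinearMap.congr_fun hg ⟨v, h2.1⟩
    simp only [LinearMap.coe_comp, Function.comp_apply, Submodule.subtype_apply,
      LinearEquiv.coe_coe, h2.2] at h3
    have h4 : (⟨v, h2.1⟩ : LinearMap.ker B) = 0 := by
      apply f.injective; simp [← h3]
    simpa using congrArg Subtype.val h4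
  refine ⟨LinearEquiv.ofInjectiveOfFinrankEq _ hD (by simp [hm]), fun v j => ?_⟩
  have : Fin.castLE hr j = finSumFinEquiv (Sum.inl j : Fin r ⊕ Fin k) := by
    ext; simp
  rw [this]
  change (e (D v)) (finSumFinEquiv (Sum.inl j)) = B v j
  simp [e, D, LinearEquiv.funCongrLeft]

end LinearAlgebra

/-! ### Division of convergent power series by coordinates. -/

section Hadamard

variable {N : ℕ}

/-- The coordinate hyperplane projection `w ↦ (w with w_j = 0)`. -/
def zeroCoord (j : Fin N) : (Fin N → ℂ) →L[ℂ] (Fin N → ℂ) :=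
  ContinuousLinearMap.pi fun i => if i = j then 0 else ContinuousLinearMap.proj i

@[simp] theorem zeroCoord_apply (j : Fin N) (w : Fin N → ℂ) :
    zeroCoord j w = Function.update w j 0 := by
  ext i
  by_cases h : i = j
  · subst h; simp [zeroCoord]
  · simp [zeroCoord, h]

theorem norm_zeroCoord_le (j : Fin N) : ‖zeroCoord j‖ ≤ 1 := by
  refine ContinuousLinearMap.opNorm_le_bound _ zero_le_one fun w => ?_
  rw [one_mul, pi_norm_le_iff_of_nonneg (norm_nonneg _)]
  intro i
  by_cases h : i = j
  · subst h; simp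
  · simpa [h] using norm_le_pi_norm w i

/-- The power series of the difference quotient of an analytic function in the direction of the
`j`-th coordinate. -/
def quotSeries (j : Fin N) (p : FormalMultilinearSeries ℂ (Fin N → ℂ) ℂ) :
    FormalMultilinearSeries ℂ (Fin N → ℂ) ℂ := fun n =>
  ∑ i : Fin (n + 1), ((p (n + 1)).compContinuousLinearMap fun l =>
    if l < i then ContinuousLinearMap.id ℂ _ else if l = i then ContinuousLinearMap.id ℂ _
      else zeroCoord j).curryMid i (Pi.single j 1)

/-- Telescoping: the arguments change from w to its projection one slot at a time. Each difference
has w - zeroCoord j w = w_j e_j in one slot, and multilinearity pulls out w_j. Slot i of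
`quotSeries` carries the identity, so the inserted e_j is not projected. -/
theorem quotSeries_apply (j : Fin N) (p : FormalMultilinearSeries ℂ (Fin N → ℂ) ℂ) (n : ℕ)
    (w : Fin N → ℂ) :
    p (n + 1) (fun _ => w) - p (n + 1) (fun _ => zeroCoord j w) =
      w j * quotSeries j p n fun _ => w := by
  have h := MultilinearMap.map_piecewise_sub_map_piecewise (p (n + 1)).toMultilinearMap
    (fun _ => w) (fun _ => zeroCoord j w) 0 Finset.univ
  simp only [Finset.piecewise_univ, Finset.mem_univ, if_true,
    ContinuousMultilinearMap.coe_coe] at h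
  rw [h, quotSeries, sum_apply, Finset.mul_sum]
  refine Finset.sum_congr rfl fun i _ => ?_
  rw [ContinuousMultilinearMap.curryMid_apply,
    ContinuousMultilinearMap.compContinuousLinearMap_apply]
  have hw : w - zeroCoord j w = w j • (Pi.single j 1 : Fin N → ℂ) := by
    ext l
    by_cases hl : l = j
    · subst hl; simp
    · simp [hl]
  rw [hw]
  have e1 : (fun l : Fin (n + 1) => if l < i then w else if l = i then
      w j • (Pi.single j 1 : Fin N → ℂ) else zeroCoord j w) =
      Function.update (fun l : Fin (n + 1) => if l < i then w else if l = i then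
        0 else zeroCoord j w) i (w j • (Pi.single j 1 : Fin N → ℂ)) := by
    ext1 l
    by_cases hl : l = i
    · subst hl; simp
    · simp [hl]
  rw [e1]
  have e2 := (p (n + 1)).map_update_smul (fun l : Fin (n + 1) => if l < i then w else if l = i then
        0 else zeroCoord j w) i (w j) (Pi.single j 1 : Fin N → ℂ)
  rw [e2, smul_eq_mul]
  congr 2
  ext1 l
  rcases eq_or_ne l i with rfl | hl
  · simp
  · obtain ⟨l', rfl⟩ := Fin.exists_succAbove_eq hl
    simp [hl]
    split_ifs <;> simp

theorem norm_quotSeries_le (j : Fin N) (p : FormalMultilinearSeries ℂ (Fin N → ℂ) ℂ) (n : ℕ) :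
    ‖quotSeries j p n‖ ≤ (n + 1) * ‖p (n + 1)‖ := by
  refine (norm_sum_le _ _).trans ?_
  have : ∀ i : Fin (n + 1), ‖((p (n + 1)).compContinuousLinearMap fun l =>
    if l < i then ContinuousLinearMap.id ℂ (Fin N → ℂ) else if l = i then
      ContinuousLinearMap.id ℂ _ else zeroCoord j).curryMid i (Pi.single j 1)‖ ≤ ‖p (n + 1)‖ := by
    intro i
    refine (ContinuousLinearMap.le_opNorm _ _).trans ?_
    rw [ContinuousMultilinearMap.norm_curryMid]
    have h1 : ‖(Pi.single j 1 : Fin N → ℂ)‖ ≤ 1 := by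
      rw [pi_norm_le_iff_of_nonneg zero_le_one]
      intro l
      by_cases hl : l = j
      · subst hl; simp
      · simp [hl]
    refine (mul_le_of_le_one_right (norm_nonneg _) h1).trans ?_
    refine (ContinuousMultilinearMap.norm_compContinuousLinearMap_le _ _).trans ?_
    refine mul_le_of_le_one_right (norm_nonneg _) (Finset.prod_le_one (fun _ _ => norm_nonneg _) ?_)
    intro l _
    split_ifs
    · exact ContinuousLinearMap.norm_id_le
    · exact ContinuousLinearMap.norm_id_le
    · exact norm_zeroCoord_le j
  refine (Finset.sum_le_sum fun i _ => this i).trans ?_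
  simp

/-- The quotient series costs a factor n + 1 ≤ 2^n in degree n, so half of any ρ below the radius of
p still works; the constant is C / ρ because the degree is shifted by one. -/
theorem quotSeries_radius_pos (j : Fin N) (p : FormalMultilinearSeries ℂ (Fin N → ℂ) ℂ)
    (hp : 0 < p.radius) : 0 < (quotSeries j p).radius := by
  obtain ⟨ρ, hρ0, hρ⟩ := ENNReal.lt_iff_exists_nnreal_btwn.1 hp
  have hρ0' : 0 < ρ := by exact_mod_cast hρ0
  obtain ⟨C, hC, hpC⟩ := p.norm_mul_pow_le_of_lt_radius hρ
  have : ((ρ / 2 : NNReal) : ENNReal) ≤ (quotSeries j p).radius := by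
    refine FormalMultilinearSeries.le_radius_of_bound _ (C / ρ) fun n => ?_
    have h1 := hpC (n + 1)
    have h2 := norm_quotSeries_le j p n
    have h3 : ((n : ℝ) + 1) ≤ 2 ^ n := by exact_mod_cast Nat.lt_two_pow_self (n := n)
    have hρr : (0 : ℝ) < ρ := by exact_mod_cast hρ0'
    rw [le_div_iff₀ hρr]
    push_cast
    rw [div_pow]
    calc ‖quotSeries j p n‖ * ((ρ : ℝ) ^ n / 2 ^ n) * ρ
        ≤ (2 ^ n * ‖p (n + 1)‖) * ((ρ : ℝ) ^ n / 2 ^ n) * ρ := by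
          gcongr
          exact h2.trans (by gcongr)
      _ = ‖p (n + 1)‖ * ρ ^ (n + 1) := by field_simp; ring
      _ ≤ C := h1
  refine lt_of_lt_of_le ?_ this
  simpa [pos_iff_ne_zero] using hρ0'.ne'

/-- Division of an analytic function by a coordinate. -/
theorem AnalyticAt.exists_sub_eq_mul {f : (Fin N → ℂ) → ℂ} (hf : AnalyticAt ℂ f 0) (j : Fin N) :
    ∃ g : (Fin N → ℂ) → ℂ, AnalyticAt ℂ g 0 ∧
      ∀ᶠ w in 𝓝 0, f w - f (zeroCoord j w) = w j * g w := by
  obtain ⟨p, R, hp⟩ := hf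
  have hq := quotSeries_radius_pos j p (hp.r_pos.trans_le hp.r_le)
  have hQ := (quotSeries j p).hasFPowerSeriesOnBall hq
  refine ⟨(quotSeries j p).sum, hQ.analyticAt, ?_⟩
  filter_upwards [Metric.eball_mem_nhds (0 : Fin N → ℂ) hq,
    Metric.eball_mem_nhds (0 : Fin N → ℂ) hp.r_pos] with w hw1 hw2
  have hw3 : zeroCoord j w ∈ Metric.eball (0 : Fin N → ℂ) R := by
    rw [Metric.mem_eball, edist_zero_right] at hw2 ⊢
    refine lt_of_le_of_lt ?_ hw2
    rw [enorm_le_iff_norm_le]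
    simpa using (zeroCoord j).le_of_opNorm_le (norm_zeroCoord_le j) w
  have h1 := (hp.hasSum hw2).sub (hp.hasSum hw3)
  have h2 := (hQ.hasSum hw1).mul_left (w j)
  simp only [zero_add] at h1 h2
  -- The constant terms cancel, so both series can be compared from degree one on.
  rw [← hasSum_nat_add_iff' 1] at h1
  simp only [quotSeries_apply] at h1
  refine Eq.trans ?_ (h1.unique h2)
  simp only [Finset.range_one, Finset.sum_singleton]
  rw [show (p 0 fun _ => w) = p 0 fun _ => zeroCoord j w from
    congrArg _ (Subsingleton.elim _ _)]
  simp

/-- **Hadamard's lemma**: an analytic function vanishing on the coordinate subspace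
`(w_j = 0, j ∈ s)` is in the ideal generated by the `w_j`, `j ∈ s`. -/
theorem AnalyticAt.exists_eq_sum_mul {f : (Fin N → ℂ) → ℂ} (hf : AnalyticAt ℂ f 0)
    (s : Finset (Fin N)) (h0 : ∀ᶠ w in 𝓝 0, (∀ j ∈ s, w j = 0) → f w = 0) :
    ∃ g : Fin N → (Fin N → ℂ) → ℂ, (∀ j, AnalyticAt ℂ (g j) 0) ∧
      ∀ᶠ w in 𝓝 0, f w = ∑ j ∈ s, w j * g j w := by
  induction s using Finset.induction_on generalizing f with
  | empty => exact ⟨fun _ _ => 0, fun _ => analyticAt_const, by simpa using h0⟩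
  | insert j s hj ih =>
    have hc : Filter.Tendsto (zeroCoord j) (𝓝 (0 : Fin N → ℂ)) (𝓝 0) := by
      simpa using (zeroCoord j).continuous.tendsto 0
    have hf' : AnalyticAt ℂ (f ∘ zeroCoord j) 0 :=
      AnalyticAt.comp (by simpa using hf) ((zeroCoord j).analyticAt 0)
    -- The restriction of f to w_j = 0 satisfies the hypothesis for s, and f minus this restriction
    -- is divisible by w_j.
    obtain ⟨g, hg, hfg⟩ := ih hf' <| by
      filter_upwards [hc.eventually h0] with w hw hs
      refine hw fun i hi => ?_
      by_cases hij : i = j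
      · subst hij; simp
      · simpa [hij] using hs i ((Finset.mem_insert.1 hi).resolve_left hij)
    obtain ⟨q, hq, hfq⟩ := hf.exists_sub_eq_mul j
    refine ⟨Function.update g j q, fun i => ?_, ?_⟩
    · by_cases hij : i = j
      · subst hij; simpa using hq
      · simpa [hij] using hg i
    · filter_upwards [hfg, hfq] with w h1 h2
      rw [Finset.sum_insert hj, Function.update_self, ← h2]
      have : ∑ i ∈ s, w i * Function.update g j q i w = ∑ i ∈ s, w i * g i w :=
        Finset.sum_congr rfl fun i hi => by
          rw [Function.update_of_ne (ne_of_mem_of_not_mem hi hj)]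
      rw [this, ← h1]
      simp

end Hadamard

/-! ### Hausdorff dimension of images of constant-rank maps. -/

section HausdorffDimension

/-- The Hausdorff dimension of an image can be bounded locally. -/
theorem dimH_image_le_of_locally {A B : Type*} [TopologicalSpace A] [SecondCountableTopology A]
    [EMetricSpace B] {f : A → B} {s : Set A} {D : ENNReal}
    (h : ∀ x ∈ s, ∃ t ∈ 𝓝[s] x, dimH (f '' t) ≤ D) : dimH (f '' s) ≤ D := by
  choose! t ht hD using h
  obtain ⟨c, hcs, hc, hsc⟩ := TopologicalSpace.countable_cover_nhdsWithin ht
  have : f '' s ⊆ ⋃ x ∈ c, f '' t x := by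
    rw [← Set.image_iUnion₂]
    exact Set.image_mono hsc
  refine (dimH_mono this).trans ?_
  rw [dimH_bUnion hc]
  exact iSup₂_le fun x hx => hD x (hcs hx)

variable {T F : Type*} [NormedAddCommGroup T] [NormedSpace ℂ T] [FiniteDimensional ℂ T]
  [NormedAddCommGroup F] [NormedSpace ℂ F] [FiniteDimensional ℂ F]

/-- The image of a map of constant rank `r` has local dimension at most `r`. -/
theorem exists_mem_nhds_dimH_image_le {f : T → F} {w : T} {r : ℕ} (hf : AnalyticAt ℂ f w)
    (hr : ∀ᶠ w' in 𝓝 w, Module.finrank ℂ (fderiv ℂ f w').range = r) :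
    ∃ V ∈ 𝓝 w, dimH (f '' V) ≤ 2 * r := by
  have : CompleteSpace T := FiniteDimensional.complete ℂ T
  set L := fderiv ℂ f w with hL
  set R : Submodule ℂ F := L.range with hR
  set K : Submodule ℂ T := L.ker with hK
  have hrR : Module.finrank ℂ R = r := hr.self_of_nhds
  have : CompleteSpace R := FiniteDimensional.complete ℂ R
  have : CompleteSpace K := FiniteDimensional.complete ℂ K
  obtain ⟨p, hp⟩ := Submodule.ClosedComplemented.of_finiteDimensional_quotient
    (p := R) (Submodule.closed_of_finiteDimensional R)
  obtain ⟨q, hq⟩ := Submodule.ClosedComplemented.of_finiteDimensional_quotient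
    (p := K) (Submodule.closed_of_finiteDimensional K)
  -- Constant-rank theorem: projecting f to the range of its derivative at w, and the point to the
  -- kernel, gives a local diffeomorphism Ψ. The map h = f ∘ Ψ⁻¹ will not depend on the kernel
  -- variable.
  set Ψ : T → R × K := fun x => (p (f x), q x) with hΨ
  have hfd : HasFDerivAt f L w := hf.differentiableAt.hasFDerivAt
  have hΨd : HasFDerivAt Ψ ((p.comp L).prod q) w :=
    (p.hasFDerivAt.comp w hfd).prodMk q.hasFDerivAt
  have hinj : Function.Injective ((p.comp L).prod q : T →ₗ[ℂ] R × K) := by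
    rw [← LinearMap.ker_eq_bot, LinearMap.ker_eq_bot']
    intro x hx
    have h1 : p (L x) = 0 ∧ q x = 0 := by simpa using hx
    have h2 : L x = 0 := by
      have := hp ⟨L x, ⟨x, rfl⟩⟩
      simp only [h1.1] at this
      simpa using congrArg Subtype.val this.symm
    have h3 := hq ⟨x, h2⟩
    simp only [h1.2] at h3
    simpa using congrArg Subtype.val h3.symm
  have hdim : Module.finrank ℂ T = Module.finrank ℂ (R × K) := by
    rw [Module.finrank_prod, ← L.toLinearMap.finrank_range_add_finrank_ker]
  let e : T ≃L[ℂ] R × K :=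
    (LinearEquiv.ofInjectiveOfFinrankEq _ hinj hdim).toContinuousLinearEquiv
  have he : ((p.comp L).prod q) = (e : T →L[ℂ] R × K) := by
    ext x : 1; rfl
  rw [he] at hΨd
  have hf1 : ContDiffAt ℂ 1 f w := hf.contDiffAt
  have hΨc : ContDiffAt ℂ 1 Ψ w := (p.contDiff.contDiffAt.comp w hf1).prodMk q.contDiff.contDiffAt
  set g := hΨc.localInverse hΨd one_ne_zero with hg
  have hgc : ContDiffAt ℂ 1 g (Ψ w) := hΨc.to_localInverse hΨd one_ne_zero
  have hgw : g (Ψ w) = w := hΨc.localInverse_apply_image hΨd one_ne_zero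
  have hstr := hΨc.hasStrictFDerivAt' hΨd one_ne_zero
  have hleft : ∀ᶠ x in 𝓝 w, g (Ψ x) = x := hstr.eventually_left_inverse
  have hright : ∀ᶠ z in 𝓝 (Ψ w), Ψ (g z) = z := hstr.eventually_right_inverse
  have hgt : Filter.Tendsto g (𝓝 (Ψ w)) (𝓝 w) := by
    simpa [hgw] using hgc.continuousAt.tendsto
  set h : R × K → F := f ∘ g with hh
  have hhc : ContDiffAt ℂ 1 h (Ψ w) := ContDiffAt.comp _ (by rwa [hgw]) hgc
  have key : ∀ᶠ z in 𝓝 (Ψ w), ContDiffAt ℂ 1 h z ∧ ∀ k : K, fderiv ℂ h z (0, k) = 0 := by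
    filter_upwards [hhc.eventually (by simp), hgc.eventually (by simp), hgt.eventually
      (hf1.eventually (by simp)), hright.eventually_nhds, hgt.eventually hr] with z h1 h2 h3 h4 h5
    refine ⟨h1, fun k => ?_⟩
    have e1 : fderiv ℂ h z = (fderiv ℂ f (g z)).comp (fderiv ℂ g z) :=
      fderiv_comp z (h3.differentiableAt one_ne_zero) (h2.differentiableAt one_ne_zero)
    -- As p ∘ h is the first projection, p maps the range of the derivative of f onto R. Both have
    -- dimension r, so p is injective there, and a derivative of h killed by p is zero.
    have e2 : ∀ y, p (fderiv ℂ h z y) = y.1 := by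
      intro y
      have e3 : (fun z => p (h z)) =ᶠ[𝓝 z] Prod.fst := by
        filter_upwards [h4] with z hz
        exact congrArg Prod.fst hz
      have e4 : HasFDerivAt (fun z => p (h z)) (p.comp (fderiv ℂ h z)) z :=
        p.hasFDerivAt.comp z (h1.differentiableAt one_ne_zero).hasFDerivAt
      have e5 := (e4.congr_of_eventuallyEq e3.symm).unique hasFDerivAt_fst
      simpa using congrArg (fun l => l y) e5
    set M := (fderiv ℂ f (g z)).range
    have hmem : ∀ y, fderiv ℂ h z y ∈ M := fun y => ⟨fderiv ℂ g z y, by rw [e1]; rfl⟩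
    let pM : M →ₗ[ℂ] R := p.toLinearMap ∘ₗ M.subtype
    have hsurj : Function.Surjective pM := fun y => ⟨⟨_, hmem (y, 0)⟩, e2 (y, 0)⟩
    have hinjM : Function.Injective pM :=
      (LinearMap.injective_iff_surjective_of_finrank_eq_finrank (h5.trans hrR.symm)).2 hsurj
    have : (⟨_, hmem (0, k)⟩ : M) = 0 := hinjM (by
      rw [map_zero]; exact e2 (0, k))
    exact congrArg Subtype.val this
  obtain ⟨ε, hε, hball⟩ := Metric.eventually_nhds_iff_ball.1 key
  have hconst : ∀ y ∈ Metric.ball (Ψ w).1 ε, ∀ k ∈ Metric.ball (Ψ w).2 ε,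
      h (y, k) = h (y, (Ψ w).2) := by
    intro y hy k hk
    have hd : ∀ k ∈ Metric.ball (Ψ w).2 ε,
        HasFDerivAt (fun k => h (y, k)) (0 : K →L[ℂ] F) k := by
      intro k hk
      have hz := hball (y, k) (by rw [← ball_prod_same]; exact ⟨hy, hk⟩)
      have h1 := (hz.1.differentiableAt one_ne_zero).hasFDerivAt.comp k
        (hasFDerivAt_prodMk_right (𝕜 := ℂ) y k)
      have h2 : (fderiv ℂ h (y, k)).comp (ContinuousLinearMap.inr ℂ R K) = 0 := by
        ext1 x
        simpa using hz.2 x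
      rw [h2] at h1
      exact h1
    refine (convex_ball _ _).is_const_of_fderivWithin_eq_zero (𝕜 := ℂ) (f := fun k => h (y, k))
      (fun k hk => (hd k hk).differentiableAt.differentiableWithinAt) (fun k hk => ?_) hk
      (Metric.mem_ball_self hε)
    rw [fderivWithin_of_isOpen Metric.isOpen_ball hk]
    exact (hd k hk).fderiv
  have hpre : Ψ ⁻¹' Metric.ball (Ψ w) ε ∈ 𝓝 w :=
    hΨc.continuousAt.preimage_mem_nhds (Metric.ball_mem_nhds _ hε)
  refine ⟨_, Filter.inter_mem hleft hpre, ?_⟩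
  have hsub : f '' ({x | g (Ψ x) = x} ∩ Ψ ⁻¹' Metric.ball (Ψ w) ε) ⊆
      (fun y => h (y, (Ψ w).2)) '' Metric.ball (Ψ w).1 ε := by
    rintro _ ⟨x, ⟨hx1, hx2⟩, rfl⟩
    rw [Set.mem_preimage, ← ball_prod_same] at hx2
    refine ⟨(Ψ x).1, hx2.1, ?_⟩
    change h ((Ψ x).1, (Ψ w).2) = f x
    rw [← hconst _ hx2.1 _ hx2.2]
    change f (g (Ψ x)) = f x
    rw [hx1]
  refine (dimH_mono hsub).trans ?_
  -- What remains is a C¹ map on a ball of R, whose real dimension is 2r.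
  have hcd : ContDiffOn ℝ 1 (fun y => h (y, (Ψ w).2)) (Metric.ball (Ψ w).1 ε) := by
    intro y hy
    have hz := (hball (y, (Ψ w).2) (by
      rw [← ball_prod_same]; exact ⟨hy, Metric.mem_ball_self hε⟩)).1.restrict_scalars ℝ
    exact (hz.comp y (contDiff_prodMk_left _).contDiffAt).contDiffWithinAt
  refine (hcd.dimH_image_le (convex_ball _ _) subset_rfl).trans ?_
  refine (dimH_mono (Set.subset_univ _)).trans ?_
  rw [Real.dimH_univ_eq_finrank, finrank_real_of_complex, hrR]
  simp

end HausdorffDimension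

namespace Analytic

/-! ### Holomorphic functions in charts and changes of coordinates. -/

section Charts

variable {n : ℕ} {X : Type*} [TopologicalSpace X] [ChartedSpace (Fin n → ℂ) X]

theorem holAt_iff [IsManifold 𝓘(ℂ, Fin n → ℂ) ω X] {e : OpenPartialHomeomorph X (Fin n → ℂ)}
    (he : e ∈ IsManifold.maximalAtlas 𝓘(ℂ, Fin n → ℂ) ω X) {x : X} (hx : x ∈ e.source)
    {f : X → ℂ} : HolAt n f x ↔ AnalyticAt ℂ (f ∘ e.symm) (e x) := by
  rw [HolAt, contMDiffAt_iff_of_mem_maximalAtlas he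
    (IsManifold.chart_mem_maximalAtlas (I := 𝓘(ℂ, ℂ)) (f x)) hx (by simp)]
  have h2 : ContDiffAt ℂ ω (f ∘ e.symm) (e x) ↔ AnalyticAt ℂ (f ∘ e.symm) (e x) :=
    by rw [← contDiffWithinAt_univ, contDiffWithinAt_omega_iff_analyticWithinAt, analyticWithinAt_univ]
  rw [← h2]
  simp only [mfld_simps, OpenPartialHomeomorph.extend, chartAt_self_eq]
  rw [contDiffWithinAt_univ]
  refine ⟨fun h => h.2, fun h => ⟨?_, h⟩⟩
  have h3 := h.continuousAt.comp (e.continuousAt hx)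
  refine h3.congr ?_
  filter_upwards [e.open_source.mem_nhds hx] with y hy
  simp [e.left_inv hy]

theorem holAt_comp_chart [IsManifold 𝓘(ℂ, Fin n → ℂ) ω X]
    {e : OpenPartialHomeomorph X (Fin n → ℂ)}
    (he : e ∈ IsManifold.maximalAtlas 𝓘(ℂ, Fin n → ℂ) ω X) {x : X} (hx : x ∈ e.source)
    {g : (Fin n → ℂ) → ℂ} (hg : AnalyticAt ℂ g (e x)) : HolAt n (g ∘ e) x := by
  rw [holAt_iff he hx]
  refine hg.congr ?_
  filter_upwards [e.open_target.mem_nhds (e.map_source hx)] with y hy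
  simp [e.right_inv hy]

/-- An analytic change of coordinates with injective derivative gives a new chart. -/
theorem exists_chart_comp [IsManifold 𝓘(ℂ, Fin n → ℂ) ω X]
    {e : OpenPartialHomeomorph X (Fin n → ℂ)}
    (he : e ∈ IsManifold.maximalAtlas 𝓘(ℂ, Fin n → ℂ) ω X) {a : X} (ha : a ∈ e.source)
    {Φ : (Fin n → ℂ) → (Fin n → ℂ)} (hΦ : AnalyticAt ℂ Φ (e a))
    (hinj : Function.Injective (fderiv ℂ Φ (e a))) {O : Set X} (hO : O ∈ 𝓝 a) :
    ∃ e' ∈ IsManifold.maximalAtlas 𝓘(ℂ, Fin n → ℂ) ω X, a ∈ e'.source ∧ e'.source ⊆ O ∧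
      e'.source ⊆ e.source ∧ ∀ x ∈ e'.source, e' x = Φ (e x) := by
  let L : (Fin n → ℂ) ≃L[ℂ] (Fin n → ℂ) := (LinearEquiv.ofInjectiveEndo
    (fderiv ℂ Φ (e a)).toLinearMap hinj).toContinuousLinearEquiv
  have hL : fderiv ℂ Φ (e a) = (L : (Fin n → ℂ) →L[ℂ] (Fin n → ℂ)) := by ext x : 1; rfl
  have hcd : ContDiffAt ℂ ω Φ (e a) := hΦ.contDiffAt
  have hd : HasFDerivAt Φ (L : (Fin n → ℂ) →L[ℂ] (Fin n → ℂ)) (e a) :=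
    hL ▸ hΦ.differentiableAt.hasFDerivAt
  let Ψ := hcd.toOpenPartialHomeomorph Φ hd (by simp)
  have hΨs : e a ∈ Ψ.source := hcd.mem_toOpenPartialHomeomorph_source hd (by simp)
  -- A chart must be analytic in both directions at every point of its source, so the local inverse
  -- is restricted to where Φ remains analytic with invertible derivative.
  have hev : ∀ᶠ w in 𝓝 (e a), AnalyticAt ℂ Φ w ∧
      ∃ L' : (Fin n → ℂ) ≃L[ℂ] (Fin n → ℂ),
        HasFDerivAt Φ (L' : (Fin n → ℂ) →L[ℂ] (Fin n → ℂ)) w := by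
    have hopen : ∀ᶠ w in 𝓝 (e a), fderiv ℂ Φ w ∈
        Set.range ((↑) : ((Fin n → ℂ) ≃L[ℂ] (Fin n → ℂ)) → _) := by
      refine hΦ.fderiv.continuousAt.eventually
        (ContinuousLinearEquiv.isOpen.mem_nhds ⟨L, hL.symm⟩)
    filter_upwards [hΦ.eventually_analyticAt, hopen] with w h1 ⟨L', hL'⟩
    exact ⟨h1, L', hL' ▸ h1.differentiableAt.hasFDerivAt⟩
  obtain ⟨W, hW, hWo, hWa⟩ := eventually_nhds_iff.1 hev
  let Ψ' := Ψ.restrOpen W hWo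
  have hΨ' : ∀ w, Ψ' w = Φ w := fun _ => rfl
  have hsrc : Ψ'.source = Ψ.source ∩ W := rfl
  let e₁ := e.trans Ψ'
  have he₁ : e₁ ∈ IsManifold.maximalAtlas 𝓘(ℂ, Fin n → ℂ) ω X := by
    refine OpenPartialHomeomorph.mem_maximalAtlas_of_contMDiffOn _ ?_ ?_
    · rw [OpenPartialHomeomorph.trans_source]
      have h1 : ContMDiffOn 𝓘(ℂ, Fin n → ℂ) 𝓘(ℂ, Fin n → ℂ) ω Φ Ψ'.source := fun w hw =>
        (hW w hw.2).1.contDiffAt.contMDiffAt.contMDiffWithinAt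
      exact h1.comp ((contMDiffOn_of_mem_maximalAtlas he).mono Set.inter_subset_left)
        Set.inter_subset_right
    · have h1 : ContMDiffOn 𝓘(ℂ, Fin n → ℂ) 𝓘(ℂ, Fin n → ℂ) ω Ψ'.symm Ψ'.target := by
        intro w hw
        have hw' := Ψ'.map_target hw
        obtain ⟨h2, L', h3⟩ := hW _ hw'.2
        exact (Ψ'.contDiffAt_symm hw h3 h2.contDiffAt).contMDiffAt.contMDiffWithinAt
      rw [OpenPartialHomeomorph.trans_target]
      exact (contMDiffOn_symm_of_mem_maximalAtlas he).comp (h1.mono Set.inter_subset_left)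
        Set.inter_subset_right
  refine ⟨e₁.restr (interior O), restr_mem_maximalAtlas _ he₁ isOpen_interior, ?_, ?_, ?_, ?_⟩
  · rw [OpenPartialHomeomorph.restr_source, interior_interior]
    exact ⟨⟨ha, hΨs, hWa⟩, mem_interior_iff_mem_nhds.2 hO⟩
  · rw [OpenPartialHomeomorph.restr_source, interior_interior]
    exact fun x hx => interior_subset hx.2
  · exact fun x hx => hx.1.1
  · exact fun x hx => rfl

end Charts

end Analytic

namespace Analytic

theorem analyticAt_apply {N : ℕ} (j : Fin N) (v : Fin N → ℂ) :
    AnalyticAt ℂ (fun v : Fin N → ℂ => v j) v :=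
  (ContinuousLinearMap.proj (R := ℂ) (φ := fun _ : Fin N => ℂ) j).analyticAt v

/-! ### Comparison of analytic local embeddings. -/

section Embedding

variable {X₀ : Type*} [TopologicalSpace X₀] {N : ℕ} {M : Type*} [TopologicalSpace M]
  [ChartedSpace (Fin N → ℂ) M] {𝒪 : ∀ x : X₀, Subring ((𝓝 x).Germ ℂ)} {ι : X₀ → M} {U : Set X₀}

theorem IsLocalEmbedding.continuousAt (h : IsLocalEmbedding N 𝒪 ι U) {b : X₀} (hb : b ∈ U) :
    ContinuousAt ι b :=
  (continuousOn_iff_continuous_domRestrict.2 h.isEmbedding.continuous).continuousAt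
    (h.isOpen.mem_nhds hb)

/-- As ι is a homeomorphism of U with its image, points of U mapped near ι b are near b. This brings
conditions on the ambient manifold back to X₀. -/
theorem IsLocalEmbedding.eventually_mem (h : IsLocalEmbedding N 𝒪 ι U) {b : X₀} (hb : b ∈ U)
    {V : Set X₀} (hV : V ∈ 𝓝 b) : ∀ᶠ w in 𝓝 (ι b), ∀ y ∈ U, ι y = w → y ∈ V := by
  have h1 := h.isEmbedding.isInducing.nhds_eq_comap ⟨b, hb⟩
  have h2 : ((↑) : U → X₀) ⁻¹' V ∈ 𝓝 (⟨b, hb⟩ : U) :=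
    continuous_subtype_val.continuousAt.preimage_mem_nhds hV
  rw [h1] at h2
  obtain ⟨t, ht, hts⟩ := h2
  filter_upwards [ht] with w hw y hy hyw
  exact hts (show (U.domRestrict ι) ⟨y, hy⟩ ∈ t by
    change ι y ∈ t
    rwa [hyw])

theorem IsLocalEmbedding.injOn (h : IsLocalEmbedding N 𝒪 ι U) : Set.InjOn ι U := by
  intro x hx y hy hxy
  have := h.isEmbedding.injective (a₁ := ⟨x, hx⟩) (a₂ := ⟨y, hy⟩) hxy
  exact congrArg Subtype.val this

variable [IsManifold 𝓘(ℂ, Fin N → ℂ) ω M]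
  {N' : ℕ} {M' : Type*} [TopologicalSpace M'] [ChartedSpace (Fin N' → ℂ) M']
  [IsManifold 𝓘(ℂ, Fin N' → ℂ) ω M'] {ι' : X₀ → M'} {U' : Set X₀}

/-- In charts, two local embeddings differ by a holomorphic map. -/
theorem IsLocalEmbedding.exists_transition (h : IsLocalEmbedding N 𝒪 ι U)
    (h' : IsLocalEmbedding N' 𝒪 ι' U') {b : X₀} (hb : b ∈ U) (hb' : b ∈ U')
    {w : OpenPartialHomeomorph M (Fin N → ℂ)}
    (hw : w ∈ IsManifold.maximalAtlas 𝓘(ℂ, Fin N → ℂ) ω M) (hwb : ι b ∈ w.source)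
    {w' : OpenPartialHomeomorph M' (Fin N' → ℂ)}
    (hw' : w' ∈ IsManifold.maximalAtlas 𝓘(ℂ, Fin N' → ℂ) ω M') (hwb' : ι' b ∈ w'.source) :
    ∃ H : (Fin N → ℂ) → (Fin N' → ℂ), AnalyticAt ℂ H (w (ι b)) ∧
      ∀ᶠ y in 𝓝 b, w' (ι' y) = H (w (ι y)) := by
  -- The coordinates of the second embedding belong to the structure sheaf, hence are restrictions
  -- of holomorphic functions on the first ambient manifold.
  have h1 : ∀ j : Fin N', ∃ f : M → ℂ, HolAt N f (ι b) ∧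
      (f ∘ ι) =ᶠ[𝓝 b] fun y => w' (ι' y) j := by
    intro j
    have h2 : HolAt N' ((fun v : Fin N' → ℂ => v j) ∘ w') (ι' b) :=
      holAt_comp_chart hw' hwb' (analyticAt_apply j _)
    obtain ⟨f, hf, hfe⟩ := (h.mem_iff b hb _).1 ((h'.mem_iff b hb' _).2 ⟨_, h2, rfl⟩)
    exact ⟨f, hf, Filter.Germ.coe_eq.1 hfe⟩
  choose f hf hfe using h1
  refine ⟨fun v j => f j (w.symm v), ?_, ?_⟩
  · rw [analyticAt_pi_iff]
    exact fun j => (holAt_iff hw hwb).1 (hf j)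
  · filter_upwards [Filter.eventually_all.2 hfe,
      (h.continuousAt hb).preimage_mem_nhds (w.open_source.mem_nhds hwb)] with y hy hyw
    ext j
    rw [w.left_inv hyw]
    exact (hy j).symm

end Embedding

/-! ### The logarithmic Jacobian and tangent spaces of strata. -/

section Tangent

variable {n : ℕ}

/-- In adapted coordinates, the tangent space at `w` of the smallest intersection of components
of the divisor containing `w`. -/
def stratumTangent {s m : ℕ} (κ : Fin s ⊕ Fin m ≃ Fin n) (w : Fin n → ℂ) :
    Submodule ℂ (Fin n → ℂ) where
  carrier := {ξ | ∀ i, w (κ (.inl i)) = 0 → ξ (κ (.inl i)) = 0}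
  add_mem' := fun {a b} ha hb i hi => by simp [ha i hi, hb i hi]
  zero_mem' := fun i _ => rfl
  smul_mem' := fun c a ha i hi => by simp [ha i hi]

/-- Where all u_i vanish, the u-columns are zero and the v-columns span the image of the tangent
space of the stratum. -/
theorem rank_logJac {s m N : ℕ} (κ : Fin s ⊕ Fin m ≃ Fin n) (F : (Fin n → ℂ) → (Fin N → ℂ))
    {w : Fin n → ℂ} (hw : ∀ i, w (κ (.inl i)) = 0) :
    (logJac κ F w).rank =
      Module.finrank ℂ ((stratumTangent κ w).map (fderiv ℂ F w).toLinearMap) := by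
  rw [Matrix.rank_eq_finrank_span_cols]
  suffices h : Submodule.span ℂ (Set.range (logJac κ F w).col) =
      (stratumTangent κ w).map (fderiv ℂ F w).toLinearMap by rw [h]
  apply le_antisymm
  · rw [Submodule.span_le]
    rintro _ ⟨i | l, rfl⟩
    · have : (logJac κ F w).col (.inl i) = 0 := by
        ext j; simp [logJac, hw]
      rw [this]
      exact Submodule.zero_mem _
    · refine ⟨Pi.single (κ (.inr l)) 1, fun i _ => ?_, ?_⟩
      · simp
      · ext j; simp [logJac]
  · rintro _ ⟨ξ, hξ, rfl⟩
    have h1 : ξ = ∑ l : Fin m, ξ (κ (.inr l)) • (Pi.single (κ (.inr l)) 1 : Fin n → ℂ) := by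
      ext i
      obtain ⟨i | i, rfl⟩ := κ.surjective i
      · simp [hξ i (hw i)]
      · simp [Pi.single_apply]
    rw [h1, map_sum]
    refine Submodule.sum_mem _ fun l _ => ?_
    rw [map_smul]
    refine Submodule.smul_mem _ _ (Submodule.subset_span ⟨.inr l, ?_⟩)
    ext j; simp [logJac]

end Tangent

/-! ### Independence of the logarithmic rank from choices. -/

section Rank

variable {n : ℕ} {X : Type*} [TopologicalSpace X] [ChartedSpace (Fin n → ℂ) X]
  {Q : Type*} {E : Q → Set X}

theorem IsAdapted.exists_index {a : X} {s m : ℕ} {e : OpenPartialHomeomorph X (Fin n → ℂ)}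
    {κ : Fin s ⊕ Fin m ≃ Fin n} {c : Fin s → Q} (h : IsAdapted E a e κ c) {x : X}
    (hx : x ∈ e.source) {q : Q} (hq : x ∈ E q) : ∃ i, c i = q := by
  have h1 : q ∈ Set.range c := by
    rw [h.range_eq]
    by_contra h2
    exact Set.disjoint_left.1 (h.disjoint q h2) hq hx
  exact h1

theorem IsAdapted.apply_eq_zero {a : X} {s m : ℕ} {e : OpenPartialHomeomorph X (Fin n → ℂ)}
    {κ : Fin s ⊕ Fin m ≃ Fin n} {c : Fin s → Q} (h : IsAdapted E a e κ c) (i : Fin s) :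
    e a (κ (.inl i)) = 0 := by
  rw [h.map_eq_zero]; rfl

variable [IsManifold 𝓘(ℂ, Fin n → ℂ) ω X]

theorem analyticAt_transition {e e' : OpenPartialHomeomorph X (Fin n → ℂ)}
    (he : e ∈ IsManifold.maximalAtlas 𝓘(ℂ, Fin n → ℂ) ω X)
    (he' : e' ∈ IsManifold.maximalAtlas 𝓘(ℂ, Fin n → ℂ) ω X) {x : X} (hx : x ∈ e.source)
    (hx' : x ∈ e'.source) : AnalyticAt ℂ (e' ∘ e.symm) (e x) := by
  rw [analyticAt_pi_iff]
  intro j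
  exact (holAt_iff he hx).1 (holAt_comp_chart he' hx'
    (analyticAt_apply j _))

/-- The line through e x in the direction ξ stays in the component, so the coordinate of e' that
defines this component vanishes along it, and so does its derivative. -/
theorem fderiv_transition_mem {e e' : OpenPartialHomeomorph X (Fin n → ℂ)}
    (he : e ∈ IsManifold.maximalAtlas 𝓘(ℂ, Fin n → ℂ) ω X)
    (he' : e' ∈ IsManifold.maximalAtlas 𝓘(ℂ, Fin n → ℂ) ω X) {x : X} (hx : x ∈ e.source)
    (hx' : x ∈ e'.source) {s m s' m' : ℕ} {κ : Fin s ⊕ Fin m ≃ Fin n}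
    {κ' : Fin s' ⊕ Fin m' ≃ Fin n}
    (h : ∀ i', e' x (κ' (.inl i')) = 0 → ∃ i, e x (κ (.inl i)) = 0 ∧
      ∀ᶠ y in 𝓝 x, e y (κ (.inl i)) = 0 → e' y (κ' (.inl i')) = 0)
    {ξ : Fin n → ℂ} (hξ : ξ ∈ stratumTangent κ (e x)) :
    fderiv ℂ (e' ∘ e.symm) (e x) ξ ∈ stratumTangent κ' (e' x) := by
  intro i' hi'
  obtain ⟨i, hi, hy⟩ := h i' hi'
  have hξi := hξ i hi
  have hA := (analyticAt_transition he he' hx hx').differentiableAt.hasFDerivAt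
  have hline : HasDerivAt (fun t : ℂ => e x + t • ξ) ξ 0 := by
    simpa using ((hasDerivAt_id (0 : ℂ)).smul_const ξ).const_add (e x)
  have h1 : HasDerivAt (fun t : ℂ => (e' ∘ e.symm) (e x + t • ξ))
      (fderiv ℂ (e' ∘ e.symm) (e x) ξ) 0 :=
    HasFDerivAt.comp_hasDerivAt (0 : ℂ) (by rw [zero_smul, add_zero]; exact hA) hline
  have h2 := (hasDerivAt_pi.1 h1) (κ' (.inl i'))
  have h3 : (fun t : ℂ => (e' ∘ e.symm) (e x + t • ξ) (κ' (.inl i'))) =ᶠ[𝓝 0] fun _ => 0 := by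
    have hc : Filter.Tendsto (fun t : ℂ => e x + t • ξ) (𝓝 0) (𝓝 (e x)) := by
      simpa using hline.continuousAt.tendsto
    have hs : Filter.Tendsto e.symm (𝓝 (e x)) (𝓝 x) := by
      simpa [e.left_inv hx] using (e.symm.continuousAt (e.map_source hx)).tendsto
    filter_upwards [hc.eventually (hs.eventually hy),
      hc.eventually (e.open_target.mem_nhds (e.map_source hx))] with t ht htt
    apply ht
    rw [e.right_inv htt]
    simp [hi, hξi]
  exact (h2.congr_of_eventuallyEq h3.symm).unique (hasDerivAt_const _ _)

/-- Neither chart need be centred at x: only the components through x enter, and they are the same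
for both charts. Hence one chart computes the logarithmic rank at all its points. -/
theorem map_stratumTangent_transition {e e' : OpenPartialHomeomorph X (Fin n → ℂ)} {a a' : X}
    {s m s' m' : ℕ} {κ : Fin s ⊕ Fin m ≃ Fin n} {κ' : Fin s' ⊕ Fin m' ≃ Fin n}
    {c : Fin s → Q} {c' : Fin s' → Q} (he : IsAdapted E a e κ c) (he' : IsAdapted E a' e' κ' c')
    {x : X} (hx : x ∈ e.source) (hx' : x ∈ e'.source) :
    (stratumTangent κ (e x)).map (fderiv ℂ (e' ∘ e.symm) (e x)).toLinearMap =
      stratumTangent κ' (e' x) := by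
  have aux : ∀ {e e' : OpenPartialHomeomorph X (Fin n → ℂ)} {a a' : X}
    {s m s' m' : ℕ} {κ : Fin s ⊕ Fin m ≃ Fin n} {κ' : Fin s' ⊕ Fin m' ≃ Fin n}
    {c : Fin s → Q} {c' : Fin s' → Q} (_ : IsAdapted E a e κ c) (_ : IsAdapted E a' e' κ' c')
    (_ : x ∈ e.source) (_ : x ∈ e'.source), ∀ i', e' x (κ' (.inl i')) = 0 →
      ∃ i, e x (κ (.inl i)) = 0 ∧
      ∀ᶠ y in 𝓝 x, e y (κ (.inl i)) = 0 → e' y (κ' (.inl i')) = 0 := by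
    intro e e' a a' s m s' m' κ κ' c c' he he' hx hx' i' hi'
    have h1 := (he'.mem_comp_iff i' x hx').2 hi'
    obtain ⟨i, hi⟩ := he.exists_index hx h1
    refine ⟨i, (he.mem_comp_iff i x hx).1 (hi ▸ h1), ?_⟩
    filter_upwards [e.open_source.mem_nhds hx, e'.open_source.mem_nhds hx'] with y hy hy' h2
    exact (he'.mem_comp_iff i' y hy').1 (hi ▸ (he.mem_comp_iff i y hy).2 h2)
  apply le_antisymm
  · rintro _ ⟨ξ, hξ, rfl⟩
    exact fderiv_transition_mem he.mem_atlas he'.mem_atlas hx hx' (aux he he' hx hx') hξ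
  · intro ξ hξ
    refine ⟨_, fderiv_transition_mem he'.mem_atlas he.mem_atlas hx' hx
      (aux he' he hx' hx) hξ, ?_⟩
    have hd := (analyticAt_transition he.mem_atlas he'.mem_atlas hx hx').differentiableAt
    have hd' := (analyticAt_transition he'.mem_atlas he.mem_atlas hx' hx).differentiableAt
    have h1 : (e ∘ e'.symm) (e' x) = e x := by simp [e'.left_inv hx']
    have h2 := fderiv_comp (e' x) (g := e' ∘ e.symm) (h1 ▸ hd) hd'
    rw [h1] at h2
    have h3 : (e' ∘ e.symm) ∘ (e ∘ e'.symm) =ᶠ[𝓝 (e' x)] id := by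
      have hs : Filter.Tendsto e'.symm (𝓝 (e' x)) (𝓝 x) := by
        simpa [e'.left_inv hx'] using (e'.symm.continuousAt (e'.map_source hx')).tendsto
      filter_upwards [hs.eventually (e.open_source.mem_nhds hx),
        e'.open_target.mem_nhds (e'.map_source hx')] with y hy hy'
      simp [e.left_inv hy, e'.right_inv hy']
    rw [h3.fderiv_eq, fderiv_id] at h2
    exact (congrArg (fun l => l ξ) h2).symm

variable {X₀ : Type*} [TopologicalSpace X₀] [ReducedSpace X₀] {σ : X → X₀}

theorem IsResolution.analyticAt_coord (hσ : IsResolution n E σ) {N : ℕ} {M : Type*}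
    [TopologicalSpace M] [ChartedSpace (Fin N → ℂ) M] [IsManifold 𝓘(ℂ, Fin N → ℂ) ω M]
    {ι : X₀ → M} {U : Set X₀} (hι : IsLocalEmbedding N ReducedSpace.stalk ι U)
    {e : OpenPartialHomeomorph X (Fin n → ℂ)}
    (he : e ∈ IsManifold.maximalAtlas 𝓘(ℂ, Fin n → ℂ) ω X) {x : X} (hx : x ∈ e.source)
    (hU : σ x ∈ U) {w : OpenPartialHomeomorph M (Fin N → ℂ)}
    (hw : w ∈ IsManifold.maximalAtlas 𝓘(ℂ, Fin N → ℂ) ω M) (hwx : ι (σ x) ∈ w.source) :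
    AnalyticAt ℂ (w ∘ ι ∘ σ ∘ e.symm) (e x) := by
  rw [analyticAt_pi_iff]
  intro j
  have h1 : HolAt N ((fun v : Fin N → ℂ => v j) ∘ w) (ι (σ x)) :=
    holAt_comp_chart hw hwx (analyticAt_apply j _)
  exact (holAt_iff he hx).1 (hσ.holomorphic x _ ((hι.mem_iff _ hU _).2 ⟨_, h1, rfl⟩))

/-- The rank of `σ` restricted to the stratum of `E` through `x`, in given coordinates. -/
def coordRank (σ : X → X₀) {s m N : ℕ} {M : Type*} [TopologicalSpace M]
    (e : OpenPartialHomeomorph X (Fin n → ℂ)) (κ : Fin s ⊕ Fin m ≃ Fin n)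
    (ι : X₀ → M) (w : OpenPartialHomeomorph M (Fin N → ℂ)) (x : X) : ℕ :=
  Module.finrank ℂ ((stratumTangent κ (e x)).map
    (fderiv ℂ (w ∘ ι ∘ σ ∘ e.symm) (e x)).toLinearMap)

/-- The second composite is a holomorphic function of the first, and a further linear map cannot
raise the rank. Exchanging the embeddings gives equality. -/
theorem IsResolution.coordRank_le (hσ : IsResolution n E σ) {N : ℕ} {M : Type*}
    [TopologicalSpace M] [ChartedSpace (Fin N → ℂ) M] [IsManifold 𝓘(ℂ, Fin N → ℂ) ω M]
    {ι : X₀ → M} {U : Set X₀} (hι : IsLocalEmbedding N ReducedSpace.stalk ι U)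
    {N' : ℕ} {M' : Type*}
    [TopologicalSpace M'] [ChartedSpace (Fin N' → ℂ) M'] [IsManifold 𝓘(ℂ, Fin N' → ℂ) ω M']
    {ι' : X₀ → M'} {U' : Set X₀} (hι' : IsLocalEmbedding N' ReducedSpace.stalk ι' U')
    {s m : ℕ} {κ : Fin s ⊕ Fin m ≃ Fin n}
    {e : OpenPartialHomeomorph X (Fin n → ℂ)}
    (he : e ∈ IsManifold.maximalAtlas 𝓘(ℂ, Fin n → ℂ) ω X) {x : X} (hx : x ∈ e.source)
    (hU : σ x ∈ U) (hU' : σ x ∈ U') {w : OpenPartialHomeomorph M (Fin N → ℂ)}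
    (hw : w ∈ IsManifold.maximalAtlas 𝓘(ℂ, Fin N → ℂ) ω M) (hwx : ι (σ x) ∈ w.source)
    {w' : OpenPartialHomeomorph M' (Fin N' → ℂ)}
    (hw' : w' ∈ IsManifold.maximalAtlas 𝓘(ℂ, Fin N' → ℂ) ω M') (hwx' : ι' (σ x) ∈ w'.source) :
    coordRank σ e κ ι' w' x ≤ coordRank σ e κ ι w x := by
  obtain ⟨H, hH, hHe⟩ := hι.exists_transition hι' hU hU' hw hwx hw' hwx'
  have hs : Filter.Tendsto (σ ∘ e.symm) (𝓝 (e x)) (𝓝 (σ x)) := by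
    have : Filter.Tendsto e.symm (𝓝 (e x)) (𝓝 x) := by
      simpa [e.left_inv hx] using (e.symm.continuousAt (e.map_source hx)).tendsto
    exact (hσ.isProperMap.continuous.tendsto x).comp this
  have h1 : w' ∘ ι' ∘ σ ∘ e.symm =ᶠ[𝓝 (e x)] H ∘ (w ∘ ι ∘ σ ∘ e.symm) := hs.eventually hHe
  have h2 : (w ∘ ι ∘ σ ∘ e.symm) (e x) = w (ι (σ x)) := by simp [e.left_inv hx]
  rw [coordRank, h1.fderiv_eq, fderiv_comp _ (h2 ▸ hH.differentiableAt)
    (hσ.analyticAt_coord hι he hx hU hw hwx).differentiableAt]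
  rw [ContinuousLinearMap.toLinearMap_comp, Submodule.map_comp]
  exact Submodule.finrank_map_le _ _

theorem IsResolution.coordRank_chart (hσ : IsResolution n E σ) {N : ℕ} {M : Type*}
    [TopologicalSpace M] [ChartedSpace (Fin N → ℂ) M] [IsManifold 𝓘(ℂ, Fin N → ℂ) ω M]
    {ι : X₀ → M} {U : Set X₀} (hι : IsLocalEmbedding N ReducedSpace.stalk ι U)
    {e e' : OpenPartialHomeomorph X (Fin n → ℂ)} {a a' : X}
    {s m s' m' : ℕ} {κ : Fin s ⊕ Fin m ≃ Fin n} {κ' : Fin s' ⊕ Fin m' ≃ Fin n}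
    {c : Fin s → Q} {c' : Fin s' → Q} (he : IsAdapted E a e κ c) (he' : IsAdapted E a' e' κ' c')
    {x : X} (hx : x ∈ e.source) (hx' : x ∈ e'.source)
    (hU : σ x ∈ U) {w : OpenPartialHomeomorph M (Fin N → ℂ)}
    (hw : w ∈ IsManifold.maximalAtlas 𝓘(ℂ, Fin N → ℂ) ω M) (hwx : ι (σ x) ∈ w.source) :
    coordRank σ e κ ι w x = coordRank σ e' κ' ι w x := by
  have h1 : w ∘ ι ∘ σ ∘ e.symm =ᶠ[𝓝 (e x)] (w ∘ ι ∘ σ ∘ e'.symm) ∘ (e' ∘ e.symm) := by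
    have hs : Filter.Tendsto e.symm (𝓝 (e x)) (𝓝 x) := by
      simpa [e.left_inv hx] using (e.symm.continuousAt (e.map_source hx)).tendsto
    filter_upwards [hs.eventually (e'.open_source.mem_nhds hx')] with y hy
    simp [e'.left_inv hy]
  have h2 : (e' ∘ e.symm) (e x) = e' x := by simp [e.left_inv hx]
  rw [coordRank, h1.fderiv_eq, fderiv_comp _
    (h2 ▸ (hσ.analyticAt_coord hι he'.mem_atlas hx' hU hw hwx).differentiableAt)
    (analyticAt_transition he.mem_atlas he'.mem_atlas hx hx').differentiableAt, h2,
    ContinuousLinearMap.toLinearMap_comp, Submodule.map_comp,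
    map_stratumTangent_transition he he' hx hx']
  rfl

/-- The logarithmic rank is computed by any adapted coordinates and any local embedding. -/
theorem IsResolution.logRank_eq (hσ : IsResolution n E σ) {N : ℕ} {M : Type*}
    [TopologicalSpace M] [ChartedSpace (Fin N → ℂ) M] [IsManifold 𝓘(ℂ, Fin N → ℂ) ω M]
    {ι : X₀ → M} {U : Set X₀} (hι : IsLocalEmbedding N ReducedSpace.stalk ι U)
    {e : OpenPartialHomeomorph X (Fin n → ℂ)} {a : X}
    {s m : ℕ} {κ : Fin s ⊕ Fin m ≃ Fin n}
    {c : Fin s → Q} (he : IsAdapted E a e κ c) {x : X} (hx : x ∈ e.source)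
    (hU : σ x ∈ U) {w : OpenPartialHomeomorph M (Fin N → ℂ)}
    (hw : w ∈ IsManifold.maximalAtlas 𝓘(ℂ, Fin N → ℂ) ω M) (hwx : ι (σ x) ∈ w.source) :
    logRank n E σ x = coordRank σ e κ ι w x := by
  have key : ∀ r ∈ {r | ∃ (s m : ℕ) (e : OpenPartialHomeomorph X (Fin n → ℂ))
      (κ : Fin s ⊕ Fin m ≃ Fin n) (c : Fin s → Q), IsAdapted E x e κ c ∧
      ∃ (N : ℕ) (φ : X₀ → (Fin N → ℂ)) (U : Set X₀), σ x ∈ U ∧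
      IsLocalEmbedding N ReducedSpace.stalk φ U ∧
      r = (logJac κ (φ ∘ σ ∘ e.symm) (e x)).rank}, r = coordRank σ e κ ι w x := by
    rintro r ⟨s', m', e', κ', c', he', N', φ, U', hU', hφ, rfl⟩
    have hx' := he'.mem_source
    have hid : OpenPartialHomeomorph.refl (Fin N' → ℂ) ∈
        IsManifold.maximalAtlas 𝓘(ℂ, Fin N' → ℂ) ω (Fin N' → ℂ) :=
      StructureGroupoid.id_mem_maximalAtlas _
    have hsrc : φ (σ x) ∈ (OpenPartialHomeomorph.refl (Fin N' → ℂ)).source := Set.mem_univ _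
    have hc : (logJac κ' (φ ∘ σ ∘ e'.symm) (e' x)).rank =
        coordRank σ e' κ' φ (OpenPartialHomeomorph.refl (Fin N' → ℂ)) x := by
      rw [rank_logJac κ' _ he'.apply_eq_zero, coordRank,
        show ⇑(OpenPartialHomeomorph.refl (Fin N' → ℂ)) = id from rfl, Function.id_comp]
    rw [hc, hσ.coordRank_chart hι he he' hx hx' hU hw hwx]
    exact le_antisymm
      (hσ.coordRank_le hι hφ he'.mem_atlas hx' hU hU' hw hwx hid hsrc)
      (hσ.coordRank_le hφ hι he'.mem_atlas hx' hU' hU hid hsrc hw hwx)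
  -- Adapted coordinates and an embedding exist, so the `sInf` is attained and is not the default
  -- value 0.
  obtain ⟨s', m', e', κ', c', he'⟩ := hσ.isSNC x
  obtain ⟨N', φ, U', hU', hφ⟩ := ReducedSpace.exists_localEmbedding (σ x)
  exact key _ (Nat.sInf_mem ⟨_, s', m', e', κ', c', he', N', φ, U', hU', hφ, rfl⟩)

end Rank

end Analytic

namespace Analytic

theorem exists_germ_eq {Z : Type*} {l : Filter Z} (g : l.Germ ℂ) :
    ∃ f : Z → ℂ, (f : l.Germ ℂ) = g :=
  Filter.Germ.inductionOn g fun f => ⟨f, rfl⟩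

/-! ### Closedness of the strata and consequences of monomiality. -/

section Strata

variable {n : ℕ} {X : Type*} [TopologicalSpace X] [ChartedSpace (Fin n → ℂ) X]
  [IsManifold 𝓘(ℂ, Fin n → ℂ) ω X] {Q : Type*} {E : Q → Set X}
  {X₀ : Type*} [TopologicalSpace X₀] [ReducedSpace X₀] {σ : X → X₀}

theorem tendsto_symm {N : ℕ} {M : Type*} [TopologicalSpace M]
    (e : OpenPartialHomeomorph M (Fin N → ℂ)) {x : M} (hx : x ∈ e.source) :
    Filter.Tendsto e.symm (𝓝 (e x)) (𝓝 x) := by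
  simpa [e.left_inv hx] using (e.symm.continuousAt (e.map_source hx)).tendsto

theorem id_mem_maximalAtlas (N : ℕ) : OpenPartialHomeomorph.refl (Fin N → ℂ) ∈
    IsManifold.maximalAtlas 𝓘(ℂ, Fin N → ℂ) ω (Fin N → ℂ) :=
  StructureGroupoid.id_mem_maximalAtlas _

/-- The logarithmic rank is lower semicontinuous. -/
theorem IsResolution.eventually_logRank_le (hσ : IsResolution n E σ) (a : X) :
    ∀ᶠ x in 𝓝 a, logRank n E σ a ≤ logRank n E σ x := by
  obtain ⟨s, m, e, κ, c, he⟩ := hσ.isSNC a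
  obtain ⟨N, φ, U, hU, hφ⟩ := ReducedSpace.exists_localEmbedding (σ a)
  have ha := he.mem_source
  have hrk : ∀ x ∈ e.source, σ x ∈ U → logRank n E σ x =
      coordRank σ e κ φ (OpenPartialHomeomorph.refl _) x := fun x hx hxU =>
    hσ.logRank_eq hφ he hx hxU (id_mem_maximalAtlas N) (Set.mem_univ _)
  have han := hσ.analyticAt_coord hφ he.mem_atlas ha hU (id_mem_maximalAtlas N) (Set.mem_univ _)
  set F := OpenPartialHomeomorph.refl (Fin N → ℂ) ∘ φ ∘ σ ∘ e.symm with hF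
  set P := (stratumTangent κ (e a)).map (fderiv ℂ F (e a)).toLinearMap with hP
  have hbasis := (Module.finBasis ℂ P).linearIndependent.map' P.subtype (by simp)
  have hpre : ∀ i, ∃ ξ ∈ stratumTangent κ (e a), fderiv ℂ F (e a) ξ = (Module.finBasis ℂ P i : P) :=
    fun i => (Module.finBasis ℂ P i).2
  choose ξ hξ hξe using hpre
  have hli : LinearIndependent ℂ fun i => fderiv ℂ F (e a) (ξ i) := by
    have : (fun i => fderiv ℂ F (e a) (ξ i)) = P.subtype ∘ Module.finBasis ℂ P := funext hξe
    rw [this]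
    exact hbasis
  have hcont : Filter.Tendsto (fun x i => fderiv ℂ F (e x) (ξ i)) (𝓝 a)
      (𝓝 fun i => fderiv ℂ F (e a) (ξ i)) := by
    rw [tendsto_pi_nhds]
    intro i
    exact ((ContinuousLinearMap.apply ℂ (Fin N → ℂ) (ξ i)).continuous.tendsto _).comp
      (han.fderiv.continuousAt.tendsto.comp (e.continuousAt ha))
  filter_upwards [hcont.eventually hli.eventually, e.open_source.mem_nhds ha,
    (hσ.isProperMap.continuous.tendsto a).eventually (hφ.isOpen.mem_nhds hU)] with x h1 h2 h3
  rw [hrk a ha hU, hrk x h2 h3]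
  have h4 : Submodule.span ℂ (Set.range fun i => fderiv ℂ F (e x) (ξ i)) ≤
      (stratumTangent κ (e x)).map (fderiv ℂ F (e x)).toLinearMap := by
    rw [Submodule.span_le]
    rintro _ ⟨i, rfl⟩
    -- All E-coordinates vanish at a, so those of ξ i are all zero; hence ξ i is tangent to the
    -- stratum through any nearby point.
    exact ⟨ξ i, fun l _ => hξ i l (he.apply_eq_zero l), rfl⟩
  have h5 := finrank_span_eq_card h1
  rw [Fintype.card_fin] at h5
  calc coordRank σ e κ φ (OpenPartialHomeomorph.refl _) a = Module.finrank ℂ P := rfl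
    _ = _ := h5.symm
    _ ≤ _ := Submodule.finrank_mono h4

theorem IsSNC.isClosed_iUnion (h : IsSNC n E) : IsClosed (⋃ q, E q) := by
  rw [← isOpen_compl_iff, isOpen_iff_mem_nhds]
  intro a ha
  obtain ⟨s, m, e, κ, c, he⟩ := h a
  simp only [Set.mem_compl_iff, Set.mem_iUnion, not_exists] at ha
  filter_upwards [e.open_source.mem_nhds he.mem_source] with x hx
  simp only [Set.mem_compl_iff, Set.mem_iUnion, not_exists]
  exact fun q hq => Set.disjoint_left.1 (he.disjoint q (ha q)) hq hx

theorem IsResolution.isClosed_logStratum (hσ : IsResolution n E σ) (k : ℕ) :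
    IsClosed (logStratum n E σ k) := by
  have : logStratum n E σ k = (⋃ q, E q) ∩ {a | logRank n E σ a + k ≤ maxLogRank n E σ} := by
    ext; rfl
  rw [this]
  refine hσ.isSNC.isClosed_iUnion.inter ?_
  rw [← isOpen_compl_iff, isOpen_iff_mem_nhds]
  intro a ha
  filter_upwards [hσ.eventually_logRank_le a] with x hx h
  exact ha (le_trans (Nat.add_le_add_right hx k) h)

theorem IsResolution.isClosed_imgStratum (hσ : IsResolution n E σ) (k : ℕ) :
    IsClosed (imgStratum n E σ k) :=
  hσ.isProperMap.isClosedMap _ (hσ.isClosed_logStratum k)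

/-- The bound makes the `sSup` defining p a genuine upper bound. -/
theorem IsResolution.logRank_le (hσ : IsResolution n E σ) (a : X) : logRank n E σ a ≤ n := by
  obtain ⟨s, m, e, κ, c, he⟩ := hσ.isSNC a
  obtain ⟨N, φ, U, hU, hφ⟩ := ReducedSpace.exists_localEmbedding (σ a)
  rw [hσ.logRank_eq hφ he he.mem_source hU (id_mem_maximalAtlas N) (Set.mem_univ _), coordRank]
  refine (Submodule.finrank_map_le _ _).trans ((Submodule.finrank_le _).trans ?_)
  simp

theorem IsResolution.logRank_le_maxLogRank (hσ : IsResolution n E σ) {a : X}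
    (ha : a ∈ ⋃ q, E q) : logRank n E σ a ≤ maxLogRank n E σ := by
  refine le_csSup ⟨n, ?_⟩ ⟨a, ha, rfl⟩
  rintro _ ⟨x, -, rfl⟩
  exact hσ.logRank_le x

/-- From Σ_k = σ⁻¹(Y_k) for k and k + 1. At k = p nothing is assumed for k + 1, but Σ_{p+1} is empty
because ranks are natural numbers. -/
theorem IsStratified.mem_sdiff_iff (hS : IsStratified n E σ) {k : ℕ} (hk : k ≤ maxLogRank n E σ)
    {x : X} : σ x ∈ imgStratum n E σ k \ imgStratum n E σ (k + 1) ↔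
      x ∈ ⋃ q, E q ∧ logRank n E σ x + k = maxLogRank n E σ := by
  have h1 : σ x ∈ imgStratum n E σ k ↔ x ∈ logStratum n E σ k := by
    rw [hS.eq_preimage k hk]; rfl
  have h2 : σ x ∈ imgStratum n E σ (k + 1) ↔ x ∈ logStratum n E σ (k + 1) := by
    rcases Nat.lt_or_ge (maxLogRank n E σ) (k + 1) with h | h
    · have : logStratum n E σ (k + 1) = ∅ := by
        ext y
        simp only [logStratum, Set.mem_ofPred_eq, Set.mem_empty_iff_false, iff_false]
        omega
      simp [imgStratum, this]
    · rw [hS.eq_preimage _ h]; rfl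
  rw [Set.mem_sdiff, h1, h2]
  simp only [logStratum, Set.mem_ofPred_eq]
  constructor
  · rintro ⟨⟨h3, h4⟩, h5⟩
    refine ⟨h3, ?_⟩
    by_contra h6
    exact h5 ⟨h3, by omega⟩
  · rintro ⟨h3, h4⟩
    exact ⟨⟨h3, by omega⟩, fun h => by omega⟩

/-- Principal ideals are written as spans of sets of this form, so that no membership proof enters
the statements. -/
theorem germ_setOf_eq {Z : Type*} [TopologicalSpace Z] {x : Z} (S : Subring ((𝓝 x).Germ ℂ))
    {f : Z → ℂ} (hf : (f : (𝓝 x).Germ ℂ) ∈ S) :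
    {g : S | (f : (𝓝 x).Germ ℂ) = g} = {⟨_, hf⟩} := by
  ext g
  simp only [Set.mem_ofPred_eq, Set.mem_singleton_iff, Subtype.ext_iff]
  exact eq_comm

theorem mem_idealAt_of_eventually {Y : Set X₀} {b : X₀} {f : X₀ → ℂ} (hf : RegAt f b)
    (h : ∀ᶠ y in 𝓝 b, y ∈ Y → f y = 0) : ⟨_, hf⟩ ∈ idealAt Y b :=
  Ideal.subset_span ⟨f, rfl, h⟩

/-- Germs vanishing on Y are closed under sums and multiples, so taking the span adds nothing. -/
theorem eventually_eq_zero_of_mem_idealAt {Y : Set X₀} {b : X₀} {f : X₀ → ℂ} (hf : RegAt f b)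
    (h : ⟨_, hf⟩ ∈ idealAt Y b) : ∀ᶠ y in 𝓝 b, y ∈ Y → f y = 0 := by
  have key : ∀ g ∈ idealAt Y b, ∃ f : X₀ → ℂ, (f : (𝓝 b).Germ ℂ) = g ∧
      ∀ᶠ y in 𝓝 b, y ∈ Y → f y = 0 := by
    intro g hg
    refine Submodule.span_induction (fun g hg => hg) ⟨0, rfl, by simp⟩ ?_ ?_ hg
    · rintro g₁ g₂ - - ⟨f₁, h₁, h₁'⟩ ⟨f₂, h₂, h₂'⟩
      refine ⟨f₁ + f₂, by push_cast [← h₁, ← h₂]; rfl, ?_⟩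
      filter_upwards [h₁', h₂'] with y hy₁ hy₂ hy
      simp [hy₁ hy, hy₂ hy]
    · rintro ⟨c, hc⟩ g₁ - ⟨f₁, h₁, h₁'⟩
      obtain ⟨c', rfl⟩ := exists_germ_eq c
      refine ⟨c' * f₁, by simp only [smul_eq_mul, Subring.coe_mul, ← h₁]; rfl, ?_⟩
      filter_upwards [h₁'] with y hy₁ hy
      simp [hy₁ hy]
  obtain ⟨f', h1, h2⟩ := key _ h
  filter_upwards [Filter.Germ.coe_eq.1 h1, h2] with y h3 h4 hy
  rw [← h3, h4 hy]

variable (n) in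
/-- The pull-back of germs by `σ`. -/
def pullbackHom (hσ : IsResolution n E σ) (a : X) :
    (ReducedSpace.stalk (σ a) : Subring _) →+* holGerm n X a where
  toFun g := ⟨Filter.Germ.compTendsto g.1 σ (hσ.isProperMap.continuous.tendsto a), by
    obtain ⟨g, hg⟩ := g
    obtain ⟨f, rfl⟩ := exists_germ_eq g
    exact ⟨f ∘ σ, hσ.holomorphic a f hg, rfl⟩⟩
  map_one' := rfl
  map_zero' := rfl
  map_mul' := by
    rintro ⟨g, hg⟩ ⟨g', hg'⟩
    obtain ⟨f, rfl⟩ := exists_germ_eq g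
    obtain ⟨f', rfl⟩ := exists_germ_eq g'
    rfl
  map_add' := by
    rintro ⟨g, hg⟩ ⟨g', hg'⟩
    obtain ⟨f, rfl⟩ := exists_germ_eq g
    obtain ⟨f', rfl⟩ := exists_germ_eq g'
    rfl

theorem pullbackIdealAt_eq_map (hσ : IsResolution n E σ) (Y : Set X₀) (a : X) :
    pullbackIdealAt n σ Y a = (idealAt Y (σ a)).map (pullbackHom n hσ a) := by
  rw [pullbackIdealAt, Ideal.map]
  congr 1
  ext g
  constructor
  · rintro ⟨f, ⟨hf, hfI⟩, hg⟩
    exact ⟨_, hfI, Subtype.ext hg⟩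
  · rintro ⟨⟨f, hf⟩, hfI, rfl⟩
    obtain ⟨f, rfl⟩ := exists_germ_eq f
    exact ⟨f, ⟨hf, hfI⟩, rfl⟩

/-- An element of the pull-back of the ideal of `Y` vanishes at the points over `Y`. -/
theorem one_notMem_pullbackIdealAt {Y : Set X₀} {a : X}
    (ha : σ a ∈ Y) : (1 : holGerm n X a) ∉ pullbackIdealAt n σ Y a := by
  intro h
  have h1 : pullbackIdealAt n σ Y a ≤
      RingHom.ker ((Filter.Germ.valueRingHom : (𝓝 a).Germ ℂ →+* ℂ).comp
        (holGerm n X a).subtype) := by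
    rw [pullbackIdealAt, Ideal.span_le]
    rintro g ⟨f, ⟨hf, hfI⟩, hg⟩
    have := (eventually_eq_zero_of_mem_idealAt hf hfI).self_of_nhds ha
    change Filter.Germ.value (g : (𝓝 a).Germ ℂ) = 0
    rw [← hg]
    exact this
  have h2 := h1 h
  rw [RingHom.mem_ker, map_one] at h2
  exact one_ne_zero h2

/-- Consequence of monomiality: elements of the ideal pull back to multiples of the monomial. -/
theorem exists_eq_mul_prod (hσ : IsResolution n E σ) {Y : Set X₀} {a : X} {s m : ℕ}
    {e : OpenPartialHomeomorph X (Fin n → ℂ)} {κ : Fin s ⊕ Fin m ≃ Fin n} {α : Fin s → ℕ}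
    (he : e ∈ IsManifold.maximalAtlas 𝓘(ℂ, Fin n → ℂ) ω X) (ha : a ∈ e.source)
    (h : pullbackIdealAt n σ Y a = Ideal.span {g : holGerm n X a |
      ((fun x => ∏ i, e x (κ (.inl i)) ^ α i : X → ℂ) : (𝓝 a).Germ ℂ) = g})
    {f : X₀ → ℂ} (hf : RegAt f (σ a)) (hfY : ∀ᶠ y in 𝓝 (σ a), y ∈ Y → f y = 0) :
    ∃ g : X → ℂ, HolAt n g a ∧ ∀ᶠ x in 𝓝 a, f (σ x) = g x * ∏ i, e x (κ (.inl i)) ^ α i := by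
  have hmem : (((fun x => ∏ i, e x (κ (.inl i)) ^ α i : X → ℂ) : (𝓝 a).Germ ℂ)) ∈
      holGerm n X a := by
    refine ⟨_, holAt_comp_chart he ha (g := fun w => ∏ i, w (κ (.inl i)) ^ α i) ?_, rfl⟩
    exact Finset.analyticAt_fun_prod _ fun i _ => (analyticAt_apply _ _).pow _
  rw [germ_setOf_eq _ hmem] at h
  have h1 : (⟨_, f ∘ σ, hσ.holomorphic a f hf, rfl⟩ : holGerm n X a) ∈
      pullbackIdealAt n σ Y a :=
    Ideal.subset_span ⟨f, ⟨hf, mem_idealAt_of_eventually hf hfY⟩, rfl⟩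
  rw [h, Ideal.mem_span_singleton'] at h1
  obtain ⟨⟨_, g, hg, rfl⟩, h2⟩ := h1
  refine ⟨g, hg, ?_⟩
  have h3 := Filter.Germ.coe_eq.1 (congrArg Subtype.val h2)
  filter_upwards [h3] with x hx
  exact hx.symm

/-- Elements of σ^*ℐ_Y vanish at points over Y, so the monomial cannot be 1. -/
theorem exists_pos_of_pullbackIdealAt {Y : Set X₀} {a : X} {s m : ℕ}
    {e : OpenPartialHomeomorph X (Fin n → ℂ)} {κ : Fin s ⊕ Fin m ≃ Fin n} {α : Fin s → ℕ}
    (ha : σ a ∈ Y)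
    (h : pullbackIdealAt n σ Y a = Ideal.span {g : holGerm n X a |
      ((fun x => ∏ i, e x (κ (.inl i)) ^ α i : X → ℂ) : (𝓝 a).Germ ℂ) = g}) :
    ∃ i, 0 < α i := by
  by_contra! hα
  refine one_notMem_pullbackIdealAt (n := n) ha ?_
  rw [h]
  refine Ideal.subset_span ?_
  have : (fun x => ∏ i, e x (κ (.inl i)) ^ α i : X → ℂ) = 1 := by
    ext x
    exact Finset.prod_eq_one fun i _ => by rw [Nat.le_zero.1 (hα i), pow_zero]
  rw [Set.mem_ofPred_eq, this]
  rfl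

/-- Some u_{i₀} has positive exponent in the monomial generating σ^*ℐ_{Y_k}. The equations of the
smooth image stratum therefore pull back to functions vanishing on (u_{i₀} = 0), and σ maps this
component, and with it the stratum through x, into Y_k ∖ Y_{k+1} near x. -/
theorem IsStratified.eventually_mem_of_stratum (hσ : IsResolution n E σ)
    (hS : IsStratified n E σ) {k : ℕ} (hk : k ≤ maxLogRank n E σ) {x : X}
    (hx : σ x ∈ imgStratum n E σ k \ imgStratum n E σ (k + 1)) :
    ∀ᶠ x' in 𝓝 x, (∀ q, x ∈ E q → x' ∈ E q) →
      σ x' ∈ imgStratum n E σ k \ imgStratum n E σ (k + 1) := by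
  obtain ⟨N, φ, U, hU, hφ, z, hz, d, hzs, hz0, hzY⟩ := hS.smooth k hk _ hx
  obtain ⟨s, m, e, κ, c, α, he, hmon⟩ := hS.monomial k hk x
  obtain ⟨i₀, hi₀⟩ := exists_pos_of_pullbackIdealAt hx.1 hmon
  have hσc := hσ.isProperMap.continuous.tendsto x
  have hφσ := (hφ.continuousAt hU).tendsto
  have hout : ∀ᶠ y in 𝓝 (σ x), y ∈ imgStratum n E σ k →
      y ∈ imgStratum n E σ k \ imgStratum n E σ (k + 1) := by
    filter_upwards [(hσ.isClosed_imgStratum (k + 1)).isOpen_compl.mem_nhds hx.2] with y hy hy'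
    exact ⟨hy', hy⟩
  have hvan : ∀ j : Fin N, d ≤ (j : ℕ) → ∀ᶠ x' in 𝓝 x, e x' (κ (.inl i₀)) = 0 →
      z (φ (σ x')) j = 0 := by
    intro j hj
    have hreg : RegAt (fun y => z (φ y) j) (σ x) :=
      (hφ.mem_iff _ hU _).2 ⟨_, holAt_comp_chart hz hzs (analyticAt_apply j _), rfl⟩
    obtain ⟨g, -, hg⟩ := exists_eq_mul_prod hσ he.mem_atlas he.mem_source hmon hreg (by
      filter_upwards [hout, hφσ.eventually hzY, hφ.isOpen.mem_nhds hU] with y h1 h2 h3 h4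
      exact h2.1 ⟨y, ⟨h1 h4, h3⟩, rfl⟩ j hj)
    filter_upwards [hg] with x' h1 h2
    rw [h1, Finset.prod_eq_zero (Finset.mem_univ i₀) (by rw [h2, zero_pow hi₀.ne']), mul_zero]
  have hc : x ∈ E (c i₀) := by
    have : c i₀ ∈ Set.range c := ⟨i₀, rfl⟩
    rwa [he.range_eq] at this
  filter_upwards [Filter.eventually_all.2 fun j => Filter.eventually_imp_distrib_left.2 (hvan j),
    e.open_source.mem_nhds he.mem_source, hσc.eventually (hφσ.eventually hzY),
    hσc.eventually (hφ.isOpen.mem_nhds hU)] with x' h1 h2 h3 h4 h5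
  have h6 := (he.mem_comp_iff i₀ x' h2).1 (h5 _ hc)
  obtain ⟨y, ⟨hy, hyU⟩, hyx⟩ := h3.2 fun j hj => h1 j hj h6
  rwa [← hφ.injOn hyU h4 hyx]

end Strata

end Analytic

namespace Analytic

/-! ### The image strata have dimension at most p - k. -/

section Dimension

variable {n : ℕ} {X : Type*} [TopologicalSpace X] [ChartedSpace (Fin n → ℂ) X]
  [IsManifold 𝓘(ℂ, Fin n → ℂ) ω X] {Q : Type*} {E : Q → Set X}
  {X₀ : Type*} [TopologicalSpace X₀] [ReducedSpace X₀] {σ : X → X₀}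

/-- The coordinate subspace `(w_j = 0, j ≥ d)`. -/
def firstCoords (N d : ℕ) : Submodule ℂ (Fin N → ℂ) where
  carrier := {w | ∀ j : Fin N, d ≤ (j : ℕ) → w j = 0}
  add_mem' := fun {a b} ha hb i hi => by simp [ha i hi, hb i hi]
  zero_mem' := fun i _ => rfl
  smul_mem' := fun c a ha i hi => by simp [ha i hi]

/-- Near a point, `σ` maps each stratum of the divisor contained in the preimage of
`Y_k ∖ Y_{k+1}` to a set of dimension at most the logarithmic rank. -/
theorem exists_dimH_image_stratum_le (hσ : IsResolution n E σ)
    (hS : IsStratified n E σ) {k : ℕ} (hk : k ≤ maxLogRank n E σ)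
    {N : ℕ} {φ : X₀ → (Fin N → ℂ)} {U : Set X₀}
    (hφ : IsLocalEmbedding N ReducedSpace.stalk φ U)
    {z : OpenPartialHomeomorph (Fin N → ℂ) (Fin N → ℂ)}
    (hz : z ∈ IsManifold.maximalAtlas 𝓘(ℂ, Fin N → ℂ) ω (Fin N → ℂ))
    {a : X} {s m : ℕ} {e : OpenPartialHomeomorph X (Fin n → ℂ)} {κ : Fin s ⊕ Fin m ≃ Fin n}
    {c : Fin s → Q} (he : IsAdapted E a e κ c) {x : X} (hx : x ∈ e.source)
    (hxU : σ x ∈ U) (hxz : φ (σ x) ∈ z.source)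
    (hxD : σ x ∈ imgStratum n E σ k \ imgStratum n E σ (k + 1)) :
    ∃ V ∈ 𝓝 (e x), dimH ((z ∘ φ ∘ σ ∘ e.symm) '' {w | w ∈ V ∧ ∀ i, e x (κ (.inl i)) = 0 →
      w (κ (.inl i)) = 0}) ≤ 2 * (maxLogRank n E σ - k : ℕ) := by
  set T := stratumTangent κ (e x) with hT
  set G := z ∘ φ ∘ σ ∘ e.symm with hG
  have hGan : AnalyticAt ℂ G (e x) := hσ.analyticAt_coord hφ he.mem_atlas hx hxU hz hxz
  -- In the chart, the stratum through x is the affine space through e x with direction T.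
  let tr : T → (Fin n → ℂ) := fun τ => e x + τ
  have htr0 : tr 0 = e x := by simp [tr]
  have htr : ∀ τ, HasFDerivAt tr T.subtypeL τ := fun τ =>
    T.subtypeL.hasFDerivAt.const_add (e x)
  have htran : AnalyticAt ℂ tr 0 := analyticAt_const.add (T.subtypeL.analyticAt 0)
  have htrt : Filter.Tendsto tr (𝓝 0) (𝓝 (e x)) := by
    simpa [htr0] using htran.continuousAt.tendsto
  have hfan : AnalyticAt ℂ (G ∘ tr) 0 := AnalyticAt.comp (by rwa [htr0]) htran
  -- Nearby points of the stratum stay over Y_k ∖ Y_{k+1}, where the logarithmic rank is p - k. The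
  -- nonzero E-coordinates stay nonzero, so the tangent space of the stratum is T at all these
  -- points, and G ∘ tr has constant rank.
  have hr : ∀ᶠ τ in 𝓝 (0 : T), Module.finrank ℂ (fderiv ℂ (G ∘ tr) τ).range =
      maxLogRank n E σ - k := by
    have hsymm := tendsto_symm e hx
    have hσc := hσ.isProperMap.continuous.tendsto x
    have hnz : ∀ᶠ w in 𝓝 (e x), ∀ i, e x (κ (.inl i)) ≠ 0 → w (κ (.inl i)) ≠ 0 := by
      refine Filter.eventually_all.2 fun i => Filter.eventually_imp_distrib_left.2 fun h => ?_
      exact ((continuous_apply _).tendsto (e x)).eventually_ne h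
    filter_upwards [htrt.eventually hGan.eventually_analyticAt,
      htrt.eventually (e.open_target.mem_nhds (e.map_source hx)),
      htrt.eventually (hsymm.eventually (hS.eventually_mem_of_stratum hσ hk hxD)),
      htrt.eventually (hsymm.eventually (hσc.eventually (hφ.isOpen.mem_nhds hxU))),
      htrt.eventually (hsymm.eventually (hσc.eventually
        ((hφ.continuousAt hxU).preimage_mem_nhds (z.open_source.mem_nhds hxz)))),
      htrt.eventually hnz] with τ h1 h2 h3 h4 h5 h6
    set x' := e.symm (tr τ) with hx'
    have hx's : x' ∈ e.source := e.map_target h2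
    have hex' : e x' = tr τ := e.right_inv h2
    have hτ0 : ∀ i, e x (κ (.inl i)) = 0 → tr τ (κ (.inl i)) = 0 := fun i hi => by
      simp [tr, hi, τ.2 i hi]
    have hD : σ x' ∈ imgStratum n E σ k \ imgStratum n E σ (k + 1) := by
      refine h3 fun q hq => ?_
      obtain ⟨i, rfl⟩ := he.exists_index hx hq
      rw [he.mem_comp_iff i _ hx's, hex']
      exact hτ0 i ((he.mem_comp_iff i x hx).1 hq)
    have hlr := ((hS.mem_sdiff_iff hk).1 hD).2
    rw [hσ.logRank_eq hφ he hx's h4 hz h5, coordRank, hex'] at hlr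
    have hTT : stratumTangent κ (tr τ) = T := by
      ext ξ
      refine ⟨fun h i hi => h i (hτ0 i hi), fun h i hi => h i ?_⟩
      by_contra hne
      exact h6 i hne hi
    rw [hTT] at hlr
    have hd : fderiv ℂ (G ∘ tr) τ = (fderiv ℂ G (tr τ)).comp T.subtypeL := by
      rw [fderiv_comp τ h1.differentiableAt (htr τ).differentiableAt, (htr τ).fderiv]
    have hrange : (fderiv ℂ (G ∘ tr) τ).range = T.map (fderiv ℂ G (tr τ)).toLinearMap := by
      rw [hd, ContinuousLinearMap.toLinearMap_comp, LinearMap.range_comp]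
      congr 1
      exact T.range_subtype
    rw [hrange]
    exact Nat.eq_sub_of_add_eq hlr
  obtain ⟨V, hV, hdim⟩ := exists_mem_nhds_dimH_image_le hfan hr
  obtain ⟨V', hV', hVV'⟩ := (mem_nhds_subtype _ _ _).1 hV
  have hsub : Filter.Tendsto (fun w => w - e x) (𝓝 (e x)) (𝓝 ((0 : T) : Fin n → ℂ)) := by
    have : Filter.Tendsto (fun w => w - e x) (𝓝 (e x)) (𝓝 (e x - e x)) :=
      (continuous_id.sub continuous_const).tendsto _
    simpa using this
  refine ⟨_, hsub hV', (dimH_mono ?_).trans hdim⟩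
  rintro _ ⟨w, ⟨hw, hw0⟩, rfl⟩
  have hwT : w - e x ∈ T := fun i hi => by simp [hw0 i hi, hi]
  refine ⟨⟨w - e x, hwT⟩, hVV' hw, ?_⟩
  simp [tr]

/-- Finitely many adapted charts cover the compact preimage. Each chart has finitely many strata,
indexed by the set J of vanishing E-coordinates, and on each of them the constant-rank estimate
holds locally. -/
theorem dimH_image_preimage_le (hσ : IsResolution n E σ)
    (hS : IsStratified n E σ) {k : ℕ} (hk : k ≤ maxLogRank n E σ)
    {N : ℕ} {φ : X₀ → (Fin N → ℂ)} {U : Set X₀}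
    (hφ : IsLocalEmbedding N ReducedSpace.stalk φ U)
    {z : OpenPartialHomeomorph (Fin N → ℂ) (Fin N → ℂ)}
    (hz : z ∈ IsManifold.maximalAtlas 𝓘(ℂ, Fin N → ℂ) ω (Fin N → ℂ)) {K : Set X₀}
    (hK : IsCompact (σ ⁻¹' K)) (hKU : K ⊆ U) (hKz : ∀ y ∈ K, φ y ∈ z.source)
    (hKD : K ⊆ imgStratum n E σ k \ imgStratum n E σ (k + 1)) :
    dimH ((z ∘ φ ∘ σ) '' (σ ⁻¹' K)) ≤ 2 * (maxLogRank n E σ - k : ℕ) := by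
  choose s m e κ c he using hσ.isSNC
  obtain ⟨t, -, ht⟩ := hK.elim_nhds_subcover (fun x => (e x).source)
    fun x _ => (e x).open_source.mem_nhds (he x).mem_source
  have hcov : (z ∘ φ ∘ σ) '' (σ ⁻¹' K) ⊆ ⋃ x ∈ t, ⋃ J : Set (Fin (s x)),
      (z ∘ φ ∘ σ ∘ (e x).symm) '' ((e x) '' {x' | x' ∈ (e x).source ∧ σ x' ∈ K ∧
        {i | e x x' (κ x (.inl i)) = 0} = J}) := by
    rintro _ ⟨x', hx', rfl⟩
    obtain ⟨x, hx, hxx⟩ := Set.mem_iUnion₂.1 (ht hx')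
    refine Set.mem_iUnion₂.2 ⟨x, hx, Set.mem_iUnion.2 ⟨{i | e x x' (κ x (.inl i)) = 0},
      e x x', ⟨x', ⟨hxx, hx', rfl⟩, rfl⟩, ?_⟩⟩
    simp [(e x).left_inv hxx]
  refine (dimH_mono hcov).trans ?_
  simp only [← Finset.mem_coe]
  rw [dimH_bUnion t.countable_toSet]
  refine iSup₂_le fun x _ => ?_
  rw [dimH_iUnion]
  refine iSup_le fun J => dimH_image_le_of_locally ?_
  rintro _ ⟨x', ⟨hx1, hx2, rfl⟩, rfl⟩
  obtain ⟨V, hV, hdim⟩ := exists_dimH_image_stratum_le hσ hS hk hφ hz (he x) hx1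
    (hKU hx2) (hKz _ hx2) (hKD hx2)
  refine ⟨_, Filter.inter_mem (mem_nhdsWithin_of_mem_nhds hV) self_mem_nhdsWithin,
    (dimH_mono (Set.image_mono ?_)).trans hdim⟩
  rintro _ ⟨hw, y, ⟨-, -, hy⟩, rfl⟩
  refine ⟨hw, fun i hi => ?_⟩
  have : i ∈ {i | e x y (κ x (.inl i)) = 0} := by rw [hy]; exact hi
  exact this

/-- The stratum `Y_k ∖ Y_{k+1}` has dimension at most `p - k`. -/
theorem finrank_firstCoords_le [T2Space X₀] (hσ : IsResolution n E σ)
    (hS : IsStratified n E σ) {k : ℕ} (hk : k ≤ maxLogRank n E σ)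
    {N : ℕ} {φ : X₀ → (Fin N → ℂ)} {U : Set X₀}
    (hφ : IsLocalEmbedding N ReducedSpace.stalk φ U)
    {z : OpenPartialHomeomorph (Fin N → ℂ) (Fin N → ℂ)}
    (hz : z ∈ IsManifold.maximalAtlas 𝓘(ℂ, Fin N → ℂ) ω (Fin N → ℂ)) {b : X₀} (hzb : φ b ∈ z.source)
    (hz0 : z (φ b) = 0) {d : ℕ}
    (hzY : ∀ᶠ w in 𝓝 (φ b), w ∈ φ '' ((imgStratum n E σ k \ imgStratum n E σ (k + 1)) ∩ U) ↔
      ∀ j : Fin N, d ≤ (j : ℕ) → z w j = 0) :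
    Module.finrank ℂ (firstCoords N d) ≤ maxLogRank n E σ - k := by
  set D := imgStratum n E σ k \ imgStratum n E σ (k + 1) with hD
  have h0 : (0 : Fin N → ℂ) ∈ z.target := hz0 ▸ z.map_source hzb
  have hsymm : Filter.Tendsto z.symm (𝓝 0) (𝓝 (φ b)) := by
    simpa [hz0] using tendsto_symm z hzb
  obtain ⟨ε, hε, hball⟩ := Metric.nhds_basis_closedBall.eventually_iff.1
    ((hsymm.eventually hzY).and (z.open_target.mem_nhds h0))
  -- A compact ball of the coordinate plane, small enough to come from points of D; K is the
  -- corresponding compact subset of X₀. Properness makes σ⁻¹(K) compact, while its image contains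
  -- the ball, whose real dimension is twice that of the plane.
  set S : Set (Fin N → ℂ) := Metric.closedBall 0 ε ∩ firstCoords N d with hSdef
  have hScomp : IsCompact S := (isCompact_closedBall _ _).inter_right
    (Submodule.closed_of_finiteDimensional _)
  have hSt : S ⊆ z.target := fun t ht => (hball ht.1).2
  have hSD : ∀ t ∈ S, ∃ y ∈ D ∩ U, φ y = z.symm t := fun t ht => by
    refine (hball ht.1).1.2 fun j hj => ?_
    rw [z.right_inv (hSt ht)]
    exact ht.2 j hj
  have hC : IsCompact (z.symm '' S) := hScomp.image_of_continuousOn (z.continuousOn_symm.mono hSt)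
  set K' : Set U := (U.domRestrict φ) ⁻¹' (z.symm '' S) with hK'
  have hK'c : IsCompact K' := by
    refine (hφ.isEmbedding.isInducing.isCompact_preimage_iff ?_).2 hC
    rintro _ ⟨t, ht, rfl⟩
    obtain ⟨y, hy, hyt⟩ := hSD t ht
    exact ⟨⟨y, hy.2⟩, hyt⟩
  set K : Set X₀ := (↑) '' K' with hK
  have hKc : IsCompact K := hK'c.image continuous_subtype_val
  have hKprop : ∀ y ∈ K, y ∈ U ∧ ∃ t ∈ S, z.symm t = φ y := by
    rintro _ ⟨⟨y, hyU⟩, hy, rfl⟩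
    exact ⟨hyU, hy⟩
  have hKD : K ⊆ D := by
    intro y hy
    obtain ⟨hyU, t, ht, hty⟩ := hKprop y hy
    obtain ⟨y', hy', hyt⟩ := hSD t ht
    rw [← hφ.injOn hy'.2 hyU (hyt.trans hty)]
    exact hy'.1
  have hdim := dimH_image_preimage_le hσ hS hk hφ hz (K := K)
    (hσ.isProperMap.isCompact_preimage hKc) (fun y hy => (hKprop y hy).1)
    (fun y hy => by
      obtain ⟨-, t, ht, hty⟩ := hKprop y hy
      rw [← hty]
      exact z.map_target (hSt ht)) hKD
  have hsub : (↑) '' (Metric.closedBall (0 : firstCoords N d) ε) ⊆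
      (z ∘ φ ∘ σ) '' (σ ⁻¹' K) := by
    rintro _ ⟨t, ht, rfl⟩
    have htS : (t : Fin N → ℂ) ∈ S := by
      refine ⟨?_, t.2⟩
      simpa using ht
    obtain ⟨y, hy, hyt⟩ := hSD t htS
    obtain ⟨x, -, rfl⟩ := hy.1.1
    refine ⟨x, ⟨⟨σ x, hy.2⟩, ⟨t, htS, hyt.symm⟩, rfl⟩, ?_⟩
    simp [hyt, z.right_inv (hSt htS)]
  have h1 := (dimH_mono hsub).trans hdim
  have hiso : Isometry ((↑) : firstCoords N d → Fin N → ℂ) := (firstCoords N d).subtypeₗᵢ.isometry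
  rw [hiso.dimH_image,
    Real.dimH_of_mem_nhds (Metric.closedBall_mem_nhds _ hε), finrank_real_of_complex] at h1
  have h2 : 2 * Module.finrank ℂ (firstCoords N d) ≤ 2 * (maxLogRank n E σ - k) := by
    exact_mod_cast h1
  omega

end Dimension

end Analytic

namespace Analytic

/-! ### Smooth subsets seen in another local embedding. -/

section SmoothSubset

variable {X₀ : Type*} [TopologicalSpace X₀] {N : ℕ} {M : Type*} [TopologicalSpace M]
  [ChartedSpace (Fin N → ℂ) M] [IsManifold 𝓘(ℂ, Fin N → ℂ) ω M]
  {𝒪 : ∀ x : X₀, Subring ((𝓝 x).Germ ℂ)} {ι : X₀ → M} {U : Set X₀}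
  {N' : ℕ} {φ : X₀ → (Fin N' → ℂ)} {U' : Set X₀}

/-- A subset which is smooth in one local embedding is a coordinate subspace in any other one. -/
theorem IsLocalEmbedding.exists_chart_of_smooth (h : IsLocalEmbedding N 𝒪 ι U)
    (h' : IsLocalEmbedding N' 𝒪 φ U') {b : X₀} (hb : b ∈ U) (hb' : b ∈ U')
    {z : OpenPartialHomeomorph (Fin N' → ℂ) (Fin N' → ℂ)}
    (hz : z ∈ IsManifold.maximalAtlas 𝓘(ℂ, Fin N' → ℂ) ω (Fin N' → ℂ)) (hzb : φ b ∈ z.source)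
    (hz0 : z (φ b) = 0) {d : ℕ} {Y : Set X₀}
    (hzY : ∀ᶠ w in 𝓝 (φ b), w ∈ φ '' (Y ∩ U') ↔ ∀ j : Fin N', d ≤ (j : ℕ) → z w j = 0)
    {ρ : ℕ} (hρ : Module.finrank ℂ (firstCoords N' d) = ρ) :
    ∃ w ∈ IsManifold.maximalAtlas 𝓘(ℂ, Fin N → ℂ) ω M, ι b ∈ w.source ∧ w (ι b) = 0 ∧ ρ ≤ N ∧
      (∀ᶠ y in 𝓝 b, y ∈ Y ↔ ∀ j : Fin N, ρ ≤ (j : ℕ) → w (ι y) j = 0) ∧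
      ∀ V ∈ 𝓝 b, ∀ᶠ t in 𝓝 (0 : Fin N → ℂ), (∀ j : Fin N, ρ ≤ (j : ℕ) → t j = 0) →
        ∃ y ∈ V, w (ι y) = t := by
  set w₀ := chartAt (Fin N → ℂ) (ι b)
  have hw₀ : w₀ ∈ IsManifold.maximalAtlas 𝓘(ℂ, Fin N → ℂ) ω M :=
    IsManifold.chart_mem_maximalAtlas (ι b)
  have hwb : ι b ∈ w₀.source := mem_chart_source (Fin N → ℂ) (ι b)
  -- H and G are the two transitions between the embeddings. Combined with linear coordinates of the
  -- plane T they give a parametrisation G' of Y in the new chart, with left inverse H'.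
  obtain ⟨H, hH, hHe⟩ := h.exists_transition h' hb hb' hw₀ hwb hz hzb
  obtain ⟨G, hG, hGe⟩ := h'.exists_transition h hb' hb hz hzb hw₀ hwb
  rw [hz0] at hG
  set T := firstCoords N' d
  let τ : T ≃ₗ[ℂ] (Fin ρ → ℂ) := LinearEquiv.ofFinrankEq _ _ (by simp [hρ, T])
  obtain ⟨π, hπ⟩ := LinearMap.exists_leftInverse_of_injective T.subtype (by simp)
  let S : (Fin N' → ℂ) →L[ℂ] (Fin ρ → ℂ) := (τ.toLinearMap ∘ₗ π).toContinuousLinearMap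
  let R : (Fin ρ → ℂ) →L[ℂ] (Fin N' → ℂ) := (T.subtype ∘ₗ τ.symm.toLinearMap).toContinuousLinearMap
  have hSR : ∀ t, S (R t) = t := fun t => by
    have := LinearMap.congr_fun hπ (τ.symm t)
    simp only [LinearMap.comp_apply, LinearMap.id_apply, Submodule.subtype_apply] at this
    simp [S, R, this]
  have hRS : ∀ t ∈ T, R (S t) = t := fun t ht => by
    have := LinearMap.congr_fun hπ ⟨t, ht⟩
    simp only [LinearMap.comp_apply, LinearMap.id_apply, Submodule.subtype_apply] at this
    simp [S, R, this]
  have hRT : ∀ t, R t ∈ T := fun t => (τ.symm t).2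
  set x₀ := w₀ (ι b)
  have hHx : H x₀ = 0 := by rw [← hHe.self_of_nhds, hz0]
  have hGx : G 0 = x₀ := by rw [← hz0, ← hGe.self_of_nhds]
  -- all small points of `T` come from points of `Y` near `b`
  have hT : ∀ V ∈ 𝓝 b, ∀ᶠ t in 𝓝 (0 : Fin ρ → ℂ), ∃ y ∈ V, y ∈ Y ∧ z (φ y) = R t := by
    intro V hV
    have hs : Filter.Tendsto (fun t => z.symm (R t)) (𝓝 0) (𝓝 (φ b)) := by
      have h1 := tendsto_symm z hzb
      rw [hz0, ← map_zero R] at h1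
      exact h1.comp (R.continuous.tendsto 0)
    have ht : ∀ᶠ t in 𝓝 (0 : Fin ρ → ℂ), R t ∈ z.target := by
      refine (R.continuous.tendsto 0).eventually (z.open_target.mem_nhds ?_)
      rw [map_zero, ← hz0]
      exact z.map_source hzb
    filter_upwards [hs.eventually hzY, hs.eventually (h'.eventually_mem hb' hV), ht]
      with t h1 h2 h3
    rw [z.right_inv h3] at h1
    obtain ⟨y, ⟨hyY, hyU⟩, hy⟩ := h1.2 fun j hj => hRT t j hj
    exact ⟨y, h2 y hyU hy, hyY, by rw [hy, z.right_inv h3]⟩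
  let H' : (Fin N → ℂ) → (Fin ρ → ℂ) := S ∘ H
  let G' : (Fin ρ → ℂ) → (Fin N → ℂ) := G ∘ R
  have hH' : AnalyticAt ℂ H' x₀ := (S.analyticAt _).comp hH
  have hG' : AnalyticAt ℂ G' 0 := AnalyticAt.comp (by rwa [map_zero]) (R.analyticAt 0)
  have hH'x : H' x₀ = 0 := by simp [H', hHx]
  have hG'x : G' 0 = x₀ := by simp [G', hGx]
  have hGY : ∀ V ∈ 𝓝 b, ∀ᶠ t in 𝓝 (0 : Fin ρ → ℂ), ∃ y ∈ V, y ∈ Y ∧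
      w₀ (ι y) = G' t ∧ H' (w₀ (ι y)) = t := by
    intro V hV
    filter_upwards [hT _ (Filter.inter_mem hV (Filter.inter_mem hHe hGe))]
      with t ⟨y, ⟨hyV, hyH, hyG⟩, hyY, hyt⟩
    rw [Set.mem_ofPred_eq] at hyH hyG
    refine ⟨y, hyV, hyY, by rw [hyG, hyt]; rfl, ?_⟩
    rw [show H' (w₀ (ι y)) = S (H (w₀ (ι y))) from rfl, ← hyH, hyt, hSR]
  have hHG : ∀ᶠ t in 𝓝 (0 : Fin ρ → ℂ), H' (G' t) = t := by
    filter_upwards [hGY _ Filter.univ_mem] with t ⟨y, _, _, h1, h2⟩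
    rw [← h1, h2]
  set B := fderiv ℂ H' x₀
  set A := fderiv ℂ G' 0
  have hBd : HasFDerivAt H' B x₀ := hH'.differentiableAt.hasFDerivAt
  have hAd : HasFDerivAt G' A 0 := hG'.differentiableAt.hasFDerivAt
  have hBA : ∀ t, B (A t) = t := by
    have h1 : HasFDerivAt (H' ∘ G') (B.comp A) 0 := HasFDerivAt.comp 0 (by rwa [hG'x]) hAd
    have h2 : HasFDerivAt (H' ∘ G') (ContinuousLinearMap.id ℂ _) 0 :=
      (hasFDerivAt_id _).congr_of_eventuallyEq hHG
    intro t
    exact DFunLike.congr_fun (h1.unique h2) t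
  have hBs : Function.Surjective B.toLinearMap := fun t => ⟨A t, hBA t⟩
  have hρN : ρ ≤ N := by
    simpa using LinearMap.finrank_le_finrank_of_surjective hBs
  obtain ⟨C, hC⟩ := LinearMap.exists_linearEquiv_extending B.toLinearMap hBs
    (m := N) (by simp) hρN
  let C' : (Fin N → ℂ) →L[ℂ] (Fin N → ℂ) := C.toLinearMap.toContinuousLinearMap
  -- The first ρ coordinates are H'; the others are taken from the displacement y - G'(H' y), which
  -- vanishes on Y. When B v = 0 the displacement has derivative v, and C extends B, so the
  -- derivative of Z is injective.
  let Z : (Fin N → ℂ) → (Fin N → ℂ) := fun y j =>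
    if hj : (j : ℕ) < ρ then H' y ⟨j, hj⟩ else C' (y - G' (H' y)) j
  have hGH : AnalyticAt ℂ (fun y => C' (y - G' (H' y))) x₀ := by
    have h1 : AnalyticAt ℂ G' (H' x₀) := by rwa [hH'x]
    exact (C'.analyticAt _).comp (analyticAt_id.sub (h1.comp hH'))
  have hZ : AnalyticAt ℂ Z x₀ := by
    rw [analyticAt_pi_iff]
    intro j
    by_cases hj : (j : ℕ) < ρ
    · simp only [hj, dif_pos]
      exact (analyticAt_apply _ _).comp hH'
    · simp only [hj, dif_neg, not_false_eq_true]
      exact (analyticAt_apply _ _).comp hGH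
  have hZd : ∀ v j, fderiv ℂ Z x₀ v j =
      if hj : (j : ℕ) < ρ then B v ⟨j, hj⟩ else C' (v - A (B v)) j := by
    intro v j
    have h1 : fderiv ℂ Z x₀ v j = fderiv ℂ (fun y => Z y j) x₀ v := by
      rw [fderiv_apply hZ.differentiableAt]; rfl
    rw [h1]
    by_cases hj : (j : ℕ) < ρ
    · simp only [Z, hj, dif_pos]
      have := (hasFDerivAt_pi'.1 hBd ⟨j, hj⟩).fderiv
      rw [this]; rfl
    · simp only [Z, hj, dif_neg, not_false_eq_true]
      have h2 : HasFDerivAt (fun y => C' (y - G' (H' y)))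
          (C'.comp (ContinuousLinearMap.id ℂ _ - A.comp B)) x₀ := by
        refine C'.hasFDerivAt.comp x₀ ((hasFDerivAt_id x₀).sub ?_)
        exact HasFDerivAt.comp x₀ (by rwa [hH'x]) hBd
      rw [(hasFDerivAt_pi'.1 h2 j).fderiv]; rfl
  have hinj : Function.Injective (fderiv ℂ Z x₀) := by
    rw [injective_iff_map_eq_zero]
    intro v hv
    have hBv : B v = 0 := by
      ext i
      have h1 := hZd v (Fin.castLE hρN i)
      rw [hv, dif_pos (by simp)] at h1
      simpa using h1.symm
    refine C.injective ?_
    rw [map_zero]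
    ext j
    by_cases hj : (j : ℕ) < ρ
    · have := hC v ⟨j, hj⟩
      rw [show Fin.castLE hρN ⟨j, hj⟩ = j from rfl] at this
      rw [this]
      simp [hBv]
    · have h1 := hZd v j
      rw [hv, dif_neg hj, hBv, map_zero, sub_zero] at h1
      exact h1.symm
  obtain ⟨w, hw, hws, -, hw₀s, hwZ⟩ := exists_chart_comp hw₀ hwb hZ hinj Filter.univ_mem
  have hιw : ∀ᶠ y in 𝓝 b, ι y ∈ w.source :=
    (h.continuousAt hb).eventually (w.open_source.mem_nhds hws)
  have hYZ : ∀ᶠ y in 𝓝 b, y ∈ Y → ∀ j : Fin N, ρ ≤ (j : ℕ) → w (ι y) j = 0 := by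
    filter_upwards [hHe, hGe, (h'.continuousAt hb').eventually hzY, hιw,
      h'.isOpen.mem_nhds hb'] with y h1 h2 h3 h4 h5 hy j hj
    have hTy : z (φ y) ∈ T := fun j hj => h3.1 ⟨y, ⟨hy, h5⟩, rfl⟩ j hj
    rw [hwZ _ h4]
    simp only [Z, not_lt.2 hj, dif_neg, not_false_eq_true]
    have : G' (H' (w₀ (ι y))) = w₀ (ι y) := by
      simp only [G', H', Function.comp_apply]
      rw [← h1, hRS _ hTy, ← h2]
    rw [this, sub_self, map_zero]; rfl
  have hZlt : ∀ y, ι y ∈ w.source → ∀ j : Fin ρ, w (ι y) (Fin.castLE hρN j) = H' (w₀ (ι y)) j := by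
    intro y hy j
    rw [hwZ _ hy]
    simp [Z]
  have hH't : Filter.Tendsto (fun y => H' (w₀ (ι y))) (𝓝 b) (𝓝 0) := by
    rw [← hH'x]
    exact hH'.continuousAt.tendsto.comp ((w₀.continuousAt hwb).tendsto.comp (h.continuousAt hb))
  refine ⟨w, hw, hws, ?_, hρN, ?_, fun V hV => ?_⟩
  · rw [hwZ _ hws]
    ext j
    simp only [Z]
    split_ifs
    · rw [hH'x]; rfl
    · rw [hH'x, hG'x, sub_self, map_zero]
  · filter_upwards [hYZ, hH't.eventually (hGY _ (Filter.inter_mem hιw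
      (Filter.inter_mem hYZ (h.isOpen.mem_nhds hb)))), hιw, h.isOpen.mem_nhds hb] with y h1 h2 h3 h4
    refine ⟨h1, fun h0 => ?_⟩
    -- If the last coordinates of y vanish, the point y' of Y with the same first coordinates has
    -- the same image in the chart, so y = y'.
    obtain ⟨y', ⟨hy's, hy'Y, hy'U⟩, hyY, -, hH'y⟩ := h2
    have hww : w (ι y) = w (ι y') := by
      ext j
      by_cases hj : (j : ℕ) < ρ
      · have e1 := hZlt y h3 ⟨j, hj⟩
        have e2 := hZlt y' hy's ⟨j, hj⟩
        rw [hH'y] at e2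
        exact e1.trans e2.symm
      · rw [h0 j (not_lt.1 hj), hy'Y hyY j (not_lt.1 hj)]
    rwa [h.injOn h4 hy'U (w.injOn h3 hy's hww)]
  · have hres : Filter.Tendsto (fun (t : Fin N → ℂ) (i : Fin ρ) => t (Fin.castLE hρN i))
        (𝓝 0) (𝓝 0) :=
      Continuous.tendsto' (by fun_prop) _ _ rfl
    filter_upwards [hres.eventually (hGY _ (Filter.inter_mem hV (Filter.inter_mem hιw hYZ)))]
      with t ⟨y, ⟨hyV, hys, hyY'⟩, hyY, _, hH'y⟩ ht
    refine ⟨y, hyV, ?_⟩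
    ext j
    by_cases hj : (j : ℕ) < ρ
    · have e1 := hZlt y hys ⟨j, hj⟩
      rw [hH'y] at e1
      exact e1
    · rw [hyY' hyY j (not_lt.1 hj), ht j (not_lt.1 hj)]

end SmoothSubset

end Analytic

namespace Analytic

/-! ### The ideal of an image stratum and its coordinates. -/

section Ideals

variable {n : ℕ} {X : Type*} [TopologicalSpace X] [ChartedSpace (Fin n → ℂ) X]
  [IsManifold 𝓘(ℂ, Fin n → ℂ) ω X] {Q : Type*} {E : Q → Set X}
  {X₀ : Type*} [TopologicalSpace X₀] [ReducedSpace X₀] {σ : X → X₀}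
  {N : ℕ} {M : Type*} [TopologicalSpace M]
  [ChartedSpace (Fin N → ℂ) M] [IsManifold 𝓘(ℂ, Fin N → ℂ) ω M] {ι : X₀ → M} {U : Set X₀}

/-- Only an inequality, because d may exceed N; the dimension of the plane is used in place of d for
the same reason. -/
theorem finrank_firstCoords_le_right (N d : ℕ) : Module.finrank ℂ (firstCoords N d) ≤ d := by
  let f : firstCoords N d →ₗ[ℂ] (Fin d → ℂ) :=
    { toFun := fun w i => if h : (i : ℕ) < N then w.1 ⟨i, h⟩ else 0
      map_add' := fun w w' => by ext i; by_cases h : (i : ℕ) < N <;> simp [h]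
      map_smul' := fun c w => by ext i; by_cases h : (i : ℕ) < N <;> simp [h] }
  have hf : Function.Injective f := by
    rw [injective_iff_map_eq_zero]
    intro w hw
    ext j
    by_cases hj : (j : ℕ) < d
    · have := congrFun hw ⟨j, hj⟩
      simpa [f] using this
    · exact w.2 j (not_lt.1 hj)
  simpa using LinearMap.finrank_le_finrank_of_injective hf

theorem IsResolution.eventually_mem_sdiff_iff (hσ : IsResolution n E σ) {k : ℕ} {b : X₀}
    (hb : b ∈ imgStratum n E σ k \ imgStratum n E σ (k + 1)) :
    ∀ᶠ y in 𝓝 b, y ∈ imgStratum n E σ k \ imgStratum n E σ (k + 1) ↔ y ∈ imgStratum n E σ k := by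
  filter_upwards [(hσ.isClosed_imgStratum (k + 1)).isOpen_compl.mem_nhds hb.2] with y hy
  exact ⟨fun h => h.1, fun h => ⟨h, hy⟩⟩

/-- In a chart in which the image stratum is a coordinate subspace, `σ` maps the tangent space of
the stratum of the divisor to this subspace. -/
theorem IsStratified.fderiv_mem_firstCoords (hσ : IsResolution n E σ) (hS : IsStratified n E σ)
    {a : X} {k : ℕ} (hk : k ≤ maxLogRank n E σ)
    (ha : σ a ∈ imgStratum n E σ k \ imgStratum n E σ (k + 1))
    (hι : IsLocalEmbedding N ReducedSpace.stalk ι U) (hU : σ a ∈ U)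
    {w : OpenPartialHomeomorph M (Fin N → ℂ)}
    (hw : w ∈ IsManifold.maximalAtlas 𝓘(ℂ, Fin N → ℂ) ω M) (hwa : ι (σ a) ∈ w.source) {ρ : ℕ}
    (hY : ∀ᶠ y in 𝓝 (σ a), y ∈ imgStratum n E σ k \ imgStratum n E σ (k + 1) →
      ∀ j : Fin N, ρ ≤ (j : ℕ) → w (ι y) j = 0)
    {s m : ℕ} {e : OpenPartialHomeomorph X (Fin n → ℂ)} {κ : Fin s ⊕ Fin m ≃ Fin n}
    {c : Fin s → Q} (he : IsAdapted E a e κ c) {ξ : Fin n → ℂ}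
    (hξ : ξ ∈ stratumTangent κ (e a)) :
    fderiv ℂ (w ∘ ι ∘ σ ∘ e.symm) (e a) ξ ∈ firstCoords N ρ := by
  have hF := hσ.analyticAt_coord hι he.mem_atlas he.mem_source hU hw hwa
  have hline : HasDerivAt (fun t : ℂ => e a + t • ξ) ξ 0 := by
    simpa using ((hasDerivAt_id (0 : ℂ)).smul_const ξ).const_add (e a)
  have hl0 : Filter.Tendsto (fun t : ℂ => e a + t • ξ) (𝓝 0) (𝓝 (e a)) := by
    simpa using hline.continuousAt.tendsto
  have hd : HasDerivAt ((w ∘ ι ∘ σ ∘ e.symm) ∘ fun t : ℂ => e a + t • ξ)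
      (fderiv ℂ (w ∘ ι ∘ σ ∘ e.symm) (e a) ξ) 0 := by
    refine HasFDerivAt.comp_hasDerivAt (0 : ℂ) ?_ hline
    simpa using hF.differentiableAt.hasFDerivAt
  intro j hj
  have hdj := hasDerivAt_pi.1 hd j
  have hsymm := hl0.eventually ((tendsto_symm e he.mem_source).eventually
    ((hS.eventually_mem_of_stratum hσ hk ha).and
      ((hσ.isProperMap.continuous.tendsto a).eventually hY)))
  -- All E-coordinates remain zero along the line in the direction ξ, so the line stays in the
  -- stratum, which σ maps into Y_k ∖ Y_{k+1}.
  have h0 : (fun t : ℂ => ((w ∘ ι ∘ σ ∘ e.symm) ∘ fun t : ℂ => e a + t • ξ) t j) =ᶠ[𝓝 0]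
      fun _ => (0 : ℂ) := by
    filter_upwards [hsymm, hl0.eventually (e.open_target.mem_nhds (e.map_source he.mem_source))]
      with t ⟨h1, h2⟩ h3
    refine h2 (h1 fun q hq => ?_) j hj
    obtain ⟨i, rfl⟩ := he.exists_index he.mem_source hq
    rw [he.mem_comp_iff i _ (e.map_target h3), e.right_inv h3]
    simp [he.apply_eq_zero i, hξ i (he.apply_eq_zero i)]
  exact hdj.unique ((hasDerivAt_const (0 : ℂ) (0 : ℂ)).congr_of_eventuallyEq h0)

/-- Coordinates of the ambient manifold in which the image stratum is a coordinate subspace, of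
dimension the logarithmic rank. -/
theorem IsStratified.exists_chart [T2Space X₀] (hσ : IsResolution n E σ)
    (hS : IsStratified n E σ) {a : X} (ha : a ∈ ⋃ q, E q)
    (hι : IsLocalEmbedding N ReducedSpace.stalk ι U) (hU : σ a ∈ U) {k r : ℕ}
    (hr : logRank n E σ a = r) (hkr : r + k = maxLogRank n E σ) :
    ∃ w ∈ IsManifold.maximalAtlas 𝓘(ℂ, Fin N → ℂ) ω M, ι (σ a) ∈ w.source ∧
      w (ι (σ a)) = 0 ∧ r ≤ N ∧
      (∀ᶠ y in 𝓝 (σ a), y ∈ imgStratum n E σ k \ imgStratum n E σ (k + 1) ↔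
        ∀ j : Fin N, r ≤ (j : ℕ) → w (ι y) j = 0) ∧
      ∀ V ∈ 𝓝 (σ a), ∀ᶠ t in 𝓝 (0 : Fin N → ℂ), (∀ j : Fin N, r ≤ (j : ℕ) → t j = 0) →
        ∃ y ∈ V, w (ι y) = t := by
  have hk : k ≤ maxLogRank n E σ := by omega
  have hb := (hS.mem_sdiff_iff hk).2 ⟨ha, by rw [hr, hkr]⟩
  obtain ⟨N', φ, U', hbU', hφ, z, hz, d, hzb, hz0, hzY⟩ := hS.smooth k hk _ hb
  have hle := finrank_firstCoords_le hσ hS hk hφ hz hzb hz0 hzY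
  obtain ⟨w, hw, hwb, hw0, hρN, hY, hsurj⟩ :=
    hι.exists_chart_of_smooth hφ hU hbU' hz hzb hz0 hzY rfl
  -- The image of dσ, of dimension r, lies in the tangent plane of the image stratum. The Hausdorff
  -- bound p - k equals r, so the two inequalities fix the dimension.
  have hge : r ≤ Module.finrank ℂ (firstCoords N' d) := by
    obtain ⟨s, m, e, κ, c, he⟩ := hσ.isSNC a
    rw [← hr, hσ.logRank_eq hι he he.mem_source hU hw hwb, coordRank]
    refine le_trans ?_ (finrank_firstCoords_le_right N _)
    refine Submodule.finrank_mono ?_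
    rintro _ ⟨ξ, hξ, rfl⟩
    exact hS.fderiv_mem_firstCoords hσ hk hb hι hU hw hwb
      (by filter_upwards [hY] with y hy using hy.1) he hξ
  have : Module.finrank ℂ (firstCoords N' d) = r := by omega
  rw [this] at hρN hY hsurj
  exact ⟨w, hw, hwb, hw0, hρN, hY, hsurj⟩

/-- The germ of a coordinate function of the ambient manifold, restricted to `X₀`. -/
def coordGerm (hι : IsLocalEmbedding N ReducedSpace.stalk ι U) {b : X₀} (hb : b ∈ U)
    {w : OpenPartialHomeomorph M (Fin N → ℂ)}
    (hw : w ∈ IsManifold.maximalAtlas 𝓘(ℂ, Fin N → ℂ) ω M) (hwb : ι b ∈ w.source) (j : Fin N) :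
    (ReducedSpace.stalk b : Subring _) :=
  ⟨((fun y => w (ι y) j : X₀ → ℂ) : (𝓝 b).Germ ℂ),
    (hι.mem_iff _ hb _).2 ⟨_, holAt_comp_chart hw hwb (analyticAt_apply j _), rfl⟩⟩

theorem eq_sum_mul_of_eventuallyEq {Z J : Type*} [TopologicalSpace Z] {x : Z}
    {S : Subring ((𝓝 x).Germ ℂ)} {f : Z → ℂ} (hf : (f : (𝓝 x).Germ ℂ) ∈ S) (s : Finset J)
    {F G : J → Z → ℂ} (hF : ∀ j, (F j : (𝓝 x).Germ ℂ) ∈ S) (hG : ∀ j, (G j : (𝓝 x).Germ ℂ) ∈ S)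
    (h : ∀ᶠ z in 𝓝 x, f z = ∑ j ∈ s, F j z * G j z) :
    (⟨_, hf⟩ : S) = ∑ j ∈ s, (⟨_, hF j⟩ : S) * ⟨_, hG j⟩ := by
  apply Subtype.ext
  rw [AddSubmonoidClass.coe_finsetSum]
  have : ∑ j ∈ s, ((((⟨_, hF j⟩ : S) * ⟨_, hG j⟩ : S)) : (𝓝 x).Germ ℂ) =
      Filter.Germ.coeRingHom (𝓝 x) (∑ j ∈ s, F j * G j) := by
    rw [map_sum]; rfl
  rw [this]
  refine Filter.Germ.coe_eq.2 ?_
  filter_upwards [h] with z hz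
  simp [hz]

/-- A function vanishing on Y extends to the ambient manifold. By `hsurj` every point of the plane
near 0 comes from Y, so the extension vanishes on the plane and Hadamard's lemma applies. -/
theorem idealAt_eq_span (hι : IsLocalEmbedding N ReducedSpace.stalk ι U) {b : X₀} (hb : b ∈ U)
    {w : OpenPartialHomeomorph M (Fin N → ℂ)}
    (hw : w ∈ IsManifold.maximalAtlas 𝓘(ℂ, Fin N → ℂ) ω M) (hwb : ι b ∈ w.source)
    (hw0 : w (ι b) = 0) {r : ℕ} {Y : Set X₀}
    (hY : ∀ᶠ y in 𝓝 b, y ∈ Y ↔ ∀ j : Fin N, r ≤ (j : ℕ) → w (ι y) j = 0)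
    (hsurj : ∀ V ∈ 𝓝 b, ∀ᶠ t in 𝓝 (0 : Fin N → ℂ), (∀ j : Fin N, r ≤ (j : ℕ) → t j = 0) →
        ∃ y ∈ V, w (ι y) = t) :
    idealAt Y b = Ideal.span (Set.range fun j : {j : Fin N // r ≤ (j : ℕ)} =>
      coordGerm hι hb hw hwb j) := by
  apply le_antisymm
  · rw [idealAt, Ideal.span_le]
    rintro ⟨g, hg⟩ ⟨f, rfl, hfY⟩
    obtain ⟨F, hF, hFf⟩ := (hι.mem_iff _ hb _).1 hg
    have hFf' := Filter.Germ.coe_eq.1 hFf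
    have hιw : ∀ᶠ y in 𝓝 b, ι y ∈ w.source :=
      (hι.continuousAt hb).eventually (w.open_source.mem_nhds hwb)
    have hFan := (holAt_iff hw hwb).1 hF
    rw [hw0] at hFan
    obtain ⟨G, hG, hGs⟩ := hFan.exists_eq_sum_mul {j : Fin N | r ≤ (j : ℕ)} (by
      filter_upwards [hsurj _ (Filter.inter_mem (Filter.inter_mem hFf' hfY)
        (Filter.inter_mem hY hιw))] with t ht h0
      have h0' : ∀ j : Fin N, r ≤ (j : ℕ) → t j = 0 := fun j hj => h0 j (by simpa using hj)
      obtain ⟨y, ⟨⟨hy1, hy2⟩, hy3, hy4⟩, rfl⟩ := ht h0'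
      rw [Set.mem_ofPred_eq] at hy1 hy2 hy3 hy4
      rw [Function.comp_apply, w.left_inv hy4]
      exact hy1.trans (hy2 (hy3.2 h0')))
    have hGreg : ∀ j, (((fun y => G j (w (ι y))) : X₀ → ℂ) : (𝓝 b).Germ ℂ) ∈
        ReducedSpace.stalk b := fun j =>
      (hι.mem_iff _ hb _).2 ⟨_, holAt_comp_chart hw hwb (by rw [hw0]; exact hG j), rfl⟩
    have hιt : Filter.Tendsto (fun y => w (ι y)) (𝓝 b) (𝓝 0) := by
      rw [← hw0]
      exact (w.continuousAt hwb).tendsto.comp (hι.continuousAt hb)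
    rw [eq_sum_mul_of_eventuallyEq hg ({j : Fin N | r ≤ (j : ℕ)} : Finset (Fin N))
      (fun j => (coordGerm hι hb hw hwb j).2) hGreg (by
        filter_upwards [hFf', hιt.eventually hGs, hιw] with y h1 h2 h3
        rw [← h1, ← h2]
        simp [w.left_inv h3])]
    refine Ideal.sum_mem _ fun j hj => Ideal.mul_mem_right _ _ (Ideal.subset_span ?_)
    exact ⟨⟨j, by simpa using hj⟩, rfl⟩
  · rw [Ideal.span_le]
    rintro _ ⟨⟨j, hj⟩, rfl⟩
    refine mem_idealAt_of_eventually _ ?_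
    filter_upwards [hY] with y hy hyY
    exact hy.1 hyY j hj

end Ideals

end Analytic

namespace Analytic

/-! ### A generator among the coordinates, permutations, roots of units. -/

section NormalForm

variable {n : ℕ} {X : Type*} [TopologicalSpace X] [ChartedSpace (Fin n → ℂ) X]
  [IsManifold 𝓘(ℂ, Fin n → ℂ) ω X] {Q : Type*} {E : Q → Set X}
  {X₀ : Type*} [TopologicalSpace X₀] [ReducedSpace X₀] {σ : X → X₀}
  {N : ℕ} {M : Type*} [TopologicalSpace M]
  [ChartedSpace (Fin N → ℂ) M] [IsManifold 𝓘(ℂ, Fin N → ℂ) ω M] {ι : X₀ → M} {U : Set X₀}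

/-- Moving along the diagonal makes all E-coordinates nonzero at once; hence a monomial is not the
zero germ. -/
theorem frequently_prod_ne_zero {s m : ℕ} {e : OpenPartialHomeomorph X (Fin n → ℂ)}
    {κ : Fin s ⊕ Fin m ≃ Fin n} {a : X} (ha : a ∈ e.source) (α : Fin s → ℕ) :
    ∃ᶠ x in 𝓝 a, ∏ i, e x (κ (.inl i)) ^ α i ≠ 0 := by
  intro h
  have hl : Filter.Tendsto (fun t : ℂ => e a + fun _ => t) (𝓝 0) (𝓝 (e a)) :=
    Continuous.tendsto' (by fun_prop) _ _ (by ext; simp)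
  have h1 : ∀ᶠ t in 𝓝[≠] (0 : ℂ), ∀ i : Fin s, e a (κ (.inl i)) + t ≠ 0 := by
    refine Filter.eventually_all.2 fun i => ?_
    by_cases h0 : e a (κ (.inl i)) = 0
    · filter_upwards [self_mem_nhdsWithin] with t ht
      simpa [h0] using ht
    · refine eventually_nhdsWithin_of_eventually_nhds ?_
      have : Filter.Tendsto (fun t : ℂ => e a (κ (.inl i)) + t) (𝓝 0) (𝓝 (e a (κ (.inl i)))) :=
        Continuous.tendsto' (by fun_prop) _ _ (by simp)
      exact this.eventually_ne h0
  have h2 := ((hl.eventually ((tendsto_symm e ha).eventually h)).filter_mono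
    nhdsWithin_le_nhds).and (h1.and (((hl.eventually (e.open_target.mem_nhds
    (e.map_source ha)))).filter_mono nhdsWithin_le_nhds))
  obtain ⟨t, ht1, ht2, ht3⟩ := h2.exists
  refine ht1 ?_
  beta_reduce
  rw [e.right_inv ht3]
  exact Finset.prod_ne_zero_iff.2 fun i _ => pow_ne_zero _ (ht2 i)

/-- One of the coordinates vanishing on the image stratum pulls back to a generator of the
pulled-back ideal. -/
theorem exists_coord_eq_unit_mul (hσ : IsResolution n E σ)
    {a : X} (hι : IsLocalEmbedding N ReducedSpace.stalk ι U) (hU : σ a ∈ U)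
    {w : OpenPartialHomeomorph M (Fin N → ℂ)}
    (hw : w ∈ IsManifold.maximalAtlas 𝓘(ℂ, Fin N → ℂ) ω M) (hwb : ι (σ a) ∈ w.source)
    {r : ℕ} {Y : Set X₀}
    (hY : ∀ᶠ y in 𝓝 (σ a), y ∈ Y ↔ ∀ j : Fin N, r ≤ (j : ℕ) → w (ι y) j = 0)
    (hideal : idealAt Y (σ a) = Ideal.span (Set.range fun j : {j : Fin N // r ≤ (j : ℕ)} =>
      coordGerm hι hU hw hwb j)) {s m : ℕ}
    {e : OpenPartialHomeomorph X (Fin n → ℂ)} {κ : Fin s ⊕ Fin m ≃ Fin n} {α : Fin s → ℕ}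
    (he : e ∈ IsManifold.maximalAtlas 𝓘(ℂ, Fin n → ℂ) ω X) (ha : a ∈ e.source)
    (h : pullbackIdealAt n σ Y a = Ideal.span {g : holGerm n X a |
      ((fun x => ∏ i, e x (κ (.inl i)) ^ α i : X → ℂ) : (𝓝 a).Germ ℂ) = g}) :
    ∃ j : Fin N, r ≤ (j : ℕ) ∧ ∃ h : X → ℂ, HolAt n h a ∧ h a ≠ 0 ∧
      ∀ᶠ x in 𝓝 a, w (ι (σ x)) j = h x * ∏ i, e x (κ (.inl i)) ^ α i := by
  have hex : ∀ j : {j : Fin N // r ≤ (j : ℕ)}, ∃ g : X → ℂ, HolAt n g a ∧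
      ∀ᶠ x in 𝓝 a, w (ι (σ x)) j = g x * ∏ i, e x (κ (.inl i)) ^ α i := fun j =>
    exists_eq_mul_prod hσ he ha h (f := fun y => w (ι y) j)
      (coordGerm hι hU hw hwb j).2 (by
        filter_upwards [hY] with y hy hyY using hy.1 hyY j j.2)
  choose g hg hge using hex
  by_contra! hcon
  have hg0 : ∀ j, g j a = 0 := fun j => by
    by_contra hne
    exact hcon j j.2 (g j) (hg j) hne ((hge j).mono fun _ hx h => h hx)
  have hmem : (((fun x => ∏ i, e x (κ (.inl i)) ^ α i : X → ℂ) : (𝓝 a).Germ ℂ)) ∈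
      holGerm n X a := by
    refine ⟨_, holAt_comp_chart he ha (g := fun w => ∏ i, w (κ (.inl i)) ^ α i) ?_, rfl⟩
    exact Finset.analyticAt_fun_prod _ fun i _ => (analyticAt_apply _ _).pow _
  have h1 : (⟨_, hmem⟩ : holGerm n X a) ∈ pullbackIdealAt n σ Y a := by
    rw [h]
    exact Ideal.subset_span rfl
  rw [pullbackIdealAt_eq_map hσ, hideal, Ideal.map_span, ← Set.range_comp,
    Ideal.mem_span_range_iff_exists_fun] at h1
  obtain ⟨C, hC⟩ := h1
  choose c hc hcC using fun j => (C j).2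
  have hF : ∀ j : {j : Fin N // r ≤ (j : ℕ)}, ((fun x => w (ι (σ x)) j : X → ℂ) : (𝓝 a).Germ ℂ) ∈
      holGerm n X a := fun j => ⟨_, hσ.holomorphic a _ (coordGerm hι hU hw hwb j).2, rfl⟩
  have h2 : ∀ᶠ x in 𝓝 a, ∏ i, e x (κ (.inl i)) ^ α i = ∑ j, c j x * w (ι (σ x)) j := by
    have h3 : (((∑ j, c j * fun x => w (ι (σ x)) j) : X → ℂ) : (𝓝 a).Germ ℂ) =
        (⟨_, hmem⟩ : holGerm n X a) := by
      rw [← hC, AddSubmonoidClass.coe_finsetSum]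
      change Filter.Germ.coeRingHom (𝓝 a) _ = _
      rw [map_sum]
      refine Finset.sum_congr rfl fun j _ => ?_
      rw [map_mul, Subring.coe_mul, ← hcC]
      rfl
    filter_upwards [Filter.Germ.coe_eq.1 h3] with x hx
    rw [← hx]
    simp
  have h4 : ContinuousAt (fun x => 1 - ∑ j, c j x * g j x) a := by
    refine continuousAt_const.sub (tendsto_finsetSum _ fun j _ => ?_)
    exact (ContMDiffAt.continuousAt (hc j)).mul (ContMDiffAt.continuousAt (hg j))
  have h5 : ∀ᶠ x in 𝓝 a, 1 - ∑ j, c j x * g j x ≠ 0 :=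
    h4.eventually_ne (by simp [hg0])
  refine frequently_prod_ne_zero ha (κ := κ) α ?_
  filter_upwards [h2, h5, Filter.eventually_all.2 hge] with x h6 h7 h8
  rw [not_not]
  -- Nakayama by hand: P = ∑ c_j g_j P with all g_j zero at a forces P = 0 near a.
  have h9 : (1 - ∑ j, c j x * g j x) * ∏ i, e x (κ (.inl i)) ^ α i = 0 := by
    rw [sub_mul, one_mul, Finset.sum_mul]
    nth_rewrite 1 [h6]
    rw [← Finset.sum_sub_distrib]
    refine Finset.sum_eq_zero fun j _ => ?_
    rw [h8]; ring
  exact (mul_eq_zero.1 h9).resolve_left h7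

/-- Permuting the coordinates of a chart. -/
theorem exists_chart_perm {w : OpenPartialHomeomorph M (Fin N → ℂ)}
    (hw : w ∈ IsManifold.maximalAtlas 𝓘(ℂ, Fin N → ℂ) ω M) {b : M} (hb : b ∈ w.source)
    (π : Equiv.Perm (Fin N)) :
    ∃ w' ∈ IsManifold.maximalAtlas 𝓘(ℂ, Fin N → ℂ) ω M, b ∈ w'.source ∧
      ∀ x ∈ w'.source, ∀ j, w' x j = w x (π j) := by
  let L : (Fin N → ℂ) →L[ℂ] (Fin N → ℂ) :=
    (LinearMap.funLeft ℂ ℂ π).toContinuousLinearMap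
  have hL : ∀ v j, L v j = v (π j) := fun v j => rfl
  obtain ⟨w', h1, h2, -, -, h3⟩ := exists_chart_comp hw hb (Φ := L) (L.analyticAt _) (by
    rw [ContinuousLinearMap.fderiv, injective_iff_map_eq_zero]
    intro v hv
    ext j
    have := congrFun hv (π.symm j)
    rwa [hL, Equiv.apply_symm_apply] at this) Filter.univ_mem
  exact ⟨w', h1, h2, fun x hx j => by rw [h3 x hx]; rfl⟩

/-- An analytic root of a non-vanishing analytic function. -/
theorem exists_analyticAt_pow_eq {V : Type*} [NormedAddCommGroup V] [NormedSpace ℂ V] {h : V → ℂ}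
    {x : V} (hh : AnalyticAt ℂ h x) (h0 : h x ≠ 0) {d : ℕ} (hd : 0 < d) :
    ∃ η : V → ℂ, AnalyticAt ℂ η x ∧ η x ≠ 0 ∧ ∀ᶠ y in 𝓝 x, η y ^ d = h y := by
  obtain ⟨c, hc⟩ := IsAlgClosed.exists_pow_nat_eq (h x) hd
  have hc0 : c ≠ 0 := by
    rintro rfl
    rw [zero_pow hd.ne'] at hc
    exact h0 hc.symm
  have h1 : AnalyticAt ℂ (fun y => h y / h x) x := hh.div analyticAt_const h0
  have h2 : AnalyticAt ℂ (fun y => Complex.log (h y / h x)) x :=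
    h1.clog (by simp [div_self h0])
  -- Division by h x brings the argument of the logarithm near 1, away from the branch cut; c is a
  -- root of the constant h x.
  refine ⟨fun y => c * Complex.exp (Complex.log (h y / h x) / d),
    analyticAt_const.mul (h2.div analyticAt_const (by exact_mod_cast hd.ne')).cexp,
    mul_ne_zero hc0 (Complex.exp_ne_zero _), ?_⟩
  filter_upwards [hh.continuousAt.eventually_ne h0] with y hy
  rw [mul_pow, hc, ← Complex.exp_nat_mul, mul_div_cancel₀ _ (by exact_mod_cast hd.ne'),
    Complex.exp_log (div_ne_zero hy h0), mul_div_cancel₀ _ h0]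

end NormalForm

end Analytic

namespace Analytic

/-! ### Straightening the map in adapted coordinates. -/

section LocalForm

variable {n : ℕ}

/-- Coordinate change straightening a map in normal form up to a unit: if the first `r`
components of `F` have independent derivatives along `v`, and the component `F r` is
`η ^ d` times a monomial, these functions become coordinates `v` and a monomial. -/
theorem exists_monomial_coordinates {N s m r : ℕ} {κ : Fin s ⊕ Fin m ≃ Fin n}
    {F : (Fin n → ℂ) → (Fin N → ℂ)} (hF : AnalyticAt ℂ F 0) (hF0 : F 0 = 0) (hrN : r ≤ N)
    (hmap : (stratumTangent κ 0).map (fderiv ℂ F 0).toLinearMap ≤ firstCoords N r)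
    (hrank : Module.finrank ℂ ((stratumTangent κ 0).map (fderiv ℂ F 0).toLinearMap) = r)
    {η : (Fin n → ℂ) → ℂ} (hη : AnalyticAt ℂ η 0) (hη0 : η 0 ≠ 0) (i₀ : Fin s) :
    ∃ (hrm : r ≤ m) (Φ : (Fin n → ℂ) → (Fin n → ℂ)), AnalyticAt ℂ Φ 0 ∧ Φ 0 = 0 ∧
      Function.Injective (fderiv ℂ Φ 0) ∧
      (∀ w i, Φ w (κ (.inl i)) = w (κ (.inl i)) * if i = i₀ then η w else 1) ∧
      ∀ w (j : Fin r), Φ w (κ (.inr (Fin.castLE hrm j))) = F w (Fin.castLE hrN j) := by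
  let emb : (Fin m → ℂ) →ₗ[ℂ] (Fin n → ℂ) :=
    { toFun := fun v i => Sum.elim (fun _ => 0) v (κ.symm i)
      map_add' := fun v v' => by ext i; rcases h : κ.symm i with l | l <;> simp [h]
      map_smul' := fun c v => by ext i; rcases h : κ.symm i with l | l <;> simp [h] }
  have hembT : ∀ v, emb v ∈ stratumTangent κ 0 := fun v i _ => by simp [emb]
  have hTemb : ∀ ξ ∈ stratumTangent κ 0, emb (fun l => ξ (κ (.inr l))) = ξ := by
    intro ξ hξ
    ext i
    obtain ⟨i, rfl⟩ := κ.surjective i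
    rcases i with i | i
    · simpa [emb] using (hξ i rfl).symm
    · simp [emb]
  let res : (Fin N → ℂ) →ₗ[ℂ] (Fin r → ℂ) := LinearMap.funLeft ℂ ℂ (Fin.castLE hrN)
  let B : (Fin m → ℂ) →ₗ[ℂ] (Fin r → ℂ) := res ∘ₗ (fderiv ℂ F 0).toLinearMap ∘ₗ emb
  have hB : ∀ v j, B v j = fderiv ℂ F 0 (emb v) (Fin.castLE hrN j) := fun v j => rfl
  -- A vector of the coordinate plane is determined by its first r entries, and the image of the
  -- stratum tangent space is r-dimensional, so these entries take all values.
  have hBs : Function.Surjective B := by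
    have hinj : Function.Injective (res.domRestrict
        ((stratumTangent κ 0).map (fderiv ℂ F 0).toLinearMap)) := by
      rw [injective_iff_map_eq_zero]
      rintro ⟨ξ, hξ⟩ h0
      ext j
      by_cases hj : (j : ℕ) < r
      · exact congrFun h0 ⟨j, hj⟩
      · exact hmap hξ j (not_lt.1 hj)
    have hsurj := (LinearMap.injective_iff_surjective_of_finrank_eq_finrank
      (by rw [hrank]; simp)).1 hinj
    intro t
    obtain ⟨⟨_, ξ, hξ, rfl⟩, ht⟩ := hsurj t
    refine ⟨fun l => ξ (κ (.inr l)), ?_⟩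
    rw [← ht]
    change res (fderiv ℂ F 0 (emb _)) = _
    rw [hTemb ξ hξ]
    rfl
  have hrm : r ≤ m := by
    simpa using LinearMap.finrank_le_finrank_of_surjective hBs
  obtain ⟨C, hC⟩ := LinearMap.exists_linearEquiv_extending B hBs (m := m) (by simp) hrm
  let vpart : (Fin n → ℂ) →L[ℂ] (Fin m → ℂ) :=
    (C.toLinearMap ∘ₗ LinearMap.funLeft ℂ ℂ fun l => κ (.inr l)).toContinuousLinearMap
  have hvpart : ∀ w, vpart w = C fun l => w (κ (.inr l)) := fun w => rfl
  obtain ⟨Φ, hΦl, hΦr⟩ : ∃ Φ : (Fin n → ℂ) → (Fin n → ℂ),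
      (∀ w i, Φ w (κ (.inl i)) = w (κ (.inl i)) * if i = i₀ then η w else 1) ∧
      ∀ w (l : Fin m), Φ w (κ (.inr l)) =
        if h : (l : ℕ) < r then F w (Fin.castLE hrN ⟨l, h⟩) else vpart w l :=
    ⟨fun w i => Sum.elim (fun i => w (κ (.inl i)) * if i = i₀ then η w else 1)
      (fun l : Fin m => if h : (l : ℕ) < r then F w (Fin.castLE hrN ⟨l, h⟩) else vpart w l)
      (κ.symm i), fun w i => by simp, fun w i => by simp⟩
  have hΦan : AnalyticAt ℂ Φ 0 := by
    rw [analyticAt_pi_iff]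
    intro i
    obtain ⟨i, rfl⟩ := κ.surjective i
    rcases i with i | l
    · refine AnalyticAt.congr (f := fun w : Fin n → ℂ => w (κ (.inl i)) *
        if i = i₀ then η w else 1) ((analyticAt_apply _ _).mul ?_)
        (.of_forall fun w => (hΦl w i).symm)
      by_cases h : i = i₀
      · simpa [h] using hη
      · simpa [h] using analyticAt_const
    · by_cases h : (l : ℕ) < r
      · exact ((analyticAt_apply (Fin.castLE hrN ⟨l, h⟩) _).comp hF).congr
          (.of_forall fun w => by beta_reduce; rw [hΦr, dif_pos h]; rfl)
      · exact ((analyticAt_apply l _).comp (vpart.analyticAt 0)).congr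
          (.of_forall fun w => by beta_reduce; rw [hΦr, dif_neg h]; rfl)
  refine ⟨hrm, Φ, hΦan, ?_, ?_, hΦl, fun w j => by rw [hΦr, dif_pos (by simp)]; rfl⟩
  · ext i
    obtain ⟨i, rfl⟩ := κ.surjective i
    rcases i with i | l
    · simp [hΦl]
    · rw [hΦr, hF0]
      split_ifs
      · rfl
      · rw [map_zero]; rfl
  -- At 0 the derivative of w_i η is η(0) dw_i, so a kernel vector is tangent to the stratum. There
  -- the differentials of the first r components of F, completed by C, detect it.
  · rw [injective_iff_map_eq_zero]
    intro ξ hξ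
    have hcomp : ∀ i (f' : (Fin n → ℂ) →L[ℂ] ℂ), HasFDerivAt (fun w => Φ w i) f' 0 → f' ξ = 0 := by
      intro i f' hf'
      have := hf'.unique (hasFDerivAt_pi'.1 hΦan.differentiableAt.hasFDerivAt i)
      rw [this]
      exact congrFun hξ i
    have hξT : ξ ∈ stratumTangent κ 0 := by
      intro i _
      have h1 := hcomp (κ (.inl i)) ((if i = i₀ then η 0 else 1) •
        ContinuousLinearMap.proj (R := ℂ) (φ := fun _ : Fin n => ℂ) (κ (.inl i))) (by
          have hp : HasFDerivAt (fun w : Fin n → ℂ => w (κ (.inl i)))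
            (ContinuousLinearMap.proj (R := ℂ) (φ := fun _ : Fin n => ℂ) (κ (.inl i))) 0 :=
            (ContinuousLinearMap.proj (R := ℂ) (φ := fun _ : Fin n => ℂ) (κ (.inl i))).hasFDerivAt
          simp only [hΦl]
          by_cases h : i = i₀
          · simp only [h, if_true]
            subst h
            refine (hp.mul hη.differentiableAt.hasFDerivAt).congr_fderiv ?_
            ext
            simp
          · simpa [h] using hp)
      by_cases h : i = i₀
      · simpa [h, hη0] using h1
      · simpa [h] using h1
    have hv : C (fun l => ξ (κ (.inr l))) = 0 := by
      ext l
      by_cases h : (l : ℕ) < r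
      · have h1 := hcomp (κ (.inr l)) _ (by
          simp only [hΦr, h, dif_pos]
          exact hasFDerivAt_pi'.1 hF.differentiableAt.hasFDerivAt (Fin.castLE hrN ⟨l, h⟩))
        have h2 := hC (fun l => ξ (κ (.inr l))) ⟨l, h⟩
        rw [show Fin.castLE hrm ⟨l, h⟩ = l from rfl, hB, hTemb ξ hξT] at h2
        rw [h2]
        exact h1
      · have h1 := hcomp (κ (.inr l)) _ (by
          simp only [hΦr, h, dif_neg, not_false_eq_true]
          exact hasFDerivAt_pi'.1 vpart.hasFDerivAt l)
        exact h1
    rw [← hTemb ξ hξT, (LinearEquiv.map_eq_zero_iff C).1 hv, map_zero]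

end LocalForm

/-! ### The normal form in the analytic case. -/

section Main

variable {n : ℕ} {X : Type*} [TopologicalSpace X] [ChartedSpace (Fin n → ℂ) X]
  [IsManifold 𝓘(ℂ, Fin n → ℂ) ω X] {Q : Type*} {E : Q → Set X}
  {X₀ : Type*} [TopologicalSpace X₀] [T2Space X₀] [ReducedSpace X₀] {σ : X → X₀}
  {N : ℕ} {M₀ : Type*} [TopologicalSpace M₀]
  [ChartedSpace (Fin N → ℂ) M₀] [IsManifold 𝓘(ℂ, Fin N → ℂ) ω M₀] {ι : X₀ → M₀} {U : Set X₀}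

theorem IsStratified.exists_normal_form (hσ : IsResolution n E σ) (hS : IsStratified n E σ)
    {a : X} (ha : a ∈ ⋃ q, E q) {p r : ℕ} (hp : p = maxLogRank n E σ)
    (hr : r = logRank n E σ a) (hU : σ a ∈ U)
    (hι : IsLocalEmbedding N ReducedSpace.stalk ι U) :
    ∃ (s m : ℕ) (e : OpenPartialHomeomorph X (Fin n → ℂ)) (κ : Fin s ⊕ Fin m ≃ Fin n)
      (c : Fin s → Q) (z : OpenPartialHomeomorph M₀ (Fin N → ℂ)) (α : Fin s → ℕ)
      (hm : r ≤ m) (hN : r < N),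
      IsAdapted E a e κ c ∧
      z ∈ IsManifold.maximalAtlas 𝓘(ℂ, Fin N → ℂ) ω M₀ ∧
      ι (σ a) ∈ z.source ∧ z (ι (σ a)) = 0 ∧
      (∀ᶠ x in 𝓝 a,
        (∀ j : Fin r, z (ι (σ x)) (Fin.castLE hN.le j) = e x (κ (.inr (Fin.castLE hm j)))) ∧
        z (ι (σ x)) ⟨r, hN⟩ = ∏ i, e x (κ (.inl i)) ^ α i) ∧
      idealAt (imgStratum n E σ (p - r)) (σ a) = Ideal.span
        {g : ReducedSpace.stalk (σ a) | ∃ j : Fin N, r ≤ (j : ℕ) ∧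
          ((fun y => z (ι y) j : X₀ → ℂ) : (𝓝 (σ a)).Germ ℂ) = g} ∧
      pullbackIdealAt n σ (imgStratum n E σ (p - r)) a = Ideal.span
        {g : holGerm n X a | ((fun x => z (ι (σ x)) ⟨r, hN⟩ : X → ℂ) : (𝓝 a).Germ ℂ) = g} := by
  subst hp
  have hrp : r ≤ maxLogRank n E σ := hr ▸ hσ.logRank_le_maxLogRank ha
  set k := maxLogRank n E σ - r with hkdef
  have hk : k ≤ maxLogRank n E σ := Nat.sub_le _ _
  have hb := (hS.mem_sdiff_iff hk).2 ⟨ha, by rw [← hr]; omega⟩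
  set Y := imgStratum n E σ k
  obtain ⟨w, hw, hwb, hw0, hrN, hD, hsurj⟩ := hS.exists_chart hσ ha hι hU hr.symm
    (k := k) (by omega)
  have hYw : ∀ᶠ y in 𝓝 (σ a), y ∈ Y ↔ ∀ j : Fin N, r ≤ (j : ℕ) → w (ι y) j = 0 := by
    filter_upwards [hD, hσ.eventually_mem_sdiff_iff hb] with y h1 h2
    rw [← h2, h1]
  obtain ⟨s, m, e, κ, c, α, he, hmon⟩ := hS.monomial k hk a
  have hea := he.mem_source
  obtain ⟨i₀, hi₀⟩ := exists_pos_of_pullbackIdealAt hb.1 hmon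
  obtain ⟨j₀, hj₀, h, hh, hh0, hhe⟩ := exists_coord_eq_unit_mul hσ hι hU hw hwb hYw
    (idealAt_eq_span hι hU hw hwb hw0 hYw hsurj) he.mem_atlas hea hmon
  have hN : r < N := hj₀.trans_lt j₀.2
  -- permute the coordinates
  set π : Equiv.Perm (Fin N) := Equiv.swap ⟨r, hN⟩ j₀ with hπ
  have hπr : π ⟨r, hN⟩ = j₀ := Equiv.swap_apply_left _ _
  have hπlt : ∀ j : Fin N, (j : ℕ) < r → π j = j := fun j hj => by
    refine Equiv.swap_apply_of_ne_of_ne ?_ ?_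
    · rintro rfl; exact lt_irrefl _ hj
    · rintro rfl; omega
  have hπle : ∀ j : Fin N, r ≤ (j : ℕ) → r ≤ (π j : ℕ) := fun j hj => by
    by_contra hlt
    have h1 := hπlt _ (not_le.1 hlt)
    have h2 : π j = j := π.injective h1
    rw [h2] at hlt
    exact hlt hj
  have hππ : ∀ j, π (π j) = j := Equiv.swap_swap _ _ |> fun h j => DFunLike.congr_fun h j
  obtain ⟨z, hz, hzb, hzw⟩ := exists_chart_perm hw hwb π
  have hιz : ∀ᶠ y in 𝓝 (σ a), ι y ∈ z.source :=
    (hι.continuousAt hU).eventually (z.open_source.mem_nhds hzb)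
  have hzY : ∀ᶠ y in 𝓝 (σ a), y ∈ Y ↔ ∀ j : Fin N, r ≤ (j : ℕ) → z (ι y) j = 0 := by
    filter_upwards [hYw, hιz] with y h1 h2
    rw [h1]
    refine ⟨fun h j hj => by rw [hzw _ h2, h _ (hπle j hj)], fun h j hj => ?_⟩
    rw [← hππ j, ← hzw _ h2, h _ (hπle j hj)]
  have hz0 : z (ι (σ a)) = 0 := by
    ext j
    rw [hzw _ hzb, hw0]; rfl
  have hzsurj : ∀ V ∈ 𝓝 (σ a), ∀ᶠ t in 𝓝 (0 : Fin N → ℂ),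
      (∀ j : Fin N, r ≤ (j : ℕ) → t j = 0) → ∃ y ∈ V, z (ι y) = t := by
    intro V hV
    have hperm : Filter.Tendsto (fun (t : Fin N → ℂ) j => t (π j)) (𝓝 0) (𝓝 0) :=
      Continuous.tendsto' (by fun_prop) _ _ rfl
    filter_upwards [hperm.eventually (hsurj _ (Filter.inter_mem hV hιz))] with t ht h0
    obtain ⟨y, ⟨hy, hys⟩, hyt⟩ := ht fun j hj => h0 _ (hπle j hj)
    refine ⟨y, hy, ?_⟩
    ext j
    rw [hzw _ hys, hyt]
    exact congrArg t (hππ j)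
  have hzh : ∀ᶠ x in 𝓝 a, z (ι (σ x)) ⟨r, hN⟩ = h x * ∏ i, e x (κ (.inl i)) ^ α i := by
    filter_upwards [hhe, (hσ.isProperMap.continuous.tendsto a).eventually hιz] with x h1 h2
    rw [hzw _ h2, hπr, h1]
  have hideal := idealAt_eq_span hι hU hz hzb hz0 hzY hzsurj
  -- adapted coordinates
  set F := z ∘ ι ∘ σ ∘ e.symm with hFdef
  have he0 := he.map_eq_zero
  have hF : AnalyticAt ℂ F 0 := by
    rw [← he0]; exact hσ.analyticAt_coord hι he.mem_atlas hea hU hz hzb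
  have hF0 : F 0 = 0 := by
    rw [← he0, hFdef]
    simp [e.left_inv hea, hz0]
  have hη := (holAt_iff he.mem_atlas hea).1 hh
  rw [he0] at hη
  -- The exponent α i₀ is positive, so a root of this order of the unit h can be absorbed into
  -- u_{i₀}.
  obtain ⟨η, hηan, hη0, hηe⟩ := exists_analyticAt_pow_eq hη
    (by rw [← he0]; simpa [e.left_inv hea] using hh0) hi₀
  obtain ⟨hrm, Φ, hΦ, hΦ0, hΦinj, hΦl, hΦr⟩ := exists_monomial_coordinates (κ := κ) hF hF0 hrN (by
      rintro _ ⟨ξ, hξ, rfl⟩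
      rw [← he0] at hξ
      have := hS.fderiv_mem_firstCoords hσ hk hb hι hU hz hzb (by
        filter_upwards [hzY] with y h1 h2 using h1.1 h2.1) he hξ
      rwa [he0] at this) (by
      have := hσ.logRank_eq hι he hea hU hz hzb
      rw [← hr, coordRank, he0] at this
      exact this.symm) hηan hη0 i₀
  rw [← he0] at hΦ hΦinj
  have het : Filter.Tendsto e (𝓝 a) (𝓝 0) := by
    rw [← he0]; exact (e.continuousAt hea).tendsto
  have hO : ∀ᶠ x in 𝓝 a, η (e x) ≠ 0 :=
    het.eventually (hηan.continuousAt.eventually_ne hη0)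
  -- The source is shrunk to η ≠ 0, so that u_{i₀} η and u_{i₀} have the same zeros and the new
  -- chart is adapted.
  obtain ⟨e', he', hae', he'O, he's, he'Φ⟩ := exists_chart_comp he.mem_atlas hea hΦ hΦinj hO
  have hprod : ∀ᶠ x in 𝓝 a, z (ι (σ x)) ⟨r, hN⟩ = ∏ i, e' x (κ (.inl i)) ^ α i := by
    filter_upwards [hzh, het.eventually hηe, e'.open_source.mem_nhds hae',
      e.open_source.mem_nhds hea] with x h1 h2 h3 h4
    rw [h1, he'Φ x h3]
    simp only [hΦl, mul_pow, Finset.prod_mul_distrib, ite_pow, one_pow]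
    rw [Finset.prod_ite_eq' Finset.univ i₀, if_pos (Finset.mem_univ _), h2, mul_comm]
    simp [e.left_inv h4]
  refine ⟨s, m, e', κ, c, z, α, hrm, hN, ⟨he', hae', ?_, he.injective, he.range_eq, ?_, ?_⟩, hz,
    hzb, hz0, ?_, ?_, ?_⟩
  · rw [he'Φ a hae', he0, hΦ0]
  · intro i x hx
    rw [he.mem_comp_iff i x (he's hx), he'Φ x hx, hΦl, mul_eq_zero]
    refine ⟨fun h => Or.inl h, fun h => h.resolve_right ?_⟩
    split_ifs
    · exact he'O hx
    · exact one_ne_zero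
  · exact fun q hq => (he.disjoint q hq).mono_right he's
  · filter_upwards [hprod, e'.open_source.mem_nhds hae', e.open_source.mem_nhds hea]
      with x h1 h2 h3
    refine ⟨fun j => ?_, h1⟩
    rw [he'Φ x h2, hΦr, hFdef]
    simp [e.left_inv h3]
  · rw [hideal]
    congr 1
    ext g
    constructor
    · rintro ⟨⟨j, hj⟩, rfl⟩
      exact ⟨j, hj, rfl⟩
    · rintro ⟨j, hj, hg⟩
      exact ⟨⟨j, hj⟩, Subtype.ext hg⟩
  -- The monomial in the old coordinates and the pulled-back coordinate z_r differ by the unit h.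
  · rw [hmon]
    have hm1 : (((fun x => ∏ i, e x (κ (.inl i)) ^ α i : X → ℂ) : (𝓝 a).Germ ℂ)) ∈
        holGerm n X a := by
      refine ⟨_, holAt_comp_chart he.mem_atlas hea (g := fun w => ∏ i, w (κ (.inl i)) ^ α i) ?_,
        rfl⟩
      exact Finset.analyticAt_fun_prod _ fun i _ => (analyticAt_apply _ _).pow _
    have hm2 : (((fun x => z (ι (σ x)) ⟨r, hN⟩ : X → ℂ) : (𝓝 a).Germ ℂ)) ∈ holGerm n X a :=
      ⟨_, hσ.holomorphic a _ (coordGerm hι hU hz hzb _).2, rfl⟩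
    have hinv : HolAt n (fun x => (h x)⁻¹) a := by
      rw [holAt_iff he.mem_atlas hea]
      refine AnalyticAt.inv ((holAt_iff he.mem_atlas hea).1 hh) ?_
      simpa [e.left_inv hea] using hh0
    rw [germ_setOf_eq _ hm1, germ_setOf_eq _ hm2]
    apply le_antisymm
    · rw [Ideal.span_singleton_le_iff_mem, Ideal.mem_span_singleton']
      refine ⟨⟨_, _, hinv, rfl⟩, Subtype.ext (Filter.Germ.coe_eq.2 ?_)⟩
      filter_upwards [hzh, (ContMDiffAt.continuousAt hh).eventually_ne hh0] with x h1 h2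
      change (h x)⁻¹ * z (ι (σ x)) ⟨r, hN⟩ = _
      rw [h1, inv_mul_cancel_left₀ h2]
    · rw [Ideal.span_singleton_le_iff_mem, Ideal.mem_span_singleton']
      refine ⟨⟨_, _, hh, rfl⟩, Subtype.ext (Filter.Germ.coe_eq.2 ?_)⟩
      filter_upwards [hzh] with x h1
      exact h1.symm

end Main

end Analytic

namespace Algebraic

/-! ### Regular local rings and systems of parameters. -/

section RegularLocalRing

open IsLocalRing

variable {A : Type*} [CommRing A] [IsLocalRing A]

theorem isLocalRing_quotient {I : Ideal A} (hI : I ≤ maximalIdeal A) : IsLocalRing (A ⧸ I) := by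
  have : Nontrivial (A ⧸ I) := Ideal.Quotient.nontrivial_iff.2 fun h => by
    rw [h, top_le_iff] at hI
    exact (maximalIdeal.isMaximal A).ne_top hI
  exact .of_surjective' (Ideal.Quotient.mk I) Ideal.Quotient.mk_surjective

theorem maximalIdeal_quotient {I : Ideal A} [IsLocalRing (A ⧸ I)] :
    (maximalIdeal A).map (Ideal.Quotient.mk I) = maximalIdeal (A ⧸ I) := by
  have hloc : IsLocalHom (Ideal.Quotient.mk I) := .of_surjective _ Ideal.Quotient.mk_surjective
  have h := ((local_hom_TFAE (Ideal.Quotient.mk I)).out 0 4).1 hloc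
  rw [← h, Ideal.map_comap_of_surjective _ Ideal.Quotient.mk_surjective]

theorem IsCoords.mem {ι : Type*} [Fintype ι] {z : ι → A} (h : IsCoords z) (i : ι) :
    z i ∈ maximalIdeal A :=
  h.1 ▸ Ideal.subset_span ⟨i, rfl⟩

theorem card_le_of_span_eq [IsNoetherianRing A] {ι : Type*} [Fintype ι] {z : ι → A}
    (h : Ideal.span (Set.range z) = maximalIdeal A) : ringKrullDim A ≤ Fintype.card ι := by
  refine (ringKrullDim_le_spanFinrank_maximalIdeal A).trans ?_
  rw [← h]
  have h1 := Submodule.spanFinrank_span_le_encard (R := A) (Set.range z)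
  have h2 : (Set.range z).encard ≤ Fintype.card ι := by
    rw [← Set.image_univ]
    refine (Set.encard_image_le _ _).trans ?_
    simp
  exact_mod_cast h1.trans h2

/-- A coordinate can be exchanged for an element of `m ∖ m ^ 2`. -/
theorem exists_span_eq_of_notMem {n : ℕ} {z : Fin (n + 1) → A}
    (hz : Ideal.span (Set.range z) = maximalIdeal A) {x : A} (hx : x ∈ maximalIdeal A)
    (hx2 : x ∉ maximalIdeal A ^ 2) :
    ∃ y : Fin n → A, Ideal.span (Set.range y) ⊔ Ideal.span {x} = maximalIdeal A := by
  have hxs := hx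
  rw [← hz, Ideal.mem_span_range_iff_exists_fun] at hxs
  obtain ⟨c, hc⟩ := hxs
  have hu : ∃ i, IsUnit (c i) := by
    by_contra! hcon
    refine hx2 (hc ▸ Ideal.sum_mem _ fun i _ => ?_)
    rw [pow_two]
    exact Ideal.mul_mem_mul ((mem_maximalIdeal _).2 (hcon i))
      (hz ▸ Ideal.subset_span ⟨i, rfl⟩)
  obtain ⟨i, hi⟩ := hu
  refine ⟨z ∘ i.succAbove, le_antisymm (sup_le ?_ ?_) ?_⟩
  · rw [Ideal.span_le, ← hz]
    rintro _ ⟨j, rfl⟩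
    exact Ideal.subset_span ⟨_, rfl⟩
  · rwa [Ideal.span_singleton_le_iff_mem]
  · rw [← hz, Ideal.span_le]
    set J := Ideal.span (Set.range (z ∘ i.succAbove)) ⊔ Ideal.span {x}
    have hj : ∀ j, z (i.succAbove j) ∈ J := fun j =>
      Ideal.mem_sup_left (Ideal.subset_span ⟨j, rfl⟩)
    rintro _ ⟨j, rfl⟩
    by_cases hij : j = i
    · subst hij
      have h1 : c j * z j ∈ J := by
        rw [Fin.sum_univ_succAbove _ j] at hc
        rw [eq_sub_of_add_eq hc]
        refine J.sub_mem (Ideal.mem_sup_right (Ideal.mem_span_singleton_self x)) ?_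
        exact J.sum_mem fun l _ => J.mul_mem_left _ (hj l)
      exact (Ideal.unit_mul_mem_iff_mem _ hi).1 h1
    · obtain ⟨l, rfl⟩ := Fin.exists_succAbove_eq hij
      exact hj l

/-- Dividing by x lowers the dimension by at most one, and the n remaining generators bound it above
by n. -/
theorem isCoords_quotient [IsNoetherianRing A] {n : ℕ} {y : Fin n → A} {x : A}
    (hy : Ideal.span (Set.range y) ⊔ Ideal.span {x} = maximalIdeal A)
    (hA : ringKrullDim A = (n + 1 : ℕ)) [IsLocalRing (A ⧸ Ideal.span {x})] :
    IsCoords (Ideal.Quotient.mk (Ideal.span {x}) ∘ y) := by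
  have hs : Ideal.span (Set.range (Ideal.Quotient.mk (Ideal.span {x}) ∘ y)) =
      maximalIdeal (A ⧸ Ideal.span {x}) := by
    rw [← maximalIdeal_quotient, ← hy, Ideal.map_sup, Ideal.map_quotient_self, sup_bot_eq,
      Ideal.map_span, Set.range_comp]
  refine ⟨hs, le_antisymm (card_le_of_span_eq hs) ?_⟩
  have hx : x ∈ maximalIdeal A := hy ▸ Ideal.mem_sup_right (Ideal.mem_span_singleton_self x)
  have h1 := ringKrullDim_le_ringKrullDim_quotient_add_spanFinrank (Ideal.span {x})
    (by rw [Ideal.span_singleton_le_iff_mem, ringJacobson_eq_maximalIdeal]; exact hx)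
  have h2 : (Ideal.span {x}).spanFinrank ≤ 1 := by
    have := Submodule.spanFinrank_span_le_encard (R := A) {x}
    simpa using this
  rw [hA] at h1
  have h3 : ((n + 1 : ℕ) : WithBot ℕ∞) ≤ ringKrullDim (A ⧸ Ideal.span {x}) + 1 := by
    refine h1.trans ?_
    gcongr
    exact_mod_cast h2
  rw [Fintype.card_fin]
  push_cast at h3
  exact ENat.WithBot.add_le_add_one_right_iff.1 h3

/-- Induction on the dimension, with the ring varying. Prime avoidance gives x in m, outside m² and
all minimal primes; by induction A/(x) is a domain, so (x) is prime. A minimal prime P ⊆ (x) does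
not contain x, hence P = xP, and P = 0 by Nakayama. -/
theorem isDomain_of_isCoords_fin : ∀ (n : ℕ) (A : Type u_1) [CommRing A] [IsLocalRing A]
    [IsNoetherianRing A] (z : Fin n → A), IsCoords z → IsDomain A := by
  intro n
  induction n with
  | zero =>
    intro A _ _ _ z hz
    have h0 : maximalIdeal A = ⊥ := by
      rw [← hz.1, Set.range_eq_empty, Ideal.span_empty]
    exact (isField_iff_maximalIdeal_eq.2 h0).isDomain
  | succ n ih =>
    intro A _ _ _ z hz
    have hdim : ringKrullDim A = (n + 1 : ℕ) := by simpa using hz.2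
    have hm2 : ¬ maximalIdeal A ≤ maximalIdeal A ^ 2 := by
      intro h
      have h0 : maximalIdeal A = ⊥ := by
        refine Submodule.eq_bot_of_le_smul_of_le_jacobson_bot (maximalIdeal A) _
          (IsNoetherian.noetherian _) ?_ (maximalIdeal_le_jacobson ⊥)
        rwa [smul_eq_mul, ← pow_two]
      have := ringKrullDim_eq_zero_of_isField (isField_iff_maximalIdeal_eq.2 h0)
      rw [hdim] at this
      norm_cast at this
    have hmin : ∀ P ∈ minimalPrimes A, ¬ maximalIdeal A ≤ P := by
      intro P hP h
      have hPp := hP.1.1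
      have hPm : P = maximalIdeal A := le_antisymm (le_maximalIdeal hPp.ne_top) h
      have h0 : (maximalIdeal A).height = 0 := by
        rw [← hPm, Ideal.height_eq_zero_iff]
        exact hP
      have := maximalIdeal_height_eq_ringKrullDim (R := A)
      rw [hdim, h0] at this
      norm_cast at this
    obtain ⟨x, hx, hx2, hxP⟩ : ∃ x ∈ maximalIdeal A, x ∉ maximalIdeal A ^ 2 ∧
        ∀ P ∈ minimalPrimes A, x ∉ P := by
      by_contra! hcon
      have hfin := minimalPrimes.finite_of_isNoetherianRing A
      have hsub : (maximalIdeal A : Set A) ⊆ ⋃ P ∈ ((insert (maximalIdeal A ^ 2) hfin.toFinset :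
          Finset (Ideal A)) : Set (Ideal A)), (P : Set A) := by
        intro x hx
        by_cases hx2 : x ∈ maximalIdeal A ^ 2
        · exact Set.mem_biUnion (Finset.mem_coe.2 (Finset.mem_insert_self _ _)) hx2
        · obtain ⟨P, hP, hxP⟩ := hcon x hx hx2
          exact Set.mem_biUnion (Finset.mem_coe.2 (Finset.mem_insert_of_mem
            (hfin.mem_toFinset.2 hP))) hxP
      -- Prime avoidance tolerates two members that are not prime; both places are given to m².
      rw [Ideal.subset_union_prime (f := fun P : Ideal A => P) (maximalIdeal A ^ 2)
        (maximalIdeal A ^ 2)] at hsub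
      · obtain ⟨P, hP, hle⟩ := hsub
        rcases Finset.mem_insert.1 hP with rfl | hP
        · exact hm2 hle
        · exact hmin P (hfin.mem_toFinset.1 hP) hle
      · intro P hP hne _
        exact (hfin.mem_toFinset.1 ((Finset.mem_insert.1 hP).resolve_left hne)).1.1
    obtain ⟨y, hy⟩ := exists_span_eq_of_notMem hz.1 hx hx2
    have hloc : IsLocalRing (A ⧸ Ideal.span {x}) :=
      isLocalRing_quotient (by rwa [Ideal.span_singleton_le_iff_mem])
    have hdom := ih _ _ (isCoords_quotient hy hdim)
    have hprime : (Ideal.span {x}).IsPrime := (Ideal.Quotient.isDomain_iff_prime _).1 hdom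
    obtain ⟨P, hP, hPx⟩ := Ideal.exists_minimalPrimes_le (I := ⊥) (J := Ideal.span {x}) bot_le
    have hPp := hP.1.1
    have hPbot : P = ⊥ := by
      refine Submodule.eq_bot_of_le_smul_of_le_jacobson_bot (maximalIdeal A) _
        (IsNoetherian.noetherian _) ?_ (maximalIdeal_le_jacobson ⊥)
      intro p hp
      obtain ⟨q, rfl⟩ := Ideal.mem_span_singleton'.1 (hPx hp)
      have hq : q ∈ P := (hPp.mem_or_mem hp).resolve_right (hxP P hP)
      rw [mul_comm]
      exact Ideal.mul_mem_mul hx hq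
    subst hPbot
    exact IsDomain.of_bot_isPrime A

theorem IsCoords.isDomain [IsNoetherianRing A] {n : ℕ} {z : Fin n → A} (hz : IsCoords z) :
    IsDomain A :=
  isDomain_of_isCoords_fin n A z hz

theorem exists_isCoords_of_isRegularLocalRing {B : Type*} [CommRing B] [IsRegularLocalRing B]
    {d : ℕ} (hd : ringKrullDim B = d) : ∃ w : Fin d → B, IsCoords w := by
  have h1 := IsRegularLocalRing.spanFinrank_maximalIdeal (R := B)
  rw [hd] at h1
  obtain ⟨s, hs, hsm⟩ := Submodule.FG.exists_span_finset_card_eq_spanFinrank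
    (IsNoetherian.noetherian (maximalIdeal B))
  have h2 : s.card = d := by
    rw [hs]; exact_mod_cast h1
  let e := (Finset.equivFinOfCardEq h2).symm
  refine ⟨fun i => e i, ?_, by simpa using hd⟩
  rw [← hsm]
  congr 1
  ext x
  refine ⟨?_, fun hx => ⟨e.symm ⟨x, hx⟩, by simp⟩⟩
  rintro ⟨i, rfl⟩
  exact (e i).2

/-- A regular quotient of a regular local ring is given by part of a system of coordinates. -/
theorem exists_isCoords_of_quotient_fin : ∀ (c d n : ℕ), n = d + c → ∀ (A : Type u_1) [CommRing A]
    [IsLocalRing A] [IsNoetherianRing A] (z : Fin n → A), IsCoords z → ∀ (I : Ideal A)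
    [IsRegularLocalRing (A ⧸ I)], ringKrullDim (A ⧸ I) = d →
    ∃ y : Fin n → A, IsCoords y ∧ I = Ideal.span (y '' {j | d ≤ (j : ℕ)}) := by
  intro c
  induction c with
  | zero =>
    rintro d n hn A _ _ _ z hz I _ hI
    obtain rfl : n = d := hn
    have hdom := hz.isDomain
    -- A is a domain, so a nonzero element of I would lower the dimension of the quotient.
    have hI0 : I = ⊥ := by
      by_contra hne
      obtain ⟨x, hx, hx0⟩ := Submodule.exists_mem_ne_zero_of_ne_bot hne
      have h1 := ringKrullDim_quotient_succ_le_of_nonZeroDivisor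
        (mem_nonZeroDivisors_of_ne_zero hx0)
      have h2 : ringKrullDim (A ⧸ I) ≤ ringKrullDim (A ⧸ Ideal.span {x}) :=
        ringKrullDim_le_of_surjective (Ideal.Quotient.factor
          ((Ideal.span_singleton_le_iff_mem _).2 hx)) (Ideal.Quotient.factor_surjective _)
      have h3 := hz.2
      rw [hI] at h2
      rw [h3] at h1
      have h4 : ((n : ℕ) : WithBot ℕ∞) + 1 ≤ (n : ℕ) := by
        refine le_trans ?_ (h1.trans (by simp))
        gcongr
      norm_cast at h4
      omega
    refine ⟨z, hz, ?_⟩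
    have : {j : Fin n | n ≤ (j : ℕ)} = ∅ := by
      ext j
      simp only [Set.mem_ofPred_eq, Set.mem_empty_iff_false, iff_false]
      omega
    rw [this, Set.image_empty, Ideal.span_empty, hI0]
  | succ c ih =>
    rintro d n rfl A _ _ _ z hz I hreg hI
    have hdim : ringKrullDim A = (d + c + 1 : ℕ) := by simpa [add_assoc] using hz.2
    have hIm : I ≤ maximalIdeal A :=
      le_maximalIdeal (Ideal.Quotient.nontrivial_iff.1 inferInstance)
    -- If I ⊆ m², lifts of d coordinates of A/I generate m modulo m², hence m, and dim A ≤ d.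
    have hI2 : ¬ I ≤ maximalIdeal A ^ 2 := by
      intro hle
      obtain ⟨w, hw⟩ := exists_isCoords_of_isRegularLocalRing hI
      choose w' hw' using fun i => Ideal.Quotient.mk_surjective (w i)
      have hw'm : Ideal.span (Set.range w') ≤ maximalIdeal A := by
        rw [Ideal.span_le]
        rintro _ ⟨i, rfl⟩
        by_contra hu
        have hu' := ((notMem_maximalIdeal).1 hu).map (Ideal.Quotient.mk I)
        rw [hw'] at hu'
        exact (mem_maximalIdeal _).1 (hw.mem i) hu'
      have hspan : Ideal.span (Set.range w') = maximalIdeal A := by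
        refine le_antisymm hw'm ?_
        refine Submodule.le_of_le_smul_of_le_jacobson_bot (I := maximalIdeal A)
          (IsNoetherian.noetherian _) (maximalIdeal_le_jacobson ⊥) ?_
        intro x hx
        have h1 : Ideal.Quotient.mk I x ∈ (Ideal.span (Set.range w')).map (Ideal.Quotient.mk I) := by
          rw [Ideal.map_span, ← Set.range_comp]
          have : Ideal.Quotient.mk I ∘ w' = w := funext hw'
          rw [this, hw.1, ← maximalIdeal_quotient]
          exact Ideal.mem_map_of_mem _ hx
        rw [Ideal.mem_quotient_iff_mem_sup] at h1
        rw [smul_eq_mul, ← pow_two]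
        exact (sup_le_sup_left hle _) h1
      have := card_le_of_span_eq hspan
      rw [hdim] at this
      simp only [Fintype.card_fin] at this
      norm_cast at this
      omega
    obtain ⟨x, hxI, hx2⟩ := SetLike.not_le_iff_exists.1 hI2
    have hx := hIm hxI
    obtain ⟨y, hy⟩ := exists_span_eq_of_notMem (n := d + c) hz.1 hx hx2
    have hxle : Ideal.span {x} ≤ I := (Ideal.span_singleton_le_iff_mem _).2 hxI
    have hloc : IsLocalRing (A ⧸ Ideal.span {x}) := isLocalRing_quotient (hxle.trans hIm)
    let φ := DoubleQuot.quotQuotEquivQuotOfLE hxle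
    have hreg' : IsRegularLocalRing ((A ⧸ Ideal.span {x}) ⧸ I.map (Ideal.Quotient.mk _)) :=
      .of_ringEquiv φ.symm
    obtain ⟨y', hy', hIy⟩ := ih d (d + c) rfl _ _ (isCoords_quotient hy hdim)
      (I.map (Ideal.Quotient.mk _)) ((ringKrullDim_eq_of_ringEquiv φ).trans hI)
    choose t ht using fun i => Ideal.Quotient.mk_surjective (y' i)
    have hmem : ∀ i, (Fin.snoc t x : Fin (d + c + 1) → A) (Fin.castSucc i) = t i := fun i => by simp
    -- Coordinates of A/(x) are lifted and x is appended last, so that it falls among the indices ≥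
    -- d.
    refine ⟨(Fin.snoc t x : Fin (d + c + 1) → A), ⟨?_, by simpa [add_assoc] using hdim⟩, ?_⟩
    · have h1 : (Ideal.span (Set.range t)).map (Ideal.Quotient.mk (Ideal.span {x})) =
          (maximalIdeal A).map (Ideal.Quotient.mk _) := by
        rw [maximalIdeal_quotient, ← hy'.1, Ideal.map_span, ← Set.range_comp]
        congr 2
        exact funext ht
      have h2 := congrArg (Ideal.comap (Ideal.Quotient.mk (Ideal.span {x}))) h1
      simp only [Ideal.comap_map_of_surjective' _ Ideal.Quotient.mk_surjective,
        Ideal.mk_ker] at h2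
      rw [sup_eq_left.2 (hxle.trans hIm)] at h2
      rw [← h2, ← Ideal.span_union]
      congr 1
      ext a
      constructor
      · rintro ⟨i, rfl⟩
        refine Fin.lastCases ?_ (fun i => ?_) i
        · exact Or.inr (by simp)
        · exact Or.inl ⟨i, by simp⟩
      · rintro (⟨i, rfl⟩ | h)
        · exact ⟨Fin.castSucc i, by simp⟩
        · exact ⟨Fin.last _, by simpa using h.symm⟩
    · have h1 : (I.map (Ideal.Quotient.mk (Ideal.span {x}))) =
          (Ideal.span (t '' {j | d ≤ (j : ℕ)})).map (Ideal.Quotient.mk _) := by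
        rw [hIy, Ideal.map_span, ← Set.image_comp]
        congr 2
        exact (funext ht).symm
      have h2 := congrArg (Ideal.comap (Ideal.Quotient.mk (Ideal.span {x}))) h1
      simp only [Ideal.comap_map_of_surjective' _ Ideal.Quotient.mk_surjective,
        Ideal.mk_ker] at h2
      rw [sup_eq_left.2 hxle] at h2
      rw [h2, ← Ideal.span_union]
      congr 1
      ext a
      constructor
      · rintro (⟨i, hi, rfl⟩ | h)
        · exact ⟨Fin.castSucc i, by simpa using hi, by simp⟩
        · exact ⟨Fin.last _, by simp, by simpa using h.symm⟩
      · rintro ⟨i, hi, rfl⟩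
        revert hi
        refine Fin.lastCases ?_ (fun i => ?_) i
        · exact fun _ => Or.inr (by simp)
        · exact fun hi => Or.inl ⟨i, by simpa using hi, by simp⟩

end RegularLocalRing

end Algebraic

namespace Algebraic

open IsLocalRing TensorProduct

/-! ### Extension of primes along flat unramified maps. -/

section Radical

variable {R S : Type*} [CommRing R] [CommRing S] [Algebra R S] [Module.Flat R S]
  [Algebra.FormallyUnramified R S] [Algebra.EssFiniteType R S]

/-- By flatness S/PS embeds in the fibre of S over the residue field of P, and this fibre is reduced
because S is unramified. -/
theorem isRadical_map_of_isPrime (P : Ideal R) [P.IsPrime] :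
    (P.map (algebraMap R S)).IsRadical := by
  have hred : IsReduced (P.ResidueField ⊗[R] S) :=
    Algebra.FormallyUnramified.isReduced_of_field P.ResidueField _
  have hinj : Function.Injective
      ((IsScalarTower.toAlgHom R (R ⧸ P) P.ResidueField).toLinearMap.rTensor S) :=
    Module.Flat.rTensor_preserves_injective_linearMap _ P.injective_algebraMap_quotient_residueField
  have hmap : ∀ x : R ⧸ P, ∀ s : S, ((IsScalarTower.toAlgHom R (R ⧸ P)
      P.ResidueField).toLinearMap.rTensor S) (x ⊗ₜ s) = algebraMap (R ⧸ P) P.ResidueField x ⊗ₜ s :=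
    fun _ _ => rfl
  intro x hx
  obtain ⟨n, hn⟩ := hx
  have key : ∀ y : S, y ∈ P.map (algebraMap R S) ↔ (1 : P.ResidueField) ⊗ₜ[R] y = 0 := by
    intro y
    have h1 : (1 : P.ResidueField) ⊗ₜ[R] y = ((IsScalarTower.toAlgHom R (R ⧸ P)
      P.ResidueField).toLinearMap.rTensor S) ((1 : R ⧸ P) ⊗ₜ y) := by rw [hmap, map_one]
    rw [h1, map_eq_zero_iff _ hinj, ← (TensorProduct.quotTensorEquivQuotSMul S P).map_eq_zero_iff]
    rw [show (1 : R ⧸ P) = Ideal.Quotient.mk P 1 from rfl,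
      TensorProduct.quotTensorEquivQuotSMul_mk_tmul, one_smul, Submodule.Quotient.mk_eq_zero,
      Ideal.smul_top_eq_map, Submodule.restrictScalars_mem]
  rw [key] at hn ⊢
  have : ((1 : P.ResidueField) ⊗ₜ[R] x) ^ n = 0 := by
    rw [Algebra.TensorProduct.tmul_pow, one_pow, hn]
  exact hred.eq_zero _ ⟨n, this⟩

end Radical

/-! ### Étale extensions of local rings and descent of coordinates. -/

section Local

variable {R S : Type*} [CommRing R] [CommRing S] [Algebra R S] [IsLocalRing R] [IsLocalRing S]
  [IsLocalHom (algebraMap R S)] [Module.Flat R S]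
  [Algebra.FormallyUnramified R S] [Algebra.EssFiniteType R S] [IsNoetherianRing R]

theorem comap_map_eq (I : Ideal R) : (I.map (algebraMap R S)).comap (algebraMap R S) = I :=
  have := Module.FaithfullyFlat.of_flat_of_isLocalHom (A := R) (B := S)
  Ideal.comap_map_eq_self_of_faithfullyFlat I

/-- Going down splits the height of the maximal ideal of S into that of R and that of the closed
fibre, which is a field since the maximal ideal of R generates that of S. -/
theorem ringKrullDim_eq_of_etale [IsNoetherianRing S] : ringKrullDim S = ringKrullDim R := by
  have h0 := Ideal.height_eq_height_add_of_liesOver_of_hasGoingDown (maximalIdeal R) (maximalIdeal S)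
  rw [Algebra.FormallyUnramified.map_maximalIdeal, Ideal.map_quotient_self] at h0
  have : Nontrivial (S ⧸ maximalIdeal S) := Ideal.Quotient.nontrivial_iff.2 (maximalIdeal.isMaximal S).ne_top
  have : IsDomain (S ⧸ maximalIdeal S) := inferInstance
  rw [Ideal.height_bot, add_zero] at h0
  rw [← maximalIdeal_height_eq_ringKrullDim, ← maximalIdeal_height_eq_ringKrullDim, h0]

theorem IsCoords.map [IsNoetherianRing S] {ι : Type*} [Fintype ι] {y : ι → R} (hy : IsCoords y) :
    IsCoords (fun i => algebraMap R S (y i)) := by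
  refine ⟨?_, by rw [ringKrullDim_eq_of_etale (R := R), hy.2]⟩
  rw [← Algebra.FormallyUnramified.map_maximalIdeal (R := R), ← hy.1, Ideal.map_span, ← Set.range_comp]
  rfl

/-- The maximal ideal of R generates that of S, and equality of residue fields lets the coefficients
be moved to R modulo the maximal ideal. -/
theorem exists_sub_mem_sq (hκ : ∀ s : S, ∃ r : R, s - algebraMap R S r ∈ maximalIdeal S)
    {x : S} (hx : x ∈ maximalIdeal S) :
    ∃ r ∈ maximalIdeal R, x - algebraMap R S r ∈ maximalIdeal S ^ 2 := by
  rw [← Algebra.FormallyUnramified.map_maximalIdeal (R := R)] at hx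
  induction hx using Submodule.span_induction with
  | mem x h => obtain ⟨r, hr, rfl⟩ := h; exact ⟨r, hr, by simp⟩
  | zero => exact ⟨0, Ideal.zero_mem _, by simp⟩
  | add x y _ _ hx hy =>
    obtain ⟨r, hr, h⟩ := hx
    obtain ⟨r', hr', h'⟩ := hy
    refine ⟨r + r', Ideal.add_mem _ hr hr', ?_⟩
    rw [map_add, add_sub_add_comm]
    exact Ideal.add_mem _ h h'
  | smul s x _ hx =>
    obtain ⟨r, hr, h⟩ := hx
    obtain ⟨t, ht⟩ := hκ s
    refine ⟨t * r, Ideal.mul_mem_left _ _ hr, ?_⟩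
    have : s • x - algebraMap R S (t * r) =
        s * (x - algebraMap R S r) + (s - algebraMap R S t) * algebraMap R S r := by
      rw [map_mul, smul_eq_mul]; ring
    rw [this]
    refine Ideal.add_mem _ (Ideal.mul_mem_left _ _ h) ?_
    rw [pow_two]
    exact Ideal.mul_mem_mul ht (((local_hom_TFAE (algebraMap R S)).out 0 2 rfl rfl).1 inferInstance
      (Ideal.mem_map_of_mem _ hr))

theorem span_eq_maximalIdeal_of_sub_mem_sq [IsNoetherianRing S] {ι : Type*} {x y : ι → S}
    (hx : Ideal.span (Set.range x) = maximalIdeal S) (h : ∀ i, x i - y i ∈ maximalIdeal S ^ 2) :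
    Ideal.span (Set.range y) = maximalIdeal S := by
  have hle : Ideal.span (Set.range y) ≤ maximalIdeal S := by
    rw [Ideal.span_le]
    rintro _ ⟨i, rfl⟩
    have := Ideal.sub_mem _ (hx ▸ Ideal.subset_span ⟨i, rfl⟩ : x i ∈ maximalIdeal S)
      (Ideal.pow_le_self two_ne_zero (h i))
    simpa using this
  refine le_antisymm hle ?_
  refine Submodule.le_of_le_smul_of_le_jacobson_bot (I := maximalIdeal S)
    (IsNoetherian.noetherian _) (maximalIdeal_le_jacobson _) ?_
  rw [smul_eq_mul, ← pow_two]
  conv_lhs => rw [← hx]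
  rw [Ideal.span_le]
  rintro _ ⟨i, rfl⟩
  have : x i = y i + (x i - y i) := by ring
  rw [this]
  exact Submodule.add_mem_sup (Ideal.subset_span ⟨i, rfl⟩) (h i)

/-- Coordinates on an étale neighbourhood can be replaced by coordinates downstairs, to first
order. Those which come from below, up to units, can be kept. -/
theorem IsCoords.exists_descend [IsNoetherianRing S]
    (hκ : ∀ s : S, ∃ r : R, s - algebraMap R S r ∈ maximalIdeal S) {s m : ℕ} {u : Fin s → S} 
    {v : Fin m → S} (h : IsCoords (Sum.elim u v)) {g : Fin s → R} 
    (hg : ∀ i, Associated (u i) (algebraMap R S (g i))) :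
    ∃ w : Fin m → R, IsCoords (Sum.elim g w) := by
  have hv : ∀ i, ∃ r ∈ maximalIdeal R, v i - algebraMap R S r ∈ maximalIdeal S ^ 2 := fun i =>
    exists_sub_mem_sq hκ (h.mem (.inr i))
  choose w hw hvw using hv
  refine ⟨w, ?_, by rw [← ringKrullDim_eq_of_etale (R := R) (S := S), h.2]⟩
  have h1 : Ideal.span (Set.range (Sum.elim (fun i => algebraMap R S (g i)) v)) =
      maximalIdeal S := by
    rw [← h.1, Set.Sum.elim_range, Set.Sum.elim_range, Ideal.span_union, Ideal.span_union]
    congr 1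
    refine le_antisymm ?_ ?_ <;> rw [Ideal.span_le] <;> rintro _ ⟨i, rfl⟩
    · exact Ideal.mem_of_dvd _ (hg i).dvd (Ideal.subset_span ⟨i, rfl⟩)
    · exact Ideal.mem_of_dvd _ (hg i).symm.dvd (Ideal.subset_span ⟨i, rfl⟩)
  have h2 := span_eq_maximalIdeal_of_sub_mem_sq (y := algebraMap R S ∘ Sum.elim g w) h1 (by
    rintro (i | i)
    · simp
    · exact hvw i)
  -- Faithful flatness: an ideal of R is recovered from its extension, here the maximal ideal of S.
  rw [← comap_map_eq (S := S) (Ideal.span (Set.range (Sum.elim g w))), Ideal.map_span,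
    ← Set.range_comp, h2, ← Algebra.FormallyUnramified.map_maximalIdeal (R := R), comap_map_eq]

/-- If `I S` generates a principal ideal, so does `I`. -/
theorem exists_span_singleton_eq {I : Ideal R} {u : S}
    (h : I.map (algebraMap R S) = Ideal.span {u}) :
    ∃ g : R, I = Ideal.span {g} ∧ Ideal.span {algebraMap R S g} = Ideal.span {u} := by
  -- Either all of I goes into m·(u), and (u) = 0 by Nakayama, or some g ∈ I is a unit times u.
  by_cases hu : ∀ g ∈ I, algebraMap R S g ∈ maximalIdeal S * Ideal.span {u}
  · have h1 : Ideal.span {u} ≤ maximalIdeal S * Ideal.span {u} := by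
      rw [← h] at hu ⊢
      exact Ideal.map_le_iff_le_comap.2 hu
    have h2 : Ideal.span {u} = ⊥ := Submodule.eq_bot_of_le_smul_of_le_jacobson_bot (maximalIdeal S) _
      (Submodule.fg_span_singleton u) h1 (maximalIdeal_le_jacobson _)
    refine ⟨0, ?_, by simp [h2]⟩
    rw [← comap_map_eq (S := S) I, h, h2, ← comap_map_eq (S := S) (Ideal.span {0})]
    simp
  · push Not at hu
    obtain ⟨g, hgI, hg⟩ := hu
    have h1 : algebraMap R S g ∈ Ideal.span {u} := h ▸ Ideal.mem_map_of_mem _ hgI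
    obtain ⟨c, hc⟩ := Ideal.mem_span_singleton'.1 h1
    have hcu : IsUnit c := by
      by_contra hcu
      exact hg (hc ▸ Ideal.mul_mem_mul hcu (Ideal.mem_span_singleton_self u))
    have h2 : Ideal.span {algebraMap R S g} = Ideal.span {u} := by
      rw [← hc, Ideal.span_singleton_mul_left_unit hcu]
    refine ⟨g, ?_, h2⟩
    rw [← comap_map_eq (S := S) I, h, ← comap_map_eq (S := S) (Ideal.span {g}), Ideal.map_span,
      Set.image_singleton, h2]

end Local

end Algebraic

namespace Algebraic

open IsLocalRing TensorProduct

theorem map_mem_maximalIdeal_iff {A B : Type*} [CommRing A] [CommRing B] [IsLocalRing A]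
    [IsLocalRing B] (φ : B →+* A) [IsLocalHom φ] {b : B} :
    φ b ∈ maximalIdeal A ↔ b ∈ maximalIdeal B := by
  simp

/-! ### Differentials of coordinates and dual derivations. -/

section DualBasis

variable {k A : Type*} [Field k] [CommRing A] [IsLocalRing A] [Algebra k A]
variable {ι : Type*} [Fintype ι]

/-- If a_i were a unit, y_i would be redundant modulo m², and by Nakayama m would have fewer
generators than the dimension. -/
theorem IsCoords.mem_of_sum_mem_sq [IsNoetherianRing A] {y : ι → A} (hy : IsCoords y) {a : ι → A}
    (ha : ∑ i, a i * y i ∈ maximalIdeal A ^ 2) (i : ι) : a i ∈ maximalIdeal A := by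
  classical
  by_contra hi
  have hi : IsUnit (a i) := by simpa using hi
  let y' : {j // j ≠ i} → A := fun j => y j
  have hle : Ideal.span (Set.range y') ≤ maximalIdeal A := by
    rw [Ideal.span_le]
    rintro _ ⟨j, rfl⟩
    exact hy.mem _
  have key : Ideal.span (Set.range y') = maximalIdeal A := by
    refine le_antisymm hle ?_
    refine Submodule.le_of_le_smul_of_le_jacobson_bot (I := maximalIdeal A)
      (IsNoetherian.noetherian _) (maximalIdeal_le_jacobson _) ?_
    rw [smul_eq_mul, ← pow_two]
    conv_lhs => rw [← hy.1]
    rw [Ideal.span_le]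
    have hj : ∀ j, j ≠ i → y j ∈ Ideal.span (Set.range y') ⊔ maximalIdeal A ^ 2 := fun j hj =>
      Ideal.mem_sup_left (Ideal.subset_span ⟨⟨j, hj⟩, rfl⟩)
    rintro _ ⟨j, rfl⟩
    by_cases hji : j = i
    · subst hji
      refine (Ideal.unit_mul_mem_iff_mem _ hi).1 ?_
      rw [← Finset.add_sum_erase _ _ (Finset.mem_univ j)] at ha
      have := Ideal.sub_mem _ ((Ideal.mem_sup_right ha : _ ∈ Ideal.span (Set.range y') ⊔ maximalIdeal A ^ 2))
        (Ideal.sum_mem _ (t := Finset.univ.erase j) fun l hl => Ideal.mul_mem_left _ (a l) (hj l (Finset.ne_of_mem_erase hl)))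
      simpa using this
    · exact hj j hji
  have h1 := card_le_of_span_eq key
  rw [hy.2] at h1
  have h2 : Fintype.card ι ≤ Fintype.card {j // j ≠ i} := by exact_mod_cast h1
  have h3 := Fintype.card_subtype_lt (p := fun j => j ≠ i) (x := i) (by simp)
  omega

variable [Algebra.FormallySmooth k A] [Algebra.EssFiniteType k A]

/-- The residue field is k, hence formally smooth over k; its first cotangent homology vanishes and
the conormal sequence is exact on the left. -/
theorem injective_kerCotangentToTensor (hk : ∀ a : A, ∃ c : k, a - algebraMap k A c ∈ maximalIdeal A) :
    Function.Injective (KaehlerDifferential.kerCotangentToTensor k A (ResidueField A)) := by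
  have hb : Function.Bijective (algebraMap k (ResidueField A)) := by
    refine ⟨(algebraMap k (ResidueField A)).injective, fun x => ?_⟩
    obtain ⟨a, rfl⟩ := residue_surjective x
    obtain ⟨c, hc⟩ := hk a
    refine ⟨c, ?_⟩
    rw [IsScalarTower.algebraMap_apply k A (ResidueField A), ResidueField.algebraMap_eq, eq_comm,
      ← sub_eq_zero, ← map_sub, residue_eq_zero_iff]
    exact hc
  have : Algebra.FormallySmooth k (ResidueField A) :=
    .of_equiv (AlgEquiv.ofBijective (Algebra.ofId k _) hb)
  rw [Algebra.FormallySmooth.kerCotangentToTensor_injective_iff residue_surjective]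
  exact Algebra.FormallySmooth.subsingleton_h1Cotangent

/-- The differentials of coordinates form a basis of the module of differentials. -/
theorem IsCoords.exists_basis {ι : Type _} [Fintype ι] [IsNoetherianRing A]
    (hk : ∀ a : A, ∃ c : k, a - algebraMap k A c ∈ maximalIdeal A) {y : ι → A} (hy : IsCoords y) :
    ∃ b : Module.Basis ι A (KaehlerDifferential k A), ∀ i, b i = KaehlerDifferential.D k A (y i) := by
  classical
  have hproj : Module.Projective A (KaehlerDifferential k A) :=
    Algebra.FormallySmooth.projective_kaehlerDifferential
  have hli : LinearIndependent A fun i => KaehlerDifferential.D k A (y i) := by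
    -- The module of differentials is projective, so independence can be tested in its fibre, where
    -- m/m² embeds.
    refine Module.IsLocalRing.linearIndependent_of_flat _ ?_
    rw [Fintype.linearIndependent_iff]
    intro c hc i
    choose a ha using fun i => Ideal.Quotient.mk_surjective (c i)
    let Y : ι → RingHom.ker (algebraMap A (ResidueField A)) := fun i =>
      ⟨y i, by rw [ResidueField.algebraMap_eq, RingHom.mem_ker, residue_eq_zero_iff]; exact hy.mem i⟩
    have h0 : KaehlerDifferential.kerCotangentToTensor k A (ResidueField A)
        (Ideal.toCotangent _ (∑ i, a i • Y i)) = 0 := by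
      rw [map_sum, map_sum, ← hc]
      refine Finset.sum_congr rfl fun i _ => ?_
      rw [map_smul, map_smul, KaehlerDifferential.kerCotangentToTensor_toCotangent, ← ha]
      rfl
    rw [map_eq_zero_iff _ (injective_kerCotangentToTensor hk), Ideal.toCotangent_eq_zero] at h0
    have h1 : ∑ i, a i * y i ∈ maximalIdeal A ^ 2 := by
      have hker : RingHom.ker (algebraMap A (ResidueField A)) = maximalIdeal A := ker_residue
      have hY : ((∑ i, a i • Y i : RingHom.ker (algebraMap A (ResidueField A))) : A) =
          ∑ i, a i * y i := by
        rw [AddSubmonoidClass.coe_finsetSum]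
        rfl
      rwa [hY, hker] at h0
    rw [← ha]
    exact Ideal.Quotient.eq_zero_iff_mem.2 (hy.mem_of_sum_mem_sq h1 i)
  refine ⟨.mk hli ?_, fun i => by rw [Module.Basis.mk_apply]⟩
  refine Submodule.le_of_le_smul_of_le_jacobson_bot (I := maximalIdeal A)
    Module.Finite.fg_top (maximalIdeal_le_jacobson _) ?_
  rw [← KaehlerDifferential.span_range_derivation, Submodule.span_le]
  rintro _ ⟨a, rfl⟩
  obtain ⟨c, hc⟩ := hk a
  rw [← hy.1, Ideal.mem_span_range_iff_exists_fun] at hc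
  obtain ⟨b, hb⟩ := hc
  -- With a = c + ∑ b_i y_i, Leibniz gives da = ∑ b_i dy_i modulo m times the differentials, and
  -- Nakayama applies.
  rw [sub_eq_iff_eq_add.1 hb.symm, map_add, Derivation.map_algebraMap, add_zero, map_sum]
  refine Submodule.sum_mem _ fun i _ => ?_
  rw [Derivation.leibniz]
  refine Submodule.add_mem_sup ?_ ?_
  · exact Submodule.smul_mem _ _ (Submodule.subset_span ⟨i, rfl⟩)
  · exact Submodule.smul_mem_smul (hy.mem i) (Submodule.subset_span ⟨_, rfl⟩)

/-- Coordinates have dual derivations, in terms of which all derivations can be expressed. -/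
theorem IsCoords.exists_derivation {ι : Type _} [Fintype ι] [DecidableEq ι] [IsNoetherianRing A]
    (hk : ∀ a : A, ∃ c : k, a - algebraMap k A c ∈ maximalIdeal A) {y : ι → A} (hy : IsCoords y) :
    ∃ D : ι → Derivation k A A, (∀ i j, D i (y j) = if j = i then 1 else 0) ∧
      ∀ (M : Type _) [AddCommGroup M] [Module k M] [Module A M] [IsScalarTower k A M]
        (θ : Derivation k A M) (f : A), θ f = ∑ i, D i f • θ (y i) := by
  obtain ⟨b, hb⟩ := hy.exists_basis hk
  refine ⟨fun i => (b.coord i).compDer (KaehlerDifferential.D k A), fun i j => ?_, ?_⟩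
  · simp [← hb, Finsupp.single_apply]
  · intro M _ _ _ _ θ f
    have h1 := congrArg θ.liftKaehlerDifferential (b.sum_repr (KaehlerDifferential.D k A f))
    rw [Derivation.liftKaehlerDifferential_comp_D, map_sum] at h1
    rw [← h1]
    refine Finset.sum_congr rfl fun i _ => ?_
    rw [map_smul, hb, Derivation.liftKaehlerDifferential_comp_D]
    rfl

end DualBasis

/-! ### The logarithmic rank without coordinates. -/

section Rank

/-- Let `χ` be the structure map of a local ring `A` over a field, `φ` a homomorphism from a local
ring `B` to `A` and `K` an ideal of `A`. This says that `φ`, as a map from the maximal ideal of `B`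
to `A ⧸ K`, has rank at least `e`. -/
def RankGE {k A B : Type*} [Field k] [CommRing A] [CommRing B] [IsLocalRing B] (χ : k →+* A)
    (φ : B →+* A) (K : Ideal A) (e : ℕ) : Prop :=
  ∃ F : Fin e → B, (∀ i, F i ∈ maximalIdeal B) ∧
    ∀ c : Fin e → k, ∑ i, χ (c i) * φ (F i) ∈ K → c = 0

variable {k A B : Type*} [Field k] [CommRing A] [CommRing B] [IsLocalRing B]

/-- Removes the ambient variety: its local ring surjects onto that of X₀, and elements of the
maximal ideal lift. -/
theorem RankGE.comp_surjective {C : Type*} [CommRing C] [IsLocalRing C] {χ : k →+* A} {φ : B →+* A}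
    {K : Ideal A} {e : ℕ} (ψ : C →+* B) (hψ : Function.Surjective ψ) :
    RankGE χ (φ.comp ψ) K e ↔ RankGE χ φ K e := by
  have : IsLocalHom ψ := .of_surjective ψ hψ
  constructor
  · rintro ⟨F, hF, h⟩
    exact ⟨fun i => ψ (F i), fun i => (map_mem_maximalIdeal_iff ψ).2 (hF i), h⟩
  · rintro ⟨F, hF, h⟩
    choose G hG using fun i => hψ (F i)
    refine ⟨G, fun i => ?_, fun c hc => h c ?_⟩
    · have := hF i
      rw [← hG] at this
      exact (map_mem_maximalIdeal_iff ψ).1 this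
    · simpa [hG] using hc

/-- Removes the étale neighbourhood: only the contraction of the ideal to the smaller ring matters.
-/
theorem RankGE.comp_comap {C : Type*} [CommRing C] {χ : k →+* A} {φ : B →+* A}
    {K : Ideal A} {L : Ideal C} {e : ℕ} (ψ : A →+* C) (hψ : L.comap ψ = K) :
    RankGE (ψ.comp χ) (ψ.comp φ) L e ↔ RankGE χ φ K e := by
  subst hψ
  simp [RankGE, Ideal.mem_comap]

variable [IsLocalRing A] [Algebra k A]

/-- Modulo m, ∂/∂v_l kills m² by Leibniz, and kills (u) because ∂u_i/∂v_l = 0. -/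
theorem residue_derivation_of_mem {s m : ℕ} {u : Fin s → A} {v : Fin m → A}
    (hy : IsCoords (Sum.elim u v))
    {D : Fin s ⊕ Fin m → Derivation k A A}
    (hD : ∀ i j, D i (Sum.elim u v j) = if j = i then 1 else 0) {f : A} (l : Fin m)
    (hf : f ∈ maximalIdeal A ^ 2 ⊔ Ideal.span (Set.range u)) : residue A (D (.inr l) f) = 0 := by
  rw [residue_eq_zero_iff]
  obtain ⟨x, hx, y, hy', rfl⟩ := Submodule.mem_sup.1 hf
  rw [map_add]
  refine Ideal.add_mem _ ?_ ?_
  · rw [pow_two] at hx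
    refine Submodule.mul_induction_on hx (fun a ha b hb => ?_) fun a b ha hb => ?_
    · rw [Derivation.leibniz]
      exact Ideal.add_mem _ (Ideal.mul_mem_right _ _ ha) (Ideal.mul_mem_right _ _ hb)
    · rw [map_add]
      exact Ideal.add_mem _ ha hb
  · rw [Ideal.mem_span_range_iff_exists_fun] at hy'
    obtain ⟨c, rfl⟩ := hy'
    rw [map_sum]
    refine Ideal.sum_mem _ fun i _ => ?_
    rw [Derivation.leibniz]
    refine Ideal.add_mem _ ?_ (Ideal.mul_mem_right _ _ (hy.mem (.inl i)))
    have := hD (.inr l) (.inl i)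
    simp only [Sum.elim_inl, reduceCtorEq, if_false] at this
    rw [this]
    simp

/-- Expand f in the coordinates: modulo m, ∂f/∂v_l is the coefficient of v_l, so all v-coefficients
lie in m. -/
theorem mem_of_residue_derivation {s m : ℕ} {u : Fin s → A} {v : Fin m → A}
    (hy : IsCoords (Sum.elim u v))
    {D : Fin s ⊕ Fin m → Derivation k A A}
    (hD : ∀ i j, D i (Sum.elim u v j) = if j = i then 1 else 0) {f : A}
    (hf : f ∈ maximalIdeal A) (h : ∀ l, residue A (D (.inr l) f) = 0) :
    f ∈ maximalIdeal A ^ 2 ⊔ Ideal.span (Set.range u) := by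
  rw [← hy.1, Ideal.mem_span_range_iff_exists_fun] at hf
  obtain ⟨c, rfl⟩ := hf
  rw [Fintype.sum_sum_type]
  refine Ideal.add_mem _ (Ideal.mem_sup_right <| Ideal.sum_mem _ fun i _ =>
    Ideal.mul_mem_left _ _ (Ideal.subset_span ⟨i, rfl⟩))
    (Ideal.mem_sup_left <| Ideal.sum_mem _ fun l _ => ?_)
  rw [pow_two]
  refine Ideal.mul_mem_mul ?_ (hy.mem (.inr l))
  have h1 := h l
  rw [map_sum, residue_eq_zero_iff] at h1
  simp_rw [Derivation.leibniz, hD] at h1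
  rw [Finset.sum_add_distrib] at h1
  have h2 : ∑ i, Sum.elim u v i • D (.inr l) (c i) ∈ maximalIdeal A :=
    Ideal.sum_mem _ fun i _ => Ideal.mul_mem_right _ _ (hy.mem i)
  have h3 := (Ideal.add_mem_iff_left _ h2).1 h1
  simpa using h3

/-- The rank of the logarithmic Jacobian matrix, without coordinates. -/
theorem le_rank_iff (hk : ∀ a : A, ∃ c : k, a - algebraMap k A c ∈ maximalIdeal A) {s m N : ℕ}
    {u : Fin s → A} {v : Fin m → A} (hy : IsCoords (Sum.elim u v))
    {D : Fin s ⊕ Fin m → Derivation k A A}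
    (hD : ∀ i j, D i (Sum.elim u v j) = if j = i then 1 else 0) (φ : B →+* A) [IsLocalHom φ]
    {z : Fin N → B} (hz : Ideal.span (Set.range z) = maximalIdeal B) (e : ℕ) :
    e ≤ (Matrix.of fun (j : Fin N) (i : Fin s ⊕ Fin m) =>
      residue A (Sum.elim u (fun _ => 1) i * D i (φ (z j)))).rank ↔
    RankGE (algebraMap k A) φ (maximalIdeal A ^ 2 ⊔ Ideal.span (Set.range u)) e := by
  -- The row of the matrix belonging to f. Its u-entries are zero and it is linear over constants,
  -- so relations among rows are combinations of functions lying in the ideal, by the two preceding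
  -- lemmas.
  let w : A → Fin s ⊕ Fin m → ResidueField A := fun f i =>
    residue A (Sum.elim u (fun _ => 1) i * D i f)
  have hwl : ∀ f i, w f (.inl i) = 0 := fun f i => by
    simp only [w, Sum.elim_inl]
    rw [residue_eq_zero_iff]
    exact Ideal.mul_mem_right _ _ (hy.mem (.inl i))
  have hwr : ∀ f l, w f (.inr l) = residue A (D (.inr l) f) := fun f l => by simp [w]
  have hsum : ∀ {n : ℕ} (c : Fin n → k) (f : Fin n → A),
      w (∑ i, algebraMap k A (c i) * f i) = ∑ i, residue A (algebraMap k A (c i)) • w (f i) := by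
    intro n c f
    ext j
    rw [Finset.sum_apply]
    simp only [w, map_sum, Finset.mul_sum, Pi.smul_apply, smul_eq_mul, ← map_mul]
    refine Finset.sum_congr rfl fun i _ => ?_
    rw [← Algebra.smul_def, Derivation.map_smul, Algebra.smul_def]
    ring_nf
  have hmax : ∀ {b}, b ∈ maximalIdeal B → φ b ∈ maximalIdeal A := fun hb =>
    (map_mem_maximalIdeal_iff φ).2 hb
  have hrow : (Matrix.of fun (j : Fin N) (i : Fin s ⊕ Fin m) =>
      residue A (Sum.elim u (fun _ => 1) i * D i (φ (z j)))).row = fun j => w (φ (z j)) := rfl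
  rw [Matrix.rank_eq_finrank_span_row, hrow]
  have hlin : ∀ (F : Fin e → B), (∀ i, F i ∈ maximalIdeal B) →
      (LinearIndependent (ResidueField A) (fun i => w (φ (F i))) ↔
        ∀ c : Fin e → k, ∑ i, algebraMap k A (c i) * φ (F i) ∈
          maximalIdeal A ^ 2 ⊔ Ideal.span (Set.range u) → c = 0) := by
    intro F hF
    rw [Fintype.linearIndependent_iff]
    constructor
    · intro h c hc
      have h1 : ∑ i, residue A (algebraMap k A (c i)) • w (φ (F i)) = 0 := by
        rw [← hsum]
        ext (i | l)
        · rw [hwl]; rfl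
        · rw [hwr, residue_derivation_of_mem hy hD l hc]; rfl
      ext i
      exact (map_eq_zero ((residue A).comp (algebraMap k A))).1 (h _ h1 i)
    · intro h c hc
      have : ∀ i, ∃ d : k, c i = residue A (algebraMap k A d) := by
        intro i
        obtain ⟨a, ha⟩ := residue_surjective (c i)
        obtain ⟨d, hd⟩ := hk a
        refine ⟨d, ?_⟩
        rw [← ha, ← sub_eq_zero, ← map_sub, residue_eq_zero_iff]
        exact hd
      choose d hd using this
      simp_rw [hd] at hc ⊢
      rw [← hsum] at hc
      have := h d (mem_of_residue_derivation hy hD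
        (Ideal.sum_mem _ fun i _ => Ideal.mul_mem_left _ _ (hmax (hF i))) fun l => by
          rw [← hwr, hc]; rfl)
      intro i
      rw [this]
      simp
  constructor
  · intro he
    obtain ⟨f, hf, -, hli⟩ := Submodule.exists_fun_fin_finrank_span_eq (ResidueField A)
      (Set.range fun j => w (φ (z j)))
    choose j hj using hf
    have hli' := hli.comp (Fin.castLE he) (Fin.castLE_injective he)
    refine ⟨fun i => z (j (Fin.castLE he i)), fun i => hz ▸ Ideal.subset_span ⟨_, rfl⟩, ?_⟩
    rw [← hlin _ fun i => hz ▸ Ideal.subset_span ⟨_, rfl⟩]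
    rw [show (fun i => w (φ (z (j (Fin.castLE he i))))) = f ∘ Fin.castLE he from
      funext fun i => hj _]
    exact hli'
  · rintro ⟨F, hF, h⟩
    rw [← hlin F hF] at h
    have hspan : Submodule.span (ResidueField A) (Set.range fun i => w (φ (F i))) ≤
        Submodule.span (ResidueField A) (Set.range fun j => w (φ (z j))) := by
      rw [Submodule.span_le]
      rintro _ ⟨i, rfl⟩
      have hFi := hF i
      rw [← hz, Ideal.mem_span_range_iff_exists_fun] at hFi
      obtain ⟨c, hc⟩ := hFi
      have : w (φ (F i)) = ∑ j, residue A (φ (c j)) • w (φ (z j)) := by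
        ext l
        rw [Finset.sum_apply, ← hc]
        simp only [w, map_sum, Finset.mul_sum, Pi.smul_apply, smul_eq_mul, map_mul,
          Derivation.leibniz, mul_add, map_add]
        refine Finset.sum_congr rfl fun j _ => ?_
        have : residue A (φ (z j)) = 0 :=
          (residue_eq_zero_iff _).2 (hmax (hz ▸ Ideal.subset_span ⟨_, rfl⟩))
        rw [this]
        ring
      change w (φ (F i)) ∈ _
      rw [this]
      exact Submodule.sum_mem _ fun j _ => Submodule.smul_mem _ _ (Submodule.subset_span ⟨j, rfl⟩)
    have h1 := Submodule.finrank_mono hspan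
    rwa [finrank_span_eq_card h, Fintype.card_fin] at h1

end Rank

end Algebraic

namespace Algebraic

open IsLocalRing

universe u

/-! ### Generizations of a point and primes of its local ring. -/

section Points

variable {X Y : Scheme.{u}}

/-- The prime ideal of the local ring at `x` given by a generization of `x`. -/
def primeAt {η x : X} (h : η ⤳ x) : Ideal (X.presheaf.stalk x) :=
  (maximalIdeal (X.presheaf.stalk η)).comap (X.presheaf.stalkSpecializes h).hom

instance {η x : X} (h : η ⤳ x) : (primeAt h).IsPrime := Ideal.comap_isPrime _ _

theorem germ_mem_primeAt {η x : X} (h : η ⤳ x) {U : X.Opens} (hx : x ∈ U) (f : Γ(X, U)) :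
    X.presheaf.germ U x hx f ∈ primeAt h ↔ η ∉ X.basicOpen f := by
  rw [primeAt, Ideal.mem_comap, Scheme.mem_basicOpen _ _ _ (h.mem_open U.2 hx),
    mem_maximalIdeal, mem_nonunits_iff]
  have := X.presheaf.germ_stalkSpecializes hx h
  rw [← ConcreteCategory.comp_apply, this]

theorem germ_mem_maximalIdeal {x : X} {U : X.Opens} (hx : x ∈ U) (f : Γ(X, U)) :
    X.presheaf.germ U x hx f ∈ maximalIdeal (X.presheaf.stalk x) ↔ x ∉ X.basicOpen f := by
  rw [Scheme.mem_basicOpen _ _ _ hx, mem_maximalIdeal, mem_nonunits_iff]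

/-- The spectrum of the local ring embeds in X with image the generizations of x. -/
theorem exists_primeAt_eq (x : X) (P : Ideal (X.presheaf.stalk x)) [hP : P.IsPrime] :
    ∃ (η : X) (h : η ⤳ x), primeAt h = P := by
  let p : Spec (X.presheaf.stalk x) := ⟨P, hP⟩
  have h : X.fromSpecStalk x p ⤳ x := by
    have : X.fromSpecStalk x p ∈ Set.range (X.fromSpecStalk x) := ⟨p, rfl⟩
    rwa [Scheme.range_fromSpecStalk] at this
  refine ⟨X.fromSpecStalk x p, h, ?_⟩
  have h1 : X.fromSpecStalk x (Spec.map (X.presheaf.stalkSpecializes h) (closedPoint _)) =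
      X.fromSpecStalk x p := by
    refine (Scheme.Hom.comp_apply _ _ _).symm.trans ?_
    rw [Scheme.SpecMap_stalkSpecializes_fromSpecStalk]
    exact Scheme.fromSpecStalk_closedPoint
  have h2 := (X.fromSpecStalk x).isEmbedding.injective h1
  exact congrArg PrimeSpectrum.asIdeal h2

theorem comap_primeAt (f : X ⟶ Y) {η x : X} (h : η ⤳ x) :
    (primeAt h).comap (f.stalkMap x).hom = primeAt (h.map f.continuous) := by
  rw [primeAt, primeAt, Ideal.comap_comap, ← CommRingCat.hom_comp,
    ← Scheme.Hom.stalkSpecializes_stalkMap f _ _ h, CommRingCat.hom_comp, ← Ideal.comap_comap]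
  congr 1
  exact ((local_hom_TFAE (f.stalkMap η).hom).out 0 4 rfl rfl).1 inferInstance

end Points

/-! ### Ideals of functions vanishing on a set of points. -/

section IdealAt

variable {X Y : Scheme.{u}}

theorem exists_restrict {U V : X.Opens} (h : V ≤ U) (f : Γ(X, U)) :
    ∃ f' : Γ(X, V), ∀ (x : X) (hx : x ∈ V),
      X.presheaf.germ V x hx f' = X.presheaf.germ U x (h hx) f :=
  ⟨X.presheaf.map (homOfLE h).op f, fun x hx => X.presheaf.germ_res_apply (homOfLE h) x hx f⟩

/-- The generators already form an ideal, after passing to a common neighbourhood. -/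
theorem mem_idealAt {Y : Set X} {b : X} {g : X.presheaf.stalk b} : g ∈ idealAt Y b ↔
    ∃ (U : X.Opens) (hb : b ∈ U) (f : Γ(X, U)), X.presheaf.germ U b hb f = g ∧
      ∀ y ∈ Y, y ∈ U → y ∉ X.basicOpen f := by
  constructor
  · intro hg
    induction hg using Submodule.span_induction with
    | mem x h => exact h
    | zero => exact ⟨⊤, trivial, 0, by simp, fun y _ _ => by simp⟩
    | add x y _ _ hx hy =>
      obtain ⟨U, hU, f, rfl, hf⟩ := hx
      obtain ⟨V, hV, f', rfl, hf'⟩ := hy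
      obtain ⟨r, hr⟩ := exists_restrict (inf_le_left : U ⊓ V ≤ U) f
      obtain ⟨r', hr'⟩ := exists_restrict (inf_le_right : U ⊓ V ≤ V) f'
      have hUV : b ∈ U ⊓ V := ⟨hU, hV⟩
      refine ⟨U ⊓ V, hUV, r + r', ?_, fun y hy hyU h => ?_⟩
      · rw [map_add, hr, hr']
      · rw [Scheme.mem_basicOpen _ _ _ hyU, map_add, hr, hr'] at h
        have h1 := (germ_mem_maximalIdeal hyU.1 f).2 (hf y hy hyU.1)
        have h2 := (germ_mem_maximalIdeal hyU.2 f').2 (hf' y hy hyU.2)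
        exact Ideal.add_mem _ h1 h2 h
    | smul a x _ hx =>
      obtain ⟨U, hU, f, rfl, hf⟩ := hx
      obtain ⟨V, hV, f', rfl⟩ := X.presheaf.exists_germ_eq a
      obtain ⟨r', hr'⟩ := exists_restrict (inf_le_left : V ⊓ U ≤ V) f'
      obtain ⟨r, hr⟩ := exists_restrict (inf_le_right : V ⊓ U ≤ U) f
      have hUV : b ∈ V ⊓ U := ⟨hV, hU⟩
      refine ⟨V ⊓ U, hUV, r' * r, ?_, fun y hy hyU h => ?_⟩
      · rw [map_mul, hr, hr']
        rfl
      · rw [Scheme.mem_basicOpen _ _ _ hyU, map_mul, hr, hr'] at h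
        exact (germ_mem_maximalIdeal hyU.2 f).2 (hf y hy hyU.2) (isUnit_of_mul_isUnit_right h)
  · exact fun h => Ideal.subset_span h

theorem isRadical_idealAt (Y : Set X) (b : X) : (idealAt Y b).IsRadical := by
  rintro g ⟨n, hn⟩
  obtain ⟨U, hU, f, rfl⟩ := X.presheaf.exists_germ_eq g
  obtain ⟨V, hV, f', hf', h⟩ := mem_idealAt.1 hn
  rw [← map_pow] at hf'
  obtain ⟨W, hW, i, j, hij⟩ := X.presheaf.germ_eq b hV hU _ _ hf'
  obtain ⟨r, hr⟩ := exists_restrict j.le f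
  rw [mem_idealAt]
  refine ⟨W, hW, r, hr _ _, fun y hy hyW hyb => ?_⟩
  refine h y hy (i.le hyW) ?_
  rw [Scheme.mem_basicOpen _ _ _ hyW, hr] at hyb
  have h1 := congrArg (X.presheaf.germ W y hyW) hij
  have h2 := X.presheaf.germ_res_apply i y hyW f'
  have h3 := X.presheaf.germ_res_apply j y hyW (f ^ n)
  rw [Scheme.mem_basicOpen _ _ _ (i.le hyW)]
  refine (h2.symm.trans (h1.trans (h3.trans (map_pow _ _ _)))) ▸ hyb.pow n

theorem idealAt_anti {Y Z : Set X} (h : Y ⊆ Z) (b : X) : idealAt Z b ≤ idealAt Y b := by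
  intro g hg
  obtain ⟨U, hU, f, hf, hv⟩ := mem_idealAt.1 hg
  exact mem_idealAt.2 ⟨U, hU, f, hf, fun y hy => hv y (h hy)⟩

theorem idealAt_le_maximalIdeal {Y : Set X} {b : X} (h : b ∈ Y) :
    idealAt Y b ≤ maximalIdeal (X.presheaf.stalk b) := by
  intro g hg
  obtain ⟨U, hU, f, rfl, hv⟩ := mem_idealAt.1 hg
  exact (germ_mem_maximalIdeal hU f).2 (hv b h hU)

theorem idealAt_le_primeAt {Y : Set X} {η b : X} (h : η ⤳ b) (hη : η ∈ Y) :
    idealAt Y b ≤ primeAt h := by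
  intro g hg
  obtain ⟨U, hU, f, rfl, hv⟩ := mem_idealAt.1 hg
  exact (germ_mem_primeAt h hU f).2 (hv η hη (h.mem_open U.2 hU))

/-- Otherwise some section on an affine neighbourhood vanishes on Y but not at η, and its germ is in
the ideal but not in the prime. -/
theorem mem_closure_of_idealAt_le {Y : Set X} {η b : X} (h : η ⤳ b)
    (hle : idealAt Y b ≤ primeAt h) : η ∈ closure Y := by
  by_contra hη
  obtain ⟨_, ⟨V, hV, rfl⟩, hbV, -⟩ :=
    X.isBasis_affineOpens.exists_subset_of_mem_open (Set.mem_univ b) isOpen_univ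
  have hηV : η ∈ V := h.mem_open V.2 hbV
  obtain ⟨f, hf, hfη⟩ := IsAffineOpen.exists_basicOpen_le (V := ⟨(closure Y)ᶜ, isClosed_closure.isOpen_compl⟩)
    hV ⟨η, hη⟩ hηV
  refine (germ_mem_primeAt h hbV f).1 (hle (mem_idealAt.2 ⟨V, hbV, f, rfl, fun y hy hyV hyf => ?_⟩)) hfη
  exact hf hyf (subset_closure hy)

theorem idealAt_eq_top {Y : Set X} {b : X} (h : b ∉ closure Y) : idealAt Y b = ⊤ := by
  rw [Ideal.eq_top_iff_one]
  refine mem_idealAt.2 ⟨⟨(closure Y)ᶜ, isClosed_closure.isOpen_compl⟩, h, 1, map_one _,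
    fun y hy hyU => ?_⟩
  exact absurd (subset_closure hy) hyU

/-- The ideal of a set does not change when a set away from the point is removed. -/
theorem idealAt_diff {Y Z : Set X} {b : X} (hb : b ∉ closure Z) : idealAt (Y \ Z) b = idealAt Y b := by
  refine le_antisymm (fun g hg => ?_) (idealAt_anti Set.sdiff_subset b)
  obtain ⟨U, hU, f, rfl, hv⟩ := mem_idealAt.1 hg
  let V : X.Opens := U ⊓ ⟨(closure Z)ᶜ, isClosed_closure.isOpen_compl⟩
  obtain ⟨r, hr⟩ := exists_restrict (inf_le_left : V ≤ U) f
  refine mem_idealAt.2 ⟨V, ⟨hU, hb⟩, r, hr _ _, fun y hy hyV h => ?_⟩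
  rw [Scheme.mem_basicOpen _ _ _ hyV, hr] at h
  exact hv y ⟨hy, fun hz => hyV.2 (subset_closure hz)⟩ hyV.1 ((Scheme.mem_basicOpen _ _ _ hyV.1).2 h)

end IdealAt

/-! ### Local rings of étale neighbourhoods. -/

section Etale

variable {X : Scheme.{u}} {a : X} (W : EtaleNhd X a)

instance isLocalHom_germMap : IsLocalHom W.germMap.hom := by
  -- Substituting π pt for a turns the comparison of stalks in `germMap` into the identity.
  obtain ⟨U, π, hπ, pt, rfl⟩ := W
  simp only [EtaleNhd.germMap, TopCat.Presheaf.stalkSpecializes_refl, Category.id_comp]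
  infer_instance

theorem flat_germMap : W.germMap.hom.Flat := by
  obtain ⟨U, π, hπ, pt, rfl⟩ := W
  simp only [EtaleNhd.germMap, TopCat.Presheaf.stalkSpecializes_refl, Category.id_comp]
  exact Flat.stalkMap π pt

theorem formallyUnramified_germMap : W.germMap.hom.FormallyUnramified := by
  obtain ⟨U, π, hπ, pt, rfl⟩ := W
  simp only [EtaleNhd.germMap, TopCat.Presheaf.stalkSpecializes_refl, Category.id_comp]
  exact FormallyUnramified.stalkMap π pt

theorem essFiniteType_germMap : W.germMap.hom.EssFiniteType := by
  obtain ⟨U, π, hπ, pt, rfl⟩ := W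
  simp only [EtaleNhd.germMap, TopCat.Presheaf.stalkSpecializes_refl, Category.id_comp]
  exact LocallyOfFiniteType.stalkMap π pt

/-- On an étale neighbourhood, the ideal of the preimage of a closed set is the radical of the
ideal generated by the ideal of the set. -/
theorem idealAt_preimage {E : Set X} (hE : IsClosed E) :
    idealAt (W.π ⁻¹' E) W.pt = ((idealAt E a).map W.germMap.hom).radical := by
  obtain ⟨U, π, hπ, pt, rfl⟩ := W
  simp only [EtaleNhd.germMap, TopCat.Presheaf.stalkSpecializes_refl, Category.id_comp]
  refine le_antisymm ?_ ((isRadical_idealAt _ _).radical_le_iff.2 ?_)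
  · rw [Ideal.radical_eq_sInf]
    -- A prime over the extended ideal is a generization η of the point; its image lies in the
    -- closure of E, which is E.
    refine le_sInf fun P ⟨hP, hPp⟩ => ?_
    obtain ⟨η, h, rfl⟩ := exists_primeAt_eq pt P
    refine idealAt_le_primeAt h ?_
    have h1 := Ideal.map_le_iff_le_comap.1 hP
    rw [comap_primeAt] at h1
    have := mem_closure_of_idealAt_le _ h1
    rwa [hE.closure_eq] at this
  · rw [Ideal.map_le_iff_le_comap]
    intro g hg
    obtain ⟨V, hV, f, rfl, hv⟩ := mem_idealAt.1 hg
    rw [Ideal.mem_comap]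
    refine mem_idealAt.2 ⟨π ⁻¹ᵁ V, hV, π.app V f, (π.germ_stalkMap_apply V pt hV f).symm, fun y hy hyV h => ?_⟩
    rw [← Scheme.preimage_basicOpen] at h
    exact hv _ hy hyV h

end Etale

end Algebraic

namespace Algebraic

open IsLocalRing

universe u

/-! ### The base field inside local rings. -/

section StructureMap

variable {k : Type u} [Field k] {X X₀ : Scheme.{u}}

/-- The structure map of the local rings of a scheme over `k`. -/
def structMap (f : X ⟶ Spec (.of k)) (a : X) : k →+* X.presheaf.stalk a :=
  ((Scheme.ΓSpecIso (.of k)).inv ≫ f.appTop ≫ X.presheaf.germ ⊤ a (TopologicalSpace.Opens.mem_top a)).hom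

theorem stalkMap_comp_structMap (f : X ⟶ Spec (.of k)) {Y : Scheme.{u}} (π : Y ⟶ X) (y : Y) :
    (π.stalkMap y).hom.comp (structMap f (π y)) = structMap (π ≫ f) y := by
  rw [structMap, structMap, ← CommRingCat.hom_comp]
  congr 1
  simp only [Category.assoc, Scheme.Hom.comp_appTop]
  rw [Scheme.Hom.germ_stalkMap]
  rfl

theorem stalkSpecializes_comp_structMap (f : X ⟶ Spec (.of k)) {x y : X} (h : x ⤳ y) :
    (X.presheaf.stalkSpecializes h).hom.comp (structMap f y) = structMap f x := by
  rw [structMap, structMap, ← CommRingCat.hom_comp]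
  congr 1
  simp only [Category.assoc, TopCat.Presheaf.germ_stalkSpecializes]

theorem bijective_structMap_id (x : Spec (.of k)) :
    Function.Bijective (structMap (𝟙 (Spec (.of k))) x) := by
  refine ⟨RingHom.injective (structMap (𝟙 (Spec (.of k))) x : k →+* _), fun s => ?_⟩
  obtain ⟨U, hU, t, rfl⟩ := (Spec (.of k)).presheaf.exists_germ_eq s
  have hsub : Subsingleton (Spec (.of k)) := inferInstanceAs (Subsingleton (PrimeSpectrum k))
  obtain rfl : U = ⊤ := top_unique fun y _ => (Subsingleton.elim x y) ▸ hU
  refine ⟨(Scheme.ΓSpecIso (.of k)).hom t, ?_⟩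
  simp [structMap]

theorem structMap_eq_comp (f : X ⟶ Spec (.of k)) (a : X) :
    structMap f a = (f.stalkMap a).hom.comp (structMap (𝟙 _) (f a)) := by
  rw [stalkMap_comp_structMap, Category.comp_id]

theorem formallySmooth_structMap (f : X ⟶ Spec (.of k)) [Smooth f] (a : X) :
    (structMap f a).FormallySmooth := by
  rw [structMap_eq_comp]
  refine RingHom.FormallySmooth.comp (.of_bijective (bijective_structMap_id _)) ?_
  have : a ∈ f.smoothLocus := by rw [f.smoothLocus_eq_top]; trivial
  exact Scheme.Hom.mem_smoothLocus.1 this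

theorem essFiniteType_structMap (f : X ⟶ Spec (.of k)) [LocallyOfFiniteType f] (a : X) :
    (structMap f a).EssFiniteType := by
  rw [structMap_eq_comp]
  exact RingHom.EssFiniteType.comp ((RingHom.FiniteType.of_surjective _
    (bijective_structMap_id _).2).essFiniteType) (LocallyOfFiniteType.stalkMap f a)

theorem isNoetherianRing_stalk (f : X ⟶ Spec (.of k)) [LocallyOfFiniteType f] (a : X) :
    IsNoetherianRing (X.presheaf.stalk a) := by
  let := (structMap f a).toAlgebra
  have : Algebra.EssFiniteType k (X.presheaf.stalk a) := essFiniteType_structMap f a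
  exact Algebra.EssFiniteType.isNoetherianRing k _

theorem SpecMap_structMap (f : X ⟶ Spec (.of k)) (a : X) :
    Spec.map (CommRingCat.ofHom (structMap f a)) = X.fromSpecStalk a ≫ f := by
  rw [structMap, CommRingCat.ofHom_hom, Spec.map_comp, Spec.map_comp,
    ← Scheme.fromSpecStalk_toSpecΓ]
  simp only [Category.assoc]
  rw [← Scheme.toSpecΓ_naturality_assoc]
  simp

/-- Nullstellensatz: the residue field at a closed point is k. -/
theorem exists_sub_structMap_mem [IsAlgClosed k] (f : X ⟶ Spec (.of k)) [LocallyOfFiniteType f]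
    {a : X} (ha : IsClosed {a}) (s : X.presheaf.stalk a) :
    ∃ c : k, s - structMap f a c ∈ maximalIdeal (X.presheaf.stalk a) := by
  let e := (residueFieldIsoBase f a ha).commRingCatIsoToRingEquiv
  refine ⟨e (X.residue a s), ?_⟩
  have h1 : (residueFieldIsoBase f a ha).inv = CommRingCat.ofHom (structMap f a) ≫ X.residue a := by
    apply Spec.map_injective
    rw [SpecMap_residueFieldIsoBase_inv, Scheme.fromSpecResidueField, Spec.map_comp, Category.assoc,
      SpecMap_structMap]
  rw [← residue_eq_zero_iff, map_sub, sub_eq_zero]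
  have h2 : (residueFieldIsoBase f a ha).inv (e (X.residue a s)) = X.residue a s :=
    (residueFieldIsoBase f a ha).hom_inv_id_apply _
  rw [h1] at h2
  exact h2.symm

end StructureMap

/-! ### The base field and étale neighbourhoods. -/

section EtaleNhd

variable {k : Type u} [Field k] {X : Scheme.{u}}

theorem germMap_comp_structMap (f : X ⟶ Spec (.of k)) {a : X} (W : EtaleNhd X a) :
    W.germMap.hom.comp (structMap f a) = structMap (W.π ≫ f) W.pt := by
  obtain ⟨U, π, hπ, pt, rfl⟩ := W
  simp only [EtaleNhd.germMap, TopCat.Presheaf.stalkSpecializes_refl, Category.id_comp]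
  exact stalkMap_comp_structMap f π pt

theorem isNoetherianRing_etaleNhd (f : X ⟶ Spec (.of k)) [LocallyOfFiniteType f] {a : X}
    (W : EtaleNhd X a) : IsNoetherianRing W.ring :=
  have := W.etale
  isNoetherianRing_stalk (W.π ≫ f) W.pt

/-- The residue field extension is integral over an algebraically closed field, hence trivial. -/
theorem exists_sub_structMap_etaleNhd_mem [IsAlgClosed k] (f : X ⟶ Spec (.of k))
    [LocallyOfFiniteType f] {a : X} (ha : IsClosed {a}) (W : EtaleNhd X a) (s : W.ring) :
    ∃ c : k, s - structMap (W.π ≫ f) W.pt c ∈ maximalIdeal W.ring := by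
  let := W.germMap.hom.toAlgebra
  have : IsLocalHom (algebraMap (X.presheaf.stalk a) W.ring) := isLocalHom_germMap W
  have : Algebra.FormallyUnramified (X.presheaf.stalk a) W.ring := formallyUnramified_germMap W
  have : Algebra.EssFiniteType (X.presheaf.stalk a) W.ring := essFiniteType_germMap W
  have := isNoetherianRing_stalk f a
  let e := (residueFieldIsoBase f a ha).commRingCatIsoToRingEquiv
  have : IsAlgClosed (ResidueField (X.presheaf.stalk a)) := IsAlgClosed.of_ringEquiv _ _ e.symm
  have hsurj := IsAlgClosed.algebraMap_bijective_of_isIntegral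
    (k := ResidueField (X.presheaf.stalk a)) (K := ResidueField W.ring)
  obtain ⟨t, ht⟩ := hsurj.2 (residue W.ring s)
  obtain ⟨r, rfl⟩ := residue_surjective t
  obtain ⟨c, hc⟩ := exists_sub_structMap_mem f ha r
  refine ⟨c, ?_⟩
  rw [← germMap_comp_structMap]
  have h1 : s - W.germMap r ∈ maximalIdeal W.ring := by
    rw [← residue_eq_zero_iff, map_sub, sub_eq_zero]
    exact ht.symm
  have h2 : W.germMap (r - structMap f a c) ∈ maximalIdeal W.ring :=
    (map_mem_maximalIdeal_iff W.germMap.hom).2 hc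
  rw [map_sub] at h2
  simpa using Ideal.add_mem _ h1 h2

end EtaleNhd

/-! ### Local rings of the ambient variety. -/

section LocalEmbedding

variable {k : Type u} [Field k] {X₀ : Scheme.{u}} {f₀ : X₀ ⟶ Spec (.of k)} {b : X₀}

theorem embedding_germMap_comp_structMap (ε : LocalEmbedding f₀ b) :
    ε.germMap.hom.comp (structMap ε.g ε.pt) = structMap f₀ b := by
  ext c
  have h1 := RingHom.congr_fun (stalkMap_comp_structMap ε.g ε.ι ⟨b, ε.mem⟩) c
  have h2 := RingHom.congr_fun (stalkMap_comp_structMap f₀ ε.V.ι ⟨b, ε.mem⟩) c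
  have h3 : structMap (ε.ι ≫ ε.g) ⟨b, ε.mem⟩ c = structMap (ε.V.ι ≫ f₀) ⟨b, ε.mem⟩ c := by
    rw [ε.comp_eq]
  have h4 := (ε.V.stalkIso ⟨b, ε.mem⟩).inv_hom_id_apply (structMap f₀ b c)
  have h5 := congrArg (ε.V.stalkIso ⟨b, ε.mem⟩).hom ((h1.trans h3).trans h2.symm)
  rw [Scheme.Opens.stalkIso_inv] at h4
  exact h5.trans h4

theorem surjective_embedding_germMap (ε : LocalEmbedding f₀ b) :
    Function.Surjective ε.germMap.hom := by
  have := ε.isImmersion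
  rw [LocalEmbedding.germMap, CommRingCat.hom_comp, RingHom.coe_comp]
  exact ((ε.V.stalkIso ⟨b, ε.mem⟩).commRingCatIsoToRingEquiv.surjective).comp
    (ε.ι.stalkMap_surjective ⟨b, ε.mem⟩)

end LocalEmbedding

/-! ### Coordinates at points of smooth schemes. -/

section SmoothPoint

theorem IsCoords.of_ringEquiv {A B ι : Type*} [Fintype ι] [CommRing A] [CommRing B] [IsLocalRing A]
    [IsLocalRing B] (e : A ≃+* B) {y : ι → A} (hy : IsCoords y) : IsCoords (fun i => e (y i)) := by
  refine ⟨?_, by rw [← ringKrullDim_eq_of_ringEquiv e, hy.2]⟩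
  have h1 : (maximalIdeal A).map (e : A →+* B) = maximalIdeal B := by
    have hloc : IsLocalHom (e : A →+* B) := .of_surjective _ e.surjective
    rw [← ((local_hom_TFAE (e : A →+* B)).out 0 4 rfl rfl).1 hloc,
      Ideal.map_comap_of_surjective (e : A →+* B) e.surjective]
  rw [← h1, ← hy.1, Ideal.map_span, ← Set.range_comp]
  rfl

theorem isRegularLocalRing_stalk_Spec (R : CommRingCat.{u}) [IsRegularRing R] (x : Spec R) :
    IsRegularLocalRing ((Spec R).presheaf.stalk x) := by
  let : Algebra R ((Spec R).presheaf.stalk x) := StructureSheaf.stalkAlgebra R x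
  have : x.asIdeal.IsPrime := x.isPrime
  have : IsLocalization.AtPrime (↑((Spec R).presheaf.stalk x)) x.asIdeal :=
    StructureSheaf.IsLocalization.to_stalk R x
  exact .of_ringEquiv (IsLocalization.algEquiv x.asIdeal.primeCompl (Localization.AtPrime x.asIdeal)
    ((Spec R).presheaf.stalk x)).toRingEquiv

variable {k : Type u} [Field k] {X : Scheme.{u}}

/-- The local rings of a smooth variety have coordinates. -/
theorem exists_isCoords (f : X ⟶ Spec (.of k)) [Smooth f] (a : X) :
    ∃ (n : ℕ) (y : Fin n → X.presheaf.stalk a), IsCoords y := by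
  obtain ⟨U, hU, V, hV, haV, e, hst⟩ := Smooth.exists_isStandardSmooth f a
  -- Locally X is étale over an affine space, whose local rings are regular; coordinates are pulled
  -- back from there.
  obtain ⟨n, g, -, hg⟩ := hst.exists_etale_mvPolynomial
  have hsub : Subsingleton (Spec (.of k)) := inferInstanceAs (Subsingleton (PrimeSpectrum k))
  obtain rfl : U = ⊤ := top_unique fun y _ => (Subsingleton.elim (f a) y) ▸ e haV
  have hreg : IsRegularRing k := inferInstance
  have hreg' : IsRegularRing Γ(Spec (.of k), ⊤) :=
    .of_ringEquiv (Scheme.ΓSpecIso (.of k)).symm.commRingCatIsoToRingEquiv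
  have hreg'' : IsRegularRing (MvPolynomial (Fin n) Γ(Spec (.of k), ⊤)) := inferInstance
  have hEt : Etale (hV.isoSpec.hom ≫ Spec.map (CommRingCat.ofHom g)) := by
    have : Etale (Spec.map (CommRingCat.ofHom g)) :=
      (HasRingHomProperty.Spec_iff (P := @Etale)).2 hg
    infer_instance
  let φ := hV.isoSpec.hom ≫ Spec.map (CommRingCat.ofHom g)
  let b := φ ⟨a, haV⟩
  have hb := isRegularLocalRing_stalk_Spec (.of (MvPolynomial (Fin n) Γ(Spec (.of k), ⊤))) b
  obtain ⟨w, hw⟩ := exists_isCoords_of_isRegularLocalRing hb.spanFinrank_maximalIdeal.symm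
  let W : EtaleNhd (Spec (.of (MvPolynomial (Fin n) Γ(Spec (.of k), ⊤)))) b :=
    ⟨V, φ, hEt, ⟨a, haV⟩, rfl⟩
  let := W.germMap.hom.toAlgebra
  have : IsLocalHom (algebraMap _ W.ring) := isLocalHom_germMap W
  have : Module.Flat _ W.ring := flat_germMap W
  have : Algebra.FormallyUnramified _ W.ring := formallyUnramified_germMap W
  have : Algebra.EssFiniteType _ W.ring := essFiniteType_germMap W
  have : IsNoetherianRing W.ring := isNoetherianRing_stalk (V.ι ≫ f) ⟨a, haV⟩
  let e' : W.ring ≃+* X.presheaf.stalk a :=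
    (V.stalkIso ⟨a, haV⟩).commRingCatIsoToRingEquiv
  exact ⟨_, _, (hw.map (S := W.ring)).of_ringEquiv e'⟩

end SmoothPoint

end Algebraic

namespace Algebraic

open IsLocalRing

universe u

theorem IsCoords.comp_equiv {A ι κ : Type*} [Fintype ι] [Fintype κ] [CommRing A] [IsLocalRing A]
    {y : ι → A} (hy : IsCoords y) (e : κ ≃ ι) : IsCoords (y ∘ e) := by
  refine ⟨?_, by rw [hy.2, Fintype.card_congr e]⟩
  rw [e.surjective.range_comp, hy.1]

/-- A coordinate of a regular local ring generates a prime ideal. -/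
theorem IsCoords.isPrime_span {A : Type*} [CommRing A] [IsLocalRing A] [IsNoetherianRing A]
    {s m : ℕ} {u : Fin s → A} {v : Fin m → A} (hy : IsCoords (Sum.elim u v)) (i : Fin s) :
    (Ideal.span {u i}).IsPrime := by
  obtain ⟨n, hn⟩ : ∃ n, s + m = n + 1 := ⟨s + m - 1, by have := i.pos; omega⟩
  let e : Fin (n + 1) ≃ Fin s ⊕ Fin m := (finCongr hn.symm).trans finSumFinEquiv.symm
  have hz := hy.comp_equiv e
  set z := Sum.elim u v ∘ e
  have hi : z (e.symm (.inl i)) = u i := by simp [z]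
  have h1 : Ideal.span (Set.range (z ∘ (e.symm (.inl i)).succAbove)) ⊔ Ideal.span {u i} =
      maximalIdeal A := by
    rw [← hz.1, ← Ideal.span_union, ← hi]
    congr 1
    ext x
    simp only [Set.mem_union, Set.mem_range, Function.comp_apply, Set.mem_singleton_iff]
    constructor
    · rintro (⟨j, rfl⟩ | rfl)
      · exact ⟨_, rfl⟩
      · exact ⟨_, rfl⟩
    · rintro ⟨j, rfl⟩
      by_cases hj : j = e.symm (.inl i)
      · exact .inr (by rw [hj])
      · obtain ⟨l, rfl⟩ := Fin.exists_succAbove_eq hj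
        exact .inl ⟨l, rfl⟩
  have hle : Ideal.span {u i} ≤ maximalIdeal A := h1 ▸ le_sup_right
  have := isLocalRing_quotient hle
  have h2 := isCoords_quotient h1 (by rw [hz.2, Fintype.card_fin])
  have := h2.isDomain
  exact (Ideal.Quotient.isDomain_iff_prime _).1 this

/-! ### Existence of algebraic local embeddings. -/

section Embedding

variable {k : Type u} [Field k] {X₀ : Scheme.{u}}

/-- An affine neighbourhood of finite type is closed in an affine space. This makes the set in the
definition of `logRank` nonempty. -/
theorem exists_localEmbedding (f₀ : X₀ ⟶ Spec (.of k)) [LocallyOfFiniteType f₀] (b : X₀) :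
    ∃ (ε : LocalEmbedding f₀ b) (N : ℕ) (z : Fin N → ε.ring), IsCoords z := by
  obtain ⟨_, ⟨V : X₀.Opens, hV, rfl⟩, hbV, -⟩ :=
    X₀.isBasis_affineOpens.exists_subset_of_mem_open (Set.mem_univ b) isOpen_univ
  have : IsAffine V := hV
  let h := V.ι ≫ f₀
  let φ := (Scheme.ΓSpecIso (.of k)).inv ≫ h.appTop
  have hφ : φ.hom.FiniteType := by
    have h1 : (h.appTop).hom.FiniteType :=
      (HasRingHomProperty.iff_of_isAffine (P := @LocallyOfFiniteType)).1 inferInstance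
    exact h1.comp (.of_surjective _ (Scheme.ΓSpecIso (.of k)).symm.commRingCatIsoToRingEquiv.surjective)
  algebraize [φ.hom]
  obtain ⟨n, ψ, hψ⟩ := Algebra.FiniteType.iff_quotient_mvPolynomial''.1 hφ
  have hMv : Algebra.Smooth k (MvPolynomial (Fin n) k) := ⟨inferInstance, inferInstance⟩
  have hsm : Smooth (Spec.map (CommRingCat.ofHom (algebraMap k (MvPolynomial (Fin n) k)))) :=
    (HasRingHomProperty.Spec_iff (P := @Smooth)).2
      (RingHom.smooth_algebraMap.2 hMv)
  let Ψ : CommRingCat.of (MvPolynomial (Fin n) k) ⟶ Γ(V.toScheme, ⊤) := CommRingCat.ofHom ψ.toRingHom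
  have hcl : IsClosedImmersion (Spec.map Ψ) := IsClosedImmersion.spec_of_surjective Ψ hψ
  have himm : IsImmersion (V.toScheme.isoSpec.hom ≫ Spec.map Ψ) := inferInstance
  let ε : LocalEmbedding f₀ b :=
    { V := V
      mem := hbV
      M₀ := Spec (.of (MvPolynomial (Fin n) k))
      g := Spec.map (CommRingCat.ofHom (algebraMap k (MvPolynomial (Fin n) k)))
      smooth := hsm
      ι := V.toScheme.isoSpec.hom ≫ Spec.map Ψ
      isImmersion := himm
      comp_eq := by
        have h2 : CommRingCat.ofHom (algebraMap k (MvPolynomial (Fin n) k)) ≫ Ψ = φ :=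
          CommRingCat.hom_ext ψ.comp_algebraMap
        rw [Category.assoc, ← Spec.map_comp, h2, Spec.map_comp, Scheme.isoSpec_hom,
          ← Scheme.toSpecΓ_naturality_assoc]
        simp [h] }
  have := ε.smooth
  obtain ⟨N, z, hz⟩ := exists_isCoords ε.g ε.pt
  exact ⟨ε, N, z, hz⟩

end Embedding

/-! ### Descent of adapted coordinates and of the logarithmic rank. -/

section LogRank

variable {k : Type u} [Field k] [IsAlgClosed k] {X X₀ : Scheme.{u}} {Q : Type*}
  {E : Q → Set X}

/-- The ideal of functions which vanish to second order along the intersection of the components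
through `a`. -/
def logIdeal (E : Q → Set X) (a : X) : Ideal (X.presheaf.stalk a) :=
  maximalIdeal (X.presheaf.stalk a) ^ 2 ⊔ ⨆ (q : Q) (_ : a ∈ E q), idealAt (E q) a

theorem logIdeal_eq {a : X} {s : ℕ} {c : Fin s → Q} (hc : Set.range c = {q | a ∈ E q})
    {g : Fin s → X.presheaf.stalk a} (hg : ∀ i, idealAt (E (c i)) a = Ideal.span {g i}) :
    logIdeal E a = maximalIdeal (X.presheaf.stalk a) ^ 2 ⊔ Ideal.span (Set.range g) := by
  rw [logIdeal]
  congr 1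
  refine le_antisymm (iSup₂_le fun q hq => ?_) (Ideal.span_le.2 ?_)
  · obtain ⟨i, rfl⟩ : q ∈ Set.range c := hc ▸ hq
    rw [hg, Ideal.span_singleton_le_iff_mem]
    exact Ideal.subset_span ⟨i, rfl⟩
  · rintro _ ⟨i, rfl⟩
    have hi : a ∈ E (c i) := (hc.subset ⟨i, rfl⟩ : c i ∈ {q | a ∈ E q})
    refine (le_iSup₂_of_le (c i) hi le_rfl : idealAt (E (c i)) a ≤ _) ?_
    rw [hg]
    exact Ideal.mem_span_singleton_self _

variable {a : X} {W : EtaleNhd X a} {s m : ℕ} {u : Fin s → W.ring} {v : Fin m → W.ring}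
  {c : Fin s → Q}

/-- The radical in `idealAt_preimage` is superfluous, since a prime extends to a radical ideal. -/
theorem map_idealAt_of_isPrime (f : X ⟶ Spec (.of k)) [LocallyOfFiniteType f] {F : Set X}
    (hF : IsClosed F) (hP : (idealAt F a).IsPrime) :
    idealAt (W.π ⁻¹' F) W.pt = (idealAt F a).map W.germMap.hom := by
  let := W.germMap.hom.toAlgebra
  have : Module.Flat (X.presheaf.stalk a) W.ring := flat_germMap W
  have : Algebra.FormallyUnramified (X.presheaf.stalk a) W.ring := formallyUnramified_germMap W
  have : Algebra.EssFiniteType (X.presheaf.stalk a) W.ring := essFiniteType_germMap W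
  rw [idealAt_preimage W hF]
  exact (isRadical_map_of_isPrime (S := W.ring) (idealAt F a)).radical

/-- The extended ideal has radical (u i), which is prime because u i is a coordinate. The ideal
downstairs is its contraction, hence prime, so the radical can be dropped. -/
theorem IsAdapted.map_idealAt (f : X ⟶ Spec (.of k)) [LocallyOfFiniteType f]
    (hE : ∀ q, IsClosed (E q)) (h : IsAdapted E W u v c) (i : Fin s) :
    (idealAt (E (c i)) a).map W.germMap.hom = Ideal.span {u i} := by
  let := W.germMap.hom.toAlgebra
  have : IsLocalHom (algebraMap (X.presheaf.stalk a) W.ring) := isLocalHom_germMap W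
  have : Module.Flat (X.presheaf.stalk a) W.ring := flat_germMap W
  have : Algebra.FormallyUnramified (X.presheaf.stalk a) W.ring := formallyUnramified_germMap W
  have : Algebra.EssFiniteType (X.presheaf.stalk a) W.ring := essFiniteType_germMap W
  have := isNoetherianRing_stalk f a
  have := isNoetherianRing_etaleNhd f W
  rw [← h.idealAt_comp i]
  refine (map_idealAt_of_isPrime f (hE _) ?_).symm
  have h1 := h.idealAt_comp i
  have h2 := h.isCoords.isPrime_span i
  rw [idealAt_preimage W (hE _)] at h1
  have h3 : (Ideal.span {u i}).comap (algebraMap (X.presheaf.stalk a) W.ring) =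
      idealAt (E (c i)) a := by
    rw [← h1]
    refine le_antisymm ?_ (Ideal.map_le_iff_le_comap.1 Ideal.le_radical)
    rintro x ⟨n, hn⟩
    rw [← map_pow] at hn
    refine isRadical_idealAt (E (c i)) a ⟨n, ?_⟩
    rw [← comap_map_eq (S := W.ring) (idealAt (E (c i)) a)]
    exact hn
  rw [← h3]
  exact Ideal.comap_isPrime _ _

/-- Coordinates adapted to a divisor, on an étale neighbourhood, give coordinates of the local ring
itself with the same property. -/
theorem IsAdapted.exists_coords (f : X ⟶ Spec (.of k)) [LocallyOfFiniteType f]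
    (ha : IsClosed {a}) (hE : ∀ q, IsClosed (E q)) (h : IsAdapted E W u v c) :
    ∃ (g : Fin s → X.presheaf.stalk a) (w : Fin m → X.presheaf.stalk a),
      IsCoords (Sum.elim g w) ∧ ∀ i, idealAt (E (c i)) a = Ideal.span {g i} := by
  have hm := fun i => h.map_idealAt f hE i
  have hκ : ∀ s : W.ring, ∃ r : X.presheaf.stalk a, s - W.germMap r ∈ maximalIdeal W.ring := by
    intro s
    obtain ⟨c, hc⟩ := exists_sub_structMap_etaleNhd_mem f ha W s
    refine ⟨structMap f a c, ?_⟩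
    rw [← germMap_comp_structMap] at hc
    exact hc
  let := W.germMap.hom.toAlgebra
  have : IsLocalHom (algebraMap (X.presheaf.stalk a) W.ring) := isLocalHom_germMap W
  have : Module.Flat (X.presheaf.stalk a) W.ring := flat_germMap W
  have : Algebra.FormallyUnramified (X.presheaf.stalk a) W.ring := formallyUnramified_germMap W
  have : Algebra.EssFiniteType (X.presheaf.stalk a) W.ring := essFiniteType_germMap W
  have := isNoetherianRing_stalk f a
  have := isNoetherianRing_etaleNhd f W
  choose g hg hgu using fun i => exists_span_singleton_eq (S := W.ring) (hm i)
  have := h.isCoords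
  have hdom : IsDomain W.ring := (this.comp_equiv (finSumFinEquiv.symm)).isDomain
  obtain ⟨w, hw⟩ := this.exists_descend (R := X.presheaf.stalk a) hκ (g := g) fun i =>
    Ideal.span_singleton_eq_span_singleton.1 (hgu i).symm
  exact ⟨g, w, hw, hg⟩

theorem IsAdapted.map_logIdeal (f : X ⟶ Spec (.of k)) [LocallyOfFiniteType f]
    (hE : ∀ q, IsClosed (E q)) (h : IsAdapted E W u v c) :
    (logIdeal E a).map W.germMap.hom =
      maximalIdeal W.ring ^ 2 ⊔ Ideal.span (Set.range u) := by
  have hm := fun i => h.map_idealAt f hE i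
  let := W.germMap.hom.toAlgebra
  have : IsLocalHom (algebraMap (X.presheaf.stalk a) W.ring) := isLocalHom_germMap W
  have : Algebra.FormallyUnramified (X.presheaf.stalk a) W.ring := formallyUnramified_germMap W
  have : Algebra.EssFiniteType (X.presheaf.stalk a) W.ring := essFiniteType_germMap W
  have hmax : (maximalIdeal (X.presheaf.stalk a)).map W.germMap.hom = maximalIdeal W.ring :=
    Algebra.FormallyUnramified.map_maximalIdeal
  rw [logIdeal, Ideal.map_sup, Ideal.map_pow, hmax]
  congr 1
  simp_rw [Ideal.map_iSup]
  refine le_antisymm (iSup₂_le fun q hq => ?_) (Ideal.span_le.2 ?_)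
  · obtain ⟨i, rfl⟩ : q ∈ Set.range c := h.range_eq ▸ hq
    rw [hm, Ideal.span_singleton_le_iff_mem]
    exact Ideal.subset_span ⟨i, rfl⟩
  · rintro _ ⟨i, rfl⟩
    have hi : a ∈ E (c i) := (h.range_eq.subset ⟨i, rfl⟩ : c i ∈ {q | a ∈ E q})
    refine (le_iSup₂_of_le (c i) hi le_rfl : (idealAt (E (c i)) a).map W.germMap.hom ≤ _) ?_
    rw [hm]
    exact Ideal.mem_span_singleton_self _

variable {f₀ : X₀ ⟶ Spec (.of k)} [LocallyOfFinitePresentation f₀] {σ : X ⟶ X₀}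

/-- The logarithmic rank, without coordinates. -/
theorem IsResolution.le_logRank_iff (hσ : IsResolution f₀ E σ) (ha : IsClosed {a}) (e : ℕ) :
    e ≤ logRank f₀ E σ a ↔
      RankGE (structMap (σ ≫ f₀) a) (σ.stalkMap a).hom (logIdeal E a) e := by
  have hsm := hσ.smooth
  have key : ∀ r ∈ {r | ∃ (W : EtaleNhd X a) (s m : ℕ) (u : Fin s → W.ring) (v : Fin m → W.ring)
      (c : Fin s → Q) (δ : Fin s ⊕ Fin m → W.ring → W.ring),
      IsAdapted E W u v c ∧ IsPartials (W.π ≫ σ ≫ f₀) W.pt (Sum.elim u v) δ ∧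
      ∃ (ε : LocalEmbedding f₀ (σ a)) (N : ℕ) (z : Fin N → ε.ring), IsCoords z ∧
        r = (Matrix.of fun (j : Fin N) (i : Fin s ⊕ Fin m) => IsLocalRing.residue W.ring
          (Sum.elim u (fun _ => 1) i * δ i (W.germMap (component σ a ε (z j))))).rank},
      (e ≤ r ↔ RankGE (structMap (σ ≫ f₀) a) (σ.stalkMap a).hom (logIdeal E a) e) := by
    rintro r ⟨W, s, m, u, v, c, δ, hA, hδ, ε, N, z, hz, rfl⟩
    let i1 := stalkAlgebra (W.π ≫ σ ≫ f₀) W.pt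
    obtain ⟨D, hD, hDx⟩ := hδ
    have h1 : ∀ i j, D i (Sum.elim u v j) = if j = i then 1 else 0 := by
      intro i j
      split_ifs with h
      · rw [h]; exact (hDx i).1
      · exact (hDx i).2 j h
    have hk := exists_sub_structMap_etaleNhd_mem (σ ≫ f₀) ha W
    let φ : ε.ring →+* W.ring := W.germMap.hom.comp ((σ.stalkMap a).hom.comp ε.germMap.hom)
    have hloc1 : IsLocalHom ε.germMap.hom := .of_surjective _ (surjective_embedding_germMap ε)
    have hφ : IsLocalHom φ := inferInstance
    have h2 := le_rank_iff hk hA.isCoords h1 φ hz.1 e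
    simp_rw [hD]
    refine h2.trans ?_
    have h3 : algebraMap k W.ring = W.germMap.hom.comp (structMap (σ ≫ f₀) a) :=
      (germMap_comp_structMap (σ ≫ f₀) W).symm
    -- Passage from the étale neighbourhood down to a, and from the ambient variety down to X₀.
    rw [h3, ← hA.map_logIdeal (σ ≫ f₀) hσ.isSNC.isClosed, RankGE.comp_comap,
      RankGE.comp_surjective _ (surjective_embedding_germMap ε)]
    let := W.germMap.hom.toAlgebra
    have : IsLocalHom (algebraMap (X.presheaf.stalk a) W.ring) := isLocalHom_germMap W
    have : Module.Flat (X.presheaf.stalk a) W.ring := flat_germMap W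
    have : Algebra.FormallyUnramified (X.presheaf.stalk a) W.ring := formallyUnramified_germMap W
    have : Algebra.EssFiniteType (X.presheaf.stalk a) W.ring := essFiniteType_germMap W
    have := isNoetherianRing_stalk (σ ≫ f₀) a
    exact comap_map_eq (S := W.ring) (logIdeal E a)
  -- The set is nonempty, so `sInf` is one of its members and not the default value 0.
  refine key _ (Nat.sInf_mem ?_)
  obtain ⟨W, s, m, u, v, c, hA⟩ := hσ.isSNC.exists_adapted a ha
  obtain ⟨ε, N, z, hz⟩ := exists_localEmbedding f₀ (σ a)
  let i1 := stalkAlgebra (W.π ≫ σ ≫ f₀) W.pt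
  have := W.etale
  have : Algebra.FormallySmooth k W.ring := formallySmooth_structMap (W.π ≫ σ ≫ f₀) W.pt
  have : Algebra.EssFiniteType k W.ring := essFiniteType_structMap (W.π ≫ σ ≫ f₀) W.pt
  have := isNoetherianRing_etaleNhd (σ ≫ f₀) W
  obtain ⟨D, hD, -⟩ := IsCoords.exists_derivation.{u, u, 0, 0}
    (exists_sub_structMap_etaleNhd_mem (σ ≫ f₀) ha W) hA.isCoords
  refine ⟨_, W, s, m, u, v, c, fun i => D i, hA, ⟨D, fun _ _ => rfl, fun i => ⟨?_, fun j hj => ?_⟩⟩,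
    ε, N, z, hz, rfl⟩
  · rw [hD, if_pos rfl]
  · rw [hD, if_neg hj]

end LogRank

end Algebraic

namespace Algebraic

open IsLocalRing

universe u

/-! ### Upper bounds for the rank. -/

section RankGE

variable {k A B : Type*} [Field k] [CommRing A] [CommRing B] [IsLocalRing B]

/-- The rank is at most the number of generators of the maximal ideal, modulo functions which do not
contribute. -/
theorem RankGE.le {χ : k →+* A} {φ : B →+* A} {K : Ideal A} {e : ℕ} (h : RankGE χ φ K e)
    {χB : k →+* B} (hχ : φ.comp χB = χ) (hB : ∀ b, ∃ c, b - χB c ∈ maximalIdeal B) {N : ℕ}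
    {z : Fin N → B} (hz : ∀ j, z j ∈ maximalIdeal B) {J : Ideal B}
    (hJ : maximalIdeal B ≤ J ⊔ Ideal.span (Set.range z)) (hJK : J.map φ ≤ K)
    (h2 : (maximalIdeal B ^ 2).map φ ≤ K) : e ≤ N := by
  obtain ⟨F, hF, hK⟩ := h
  -- Modulo J and m², each F i is a combination of the z j with constant coefficients; the
  -- coefficient vectors must be independent in k^N.
  have key : ∀ i, ∃ c : Fin N → k, F i - ∑ j, χB (c j) * z j ∈ J ⊔ maximalIdeal B ^ 2 := by
    intro i
    obtain ⟨x, hx, y, hy, hxy⟩ := Submodule.mem_sup.1 (hJ (hF i))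
    obtain ⟨a, rfl⟩ := Ideal.mem_span_range_iff_exists_fun.1 hy
    choose c hc using fun j => hB (a j)
    refine ⟨c, ?_⟩
    have : F i - ∑ j, χB (c j) * z j = x + ∑ j, (a j - χB (c j)) * z j := by
      rw [← hxy]
      simp only [sub_mul, Finset.sum_sub_distrib]
      ring
    rw [this]
    refine Ideal.add_mem _ (Ideal.mem_sup_left hx) (Ideal.mem_sup_right ?_)
    rw [pow_two]
    exact Ideal.sum_mem _ fun j _ => Ideal.mul_mem_mul (hc j) (hz j)
  choose c hc using key
  have hli : LinearIndependent k c := by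
    rw [Fintype.linearIndependent_iff]
    intro d hd
    refine fun i => congrFun (hK d ?_) i
    have h1 : ∑ i, χB (d i) * (F i - ∑ j, χB (c i j) * z j) ∈ J ⊔ maximalIdeal B ^ 2 :=
      Ideal.sum_mem _ fun i _ => Ideal.mul_mem_left _ _ (hc i)
    have h3 : ∑ i, χB (d i) * (F i - ∑ j, χB (c i j) * z j) = ∑ i, χB (d i) * F i := by
      simp only [mul_sub, Finset.sum_sub_distrib]
      rw [sub_eq_self]
      simp only [Finset.mul_sum]
      rw [Finset.sum_comm]
      refine Finset.sum_eq_zero fun j _ => ?_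
      have := congrFun hd j
      simp only [Finset.sum_apply, Pi.smul_apply, smul_eq_mul, Pi.zero_apply] at this
      simp only [← mul_assoc, ← Finset.sum_mul, ← map_mul, ← map_sum]
      rw [this, map_zero, zero_mul]
    rw [h3] at h1
    have h4 := Ideal.mem_map_of_mem φ h1
    rw [Ideal.map_sup, map_sum] at h4
    refine (sup_le hJK h2) ?_
    simpa [← hχ] using h4
  simpa using hli.fintype_card_le_finrank

/-- The rank is at most the number of coordinates. -/
theorem RankGE.le_card [IsLocalRing A] {χ : k →+* A} {φ : B →+* A} [IsLocalHom φ] {K : Ideal A}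
    {e : ℕ} (h : RankGE χ φ K e) (hA : ∀ b, ∃ c, b - χ c ∈ maximalIdeal A) {n : ℕ}
    {y : Fin n → A} (hy : IsCoords y) (hK : maximalIdeal A ^ 2 ≤ K) : e ≤ n := by
  have h1 : RankGE χ (RingHom.id A) K e := by
    obtain ⟨F, hF, h⟩ := h
    exact ⟨fun i => φ (F i), fun i => (map_mem_maximalIdeal_iff φ).2 (hF i), h⟩
  refine h1.le (χB := χ) (RingHom.id_comp χ) hA (z := y) hy.mem (J := ⊥) ?_ (by simp) (by simpa)
  rw [hy.1]
  exact le_sup_right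

end RankGE

/-! ### Finiteness of the maximal logarithmic rank. -/

section Bounded

variable {k : Type u} [Field k] {X X₀ : Scheme.{u}}

/-- The structure map of the ring of sections over an open subset of a scheme over `k`. -/
def structSection (f : X ⟶ Spec (.of k)) (V : X.Opens) : k →+* Γ(X, V) :=
  ((Scheme.ΓSpecIso (.of k)).inv ≫ f.appLE ⊤ V le_top).hom

theorem germ_comp_structSection (f : X ⟶ Spec (.of k)) {V : X.Opens} {x : X} (hx : x ∈ V) :
    (X.presheaf.germ V x hx).hom.comp (structSection f V) = structMap f x := by
  have : ((Scheme.ΓSpecIso (.of k)).inv ≫ f.appLE ⊤ V le_top) ≫ X.presheaf.germ V x hx =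
      (Scheme.ΓSpecIso (.of k)).inv ≫ f.appTop ≫ X.presheaf.germ ⊤ x trivial := by
    rw [Category.assoc, ← TopCat.Presheaf.germ_res X.presheaf (homOfLE le_top) x hx,
      ← Category.assoc f.appTop]
    rfl
  exact congrArg CommRingCat.Hom.hom this

theorem finiteType_structSection (f : X ⟶ Spec (.of k)) [LocallyOfFiniteType f] {V : X.Opens}
    (hV : IsAffineOpen V) : (structSection f V).FiniteType := by
  have h1 : (f.appLE ⊤ V le_top).hom.FiniteType :=
    LocallyOfFiniteType.finiteType_appLE (f := f) (isAffineOpen_top _) hV _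
  exact h1.comp (RingHom.FiniteType.of_surjective (Scheme.ΓSpecIso (.of k)).inv.hom
    (Scheme.ΓSpecIso (.of k)).symm.commRingCatIsoToRingEquiv.surjective)

/-- The number of generators of a finitely generated algebra bounds the dimension of its
localizations, and finitely many affine pieces suffice. -/
theorem exists_ringKrullDim_stalk_le (f : X ⟶ Spec (.of k)) [LocallyOfFiniteType f]
    [CompactSpace X] : ∃ M : ℕ, ∀ x : X, ringKrullDim (X.presheaf.stalk x) ≤ M := by
  suffices h : ∃ M : ℕ, ∀ x ∈ (Set.univ : Set X), ringKrullDim (X.presheaf.stalk x) ≤ M by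
    simpa using h
  refine isCompact_univ.induction_on (p := fun s => ∃ M : ℕ, ∀ x ∈ s,
    ringKrullDim (X.presheaf.stalk x) ≤ M) ⟨0, by simp⟩ ?_ ?_ ?_
  · rintro s t hst ⟨M, hM⟩
    exact ⟨M, fun x hx => hM x (hst hx)⟩
  · rintro s t ⟨M, hM⟩ ⟨N, hN⟩
    refine ⟨max M N, fun x hx => ?_⟩
    rcases hx with hx | hx
    · exact (hM x hx).trans (by exact_mod_cast le_max_left M N)
    · exact (hN x hx).trans (by exact_mod_cast le_max_right M N)
  · intro b _
    obtain ⟨_, ⟨V : X.Opens, hV, rfl⟩, hbV, -⟩ :=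
      X.isBasis_affineOpens.exists_subset_of_mem_open (Set.mem_univ b) isOpen_univ
    have : IsAffine V := hV
    have hφ := finiteType_structSection f hV
    algebraize [structSection f V]
    obtain ⟨n, ψ, hψ⟩ := Algebra.FiniteType.iff_quotient_mvPolynomial''.1 hφ
    have h3 := ringKrullDim_le_of_surjective ψ.toRingHom hψ
    rw [MvPolynomial.ringKrullDim_of_isNoetherianRing, ringKrullDim_eq_zero_of_field, zero_add] at h3
    simp only [Nat.card_eq_fintype_card, Fintype.card_fin] at h3
    refine ⟨V, mem_nhdsWithin_of_mem_nhds (V.isOpen.mem_nhds hbV), n, fun x hx => ?_⟩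
    have hxV : x ∈ V := hx
    let i2 : Algebra Γ(X, V) (X.presheaf.stalk x) := (X.presheaf.germ V x hxV).hom.toAlgebra
    have h4 : IsLocalization.AtPrime (X.presheaf.stalk x) (hV.primeIdealOf ⟨x, hxV⟩).asIdeal :=
      hV.isLocalization_stalk ⟨x, hxV⟩
    rw [IsLocalization.AtPrime.ringKrullDim_eq_height (hV.primeIdealOf ⟨x, hxV⟩).asIdeal]
    refine le_trans (Ideal.height_le_ringKrullDim_of_ne_top ?_) h3
    exact (hV.primeIdealOf ⟨x, hxV⟩).2.ne_top

variable [IsAlgClosed k] {Q : Type*} {E : Q → Set X} {f₀ : X₀ ⟶ Spec (.of k)}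
  [LocallyOfFinitePresentation f₀] {σ : X ⟶ X₀}

/-- The ranks are bounded by the dimensions of the local rings, so that `sSup` does not take its
default value 0. -/
theorem IsResolution.logRank_le_maxLogRank [QuasiCompact f₀] (hσ : IsResolution f₀ E σ) {a : X}
    (ha : IsClosed {a}) (haE : a ∈ ⋃ q, E q) : logRank f₀ E σ a ≤ maxLogRank f₀ E σ := by
  have := hσ.smooth
  have := hσ.isProper
  have hX : CompactSpace X := QuasiCompact.compactSpace_of_compactSpace (σ ≫ f₀)
  obtain ⟨M, hM⟩ := exists_ringKrullDim_stalk_le (σ ≫ f₀)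
  refine le_csSup ⟨M, ?_⟩ ⟨a, ⟨ha, haE⟩, rfl⟩
  rintro _ ⟨x, ⟨hx, -⟩, rfl⟩
  obtain ⟨n, y, hy⟩ := exists_isCoords (σ ≫ f₀) x
  have h1 := ((hσ.le_logRank_iff hx _).1 le_rfl).le_card (exists_sub_structMap_mem (σ ≫ f₀) hx) hy
    le_sup_left
  have h2 := hM x
  rw [hy.2, Fintype.card_fin] at h2
  exact h1.trans (by exact_mod_cast h2)

end Bounded

end Algebraic

namespace Algebraic

open IsLocalRing

universe u

/-! ### Derivations and denominators. -/

section Lift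

variable {k R A : Type*} [Field k] [CommRing R] [CommRing A] [Algebra k R] [Algebra k A]
  [Algebra R A] [IsScalarTower k R A]

/-- Up to a denominator, derivations of a localization are defined over the ring itself. -/
theorem exists_derivation_lift [Algebra.FinitePresentation k R] (S : Submonoid R)
    [IsLocalization S A] (D : Derivation k A A) :
    ∃ (θ : Derivation k R R) (s : S),
      ∀ r, algebraMap R A (θ r) = algebraMap R A s * D (algebraMap R A r) := by
  have : IsLocalizedModule S (Algebra.linearMap R A) := inferInstance
  obtain ⟨h, s, hs⟩ := Module.FinitePresentation.exists_lift_of_isLocalizedModule S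
    (Algebra.linearMap R A) (D.compAlgebraMap R).liftKaehlerDifferential
  refine ⟨h.compDer (KaehlerDifferential.D k R), s, fun r => ?_⟩
  have := LinearMap.congr_fun hs (KaehlerDifferential.D k R r)
  simp only [LinearMap.comp_apply, Algebra.linearMap_apply, LinearMap.smul_apply,
    Derivation.liftKaehlerDifferential_comp_D] at this
  refine this.trans ?_
  rw [Submonoid.smul_def, Algebra.smul_def]
  rfl

end Lift

/-! ### Derivations and primes of a ring. -/

section Stabilizer

variable {k R : Type*} [Field k] [CommRing R] [Algebra k R]

/-- The ideal of the elements of `p` which the derivation `θ` maps to `p`. -/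
def derivationIdeal (θ : Derivation k R R) (p : Ideal R) : Ideal R where
  carrier := {r | r ∈ p ∧ θ r ∈ p}
  add_mem' := fun ha hb => ⟨p.add_mem ha.1 hb.1, by rw [map_add]; exact p.add_mem ha.2 hb.2⟩
  zero_mem' := ⟨p.zero_mem, by rw [map_zero]; exact p.zero_mem⟩
  smul_mem' := fun c x hx => ⟨p.mul_mem_left c hx.1, by
    rw [smul_eq_mul, Derivation.leibniz]
    exact p.add_mem (p.mul_mem_left c hx.2) (p.mul_mem_right _ hx.1)⟩

theorem sq_le_derivationIdeal (θ : Derivation k R R) (p : Ideal R) :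
    p ^ 2 ≤ derivationIdeal θ p := by
  rw [pow_two, Ideal.mul_le]
  intro a ha b hb
  refine ⟨p.mul_mem_left a hb, ?_⟩
  rw [Derivation.leibniz]
  exact p.add_mem (p.mul_mem_right _ ha) (p.mul_mem_right _ hb)

/-- For t ∉ p with t r ∈ L, also r ∈ p, and t θ(r) = θ(t r) - r θ(t) lies in p. -/
theorem derivation_mem_of_mem_map {A : Type*} [CommRing A] [Algebra R A] (p : Ideal R) [p.IsPrime]
    [IsLocalization.AtPrime A p] (θ : Derivation k R R) {L : Ideal R}
    (hL : L ≤ derivationIdeal θ p) {r : R} (hr : algebraMap R A r ∈ L.map (algebraMap R A)) :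
    θ r ∈ p := by
  obtain ⟨t, ht, htr⟩ := (IsLocalization.algebraMap_mem_map_algebraMap_iff p.primeCompl A L r).1 hr
  obtain ⟨h0, h1⟩ := hL htr
  have h2 : r ∈ p := (Ideal.IsPrime.mem_or_mem ‹_› h0).resolve_left ht
  rw [Derivation.leibniz, smul_eq_mul, smul_eq_mul, Ideal.add_mem_iff_left _
    (Ideal.mul_mem_right _ _ h2)] at h1
  exact (Ideal.IsPrime.mem_or_mem ‹_› h1).resolve_left ht

end Stabilizer

/-! ### Derivations tangent to the divisor, on open subsets. -/

section SectionIdeal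

variable {X : Scheme.{u}}

/-- The ideal of sections over `V` which vanish on `F`. -/
def sectionIdeal (F : Set X) (V : X.Opens) : Ideal Γ(X, V) :=
  ⨅ (y : X) (hy : y ∈ V) (_ : y ∈ F),
    (maximalIdeal (X.presheaf.stalk y)).comap (X.presheaf.germ V y hy).hom

theorem mem_sectionIdeal {F : Set X} {V : X.Opens} {r : Γ(X, V)} : r ∈ sectionIdeal F V ↔
    ∀ y (hy : y ∈ V), y ∈ F → X.presheaf.germ V y hy r ∈ maximalIdeal (X.presheaf.stalk y) := by
  simp only [sectionIdeal, Ideal.mem_iInf, Ideal.mem_comap]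

theorem germ_mem_idealAt {F : Set X} {V : X.Opens} {r : Γ(X, V)} (hr : r ∈ sectionIdeal F V)
    {x : X} (hx : x ∈ V) : X.presheaf.germ V x hx r ∈ idealAt F x :=
  mem_idealAt.2 ⟨V, hx, r, rfl, fun y hy hyV =>
    (germ_mem_maximalIdeal hyV r).1 (mem_sectionIdeal.1 hr y hyV hy)⟩

/-- Clear the denominator of the germ, then multiply by a function vanishing outside the
neighbourhood where the resulting identity holds: the product vanishes on F in all of V. -/
theorem idealAt_le_map_sectionIdeal (F : Set X) {V : X.Opens} (hV : IsAffineOpen V) {x : X}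
    (hx : x ∈ V) : idealAt F x ≤ (sectionIdeal F V).map (X.presheaf.germ V x hx).hom := by
  intro g hg
  obtain ⟨U, hU, f, rfl, hv⟩ := mem_idealAt.1 hg
  let i2 : Algebra Γ(X, V) (X.presheaf.stalk x) := (X.presheaf.germ V x hx).hom.toAlgebra
  have h4 : IsLocalization.AtPrime (X.presheaf.stalk x) (hV.primeIdealOf ⟨x, hx⟩).asIdeal :=
    hV.isLocalization_stalk ⟨x, hx⟩
  obtain ⟨⟨r, t⟩, hrt⟩ := IsLocalization.surj (hV.primeIdealOf ⟨x, hx⟩).asIdeal.primeCompl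
    (X.presheaf.germ U x hU f)
  have ht := IsLocalization.map_units (X.presheaf.stalk x) t
  change _ * X.presheaf.germ V x hx t = X.presheaf.germ V x hx r at hrt
  change IsUnit (X.presheaf.germ V x hx t) at ht
  obtain ⟨f', hf'⟩ := exists_restrict (inf_le_left : U ⊓ V ≤ U) f
  obtain ⟨t', ht'⟩ := exists_restrict (inf_le_right : U ⊓ V ≤ V) t.1
  have hUV : x ∈ U ⊓ V := ⟨hU, hx⟩
  have h5 : X.presheaf.germ (U ⊓ V) x hUV (f' * t') = X.presheaf.germ V x hx r := by
    rw [map_mul, hf', ht', hrt]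
  obtain ⟨W, hW, i, j, hij⟩ := X.presheaf.germ_eq x hUV hx _ _ h5
  obtain ⟨h, hh, hhx⟩ := hV.exists_basicOpen_le (V := W) ⟨x, hW⟩ hx
  have h6 : h * r ∈ sectionIdeal F V := by
    refine mem_sectionIdeal.2 fun y hy hyF => ?_
    rw [map_mul]
    by_cases hyh : y ∈ X.basicOpen h
    · refine Ideal.mul_mem_left _ _ ?_
      have hyW := hh hyh
      have hyU : y ∈ U := (i.le hyW).1
      have h7 := congrArg (X.presheaf.germ W y hyW) hij
      have h8 := X.presheaf.germ_res_apply i y hyW (f' * t')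
      have h9 := X.presheaf.germ_res_apply j y hyW r
      have h10 := h9.symm.trans (h7.symm.trans (h8.trans (map_mul _ _ _)))
      rw [hf'] at h10
      have h11 := (germ_mem_maximalIdeal hyU f).2 (hv y hyF hyU)
      exact h10 ▸ Ideal.mul_mem_right _ _ h11
    · exact Ideal.mul_mem_right _ _ ((germ_mem_maximalIdeal hy h).2 hyh)
  have h7 := Ideal.mem_map_of_mem (X.presheaf.germ V x hx).hom h6
  have h8 : X.presheaf.germ V x hx (h * r) =
      (X.presheaf.germ V x hx h * X.presheaf.germ V x hx t) * X.presheaf.germ U x hU f := by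
    rw [map_mul, ← hrt]
    ring
  have h9 : IsUnit (X.presheaf.germ V x hx h) := (Scheme.mem_basicOpen _ _ _ hx).1 hhx
  exact (Ideal.unit_mul_mem_iff_mem _ (h9.mul ht)).1 (h8 ▸ h7)

/-- A derivation which preserves the ideal of `F` at a point does so nearby. -/
theorem eventually_derivation_mem {k : Type*} [Field k] {F : Set X} {V : X.Opens}
    [IsNoetherianRing Γ(X, V)] [Algebra k Γ(X, V)] (θ : Derivation k Γ(X, V) Γ(X, V)) {x₀ : X}
    (hx₀ : x₀ ∈ V)
    (hθ : ∀ r ∈ sectionIdeal F V, X.presheaf.germ V x₀ hx₀ (θ r) ∈ idealAt F x₀) :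
    ∀ᶠ x in 𝓝 x₀, ∀ hx : x ∈ V, x ∈ F → ∀ r ∈ sectionIdeal F V,
      X.presheaf.germ V x hx (θ r) ∈ maximalIdeal (X.presheaf.stalk x) := by
  -- Finitely many generators give finitely many open conditions; Leibniz extends them to the whole
  -- ideal at points of F.
  obtain ⟨T, hT⟩ := IsNoetherian.noetherian (sectionIdeal F V)
  have h1 : ∀ r ∈ T, ∀ᶠ x in 𝓝 x₀, ∀ hx : x ∈ V, x ∈ F →
      X.presheaf.germ V x hx (θ r) ∈ maximalIdeal (X.presheaf.stalk x) := by
    intro r hr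
    obtain ⟨U, hU, f, hf, hv⟩ := mem_idealAt.1 (hθ r (hT ▸ Submodule.subset_span hr))
    obtain ⟨W, hW, i, j, hij⟩ := X.presheaf.germ_eq x₀ hU hx₀ _ _ hf
    filter_upwards [W.isOpen.mem_nhds hW] with x hxW hx hxF
    have h7 := congrArg (X.presheaf.germ W x hxW) hij
    have h8 := X.presheaf.germ_res_apply i x hxW f
    have h9 := X.presheaf.germ_res_apply j x hxW (θ r)
    rw [← h9.symm.trans (h7.symm.trans h8) |>.symm]
    exact (germ_mem_maximalIdeal (i.le hxW) f).2 (hv x hxF (i.le hxW))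
  filter_upwards [(Filter.eventually_all_finset T).2 h1] with x hT' hx hxF r hr
  have hr' := hr
  rw [← hT] at hr
  induction hr using Submodule.span_induction with
  | mem r h => exact hT' r h hx hxF
  | zero => simp
  | add r r' h h' ih ih' =>
    rw [map_add, map_add]
    exact Ideal.add_mem _ (ih (hT ▸ h)) (ih' (hT ▸ h'))
  | smul a r h ih =>
    rw [smul_eq_mul, Derivation.leibniz, map_add, smul_eq_mul, smul_eq_mul, map_mul, map_mul]
    exact Ideal.add_mem _ (Ideal.mul_mem_left _ _ (ih (hT ▸ h)))
      (Ideal.mul_mem_right _ _ (mem_sectionIdeal.1 (hT ▸ h) x hx hxF))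

theorem logIdeal_le_map {Q : Type*} {E : Q → Set X} {V : X.Opens} (hV : IsAffineOpen V)
    {x : X} (hx : x ∈ V) : logIdeal E x ≤
      (((maximalIdeal (X.presheaf.stalk x)).comap (X.presheaf.germ V x hx).hom ^ 2 ⊔
        ⨆ (q : Q) (_ : x ∈ E q), sectionIdeal (E q) V).map (X.presheaf.germ V x hx).hom) := by
  let i2 : Algebra Γ(X, V) (X.presheaf.stalk x) := (X.presheaf.germ V x hx).hom.toAlgebra
  have h4 : IsLocalization.AtPrime (X.presheaf.stalk x) (hV.primeIdealOf ⟨x, hx⟩).asIdeal :=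
    hV.isLocalization_stalk ⟨x, hx⟩
  have h5 : ((maximalIdeal (X.presheaf.stalk x)).comap (X.presheaf.germ V x hx).hom).map
      (X.presheaf.germ V x hx).hom = maximalIdeal (X.presheaf.stalk x) :=
    IsLocalization.map_under (hV.primeIdealOf ⟨x, hx⟩).asIdeal.primeCompl _ _
  rw [logIdeal, Ideal.map_sup, Ideal.map_pow, h5]
  refine sup_le_sup le_rfl (iSup₂_le fun q hq => ?_)
  exact (idealAt_le_map_sectionIdeal (E q) hV hx).trans
    (Ideal.map_mono (le_iSup₂_of_le q hq le_rfl))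

/-- The logarithmic ideal comes from squares, which θ maps into the maximal ideal by Leibniz, and
from the components through x, to which θ is tangent. -/
theorem derivation_mem_of_mem_logIdeal {k : Type*} [Field k] {Q : Type*} {E : Q → Set X}
    {V : X.Opens} (hV : IsAffineOpen V) [Algebra k Γ(X, V)] (θ : Derivation k Γ(X, V) Γ(X, V))
    {x : X} (hx : x ∈ V)
    (hθ : ∀ q, x ∈ E q → ∀ r ∈ sectionIdeal (E q) V,
      X.presheaf.germ V x hx (θ r) ∈ maximalIdeal (X.presheaf.stalk x)) {r : Γ(X, V)}
    (hr : X.presheaf.germ V x hx r ∈ logIdeal E x) :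
    X.presheaf.germ V x hx (θ r) ∈ maximalIdeal (X.presheaf.stalk x) := by
  let i2 : Algebra Γ(X, V) (X.presheaf.stalk x) := (X.presheaf.germ V x hx).hom.toAlgebra
  let p := (hV.primeIdealOf ⟨x, hx⟩).asIdeal
  have h4 : IsLocalization.AtPrime (X.presheaf.stalk x) p := hV.isLocalization_stalk ⟨x, hx⟩
  have hp : (maximalIdeal (X.presheaf.stalk x)).comap (X.presheaf.germ V x hx).hom = p :=
    IsLocalization.AtPrime.under_maximalIdeal (X.presheaf.stalk x) p
  have h6 : ∀ r, r ∈ p ↔ X.presheaf.germ V x hx r ∈ maximalIdeal (X.presheaf.stalk x) := by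
    intro r
    rw [← hp]
    rfl
  rw [← h6]
  have h5 : algebraMap Γ(X, V) (X.presheaf.stalk x) r ∈
      (p ^ 2 ⊔ ⨆ (q : Q) (_ : x ∈ E q), sectionIdeal (E q) V).map
        (algebraMap Γ(X, V) (X.presheaf.stalk x)) := by
    rw [← hp]
    exact logIdeal_le_map hV hx hr
  have h7 : p ^ 2 ⊔ ⨆ (q : Q) (_ : x ∈ E q), sectionIdeal (E q) V ≤ derivationIdeal θ p := by
    refine sup_le (sq_le_derivationIdeal θ p) (iSup₂_le fun q hq r hr => ⟨?_, ?_⟩)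
    · rw [h6]
      exact mem_sectionIdeal.1 hr x hx hq
    · rw [h6]
      exact hθ q hq r hr
  exact derivation_mem_of_mem_map (A := X.presheaf.stalk x) p θ h7 h5

end SectionIdeal

end Algebraic

namespace Algebraic

open IsLocalRing

universe u

/-! ### Nonvanishing minors. -/

section Minor

variable {κ ι : Type*} [Field κ]

/-- Linearly independent rows have a nonvanishing minor. -/
theorem exists_det_submatrix_ne_zero [Fintype ι] {e : ℕ} {M : Matrix (Fin e) ι κ}
    (hM : LinearIndependent κ M.row) : ∃ l : Fin e → ι, (M.submatrix id l).det ≠ 0 := by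
  have hr : M.rank = e := by rw [hM.rank_matrix, Fintype.card_fin]
  have hc : Module.finrank κ (Submodule.span κ (Set.range M.col)) = e := by
    rw [← Matrix.rank_eq_finrank_span_cols, hr]
  obtain ⟨f, hf, -, hli⟩ := Submodule.exists_fun_fin_finrank_span_eq κ (Set.range M.col)
  choose j hj using hf
  refine ⟨fun i => j (Fin.cast hc.symm i), ?_⟩
  have h1 : LinearIndependent κ (M.submatrix id fun i => j (Fin.cast hc.symm i)).col := by
    have h2 := hli.comp (Fin.cast hc.symm) (Fin.cast_injective _)
    have h3 : (M.submatrix id fun i => j (Fin.cast hc.symm i)).col = f ∘ Fin.cast hc.symm := by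
      ext i x
      exact congrFun (hj _) x
    rwa [h3]
  have h3 := Matrix.linearIndependent_cols_iff_isUnit.1 h1
  exact ((Matrix.isUnit_iff_isUnit_det _).1 h3).ne_zero

end Minor

section Pullback

variable {X Y : Scheme.{u}}

theorem exists_pullback (σ : X ⟶ Y) {U : Y.Opens} {V : X.Opens} (h : V ≤ σ ⁻¹ᵁ U) (F : Γ(Y, U)) :
    ∃ f : Γ(X, V), ∀ (x : X) (hx : x ∈ V),
      X.presheaf.germ V x hx f = σ.stalkMap x (Y.presheaf.germ U (σ x) (h hx) F) := by
  obtain ⟨f, hf⟩ := exists_restrict h (σ.app U F)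
  refine ⟨f, fun x hx => ?_⟩
  rw [hf]
  exact (Scheme.Hom.germ_stalkMap_apply σ U x (h hx) F).symm

end Pullback

/-! ### Semicontinuity of the logarithmic rank. -/

section Semicontinuity

variable {k : Type u} [Field k] [IsAlgClosed k] {X X₀ : Scheme.{u}} {Q : Type*} [Finite Q]
  {E : Q → Set X} {f₀ : X₀ ⟶ Spec (.of k)} [LocallyOfFinitePresentation f₀] {σ : X ⟶ X₀}

/-- As ∂g_i/∂v_l = 0, Leibniz shows that ∂/∂v_l is tangent to the component (g_i = 0). -/
theorem IsPartials.derivation_mem {f : X ⟶ Spec (.of k)} {x₀ : X} {s m : ℕ}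
    {g : Fin s → X.presheaf.stalk x₀} {w : Fin m → X.presheaf.stalk x₀}
    {δ : Fin s ⊕ Fin m → X.presheaf.stalk x₀ → X.presheaf.stalk x₀}
    (hδ : IsPartials f x₀ (Sum.elim g w) δ) (i : Fin s) (l : Fin m) {r : X.presheaf.stalk x₀}
    (hr : r ∈ Ideal.span {g i}) : δ (.inr l) r ∈ Ideal.span {g i} := by
  let := stalkAlgebra f x₀
  obtain ⟨D, hD, hDx⟩ := hδ
  obtain ⟨b, rfl⟩ := Ideal.mem_span_singleton'.1 hr
  have : D (.inr l) (g i) = 0 := (hDx (.inr l)).2 (.inl i) (by simp)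
  rw [hD, Derivation.leibniz, this, smul_zero, zero_add, smul_eq_mul]
  exact Ideal.mul_mem_right _ _ (Ideal.mem_span_singleton_self _)

theorem IsResolution.isClosed_map (hσ : IsResolution f₀ E σ) {a : X} (ha : IsClosed {a}) :
    IsClosed {σ a} := by
  have := hσ.isProper
  have h := σ.isClosedMap _ ha
  rwa [Set.image_singleton] at h

/-- Semicontinuity of the logarithmic rank: a nonvanishing minor of the logarithmic Jacobian matrix,
at a point `η` (not necessarily closed), bounds the logarithmic rank from below near `η`. -/
theorem IsResolution.exists_open_le_logRank (hσ : IsResolution f₀ E σ) {x₀ : X} {s m : ℕ}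
    {c : Fin s → Q} (hc : Set.range c = {q | x₀ ∈ E q}) {g : Fin s → X.presheaf.stalk x₀}
    {w : Fin m → X.presheaf.stalk x₀} (hg : ∀ i, idealAt (E (c i)) x₀ = Ideal.span {g i})
    {δ : Fin s ⊕ Fin m → X.presheaf.stalk x₀ → X.presheaf.stalk x₀}
    (hδ : IsPartials (σ ≫ f₀) x₀ (Sum.elim g w) δ) {η : X} (h : η ⤳ x₀) {e : ℕ}
    (F : Fin e → X₀.presheaf.stalk (σ x₀)) (l : Fin e → Fin m)
    (hdet : (Matrix.of fun j i => δ (.inr (l i)) (σ.stalkMap x₀ (F j))).det ∉ primeAt h) :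
    ∃ O : X.Opens, η ∈ O ∧ ∀ x ∈ O, IsClosed {x} → e ≤ logRank f₀ E σ x := by
  have hsm := hσ.smooth
  have hδE := fun i l r => hδ.derivation_mem (r := r) i l
  have hU : ∀ j, ∃ (U : X₀.Opens) (hU : σ x₀ ∈ U) (F' : Γ(X₀, U)),
      X₀.presheaf.germ U _ hU F' = F j := fun j => X₀.presheaf.exists_germ_eq (F j)
  choose U hU F' hF' using hU
  obtain ⟨_, ⟨V : X.Opens, hV, rfl⟩, hxV, hVU⟩ := X.isBasis_affineOpens.exists_subset_of_mem_open
    (a := x₀) (u := ⋂ j, σ ⁻¹' (U j : Set X₀)) (Set.mem_iInter.2 hU)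
    (isOpen_iInter_of_finite fun j => (U j).isOpen.preimage σ.continuous)
  have hVU' : ∀ j, V ≤ σ ⁻¹ᵁ (U j) := fun j x hx => Set.mem_iInter.1 (hVU hx) j
  choose f hf using fun j => exists_pullback σ (hVU' j) (F' j)
  let ik : Algebra k Γ(X, V) := (structSection (σ ≫ f₀) V).toAlgebra
  have hft : Algebra.FiniteType k Γ(X, V) := finiteType_structSection (σ ≫ f₀) hV
  have : Algebra.FinitePresentation k Γ(X, V) := Algebra.FinitePresentation.of_finiteType.1 hft
  have : IsNoetherianRing Γ(X, V) := Algebra.FiniteType.isNoetherianRing k _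
  -- Up to a unit at x₀, the partial derivatives are defined on the affine neighbourhood V.
  have hθ : ∀ l, ∃ (θ : Derivation k Γ(X, V) Γ(X, V)) (t : X.presheaf.stalk x₀), IsUnit t ∧
      ∀ r, X.presheaf.germ V x₀ hxV (θ r) = t * δ (.inr l) (X.presheaf.germ V x₀ hxV r) := by
    intro l
    let i1 := stalkAlgebra (σ ≫ f₀) x₀
    obtain ⟨D, hD, -⟩ := hδ
    let i2 : Algebra Γ(X, V) (X.presheaf.stalk x₀) := (X.presheaf.germ V x₀ hxV).hom.toAlgebra
    have h4 : IsLocalization.AtPrime (X.presheaf.stalk x₀) (hV.primeIdealOf ⟨x₀, hxV⟩).asIdeal :=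
      hV.isLocalization_stalk ⟨x₀, hxV⟩
    have : IsScalarTower k Γ(X, V) (X.presheaf.stalk x₀) :=
      .of_algebraMap_eq' (germ_comp_structSection (σ ≫ f₀) hxV).symm
    obtain ⟨θ, t, ht⟩ := exists_derivation_lift
      (hV.primeIdealOf ⟨x₀, hxV⟩).asIdeal.primeCompl (D (.inr l))
    exact ⟨θ, _, IsLocalization.map_units (X.presheaf.stalk x₀) t, fun r => by rw [hD]; exact ht r⟩
  choose θ t ht hθ using hθ
  have hnear : ∀ᶠ x in 𝓝 x₀, ∀ l q, ∀ hx : x ∈ V, x ∈ E q → ∀ r ∈ sectionIdeal (E q) V,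
      X.presheaf.germ V x hx (θ l r) ∈ maximalIdeal (X.presheaf.stalk x) := by
    refine Filter.eventually_all.2 fun l => Filter.eventually_all.2 fun q =>
      eventually_derivation_mem (θ l) hxV fun r hr => ?_
    by_cases hq : x₀ ∈ E q
    · obtain ⟨i, rfl⟩ : q ∈ Set.range c := hc ▸ hq
      have h1 := germ_mem_idealAt hr hxV
      rw [hg] at h1 ⊢
      rw [hθ]
      exact Ideal.mul_mem_left _ _ (hδE i l _ h1)
    · rw [idealAt_eq_top (by rwa [(hσ.isSNC.isClosed q).closure_eq])]
      trivial
  obtain ⟨O₀, hO₀, hO₀o, hx₀O⟩ := eventually_nhds_iff.1 hnear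
  let Δ : Γ(X, V) := (Matrix.of fun j i => θ (l i) (f j)).det
  have hΔ : X.presheaf.germ V x₀ hxV Δ = (∏ i, t (l i)) *
      (Matrix.of fun j i => δ (.inr (l i)) (σ.stalkMap x₀ (F j))).det := by
    rw [← Matrix.det_mul_row]
    refine ((X.presheaf.germ V x₀ hxV).hom.map_det _).trans (congrArg Matrix.det ?_)
    ext j i
    refine (hθ (l i) (f j)).trans ?_
    rw [hf, hF']
    rfl
  have hΔη : η ∈ X.basicOpen Δ := by
    by_contra hcon
    have h1 := (germ_mem_primeAt h hxV Δ).2 hcon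
    rw [hΔ, Ideal.unit_mul_mem_iff_mem] at h1
    · exact hdet h1
    · exact (Finset.univ.prod_induction (fun i => t (l i)) IsUnit (fun _ _ => IsUnit.mul) isUnit_one
        fun i _ => ht _)
  refine ⟨⟨O₀, hO₀o⟩ ⊓ X.basicOpen Δ, ⟨h.mem_open hO₀o hx₀O, hΔη⟩, fun x hx hxc => ?_⟩
  obtain ⟨hxO, hxΔ⟩ := hx
  have hxV' : x ∈ V := X.basicOpen_le Δ hxΔ
  rw [hσ.le_logRank_iff hxc]
  -- The germs F' j at σ x are not in the maximal ideal, so their values d j are subtracted;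
  -- derivations do not see this change.
  choose d hd using fun j => exists_sub_structMap_mem f₀ (hσ.isClosed_map hxc)
    (X₀.presheaf.germ (U j) (σ x) (hVU' j hxV') (F' j))
  refine ⟨_, hd, fun b hb => ?_⟩
  let r : Γ(X, V) := ∑ j, b j • (f j - algebraMap k _ (d j))
  have hs : ∀ b, X.presheaf.germ V x hxV' (algebraMap k _ b) = structMap (σ ≫ f₀) x b := fun b =>
    RingHom.congr_fun (germ_comp_structSection (σ ≫ f₀) hxV') b
  have hr : X.presheaf.germ V x hxV' r = ∑ j, structMap (σ ≫ f₀) x (b j) *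
      (σ.stalkMap x).hom (X₀.presheaf.germ (U j) (σ x) (hVU' j hxV') (F' j) -
        structMap f₀ (σ x) (d j)) := by
    have hs' : ∀ b, (σ.stalkMap x).hom (structMap f₀ (σ x) b) = structMap (σ ≫ f₀) x b := fun b =>
      RingHom.congr_fun (stalkMap_comp_structMap f₀ σ x) b
    simp only [r, map_sum, Algebra.smul_def, map_mul, map_sub, hs, hs', hf]
  rw [← hr] at hb
  -- A combination lying in the logarithmic ideal at x is differentiated by the tangent θ (l i).
  -- This gives a linear system whose matrix is the minor Δ, invertible at x.
  have h1 : ∀ i, ∑ j, residue _ (structMap (σ ≫ f₀) x (b j)) *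
      residue _ (X.presheaf.germ V x hxV' (θ (l i) (f j))) = 0 := by
    intro i
    have h2 := derivation_mem_of_mem_logIdeal hV (θ (l i)) hxV' (hO₀ x hxO (l i) · hxV') hb
    have h4 : θ (l i) r = ∑ j, algebraMap k _ (b j) * θ (l i) (f j) := by
      rw [map_sum]
      refine Finset.sum_congr rfl fun j _ => ?_
      rw [Derivation.map_smul, map_sub, Derivation.map_algebraMap, sub_zero, Algebra.smul_def]
    rw [← residue_eq_zero_iff, h4] at h2
    simpa only [map_sum, map_mul, hs] using h2
  let N : Matrix (Fin e) (Fin e) (ResidueField (X.presheaf.stalk x)) :=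
    Matrix.of fun i j => residue _ (X.presheaf.germ V x hxV' (θ (l i) (f j)))
  have hN : N.det ≠ 0 := by
    have h2 : N.transpose.det = residue _ (X.presheaf.germ V x hxV' Δ) :=
      (((residue _).comp (X.presheaf.germ V x hxV').hom).map_det _).symm
    rw [← Matrix.det_transpose, h2, Ne, residue_eq_zero_iff, germ_mem_maximalIdeal]
    exact not_not.2 hxΔ
  have h3 := Matrix.eq_zero_of_mulVec_eq_zero hN
    (v := fun j => residue _ (structMap (σ ≫ f₀) x (b j))) (by
      ext i
      exact (Finset.sum_congr rfl fun j _ => mul_comm _ _).trans (h1 i))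
  ext j
  exact (map_eq_zero ((residue _).comp (structMap (σ ≫ f₀) x))).1 (congrFun h3 j)

end Semicontinuity

end Algebraic

namespace Algebraic

open IsLocalRing

universe u

/-! ### Extension of derivations in characteristic zero. -/

section ExtendDerivation

open scoped TensorProduct in
/-- In characteristic zero, derivations extend to field extensions. -/
theorem exists_derivation_extend {k R L : Type*} [CommRing k] [CommRing R] [IsDomain R] [Field L]
    [CharZero L] [Algebra k R] [Algebra k L] [Algebra R L] [IsScalarTower k R L]
    (hinj : Function.Injective (algebraMap R L)) (d : Derivation k R L) :
    ∃ D : Derivation k L L, ∀ r, D (algebraMap R L r) = d r := by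
  have : FaithfulSMul R L := (faithfulSMul_iff_algebraMap_injective R L).2 hinj
  let K := FractionRing R
  let : Algebra K L := FractionRing.liftAlgebra R L
  have : IsScalarTower R K L := FractionRing.isScalarTower_liftAlgebra R L
  have : CharZero K := (algebraMap K L).charZero
  have h1 : Algebra.FormallySmooth R K := .of_isLocalization (nonZeroDivisors R)
  have h2 : Algebra.FormallySmooth K L := by
    obtain ⟨s, hs⟩ := exists_isTranscendenceBasis K L
    have := hs.isAlgebraic_field
    -- L is algebraic over a purely transcendental extension of K, and separable by characteristic
    -- zero.
    exact .of_algebraicIndependent_of_isSeparable hs.1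
  have h3 : Algebra.FormallySmooth R L := .comp R K L
  -- Formal smoothness of L over R makes the differentials of R, tensored with L, a subspace of
  -- those of L; a linear retraction then extends d.
  have hi : Function.Injective (KaehlerDifferential.mapBaseChange k R L) := by
    have := h3.subsingleton_h1Cotangent
    rw [injective_iff_map_eq_zero]
    intro x hx
    obtain ⟨y, rfl⟩ := (Algebra.H1Cotangent.exact_δ_mapBaseChange k R L x).1 hx
    rw [Subsingleton.elim y 0, map_zero]
  obtain ⟨p, hp⟩ := LinearMap.exists_leftInverse_of_injective _ (LinearMap.ker_eq_bot.2 hi)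
  let φ : L ⊗[R] Ω[R⁄k] →ₗ[L] L := d.liftKaehlerDifferential.liftBaseChange L
  refine ⟨(φ ∘ₗ p).compDer (KaehlerDifferential.D k L), fun r => ?_⟩
  have h4 : KaehlerDifferential.D k L (algebraMap R L r) =
      KaehlerDifferential.mapBaseChange k R L (1 ⊗ₜ KaehlerDifferential.D k R r) := by
    simp
  change φ (p (KaehlerDifferential.D k L (algebraMap R L r))) = d r
  rw [h4, ← LinearMap.comp_apply p, hp]
  simp [φ]

end ExtendDerivation

/-! ### Closed points and closures of the strata. -/

section Strata

variable {k : Type u} [Field k] [IsAlgClosed k] {X X₀ : Scheme.{u}} {Q : Type*}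
  {E : Q → Set X} {f₀ : X₀ ⟶ Spec (.of k)} [LocallyOfFinitePresentation f₀] {σ : X ⟶ X₀}

/-- Adapted coordinates descend to the local ring at a itself. The last clause is the chain rule for
derivations along a map to a field, needed for the residue field at a non-closed point. -/
theorem IsResolution.exists_partials (hσ : IsResolution f₀ E σ) {a : X} (ha : IsClosed {a}) :
    ∃ (s m : ℕ) (c : Fin s → Q) (g : Fin s → X.presheaf.stalk a) (w : Fin m → X.presheaf.stalk a)
      (δ : Fin s ⊕ Fin m → X.presheaf.stalk a → X.presheaf.stalk a),
      Function.Injective c ∧ Set.range c = {q | a ∈ E q} ∧ IsCoords (Sum.elim g w) ∧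
      (∀ i, idealAt (E (c i)) a = Ideal.span {g i}) ∧ IsPartials (σ ≫ f₀) a (Sum.elim g w) δ ∧
      ∀ (L : Type u) [Field L] (ψ : X.presheaf.stalk a →+* L) (θ : X.presheaf.stalk a →+ L),
        (∀ x y, θ (x * y) = ψ x * θ y + ψ y * θ x) → (∀ b, θ (structMap (σ ≫ f₀) a b) = 0) →
        ∀ x, θ x = ∑ i, ψ (δ i x) * θ (Sum.elim g w i) := by
  have hsm := hσ.smooth
  obtain ⟨W, s, m, u, v, c, hA⟩ := hσ.isSNC.exists_adapted a ha
  obtain ⟨g, w, hy, hg⟩ := hA.exists_coords (σ ≫ f₀) ha hσ.isSNC.isClosed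
  let := stalkAlgebra (σ ≫ f₀) a
  have : Algebra.FormallySmooth k (X.presheaf.stalk a) := formallySmooth_structMap (σ ≫ f₀) a
  have : Algebra.EssFiniteType k (X.presheaf.stalk a) := essFiniteType_structMap (σ ≫ f₀) a
  have := isNoetherianRing_stalk (σ ≫ f₀) a
  obtain ⟨D, hD, hD'⟩ := IsCoords.exists_derivation.{u, u, 0, u}
    (exists_sub_structMap_mem (σ ≫ f₀) ha) hy
  refine ⟨s, m, c, g, w, fun i => D i, hA.injective, hA.range_eq, hy, hg,
    ⟨D, fun _ _ => rfl, fun i => ⟨?_, fun j hj => ?_⟩⟩, ?_⟩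
  · rw [hD, if_pos rfl]
  · rw [hD, if_neg hj]
  · intro L _ ψ θ hθ hθk x
    let : Algebra (X.presheaf.stalk a) L := ψ.toAlgebra
    let : Algebra k L := (ψ.comp (structMap (σ ≫ f₀) a)).toAlgebra
    have : IsScalarTower k (X.presheaf.stalk a) L := .of_algebraMap_eq' rfl
    let θ' : Derivation k (X.presheaf.stalk a) L :=
      { toFun := θ
        map_add' := θ.map_add
        map_smul' := fun b x => by
          rw [Algebra.smul_def, hθ]
          erw [hθk]
          rw [mul_zero, add_zero]
          rfl
        map_one_eq_zero' := by
          have := hθk 1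
          rw [map_one] at this
          exact this
        leibniz' := fun x y => hθ x y }
    exact hD' L θ' x

theorem notMem_primeAt {η a : X} (h : η ⤳ a) {x : X.presheaf.stalk a}
    (hx : x ∉ maximalIdeal (X.presheaf.stalk a)) : x ∉ primeAt h :=
  fun h' => hx (le_maximalIdeal (Ideal.IsPrime.ne_top inferInstance) h')

/-- Near a closed point, the logarithmic rank does not decrease. -/
theorem IsResolution.exists_open_logRank_le [Finite Q] (hσ : IsResolution f₀ E σ) {a : X}
    (ha : IsClosed {a}) :
    ∃ O : X.Opens, a ∈ O ∧ ∀ x ∈ O, IsClosed {x} → logRank f₀ E σ a ≤ logRank f₀ E σ x := by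
  obtain ⟨s, m, c, g, w, δ, -, hc, hy, hg, hδ, -⟩ := hσ.exists_partials ha
  obtain ⟨F, hF, h⟩ := (hσ.le_logRank_iff ha _).1 le_rfl
  have hrow : LinearIndependent (ResidueField (X.presheaf.stalk a))
      (Matrix.of fun j l => residue _ (δ (.inr l) (σ.stalkMap a (F j)))).row := by
    let := stalkAlgebra (σ ≫ f₀) a
    obtain ⟨D, hD, hDx⟩ := hδ
    have h1 : ∀ i j, D i (Sum.elim g w j) = if j = i then 1 else 0 := by
      intro i j
      split_ifs with h
      · rw [h]; exact (hDx i).1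
      · exact (hDx i).2 j h
    rw [Fintype.linearIndependent_iff]
    intro b hb
    have : ∀ i, ∃ d : k, b i = residue _ (structMap (σ ≫ f₀) a d) := by
      intro i
      have hsm := hσ.smooth
      obtain ⟨y, hy⟩ := residue_surjective (b i)
      obtain ⟨d, hd⟩ := exists_sub_structMap_mem (σ ≫ f₀) ha y
      refine ⟨d, ?_⟩
      rw [← hy, ← sub_eq_zero, ← map_sub, residue_eq_zero_iff]
      exact hd
    choose d hd using this
    have h2 : d = 0 := by
      refine h d ?_
      rw [logIdeal_eq hc hg]
      refine mem_of_residue_derivation hy h1 (Ideal.sum_mem _ fun i _ => Ideal.mul_mem_left _ _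
        ((map_mem_maximalIdeal_iff _).2 (hF i))) fun l => ?_
      have h3 := congrFun hb l
      simp only [Finset.sum_apply, Pi.smul_apply, Matrix.row, Matrix.of_apply, smul_eq_mul,
        Pi.zero_apply, hd, ← map_mul, ← map_sum] at h3
      rw [← h3, map_sum]
      congr 1
      refine Finset.sum_congr rfl fun j _ => ?_
      rw [hD]
      have h4 := (D (.inr l)).map_smul (d j) (σ.stalkMap a (F j))
      rw [Algebra.smul_def, Algebra.smul_def] at h4
      exact h4
    intro i
    rw [hd, h2]
    simp
  obtain ⟨l, hl⟩ := exists_det_submatrix_ne_zero hrow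
  refine hσ.exists_open_le_logRank hc hg hδ (specializes_refl a) F l (notMem_primeAt _ fun h' => hl ?_)
  rw [← residue_eq_zero_iff] at h'
  rw [← h']
  exact ((residue (X.presheaf.stalk a)).map_det _).symm

/-- Semicontinuity of the rank and closedness of E; the stratum is a set of closed points, so only
those can be recovered. -/
theorem IsResolution.mem_logStratum_of_mem_closure [Finite Q] (hσ : IsResolution f₀ E σ) {a : X}
    (ha : IsClosed {a}) {l : ℕ} (h : a ∈ closure (logStratum f₀ E σ l)) :
    a ∈ logStratum f₀ E σ l := by
  obtain ⟨O, haO, hO⟩ := hσ.exists_open_logRank_le ha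
  obtain ⟨x, hxO, hx, -, hxl⟩ := mem_closure_iff.1 h O O.isOpen haO
  refine ⟨ha, ?_, (Nat.add_le_add_right (hO x hxO hx) l).trans hxl⟩
  have h1 : IsClosed (⋃ q, E q) := isClosed_iUnion_of_finite hσ.isSNC.isClosed
  exact closure_minimal (fun x hx => hx.2.1) h1 h

/-- A closed point in the closure of the image of a set is the image of a closed point in the
closure of the set. -/
theorem IsResolution.exists_mem_closure (hσ : IsResolution f₀ E σ) {S : Set X} {b : X₀}
    (hb : IsClosed {b}) (h : b ∈ closure (σ '' S)) :
    ∃ a, IsClosed {a} ∧ a ∈ closure S ∧ σ a = b := by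
  have := hσ.isProper
  have := hσ.smooth
  have : JacobsonSpace X := LocallyOfFiniteType.jacobsonSpace (σ ≫ f₀)
  have h1 := closure_minimal (Set.image_mono subset_closure) (σ.isClosedMap _ isClosed_closure) h
  obtain ⟨x, hx, hxb⟩ := h1
  have h2 : IsClosed (closure S ∩ σ ⁻¹' {b}) := isClosed_closure.inter (hb.preimage σ.continuous)
  obtain ⟨a, ⟨haS, hab⟩, ha⟩ := nonempty_inter_closedPoints (Z := closure S ∩ σ ⁻¹' {b})
    ⟨x, hx, hxb⟩ h2.isLocallyClosed
  exact ⟨a, ha, haS, hab⟩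

/-- A closed point of the closure of the image lifts to a closed point of the closure of the
stratum, which belongs to the stratum. -/
theorem IsResolution.notMem_closure_imgStratum [Finite Q] (hσ : IsResolution f₀ E σ) {b : X₀}
    (hb : IsClosed {b}) {l : ℕ} (h : b ∉ imgStratum f₀ E σ l) :
    b ∉ closure (imgStratum f₀ E σ l) := by
  intro hcl
  obtain ⟨a, ha, haS, rfl⟩ := hσ.exists_mem_closure hb hcl
  exact h ⟨a, hσ.mem_logStratum_of_mem_closure ha haS, rfl⟩

end Strata

end Algebraic

namespace Algebraic

open IsLocalRing

universe u

/-! ### Derivations along a coordinate plane. -/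

section Derivations

/-- Partial derivatives along a coordinate plane, extended to an overfield of its function field. -/
theorem exists_derivation_of_ker_eq {k M R L : Type*} [Field k] [CommRing M] [CommRing R]
    [IsDomain R] [Field L] [CharZero L] [Algebra k M] [Algebra k R] [Algebra k L] [Algebra R L]
    [IsScalarTower k R L] (hinj : Function.Injective (algebraMap R L)) {n d : ℕ} {y : Fin n → M}
    {D : Fin n → Derivation k M M} (hD : ∀ i j, D i (y j) = if j = i then 1 else 0)
    (π : M →ₐ[k] R) (hπ : Function.Surjective π)
    (hker : RingHom.ker π = Ideal.span (y '' {j | d ≤ (j : ℕ)})) {i : Fin n} (hi : (i : ℕ) < d) :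
    ∃ Θ : Derivation k L L, ∀ j, Θ (algebraMap R L (π (y j))) = if j = i then 1 else 0 := by
  -- For i < d the derivation D i kills the generators y_j, j ≥ d, of the kernel, so it descends to
  -- R.
  have hd : ∀ x, π x = 0 → π (D i x) = 0 := by
    intro x hx
    have hx' : x ∈ Ideal.span (y '' {j | d ≤ (j : ℕ)}) := hker ▸ hx
    clear hx
    induction hx' using Submodule.span_induction with
    | mem x h =>
      obtain ⟨j, hj, rfl⟩ := h
      have hj' : d ≤ (j : ℕ) := hj
      rw [hD, if_neg (by rintro rfl; omega), map_zero]
    | zero => simp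
    | add x y _ _ hx hy => rw [map_add, map_add, hx, hy, add_zero]
    | smul a x h hx =>
      have h0 : π x = 0 := by
        rw [← RingHom.mem_ker, hker]
        exact h
      rw [smul_eq_mul, Derivation.leibniz, map_add, smul_eq_mul, smul_eq_mul, map_mul, map_mul, hx,
        h0, mul_zero, zero_mul, add_zero]
  obtain ⟨Θ, hΘ⟩ := exists_derivation_extend hinj
    ((Algebra.linearMap R L).compDer (Derivation.liftOfSurjective hπ hd))
  refine ⟨Θ, fun j => ?_⟩
  rw [hΘ]
  change algebraMap R L (Derivation.liftOfSurjective hπ hd (π (y j))) = _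
  rw [Derivation.liftOfSurjective_apply, hD]
  split_ifs <;> simp

end Derivations

/-! ### The bound d ≤ p - l for the dimension of an image stratum. -/

section Dimension

variable {k : Type u} [Field k] [IsAlgClosed k] {X X₀ : Scheme.{u}} {Q : Type*}
  {E : Q → Set X} {f₀ : X₀ ⟶ Spec (.of k)} [LocallyOfFinitePresentation f₀] {σ : X ⟶ X₀}

theorem LocalEmbedding.exists_sub_structMap_mem {b : X₀} (hb : IsClosed {b})
    (ε : LocalEmbedding f₀ b) (x : ε.ring) :
    ∃ c : k, x - structMap ε.g ε.pt c ∈ maximalIdeal ε.ring := by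
  have hloc : IsLocalHom ε.germMap.hom := .of_surjective _ (surjective_embedding_germMap ε)
  obtain ⟨c, hc⟩ := Algebraic.exists_sub_structMap_mem f₀ hb (ε.germMap x)
  refine ⟨c, ?_⟩
  rw [← map_mem_maximalIdeal_iff ε.germMap.hom, map_sub]
  have h := RingHom.congr_fun (embedding_germMap_comp_structMap ε) c
  rw [← h] at hc
  exact hc

/-- Coordinates of the ambient variety in which a smooth subvariety of `X₀` is a coordinate plane. -/
theorem LocalEmbedding.exists_isCoords {b : X₀} (ε : LocalEmbedding f₀ b)
    (J : Ideal (X₀.presheaf.stalk b)) [IsRegularLocalRing (X₀.presheaf.stalk b ⧸ J)] :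
    ∃ (n d : ℕ) (y : Fin n → ε.ring), d ≤ n ∧ IsCoords y ∧
      J.comap ε.germMap.hom = Ideal.span (y '' {j | d ≤ (j : ℕ)}) ∧
      ringKrullDim (X₀.presheaf.stalk b ⧸ J) = d := by
  have := ε.smooth
  obtain ⟨n, z, hz⟩ := Algebraic.exists_isCoords ε.g ε.pt
  have hN : IsNoetherianRing ε.ring := isNoetherianRing_stalk ε.g ε.pt
  let e : ε.ring ⧸ J.comap ε.germMap.hom ≃+* X₀.presheaf.stalk b ⧸ J :=
    (Ideal.quotEquivOfEq (by rw [← RingHom.comap_ker, Ideal.mk_ker])).trans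
      (RingHom.quotientKerEquivOfSurjective (f := (Ideal.Quotient.mk J).comp ε.germMap.hom)
        (Ideal.Quotient.mk_surjective.comp (surjective_embedding_germMap ε)))
  have hreg : IsRegularLocalRing (ε.ring ⧸ J.comap ε.germMap.hom) := .of_ringEquiv e.symm
  have hle : ringKrullDim (ε.ring ⧸ J.comap ε.germMap.hom) ≤ n := by
    have h1 := ringKrullDim_le_of_surjective (Ideal.Quotient.mk (J.comap ε.germMap.hom))
      Ideal.Quotient.mk_surjective
    rwa [hz.2, Fintype.card_fin] at h1
  obtain ⟨d, hd⟩ : ∃ d : ℕ, ringKrullDim (ε.ring ⧸ J.comap ε.germMap.hom) = d :=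
    ⟨_, IsRegularLocalRing.spanFinrank_maximalIdeal.symm⟩
  have hdn : d ≤ n := by
    rw [hd] at hle
    exact_mod_cast hle
  obtain ⟨y, hy, hI⟩ := exists_isCoords_of_quotient_fin (n - d) d n (by omega) ε.ring z hz
    (J.comap ε.germMap.hom) hd
  exact ⟨n, d, y, hdn, hy, hI, by rw [← ringKrullDim_eq_of_ringEquiv e, hd]⟩

/-- Generic smoothness, by derivations. The generic point ζ of Y_l at b lifts to a point η of the
closure of Σ_l, as σ is closed. The derivations of the local ring of Y_l dual to y_1, …, y_d extend
to the residue field L of η. By the chain rule they are expressed through the partial derivatives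
along the v-coordinates at a closed specialization of η, so some minor of order d is nonzero at η.
Then the logarithmic rank is at least d at closed points near η, one of which lies in Σ_l. -/
theorem IsResolution.add_le_maxLogRank [CharZero k] [Finite Q] (hσ : IsResolution f₀ E σ) {l : ℕ}
    {b : X₀} (hb : IsClosed {b}) (hJ : (idealAt (imgStratum f₀ E σ l) b).IsPrime)
    (ε : LocalEmbedding f₀ b) {n d : ℕ} (hdn : d ≤ n) {y : Fin n → ε.ring} (hy : IsCoords y)
    (hI : (idealAt (imgStratum f₀ E σ l) b).comap ε.germMap.hom =
      Ideal.span (y '' {j | d ≤ (j : ℕ)})) :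
    d + l ≤ maxLogRank f₀ E σ := by
  have := hσ.isProper
  have := hσ.smooth
  have := ε.smooth
  obtain ⟨ζ, h, hζ⟩ := exists_primeAt_eq b (idealAt (imgStratum f₀ E σ l) b)
  have h1 := mem_closure_of_idealAt_le h hζ.ge
  obtain ⟨η, hη, rfl⟩ := closure_minimal (Set.image_mono subset_closure)
    (σ.isClosedMap _ isClosed_closure) h1
  let R := X₀.presheaf.stalk b ⧸ idealAt (imgStratum f₀ E σ l) b
  let L := ResidueField (X.presheaf.stalk η)
  let ψ : X₀.presheaf.stalk b →+* L := (residue _).comp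
    ((σ.stalkMap η).hom.comp (X₀.presheaf.stalkSpecializes h).hom)
  have hψ : ∀ x, ψ x = 0 ↔ x ∈ idealAt (imgStratum f₀ E σ l) b := by
    intro x
    rw [← hζ]
    change residue _ _ = 0 ↔ _
    rw [residue_eq_zero_iff]
    exact map_mem_maximalIdeal_iff (σ.stalkMap η).hom
  have hR : IsDomain R := (Ideal.Quotient.isDomain_iff_prime _).2 hJ
  let i0 := stalkAlgebra f₀ b
  let i1 : Algebra R L := (Ideal.Quotient.lift _ ψ fun x hx => (hψ x).2 hx).toAlgebra
  let i2 : Algebra k L := ((residue _).comp (structMap (σ ≫ f₀) η)).toAlgebra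
  have hψk : ∀ c, ψ (structMap f₀ b c) = algebraMap k L c := by
    intro c
    have h2 := RingHom.congr_fun (stalkSpecializes_comp_structMap f₀ h) c
    have h3 := RingHom.congr_fun (stalkMap_comp_structMap f₀ σ η) c
    exact congrArg (residue _) ((congrArg (σ.stalkMap η).hom h2).trans h3)
  have hT : IsScalarTower k R L := .of_algebraMap_eq fun c => (hψk c).symm
  have hL : CharZero L := charZero_of_injective_algebraMap (algebraMap k L).injective
  have hinj : Function.Injective (algebraMap R L) := by
    rw [injective_iff_map_eq_zero]
    intro x hx
    obtain ⟨x, rfl⟩ := Ideal.Quotient.mk_surjective x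
    exact Ideal.Quotient.eq_zero_iff_mem.2 ((hψ x).1 hx)
  let i3 := stalkAlgebra ε.g ε.pt
  have : Algebra.FormallySmooth k ε.ring := formallySmooth_structMap ε.g ε.pt
  have : Algebra.EssFiniteType k ε.ring := essFiniteType_structMap ε.g ε.pt
  have : IsNoetherianRing ε.ring := isNoetherianRing_stalk ε.g ε.pt
  obtain ⟨D, hD, -⟩ := IsCoords.exists_derivation.{u, u, 0, 0} (ε.exists_sub_structMap_mem hb) hy
  let π : ε.ring →ₐ[k] R :=
    { (Ideal.Quotient.mk (idealAt (imgStratum f₀ E σ l) b)).comp ε.germMap.hom with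
      commutes' := fun c => congrArg (Ideal.Quotient.mk _)
        (RingHom.congr_fun (embedding_germMap_comp_structMap ε) c) }
  have hπ : Function.Surjective π :=
    Ideal.Quotient.mk_surjective.comp (surjective_embedding_germMap ε)
  have hker : RingHom.ker π = Ideal.span (y '' {j | d ≤ (j : ℕ)}) := by
    rw [← hI]
    ext x
    exact Ideal.Quotient.eq_zero_iff_mem
  choose Θ hΘ using fun i : Fin d => exists_derivation_of_ker_eq (L := L) hinj hD π hπ hker
    (i := Fin.castLE hdn i) i.2
  have hU : ∀ j : Fin d, ∃ (U : X₀.Opens) (hU : b ∈ U) (T : Γ(X₀, U)),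
      X₀.presheaf.germ U _ hU T = ε.germMap (y (Fin.castLE hdn j)) := fun j =>
    X₀.presheaf.exists_germ_eq _
  choose U hU T hT using hU
  have hηU : ∀ j, σ η ∈ U j := fun j => h.mem_open (U j).isOpen (hU j)
  -- Removing the components that miss η ensures that every component through the closed point a
  -- chosen in G contains η. The u-coordinates at a then vanish in L and drop out of the chain rule.
  let G : Set X := (⋂ j, σ ⁻¹' (U j : Set X₀)) ∩ ⋂ (q : Q) (_ : η ∉ E q), (E q)ᶜ
  have hG : IsOpen G := (isOpen_iInter_of_finite fun j => (U j).isOpen.preimage σ.continuous).inter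
    (isOpen_iInter_of_finite fun q => isOpen_iInter_of_finite fun _ =>
      (hσ.isSNC.isClosed q).isOpen_compl)
  have hηG : η ∈ G := ⟨Set.mem_iInter.2 hηU, Set.mem_iInter₂.2 fun q hq => hq⟩
  have : JacobsonSpace X := LocallyOfFiniteType.jacobsonSpace (σ ≫ f₀)
  obtain ⟨a, ⟨haη, haG⟩, ha⟩ := nonempty_inter_closedPoints (Z := closure {η} ∩ G)
    ⟨η, subset_closure rfl, hηG⟩ (isClosed_closure.isLocallyClosed.inter hG.isLocallyClosed)
  have hηa : η ⤳ a := specializes_iff_mem_closure.2 haη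
  have haU : ∀ j, σ a ∈ U j := fun j => Set.mem_iInter.1 haG.1 j
  have haE : ∀ q, a ∈ E q → η ∈ E q := fun q hq => by
    by_contra hcon
    exact Set.mem_iInter₂.1 haG.2 q hcon hq
  obtain ⟨s, m, c, g, w, δ, -, hc, -, hg, hδ, hchain⟩ := hσ.exists_partials ha
  let F : Fin d → X₀.presheaf.stalk (σ a) := fun j => X₀.presheaf.germ (U j) _ (haU j) (T j)
  let ψ₀ : X.presheaf.stalk a →+* L := (residue _).comp (X.presheaf.stalkSpecializes hηa).hom
  have hψ₀ : ∀ x, ψ₀ x = 0 ↔ x ∈ primeAt hηa := fun x => residue_eq_zero_iff _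
  have hψF : ∀ j, ψ₀ (σ.stalkMap a (F j)) = ψ (ε.germMap (y (Fin.castLE hdn j))) := by
    intro j
    have h2 := X₀.presheaf.germ_stalkSpecializes_apply (haU j) (hηa.map σ.continuous) (T j)
    have h3 := X₀.presheaf.germ_stalkSpecializes_apply (hU j) h (T j)
    have h4 := Scheme.Hom.stalkSpecializes_stalkMap_apply σ _ _ hηa (F j)
    rw [← hT j]
    exact congrArg (residue _) (h4.symm.trans (congrArg (σ.stalkMap η) (h2.trans h3.symm)))
  let θ : Fin d → X.presheaf.stalk a →+ L := fun i =>
    ((Θ i : L →ₗ[k] L) : L →+ L).comp (ψ₀ : X.presheaf.stalk a →+ L)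
  have hθ : ∀ i x, θ i x = Θ i (ψ₀ x) := fun _ _ => rfl
  have hθg : ∀ i q, θ i (g q) = 0 := by
    intro i q
    have h2 : a ∈ E (c q) := (hc.subset ⟨q, rfl⟩ : c q ∈ {q | a ∈ E q})
    have h3 : g q ∈ idealAt (E (c q)) a := hg q ▸ Ideal.mem_span_singleton_self _
    rw [hθ, (hψ₀ _).2 (idealAt_le_primeAt hηa (haE _ h2) h3), map_zero]
  have hsum : ∀ i j, ∑ l, ψ₀ (δ (.inr l) (σ.stalkMap a (F j))) * θ i (w l) =
      if j = i then 1 else 0 := by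
    intro i j
    have h2 := hchain L ψ₀ (θ i) (fun x y => by simp [hθ, Derivation.leibniz])
      (fun c => by
        have h3 := RingHom.congr_fun (stalkSpecializes_comp_structMap (σ ≫ f₀) hηa) c
        have h4 : ψ₀ (structMap (σ ≫ f₀) a c) = algebraMap k L c := congrArg (residue _) h3
        rw [hθ, h4, Derivation.map_algebraMap]) (σ.stalkMap a (F j))
    rw [Fintype.sum_sum_type] at h2
    simp only [Sum.elim_inl, Sum.elim_inr, hθg, mul_zero, Finset.sum_const_zero, zero_add] at h2
    rw [← h2, hθ, hψF]
    refine (hΘ i (Fin.castLE hdn j)).trans ?_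
    simp [Fin.castLE_inj]
  -- By `hsum` the Jacobian has a right inverse, with entries θ i (w l).
  have hrow : LinearIndependent L
      (Matrix.of fun j l => ψ₀ (δ (.inr l) (σ.stalkMap a (F j)))).row := by
    rw [Fintype.linearIndependent_iff]
    intro v hv i
    have h2 : ∀ l, ∑ j, v j * ψ₀ (δ (.inr l) (σ.stalkMap a (F j))) = 0 := fun l => by
      simpa [Matrix.row] using congrFun hv l
    have h3 : ∑ l, (∑ j, v j * ψ₀ (δ (.inr l) (σ.stalkMap a (F j)))) * θ i (w l) = v i := by
      rw [Finset.sum_congr rfl fun l _ => Finset.sum_mul _ _ (θ i (w l)), Finset.sum_comm,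
        Finset.sum_congr rfl fun j _ => Finset.sum_congr rfl fun l _ => mul_assoc (v j) _ _,
        Finset.sum_congr rfl fun j _ => (Finset.mul_sum _ _ (v j)).symm,
        Finset.sum_congr rfl fun j _ => congrArg (v j * ·) (hsum i j)]
      simp
    rw [← h3]
    exact Finset.sum_eq_zero fun l _ => by rw [h2, zero_mul]
  obtain ⟨l', hl⟩ := exists_det_submatrix_ne_zero hrow
  obtain ⟨O, hηO, hO⟩ := hσ.exists_open_le_logRank hc hg hδ hηa F l' fun h' => hl (by
    rw [← hψ₀] at h'
    rw [← h']
    exact (ψ₀.map_det _).symm)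
  obtain ⟨x, hxO, hx, -, hxl⟩ := mem_closure_iff.1 hη O O.isOpen hηO
  exact (Nat.add_le_add_right (hO x hxO hx) l).trans hxl

end Dimension

end Algebraic

namespace Algebraic

open IsLocalRing

universe u

/-! ### Generators of principal ideals and exchange of coordinates. -/

section LocalAlgebra

variable {A : Type*} [CommRing A] [IsLocalRing A]

/-- If finitely many elements generate a principal ideal of a local domain, then one of them does. -/
theorem exists_isUnit_mul_eq [IsDomain A] {ι : Type*} {S : Set ι} {f : ι → A} {P : A} (hP : P ≠ 0)
    (h : Ideal.span (f '' S) = Ideal.span {P}) : ∃ j ∈ S, ∃ a, IsUnit a ∧ f j = a * P := by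
  by_contra! hcon
  have h1 : Ideal.span (f '' S) ≤ maximalIdeal A * Ideal.span {P} := by
    rw [Ideal.span_le]
    rintro _ ⟨j, hj, rfl⟩
    have h2 : f j ∈ Ideal.span {P} := h ▸ Ideal.subset_span ⟨j, hj, rfl⟩
    obtain ⟨a, ha⟩ := Ideal.mem_span_singleton'.1 h2
    have h3 : a ∈ maximalIdeal A := (mem_maximalIdeal _).2 fun hu => hcon j hj a hu ha.symm
    rw [← ha]
    exact Ideal.mul_mem_mul h3 (Ideal.mem_span_singleton_self P)
  have h4 : P ∈ maximalIdeal A * Ideal.span {P} := h1 (h ▸ Ideal.mem_span_singleton_self P)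
  obtain ⟨c, hc, hcP⟩ := Ideal.mem_mul_span_singleton.1 h4
  have h5 : (1 - c) * P = 0 := by rw [sub_mul, hcP, one_mul, sub_self]
  rcases mul_eq_zero.1 h5 with h6 | h6
  · exact (mem_maximalIdeal c).1 hc ((sub_eq_zero.1 h6) ▸ isUnit_one)
  · exact hP h6

theorem IsCoords.ne_zero [IsNoetherianRing A] {ι : Type*} [Fintype ι] {y : ι → A} (hy : IsCoords y)
    (i : ι) : y i ≠ 0 := by
  classical
  intro h
  have h1 := hy.mem_of_sum_mem_sq (a := Pi.single i 1)
    (by rw [Finset.sum_eq_single i] <;> simp +contextual [h]) i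
  rw [Pi.single_eq_same] at h1
  exact (mem_maximalIdeal _).1 h1 isUnit_one

/-- Functions which are independent modulo `(g)` and second order terms can be completed to
coordinates. -/
theorem IsCoords.exists_exchange {k : Type*} [Field k] (χ : k →+* A)
    (hk : ∀ a, ∃ c, a - χ c ∈ maximalIdeal A) {s m r : ℕ} {g : Fin s → A} {w : Fin m → A}
    (hy : IsCoords (Sum.elim g w)) {f : Fin r → A} (hf : ∀ i, f i ∈ maximalIdeal A)
    (hind : ∀ c : Fin r → k, ∑ i, χ (c i) * f i ∈
      maximalIdeal A ^ 2 ⊔ Ideal.span (Set.range g) → c = 0) :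
    ∃ (hm : r ≤ m) (v : Fin m → A), IsCoords (Sum.elim g v) ∧
      ∀ i : Fin r, v (Fin.castLE hm i) = f i := by
  suffices h : ∀ t ≤ r, t ≤ m ∧ ∃ v : Fin m → A, IsCoords (Sum.elim g v) ∧
      ∀ (i : Fin r) (j : Fin m), (i : ℕ) < t → (i : ℕ) = j → v j = f i by
    obtain ⟨hm, v, hv, hvf⟩ := h r le_rfl
    exact ⟨hm, v, hv, fun i => hvf i _ i.2 rfl⟩
  intro t
  induction t with
  | zero => exact fun _ => ⟨Nat.zero_le _, w, hy, fun i j hi => absurd hi (Nat.not_lt_zero _)⟩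
  | succ t ih =>
    intro ht
    obtain ⟨htm, v, hv, hvf⟩ := ih (by omega)
    have hft := hf ⟨t, ht⟩
    rw [← hv.1, Ideal.mem_span_range_iff_exists_fun] at hft
    obtain ⟨b, hb⟩ := hft
    rw [Fintype.sum_sum_type] at hb
    simp only [Sum.elim_inl, Sum.elim_inr] at hb
    have hl : ∃ l : Fin m, t ≤ (l : ℕ) ∧ IsUnit (b (.inr l)) := by
      by_contra! hcon
      choose c hc using fun l => hk (b (.inr l))
      -- If no v_l with l ≥ t occurs in f_t with unit coefficient, then f_t minus a constant
      -- combination of f_0, …, f_{t-1} lies in m² + (g). The coefficients c' record this relation,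
      -- which contradicts independence.
      let c' : Fin r → k := fun i =>
        if h : (i : ℕ) < t then - c ⟨i, h.trans_le htm⟩ else if (i : ℕ) = t then 1 else 0
      have h1 : ∑ i, χ (c' i) * f i = f ⟨t, ht⟩ - ∑ l : Fin m, if (l : ℕ) < t then χ (c l) * v l else 0 := by
        let G : ℕ → A := fun j => if h : j < t then χ (c ⟨j, h.trans_le htm⟩) * v ⟨j, h.trans_le htm⟩ else 0
        have hG : ∀ N, t ≤ N → ∑ i : Fin N, G i = ∑ j ∈ Finset.range t, G j := by
          intro N hN
          rw [Fin.sum_univ_eq_sum_range G N]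
          refine (Finset.sum_subset (Finset.range_mono hN) fun j _ hj => ?_).symm
          exact dif_neg (by simpa using hj)
        have h3 : ∀ i : Fin r, χ (c' i) * f i = (if i = ⟨t, ht⟩ then f i else 0) - G i := by
          intro i
          simp only [c', G, Fin.ext_iff]
          split_ifs with h4 h5
          · omega
          · rw [map_neg, ← hvf i ⟨i, h4.trans_le htm⟩ h4 rfl]
            ring
          · simp
          · simp
        have h4 : ∀ l : Fin m, (if (l : ℕ) < t then χ (c l) * v l else 0) = G l := by
          intro l
          simp only [G]
          split_ifs <;> rfl
        rw [Finset.sum_congr rfl fun i _ => h3 i, Finset.sum_congr rfl fun l _ => h4 l,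
          Finset.sum_sub_distrib, hG r (by omega), hG m htm]
        simp
      have h2 := hind c' (by
        rw [h1, ← hb, add_sub_assoc, ← Finset.sum_sub_distrib]
        refine Ideal.add_mem _ (Ideal.mem_sup_right (Ideal.sum_mem _ fun i _ =>
          Ideal.mul_mem_left _ _ (Ideal.subset_span ⟨i, rfl⟩)))
          (Ideal.mem_sup_left (Ideal.sum_mem _ fun l _ => ?_))
        rw [pow_two]
        split_ifs with hlt
        · rw [← sub_mul]
          exact Ideal.mul_mem_mul (hc l) (hv.mem (.inr l))
        · rw [sub_zero]
          exact Ideal.mul_mem_mul ((mem_maximalIdeal _).2 (hcon l (by omega))) (hv.mem (.inr l)))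
      have h3 := congrFun h2 ⟨t, ht⟩
      simp [c'] at h3
    obtain ⟨l, htl, hu⟩ := hl
    have htm' : t < m := lt_of_le_of_lt htl l.2
    refine ⟨htm', ?_⟩
    let e := Equiv.swap (⟨t, htm'⟩ : Fin m) l
    -- Place t receives f_t, the old v_t moves to place l, and v_l, whose coefficient in f_t is a
    -- unit, is discarded.
    let v' : Fin m → A := Function.update (v ∘ e) ⟨t, htm'⟩ (f ⟨t, ht⟩)
    have hv't : v' ⟨t, htm'⟩ = f ⟨t, ht⟩ := Function.update_self _ _ _
    have hv' : ∀ j, j ≠ l → ∃ i, v' i = v j := by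
      intro j hj
      refine ⟨e j, ?_⟩
      have : e j ≠ ⟨t, htm'⟩ := by
        intro h
        rw [← Equiv.swap_apply_right (⟨t, htm'⟩ : Fin m) l] at h
        exact hj (e.injective h)
      rw [show v' (e j) = (v ∘ e) (e j) from Function.update_of_ne this _ _]
      simp [e]
    refine ⟨v', ⟨?_, hv.2⟩, fun i j hi hij => ?_⟩
    · refine le_antisymm (Ideal.span_le.2 ?_) ?_
      · rintro _ ⟨i | j, rfl⟩
        · exact hv.mem (.inl i)
        · change v' j ∈ maximalIdeal A
          by_cases hj : j = ⟨t, htm'⟩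
          · rw [hj, hv't]
            exact hf _
          · rw [show v' j = (v ∘ e) j from Function.update_of_ne hj _ _]
            exact hv.mem (.inr (e j))
      · have hg : ∀ i, g i ∈ Ideal.span (Set.range (Sum.elim g v')) := fun i =>
          Ideal.subset_span ⟨.inl i, rfl⟩
        have hvj : ∀ j, j ≠ l → v j ∈ Ideal.span (Set.range (Sum.elim g v')) := fun j hj => by
          obtain ⟨i, hi⟩ := hv' j hj
          exact Ideal.subset_span ⟨.inr i, hi⟩
        have hfm : f ⟨t, ht⟩ ∈ Ideal.span (Set.range (Sum.elim g v')) :=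
          Ideal.subset_span ⟨.inr ⟨t, htm'⟩, hv't⟩
        rw [← hv.1, Ideal.span_le]
        rintro _ ⟨i | j, rfl⟩
        · exact hg i
        · by_cases hj : j = l
          · subst hj
            refine (Ideal.unit_mul_mem_iff_mem _ hu).1 ?_
            have h4 : b (.inr j) * v j = f ⟨t, ht⟩ - ∑ i, b (.inl i) * g i -
                ∑ i ∈ Finset.univ.erase j, b (.inr i) * v i := by
              rw [← hb, ← Finset.add_sum_erase _ _ (Finset.mem_univ j)]
              ring
            change b (.inr j) * v j ∈ _
            rw [h4]
            exact Ideal.sub_mem _ (Ideal.sub_mem _ hfm (Ideal.sum_mem _ fun i _ =>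
              Ideal.mul_mem_left _ _ (hg i))) (Ideal.sum_mem _ fun i hi =>
              Ideal.mul_mem_left _ _ (hvj i (Finset.ne_of_mem_erase hi)))
          · exact hvj j hj
    · by_cases hit : (i : ℕ) = t
      · obtain rfl : j = ⟨t, htm'⟩ := Fin.ext (hij.symm.trans hit)
        obtain rfl : i = ⟨t, ht⟩ := Fin.ext hit
        exact hv't
      · have h5 : j ≠ ⟨t, htm'⟩ := fun h => hit (by rw [hij, h])
        have h6 : j ≠ l := fun h => by rw [hij, h] at hi; omega
        rw [show v' j = (v ∘ e) j from Function.update_of_ne h5 _ _, Function.comp_apply,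
          Equiv.swap_apply_of_ne_of_ne h5 h6]
        exact hvf i j (by omega) hij

end LocalAlgebra

/-! ### The case of equality in the rank bound. -/

section RankGE

variable {k A B : Type*} [Field k] [CommRing A] [CommRing B] [IsLocalRing B]

/-- If the rank is equal to the number of generators, then they are independent. -/
theorem RankGE.eq_zero {χ : k →+* A} {φ : B →+* A} {K : Ideal A} {e : ℕ} (h : RankGE χ φ K e)
    {χB : k →+* B} (hχ : φ.comp χB = χ) (hB : ∀ b, ∃ c, b - χB c ∈ maximalIdeal B)
    {z : Fin e → B} (hz : ∀ j, z j ∈ maximalIdeal B) {J : Ideal B}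
    (hJ : maximalIdeal B ≤ J ⊔ Ideal.span (Set.range z)) (hJK : J.map φ ≤ K)
    (h2 : (maximalIdeal B ^ 2).map φ ≤ K) {c : Fin e → k} (hc : ∑ i, χ (c i) * φ (z i) ∈ K) :
    c = 0 := by
  by_contra hc0
  obtain ⟨i, hi⟩ : ∃ i, c i ≠ 0 := by
    by_contra! hcon
    exact hc0 (funext hcon)
  obtain ⟨n, rfl⟩ : ∃ n, e = n + 1 := ⟨e - 1, by have := i.pos; omega⟩
  -- As c i ≠ 0, x can replace z i. Its image is in K, so it may join J, and the remaining e - 1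
  -- generators contradict `RankGE.le`.
  let x := ∑ j, χB (c j) * z j
  have hx : φ x ∈ K := by simpa [x, ← hχ] using hc
  have h3 := h.le hχ hB (z := z ∘ i.succAbove) (fun j => hz _) (J := J ⊔ Ideal.span {x}) (hJ.trans ?_)
    (by
      rw [Ideal.map_sup, Ideal.map_span, Set.image_singleton]
      exact sup_le hJK ((Ideal.span_singleton_le_iff_mem _).2 hx)) h2
  · omega
  · rw [sup_assoc]
    refine sup_le_sup le_rfl (Ideal.span_le.2 ?_)
    have h4 : ∀ j, z (i.succAbove j) ∈ Ideal.span {x} ⊔ Ideal.span (Set.range (z ∘ i.succAbove)) :=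
      fun j => Ideal.mem_sup_right (Ideal.subset_span ⟨j, rfl⟩)
    rintro _ ⟨j, rfl⟩
    by_cases hj : j = i
    · subst hj
      have h5 : IsUnit (χB (c j)) := (IsUnit.mk0 _ hi).map χB
      refine (Ideal.unit_mul_mem_iff_mem _ h5).1 ?_
      have h6 : χB (c j) * z j = x - ∑ l, χB (c (j.succAbove l)) * z (j.succAbove l) := by
        simp only [x]
        rw [Fin.sum_univ_succAbove _ j]
        ring
      rw [h6]
      exact Ideal.sub_mem _ (Ideal.mem_sup_left (Ideal.mem_span_singleton_self x))
        (Ideal.sum_mem _ fun l _ => Ideal.mul_mem_left _ _ (h4 l))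
    · obtain ⟨l, rfl⟩ := Fin.exists_succAbove_eq hj
      exact h4 l

end RankGE

end Algebraic

namespace Algebraic

open IsLocalRing

universe u

/-! ### Roots of units on étale neighbourhoods. -/

section Root

variable {X : Scheme.{u}}

/-- The pull-back of germs of sections over an affine open subset to the spectrum of an algebra. -/
theorem germMap_germ {V : X.Opens} (hV : IsAffineOpen V) {S : CommRingCat.{u}} (φ : Γ(X, V) ⟶ S)
    {a : X} (ha : a ∈ V) (W : EtaleNhd X a) (e : W.U = Spec S)
    (hπ : W.π = eqToHom e ≫ Spec.map φ ≫ hV.fromSpec) (T : S) (t : Γ(X, V)) (n : ℕ)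
    (hT : T ^ n = φ t) :
    ∃ T' : W.ring, T' ^ n = W.germMap (X.presheaf.germ V a ha t) := by
  obtain ⟨U, π, hπe, pt, rfl⟩ := W
  dsimp only at e
  subst e
  dsimp only at hπ
  rw [eqToHom_refl, Category.id_comp] at hπ
  subst hπ
  refine ⟨(Spec S).presheaf.germ ⊤ pt trivial ((Scheme.ΓSpecIso S).inv T), ?_⟩
  rw [← map_pow, ← map_pow, hT]
  have h1 : ∀ y : Spec Γ(X, V), ∀ hy : hV.fromSpec y ∈ V, hV.fromSpec.stalkMap y
      (X.presheaf.germ V _ hy t) =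
      (Spec Γ(X, V)).presheaf.germ ⊤ y trivial ((Scheme.ΓSpecIso _).inv t) := by
    intro y hy
    rw [Scheme.Hom.germ_stalkMap_apply, hV.fromSpec_app_self]
    exact (Spec Γ(X, V)).presheaf.germ_res_apply _ _ _ _
  have h2 : (Scheme.ΓSpecIso S).inv (φ t) = (Spec.map φ).app ⊤ ((Scheme.ΓSpecIso _).inv t) :=
    CategoryTheory.ConcreteCategory.congr_hom (Scheme.ΓSpecIso_inv_naturality φ) t
  rw [h2]
  have h3 := Scheme.Hom.germ_stalkMap_apply (Spec.map φ) ⊤ pt trivial ((Scheme.ΓSpecIso _).inv t)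
  refine h3.symm.trans ?_
  have h4 := h1 (Spec.map φ pt) ha
  have h5 := CategoryTheory.ConcreteCategory.congr_hom
    (Scheme.Hom.stalkMap_comp (Spec.map φ) hV.fromSpec pt) (X.presheaf.germ V _ ha t)
  have h6 := X.presheaf.germ_stalkSpecializes_apply ha
    (specializes_of_eq (rfl : (Spec.map φ ≫ hV.fromSpec) pt = _)) t
  refine Eq.trans ?_ (congrArg ((Spec.map φ ≫ hV.fromSpec).stalkMap pt) h6).symm
  exact (congrArg ((Spec.map φ).stalkMap pt) h4).symm.trans h5.symm

variable {k : Type u} [Field k] [IsAlgClosed k] [CharZero k]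

open Polynomial in
/-- Units have roots on étale neighbourhoods. -/
theorem exists_etaleNhd_root (f : X ⟶ Spec (.of k)) [LocallyOfFiniteType f] {a : X}
    (ha : IsClosed {a}) {h : X.presheaf.stalk a} (hh : IsUnit h) {e : ℕ} (he : e ≠ 0) :
    ∃ (W : EtaleNhd X a) (T : W.ring), IsUnit T ∧ T ^ e = W.germMap h := by
  suffices hs : ∃ (W : EtaleNhd X a) (T : W.ring), T ^ e = W.germMap h by
    obtain ⟨W, T, hT⟩ := hs
    exact ⟨W, T, (isUnit_pow_iff he).1 (hT ▸ hh.map W.germMap.hom), hT⟩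
  obtain ⟨U, hU, h', rfl⟩ := X.presheaf.exists_germ_eq h
  obtain ⟨_, ⟨V : X.Opens, hV, rfl⟩, haV : a ∈ V, hVU⟩ :=
    X.isBasis_affineOpens.exists_subset_of_mem_open hU U.isOpen
  replace hV : IsAffineOpen V := hV
  obtain ⟨t, ht⟩ := exists_restrict (V := V) hVU h'
  rw [← ht a haV] at hh ⊢
  -- The root is adjoined with the derivative of T^e - t inverted, which makes the algebra standard
  -- étale.
  let P : StandardEtalePair Γ(X, V) :=
    { f := Polynomial.X ^ e - C t
      monic_f := monic_X_pow_sub_C t he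
      g := derivative (Polynomial.X ^ e - C t)
      cond := ⟨1, 0, 1, by ring⟩ }
  obtain ⟨c, hc⟩ := exists_sub_structMap_mem f ha (X.presheaf.germ V a haV t)
  have hc0 : c ≠ 0 := by
    rintro rfl
    rw [map_zero, sub_zero] at hc
    exact (mem_maximalIdeal _).1 hc hh
  -- A root of the value c of the unit at a gives the point over a; the derivative e t₀^(e-1) is
  -- nonzero there by characteristic zero.
  obtain ⟨t₀, ht₀⟩ := IsAlgClosed.exists_pow_nat_eq c (Nat.pos_of_ne_zero he)
  have ht₀0 : t₀ ≠ 0 := by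
    rintro rfl
    exact hc0 (by rw [← ht₀, zero_pow he])
  let κ := ResidueField (X.presheaf.stalk a)
  let ρ : X.presheaf.stalk a →+* κ := residue _
  let i1 : Algebra Γ(X, V) κ := (ρ.comp (X.presheaf.germ V a haV).hom).toAlgebra
  have hκ : CharZero κ := ((ρ.comp (structMap f a)).charZero_iff (RingHom.injective _)).1 inferInstance
  let x : κ := ρ (structMap f a t₀)
  have hx : x ≠ 0 := (map_ne_zero (ρ.comp (structMap f a))).2 ht₀0
  have hxe : x ^ e = algebraMap Γ(X, V) κ t := by
    have h1 : ρ (X.presheaf.germ V a haV t) = ρ (structMap f a c) := by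
      rw [← sub_eq_zero, ← map_sub]
      exact (residue_eq_zero_iff _).2 hc
    refine Eq.trans ?_ h1.symm
    simp only [x, ← map_pow, ht₀]
  have hmap : P.HasMap x := by
    refine ⟨?_, ?_⟩
    · simp [P, hxe]
    · simp only [P, map_sub, derivative_X_pow, derivative_C, sub_zero, map_mul, map_pow, aeval_X, map_natCast]
      exact ((Nat.cast_ne_zero.2 he).isUnit).mul ((pow_ne_zero _ hx).isUnit)
  let φ : Γ(X, V) ⟶ CommRingCat.of P.Ring := CommRingCat.ofHom (algebraMap Γ(X, V) P.Ring)
  let τ : CommRingCat.of P.Ring ⟶ X.residueField a := CommRingCat.ofHom (P.lift x hmap).toRingHom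
  have hτ : φ ≫ τ = X.presheaf.germ V a haV ≫ X.residue a :=
    CommRingCat.hom_ext (P.lift x hmap).comp_algebraMap
  have hφ : Etale (Spec.map φ) :=
    (HasRingHomProperty.Spec_iff (P := @Etale)).2 (RingHom.etale_algebraMap.2 inferInstance)
  have hpt : (Spec.map φ ≫ hV.fromSpec) (Spec.map τ (closedPoint κ)) = a := by
    have h1 : Spec.map τ ≫ Spec.map φ ≫ hV.fromSpec = X.fromSpecResidueField a := by
      rw [← Spec.map_comp_assoc, hτ, Scheme.fromSpecResidueField,
        ← hV.fromSpecStalk_eq_fromSpecStalk haV, Spec.map_comp, Category.assoc]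
      rfl
    have h2 := X.fromSpecResidueField_apply a (closedPoint κ)
    rw [← h1] at h2
    exact h2
  let W : EtaleNhd X a :=
    { U := Spec (CommRingCat.of P.Ring)
      π := Spec.map φ ≫ hV.fromSpec
      etale := inferInstance
      pt := Spec.map τ (closedPoint κ)
      map_pt := hpt }
  have hX : P.X ^ e = φ t := by
    have h1 : aeval P.X (Polynomial.X ^ e - C t) = 0 := P.hasMap_X.1
    rw [map_sub, map_pow, aeval_X, aeval_C, sub_eq_zero] at h1
    exact h1
  obtain ⟨T, hT⟩ := germMap_germ hV φ haV W rfl (by simp [W]) P.X t e hX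
  exact ⟨W, T, hT⟩

end Root

end Algebraic

namespace Algebraic

open IsLocalRing

universe u

theorem IsCoords.mul_isUnit {A ι : Type*} [Fintype ι] [CommRing A] [IsLocalRing A] {y a : ι → A}
    (hy : IsCoords y) (ha : ∀ i, IsUnit (a i)) : IsCoords (fun i => y i * a i) := by
  refine ⟨?_, hy.2⟩
  rw [← hy.1]
  refine le_antisymm (Ideal.span_le.2 ?_) (Ideal.span_le.2 ?_)
  · rintro _ ⟨i, rfl⟩
    exact Ideal.mul_mem_right _ _ (Ideal.subset_span ⟨i, rfl⟩)
  · rintro _ ⟨i, rfl⟩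
    refine (Ideal.mul_unit_mem_iff_mem _ (ha i)).1 (Ideal.subset_span ⟨i, rfl⟩)

/-! ### The normal form in the algebraic case. -/

section NormalForm

variable {k : Type u} [Field k] [IsAlgClosed k] {X X₀ : Scheme.{u}} {Q : Type*} [Fintype Q]
  {E : Q → Set X} {f₀ : X₀ ⟶ Spec (.of k)} [LocallyOfFinitePresentation f₀] {σ : X ⟶ X₀} {a : X}

theorem mem_imgStratum (hσ : IsResolution f₀ E σ) [QuasiCompact f₀] (ha : IsClosed {a})
    (haE : a ∈ ⋃ q, E q) :
    σ a ∈ imgStratum f₀ E σ (maxLogRank f₀ E σ - logRank f₀ E σ a) := by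
  have := hσ.logRank_le_maxLogRank ha haE
  exact ⟨a, ⟨ha, haE, by omega⟩, rfl⟩

theorem IsStratified.notMem_imgStratum (hS : IsStratified f₀ E σ) (ha : IsClosed {a}) :
    σ a ∉ imgStratum f₀ E σ (maxLogRank f₀ E σ - logRank f₀ E σ a + 1) := by
  intro h
  by_cases hl : maxLogRank f₀ E σ - logRank f₀ E σ a + 1 ≤ maxLogRank f₀ E σ
  · have h1 : a ∈ logStratum f₀ E σ (maxLogRank f₀ E σ - logRank f₀ E σ a + 1) := by
      rw [hS.eq_preimage _ hl]
      exact ⟨ha, h⟩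
    have := h1.2.2
    omega
  · obtain ⟨x, hx, -⟩ := h
    have := hx.2.2
    omega

/-- σ a is not in the closure of Y_{k+1}, so removing Y_{k+1} from Y_k does not change the ideal at
σ a. -/
theorem IsStratified.isRegularLocalRing [QuasiCompact f₀] (hσ : IsResolution f₀ E σ)
    (hS : IsStratified f₀ E σ) (ha : IsClosed {a}) (haE : a ∈ ⋃ q, E q) :
    IsRegularLocalRing (X₀.presheaf.stalk (σ a) ⧸
      idealAt (imgStratum f₀ E σ (maxLogRank f₀ E σ - logRank f₀ E σ a)) (σ a)) := by
  have h1 := hS.smooth _ (Nat.sub_le (maxLogRank f₀ E σ) (logRank f₀ E σ a)) _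
    ⟨mem_imgStratum hσ ha haE, hS.notMem_imgStratum ha⟩
  rwa [idealAt_diff (hσ.notMem_closure_imgStratum (hσ.isClosed_map ha) (hS.notMem_imgStratum ha))]
    at h1

theorem pullbackIdealAt_le_maximalIdeal {Y : Set X₀} (h : σ a ∈ Y) :
    pullbackIdealAt σ Y a ≤ maximalIdeal (X.presheaf.stalk a) :=
  Ideal.map_le_iff_le_comap.2 fun _ hx =>
    (map_mem_maximalIdeal_iff (σ.stalkMap a).hom).2 (idealAt_le_maximalIdeal h hx)

/-- A monomial ideal, in terms of generators of the components through the point. -/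
theorem IsMonomialAt.exists_eq_span (hE : ∀ q, IsClosed (E q)) {J : Ideal (X.presheaf.stalk a)}
    (h : IsMonomialAt E a J) {s : ℕ} {c : Fin s → Q} (hinj : Function.Injective c)
    (hc : Set.range c = {q | a ∈ E q}) {g : Fin s → X.presheaf.stalk a}
    (hg : ∀ i, idealAt (E (c i)) a = Ideal.span {g i}) :
    ∃ β : Fin s → ℕ, J = Ideal.span {∏ i, g i ^ β i} := by
  obtain ⟨α, rfl⟩ := h
  refine ⟨α ∘ c, ?_⟩
  rw [← Ideal.prod_span_singleton]
  simp_rw [← Ideal.span_singleton_pow, ← hg]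
  refine (Fintype.prod_of_injective c hinj _ _ (fun q hq => ?_) fun i => rfl).symm
  have hq' : a ∉ E q := fun h => hq (hc ▸ h)
  rw [idealAt_eq_top (by rwa [(hE q).closure_eq]), Ideal.top_pow, Ideal.one_eq_top]

variable {n d : ℕ} {ε : LocalEmbedding f₀ (σ a)} {y : Fin n → ε.ring}

theorem LocalEmbedding.eq_span_of_comap_eq {J : Ideal (X₀.presheaf.stalk (σ a))}
    (hI : J.comap ε.germMap.hom = Ideal.span (y '' {j | d ≤ (j : ℕ)})) :
    J = Ideal.span ((fun j => ε.germMap (y j)) '' {j | d ≤ (j : ℕ)}) := by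
  rw [← Ideal.map_comap_of_surjective _ (surjective_embedding_germMap ε) J, hI, Ideal.map_span,
    ← Set.image_comp]
  rfl

theorem LocalEmbedding.maximalIdeal_le (hy : IsCoords y) (hdn : d ≤ n)
    {J : Ideal (X₀.presheaf.stalk (σ a))}
    (hI : J.comap ε.germMap.hom = Ideal.span (y '' {j | d ≤ (j : ℕ)})) :
    maximalIdeal (X₀.presheaf.stalk (σ a)) ≤
      J ⊔ Ideal.span (Set.range fun j : Fin d => ε.germMap (y (Fin.castLE hdn j))) := by
  intro x hx
  obtain ⟨x, rfl⟩ := surjective_embedding_germMap ε x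
  have hloc : IsLocalHom ε.germMap.hom := .of_surjective _ (surjective_embedding_germMap ε)
  rw [map_mem_maximalIdeal_iff, ← hy.1] at hx
  have h1 := Ideal.mem_map_of_mem ε.germMap.hom hx
  rw [Ideal.map_span] at h1
  refine Ideal.span_le.2 ?_ h1
  rintro _ ⟨_, ⟨j, rfl⟩, rfl⟩
  by_cases hj : (j : ℕ) < d
  · exact Ideal.mem_sup_right (Ideal.subset_span ⟨⟨j, hj⟩, rfl⟩)
  · rw [LocalEmbedding.eq_span_of_comap_eq hI]
    exact Ideal.mem_sup_left (Ideal.subset_span (Set.mem_image_of_mem _ (not_lt.1 hj)))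

theorem IsStratified.exists_normal_form [CharZero k] [QuasiCompact f₀] (hσ : IsResolution f₀ E σ)
    (hS : IsStratified f₀ E σ) (haE : a ∈ ⋃ q, E q) (ha : IsClosed {a}) {p r : ℕ}
    (hp : p = maxLogRank f₀ E σ) (hr : r = logRank f₀ E σ a) (ε : LocalEmbedding f₀ (σ a)) :
    ∃ (W : EtaleNhd X a) (s m N : ℕ) (u : Fin s → W.ring) (v : Fin m → W.ring)
      (c : Fin s → Q) (z : Fin N → ε.ring) (α : Fin s → ℕ) (hm : r ≤ m) (hN : r < N),
      IsAdapted E W u v c ∧ IsCoords z ∧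
      (∀ j : Fin r, W.germMap (component σ a ε (z (Fin.castLE hN.le j))) = v (Fin.castLE hm j)) ∧
      W.germMap (component σ a ε (z ⟨r, hN⟩)) = ∏ i, u i ^ α i ∧
      idealAt (imgStratum f₀ E σ (p - r)) (σ a) =
        Ideal.span {g | ∃ j : Fin N, r ≤ (j : ℕ) ∧ ε.germMap (z j) = g} ∧
      pullbackIdealAt σ (imgStratum f₀ E σ (p - r)) a =
        Ideal.span {component σ a ε (z ⟨r, hN⟩)} := by
  have hreg := hS.isRegularLocalRing hσ ha haE
  have hbY := mem_imgStratum hσ ha haE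
  have hrp := hσ.logRank_le_maxLogRank ha haE
  have hmon := hS.monomial _ (Nat.sub_le (maxLogRank f₀ E σ) (logRank f₀ E σ a)) a ha
  rw [← hp, ← hr] at hreg hbY hrp hmon
  set Y := imgStratum f₀ E σ (p - r) with hY
  have hb := hσ.isClosed_map ha
  have hsm := hσ.smooth
  have := ε.smooth
  have := isNoetherianRing_stalk (σ ≫ f₀) a
  obtain ⟨n, d, y, hdn, hy, hI, hd⟩ := ε.exists_isCoords (idealAt Y (σ a))
  have hJ : (idealAt Y (σ a)).IsPrime := by
    obtain ⟨x, hx⟩ := exists_isCoords_of_isRegularLocalRing hd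
    have := hx.isDomain
    exact (Ideal.Quotient.isDomain_iff_prime _).1 this
  have hdr : d ≤ r := by
    have := hσ.add_le_maxLogRank hb hJ ε hdn hy hI
    omega
  obtain ⟨s, m, c, g, w, δ, hinj, hc, hyA, hg, hδ, -⟩ := hσ.exists_partials ha
  obtain ⟨β, hβ⟩ := hmon.exists_eq_span hσ.isSNC.isClosed hinj hc hg
  have hPm : ∏ i, g i ^ β i ∈ maximalIdeal (X.presheaf.stalk a) :=
    pullbackIdealAt_le_maximalIdeal hbY (hβ ▸ Ideal.mem_span_singleton_self _)
  obtain ⟨i₀, hi₀⟩ : ∃ i, β i ≠ 0 := by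
    by_contra! hcon
    simp only [hcon, pow_zero, Finset.prod_const_one] at hPm
    exact (mem_maximalIdeal _).1 hPm isUnit_one
  have hK : logIdeal E a = _ := logIdeal_eq hc hg
  -- Some g i₀ divides the monomial, so functions vanishing on Y pull back into the logarithmic
  -- ideal and do not contribute to the rank.
  have hJK : (idealAt Y (σ a)).map (σ.stalkMap a).hom ≤ logIdeal E a := by
    change pullbackIdealAt σ Y a ≤ _
    rw [hβ, hK, Ideal.span_singleton_le_iff_mem]
    refine Ideal.mem_sup_right ?_
    rw [← Finset.mul_prod_erase _ _ (Finset.mem_univ i₀)]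
    exact Ideal.mul_mem_right _ _ (Ideal.pow_mem_of_mem _
      (Ideal.subset_span (Set.mem_range_self i₀)) _ (Nat.pos_of_ne_zero hi₀))
  have hmK : (maximalIdeal (X₀.presheaf.stalk (σ a)) ^ 2).map (σ.stalkMap a).hom ≤ logIdeal E a := by
    rw [Ideal.map_pow]
    refine (Ideal.pow_right_mono ?_ 2).trans le_sup_left
    exact Ideal.map_le_iff_le_comap.2 fun x hx => (map_mem_maximalIdeal_iff _).2 hx
  have hrank := (hσ.le_logRank_iff ha r).1 hr.le
  have hχ := stalkMap_comp_structMap f₀ σ a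
  have hz : ∀ j, ε.germMap (y j) ∈ maximalIdeal (X₀.presheaf.stalk (σ a)) := fun j => by
    have hloc : IsLocalHom ε.germMap.hom := .of_surjective _ (surjective_embedding_germMap ε)
    exact (map_mem_maximalIdeal_iff ε.germMap.hom).2 (hy.mem j)
  -- Modulo the ideal of Y the maximal ideal at σ a has d generators, so the rank r is at most d.
  -- Equality then makes their pull-backs independent, which gives `hind`.
  obtain rfl : d = r := le_antisymm hdr (hrank.le hχ (exists_sub_structMap_mem f₀ hb)
    (fun j => hz _) (LocalEmbedding.maximalIdeal_le hy hdn hI) hJK hmK)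
  have hind := fun b => hrank.eq_zero hχ (exists_sub_structMap_mem f₀ hb)
    (fun j => hz _) (LocalEmbedding.maximalIdeal_le hy hdn hI) hJK hmK (c := b)
  rw [hK] at hind
  have hσm : ∀ {x}, x ∈ maximalIdeal (X₀.presheaf.stalk (σ a)) →
      σ.stalkMap a x ∈ maximalIdeal (X.presheaf.stalk a) := fun hx =>
    (map_mem_maximalIdeal_iff (σ.stalkMap a).hom).2 hx
  obtain ⟨hm, v, hv, hvf⟩ := hyA.exists_exchange (structMap (σ ≫ f₀) a)
    (exists_sub_structMap_mem (σ ≫ f₀) ha) (fun j => hσm (hz _)) hind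
  have hdom : IsDomain (X.presheaf.stalk a) := (hyA.comp_equiv finSumFinEquiv.symm).isDomain
  have hP0 : ∏ i, g i ^ β i ≠ 0 :=
    Finset.prod_ne_zero_iff.2 fun i _ => pow_ne_zero _ (hyA.ne_zero (.inl i))
  have hJs := LocalEmbedding.eq_span_of_comap_eq hI
  have hpull : pullbackIdealAt σ Y a =
      Ideal.span ((fun j => component σ a ε (y j)) '' {j | d ≤ (j : ℕ)}) := by
    rw [pullbackIdealAt, hJs, Ideal.map_span, ← Set.image_comp]
    rfl
  obtain ⟨j₀, hj₀, h, hu, hh⟩ := exists_isUnit_mul_eq hP0 (hpull.symm.trans hβ)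
  have hdn' : d < n := lt_of_le_of_lt hj₀ j₀.2
  obtain ⟨W, T, hT, hTh⟩ := exists_etaleNhd_root (σ ≫ f₀) ha hu hi₀
  let τ := Equiv.swap (⟨d, hdn'⟩ : Fin n) j₀
  -- T is a root, of order the exponent of g i₀, of the unit by which the pulled-back coordinate
  -- differs from the monomial.
  let u : Fin s → W.ring := fun i => W.germMap (g i) * if i = i₀ then T else 1
  have huT : ∀ i, IsUnit (if i = i₀ then T else 1) := fun i => by
    split_ifs
    exacts [hT, isUnit_one]
  have hτ : ∀ j : Fin n, d ≤ (τ j : ℕ) ↔ d ≤ (j : ℕ) := by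
    intro j
    have hj₀' : d ≤ (j₀ : ℕ) := hj₀
    by_cases h1 : j = ⟨d, hdn'⟩
    · simp [h1, τ, hj₀']
    · by_cases h2 : j = j₀
      · simp [h2, τ, hj₀']
      · rw [show τ j = j from Equiv.swap_apply_of_ne_of_ne h1 h2]
  refine ⟨W, s, m, n, u, fun l => W.germMap (v l), c, y ∘ τ, β, hm, hdn', ⟨?_, hinj, hc, ?_⟩,
    hy.comp_equiv τ, fun j => ?_, ?_, ?_, ?_⟩
  · let := W.germMap.hom.toAlgebra
    have : IsLocalHom (algebraMap (X.presheaf.stalk a) W.ring) := isLocalHom_germMap W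
    have : Module.Flat (X.presheaf.stalk a) W.ring := flat_germMap W
    have : Algebra.FormallyUnramified (X.presheaf.stalk a) W.ring := formallyUnramified_germMap W
    have : Algebra.EssFiniteType (X.presheaf.stalk a) W.ring := essFiniteType_germMap W
    have := isNoetherianRing_etaleNhd (σ ≫ f₀) W
    have h1 := (hv.map (S := W.ring)).mul_isUnit
      (a := Sum.elim (fun i => if i = i₀ then T else 1) fun _ => 1) (by
        rintro (i | j)
        exacts [huT i, isUnit_one])
    convert h1 using 1
    ext (i | j)
    · rfl
    · exact (mul_one _).symm
  · intro i
    have hpr : (idealAt (E (c i)) a).IsPrime := by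
      rw [hg]
      exact hyA.isPrime_span i
    rw [map_idealAt_of_isPrime (σ ≫ f₀) (hσ.isSNC.isClosed _) hpr, hg, Ideal.map_span,
      Set.image_singleton]
    exact (Ideal.span_singleton_mul_right_unit (huT i) _).symm
  · have h1 : τ (Fin.castLE hdn'.le j) = Fin.castLE hdn j := by
      refine Equiv.swap_apply_of_ne_of_ne (fun h => ?_) fun h => ?_
      · have := congrArg Fin.val h
        simp at this
        omega
      · have h2 : d ≤ (j₀ : ℕ) := hj₀
        rw [← h] at h2
        simp at h2
        omega
    rw [Function.comp_apply, h1]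
    exact congrArg W.germMap (hvf j).symm
  · have h1 : τ ⟨d, hdn'⟩ = j₀ := Equiv.swap_apply_left _ _
    rw [Function.comp_apply, h1, hh, map_mul, ← hTh, map_prod]
    simp only [u, mul_pow, Finset.prod_mul_distrib, map_pow]
    rw [mul_comm]
    congr 1
    rw [Finset.prod_eq_single i₀]
    · rw [if_pos rfl]
    · intro i _ hi
      rw [if_neg hi, one_pow]
    · simp
  · rw [hJs]
    congr 1
    ext x
    constructor
    · rintro ⟨j, hj, rfl⟩
      exact ⟨τ j, (hτ j).2 hj, by simp [τ]⟩
    · rintro ⟨j, hj, rfl⟩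
      exact ⟨τ j, (hτ j).2 hj, rfl⟩
  · have h1 : τ ⟨d, hdn'⟩ = j₀ := Equiv.swap_apply_left _ _
    rw [Function.comp_apply, h1, hh, hβ]
    exact (Ideal.span_singleton_mul_left_unit hu _).symm

end NormalForm

end Algebraic

end

theorem theorem3p5 :
    -- complex-analytic varieties
    (∀ (n : ℕ) (X : Type*) [TopologicalSpace X] [T2Space X] [ChartedSpace (Fin n → ℂ) X]
        [IsManifold 𝓘(ℂ, Fin n → ℂ) ω X] (X₀ : Type*) [TopologicalSpace X₀] [T2Space X₀]
        [Analytic.ReducedSpace X₀] (Q : Type*) (E : Q → Set X) (σ : X → X₀),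
      Analytic.IsResolution n E σ → Analytic.IsStratified n E σ →
      ∀ a ∈ ⋃ q, E q, ∀ (p r : ℕ), p = Analytic.maxLogRank n E σ → r = Analytic.logRank n E σ a →
      ∀ (N : ℕ) (M₀ : Type*) [TopologicalSpace M₀] [ChartedSpace (Fin N → ℂ) M₀]
        [IsManifold 𝓘(ℂ, Fin N → ℂ) ω M₀] (ι : X₀ → M₀) (U : Set X₀), σ a ∈ U →
      Analytic.IsLocalEmbedding N Analytic.ReducedSpace.stalk ι U →
      ∃ (s m : ℕ) (e : OpenPartialHomeomorph X (Fin n → ℂ)) (κ : Fin s ⊕ Fin m ≃ Fin n)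
        (c : Fin s → Q) (z : OpenPartialHomeomorph M₀ (Fin N → ℂ)) (α : Fin s → ℕ)
        (hm : r ≤ m) (hN : r < N),
        Analytic.IsAdapted E a e κ c ∧
        z ∈ IsManifold.maximalAtlas 𝓘(ℂ, Fin N → ℂ) ω M₀ ∧
        ι (σ a) ∈ z.source ∧ z (ι (σ a)) = 0 ∧
        (∀ᶠ x in 𝓝 a,
          (∀ j : Fin r, z (ι (σ x)) (Fin.castLE hN.le j) = e x (κ (.inr (Fin.castLE hm j)))) ∧
          z (ι (σ x)) ⟨r, hN⟩ = ∏ i, e x (κ (.inl i)) ^ α i) ∧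
        Analytic.idealAt (Analytic.imgStratum n E σ (p - r)) (σ a) = Ideal.span
          {g : Analytic.ReducedSpace.stalk (σ a) | ∃ j : Fin N, r ≤ (j : ℕ) ∧
            ((fun y => z (ι y) j : X₀ → ℂ) : (𝓝 (σ a)).Germ ℂ) = g} ∧
        Analytic.pullbackIdealAt n σ (Analytic.imgStratum n E σ (p - r)) a = Ideal.span
          {g : Analytic.holGerm n X a | ((fun x => z (ι (σ x)) ⟨r, hN⟩ : X → ℂ) : (𝓝 a).Germ ℂ) = g}) ∧
    -- algebraic varieties over an algebraically closed field of characteristic zero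
    (∀ (k : Type*) [Field k] [IsAlgClosed k] [CharZero k] (X X₀ : Scheme)
        (f₀ : X₀ ⟶ Spec (.of k)) [LocallyOfFinitePresentation f₀] [QuasiCompact f₀]
        [IsSeparated f₀] [IsReduced X₀] (Q : Type*) [Fintype Q] (E : Q → Set X) (σ : X ⟶ X₀),
      Algebraic.IsResolution f₀ E σ → Algebraic.IsStratified f₀ E σ →
      ∀ a ∈ ⋃ q, E q, IsClosed {a} →
      ∀ (p r : ℕ), p = Algebraic.maxLogRank f₀ E σ → r = Algebraic.logRank f₀ E σ a →
      ∀ ε : Algebraic.LocalEmbedding f₀ (σ a),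
      ∃ (W : Algebraic.EtaleNhd X a) (s m N : ℕ) (u : Fin s → W.ring) (v : Fin m → W.ring)
        (c : Fin s → Q) (z : Fin N → ε.ring) (α : Fin s → ℕ) (hm : r ≤ m) (hN : r < N),
        Algebraic.IsAdapted E W u v c ∧ Algebraic.IsCoords z ∧
        (∀ j : Fin r, W.germMap (Algebraic.component σ a ε (z (Fin.castLE hN.le j))) =
          v (Fin.castLE hm j)) ∧
        W.germMap (Algebraic.component σ a ε (z ⟨r, hN⟩)) = ∏ i, u i ^ α i ∧
        Algebraic.idealAt (Algebraic.imgStratum f₀ E σ (p - r)) (σ a) =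
          Ideal.span {g | ∃ j : Fin N, r ≤ (j : ℕ) ∧ ε.germMap (z j) = g} ∧
        Algebraic.pullbackIdealAt σ (Algebraic.imgStratum f₀ E σ (p - r)) a =
          Ideal.span {Algebraic.component σ a ε (z ⟨r, hN⟩)}) := by
  refine ⟨?_, ?_⟩
  · intro n X _ _ _ _ X₀ _ _ _ Q E σ hσ hS a ha p r hp hr N M₀ _ _ _ ι U hU hι
    exact hS.exists_normal_form hσ ha hp hr hU hι
  · intro k _ _ _ X X₀ f₀ _ _ _ _ Q _ E σ hσ hS a ha hac p r hp hr ε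
    exact hS.exists_normal_form hσ ha hac hp hr ε
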